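/- Let $w:\mathbb R\to(0,\infty)$ be non-decreasing and not constant, and let $X(t)$, $t\ge 0$, be the continuous time nearest neighbour walk on $\mathbb Z$ with right continuous paths and $X(0)=0$ which at time $t$ jumps from its position $x=X(t)$ to $x\pm1$ with rate $w(\ell(t,x)-\ell(t,x\pm1))$, where $\ell(t,x)=|\{s\in[0,t):X(s)=x\}|$ is its local time. For $k\in\mathbb Z$ and $s\ge0$ let $$\theta(s,k)=\inf\{t\ge0:\ \ell(t,k)+\ell(t,k+1)>s\},\qquad \xi_k(s)=\ell(\theta(s,k),k+1)-\ell(\theta(s,k),k),$$ $$\alpha_k(s)=\mathbf 1\{X(\theta(s,k))=k+1\}-\mathbf 1\{X(\theta(s,k))=k\},$$ and for $t\ge0$ let $$\beta_\pm(t,k)=\inf\Big\{s\ge0:\int_0^s\mathbf 1\{\alpha_k(u)=\pm1\}\,du>t\Big\},\qquad \eta_{k,-}(t)=\xi_k(\beta_-(t,k)),\quad \eta_{k,+}(t)=-\xi_k(\beta_+(t,k)).$$ Let $Q(x,dy)=\exp\left(-\int_x^y w(u)\,du\right)w(y)\,dy$ on $y\ge x$ (and $0$ on $y<x$). Then, almost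 surely, all the times $\theta(s,k)$ and $\beta_\pm(t,k)$ are finite, and the following hold. 1. The processes $s\mapsto(\alpha_k(s),\xi_k(s))$, $k\in\mathbb Z$, are independent time homogeneous Markov processes on $\{-1,+1\}\times\mathbb R$ with the same law of evolution: $\alpha_k$ is right continuous and changes its sign with rate $w(\alpha_k\xi_k)$, and $\dot\xi_k=\alpha_k$, i.e. $\xi_k(s)=\xi_k(0)+\int_0^s\alpha_k(u)\,du$. Almost surely, $\xi_k(0)=0$ for all $k$, $\alpha_k(0)=+1$ for $k<0$ and $\alpha_k(0)=-1$ for $k\ge0$. 2. For every choice of exactly one of $\eta_{k,+}$ and $\eta_{k,-}$ for each $k\in\mathbb Z$, the chosen processes are independent. All the processes $\eta_{k,\pm}$ are time homogeneous Markov processes with the same law of evolution: the process decreases with unit speed, and when it is at $u$ it jumps with rate $w(-u)$, to a position with distribution $Q(u,\cdot)$. The distribution of $\eta_{k,+}(0)$ is $Q(0,\cdot)$ if $k\ge0$ and the point mass at $0$ if $k<0$; the distribution of $\eta_{k,-}(0)$ is the point mass at $0$ if $k\ge0$ and $Q(0,\cdot)$ if $k<0$. -/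

import Mathlib

open MeasureTheory ProbabilityTheory Set
open scoped NNReal ENNReal

noncomputable section

namespace RepellingWalk

/-! ### Local times and jump times of an integer-valued path -/

/-- Occupation time `ℓ(t, k) = |{s ∈ [0, t) : x(s) = k}|` of the integer-valued path `x`. -/
def localTime (x : ℝ≥0 → ℤ) (t : ℝ≥0) (k : ℤ) : ℝ :=
  (volume {s : ℝ | 0 ≤ s ∧ s < t ∧ x s.toNNReal = k}).toReal

/-- The successive jump times `0 = S₀ < S₁ < S₂ < …` of the path `x`. -/
def jumpTime (x : ℝ≥0 → ℤ) : ℕ → ℝ≥0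
  | 0 => 0
  | n + 1 => sInf {t : ℝ≥0 | jumpTime x n < t ∧ x t ≠ x (jumpTime x n)}

/-! ### The walk -/

/-- If the path `x` stays at its current position for a time `v` after its `n`-th jump, then this
is the rate `w(ℓ(t, x(t)) - ℓ(t, x(t) + e))`, at time `t = Sₙ + v`, of the jump to the
neighbour in direction `e = ±1`; on that event the local time at the current position is
`ℓ(Sₙ, x(Sₙ)) + v`, and the one at the neighbour has not changed since `Sₙ`. -/
def jumpRate (w : ℝ → ℝ) (x : ℝ≥0 → ℤ) (n : ℕ) (e : ℤˣ) (v : ℝ) : ℝ :=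
  w (localTime x (jumpTime x n) (x (jumpTime x n)) + v
    - localTime x (jumpTime x n) (x (jumpTime x n) + (e : ℤ)))

/-- The σ-algebra generated by the first `n` jumps, i.e. by `(Sᵢ, X(Sᵢ))` for `i ≤ n`. -/
abbrev history {Ω : Type*} (X : ℝ≥0 → Ω → ℤ) (n : ℕ) : MeasurableSpace Ω :=
  MeasurableSpace.comap
    (fun (ω : Ω) (i : Fin (n + 1)) =>
      (jumpTime (fun t => X t ω) i, X (jumpTime (fun t => X t ω) i) ω))
    inferInstance

/-- `X` is a continuous time nearest neighbour walk on `ℤ` with right continuous paths, started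
at `0`, which jumps at time `t` from its position `x` to `x ± 1` with rate
`w(ℓ(t, x) - ℓ(t, x ± 1))`. The rates are encoded in the usual way: given the history up to the
`n`-th jump, the pair (next holding time, direction `e` of the next jump) has the density
`r_e(v) exp(-∫₀ᵛ (r₊(y) + r₋(y)) dy)`, where `r_e(v)` is the rate of a jump in direction `e`
after the walk has waited for a time `v`. -/
structure IsWalk {Ω : Type*} [MeasurableSpace Ω] (w : ℝ → ℝ) (P : Measure Ω)
    (X : ℝ≥0 → Ω → ℤ) : Prop where
  measurable : ∀ t, Measurable (X t)
  right_continuous : ∀ ω t, ContinuousWithinAt (fun s => X s ω) (Ici t) t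
  start : ∀ ω, X 0 ω = 0
  jump_law : ∀ (n : ℕ) (B : Set Ω), MeasurableSet[history X n] B → ∀ (e : ℤˣ) (u : ℝ≥0),
    P (B ∩ {ω | jumpTime (fun t => X t ω) n + u < jumpTime (fun t => X t ω) (n + 1) ∧
        X (jumpTime (fun t => X t ω) (n + 1)) ω
          = X (jumpTime (fun t => X t ω) n) ω + (e : ℤ)})
      = ∫⁻ ω in B, (∫⁻ v in Ioi (u : ℝ),
          ENNReal.ofReal (jumpRate w (fun t => X t ω) n e v *
            Real.exp (-∫ y in (0 : ℝ)..v,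
              (jumpRate w (fun t => X t ω) n 1 y + jumpRate w (fun t => X t ω) n (-1) y)))) ∂P

/-! ### The edge processes of a path -/

/-- `τ(t, k) = ℓ(t, k) + ℓ(t, k+1)`, the local time on the edge `⟨k, k+1⟩`. -/
def edgeTime (x : ℝ≥0 → ℤ) (t : ℝ≥0) (k : ℤ) : ℝ :=
  localTime x t k + localTime x t (k + 1)

/-- `θ(s, k) = inf {t ≥ 0 : τ(t, k) > s}`. -/
def theta (x : ℝ≥0 → ℤ) (s : ℝ≥0) (k : ℤ) : ℝ≥0 :=
  sInf {t : ℝ≥0 | (s : ℝ) < edgeTime x t k}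

/-- `ξ_k(s) = ℓ(θ(s, k), k+1) - ℓ(θ(s, k), k)`. -/
def xi (x : ℝ≥0 → ℤ) (k : ℤ) (s : ℝ≥0) : ℝ :=
  localTime x (theta x s k) (k + 1) - localTime x (theta x s k) k

/-- `α_k(s) = 1{x(θ(s, k)) = k+1} - 1{x(θ(s, k)) = k}`. -/
def alpha (x : ℝ≥0 → ℤ) (k : ℤ) (s : ℝ≥0) : ℤ :=
  (if x (theta x s k) = k + 1 then 1 else 0) - (if x (theta x s k) = k then 1 else 0)

/-- The right continuous inverse
`β_σ(t, k) = inf {s ≥ 0 : ∫₀ˢ 1{α_k(u) = σ} du > t}`, `σ = ±1`, of the local times of `α_k`. -/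
def beta (x : ℝ≥0 → ℤ) (σ : ℤˣ) (k : ℤ) (t : ℝ≥0) : ℝ≥0 :=
  sInf {s : ℝ≥0 | (t : ℝ) < localTime (alpha x k) s σ}

/-- `η_{k,-}(t) = ξ_k(β_-(t, k))` and `η_{k,+}(t) = -ξ_k(β_+(t, k))`. -/
def eta (x : ℝ≥0 → ℤ) (σ : ℤˣ) (k : ℤ) (t : ℝ≥0) : ℝ :=
  -((σ : ℤ) : ℝ) * xi x k (beta x σ k t)

/-! ### Markov processes -/

/-- `Z` is a (time homogeneous) Markov process with transition function `p`, with respect to its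
natural filtration: `P(Z(s+t) ∈ A | Z(r), r ≤ s) = p(t, Z(s), A)` almost surely. -/
structure IsMarkovProcess {Ω E : Type*} [MeasurableSpace Ω] [MeasurableSpace E] (P : Measure Ω)
    (Z : ℝ≥0 → Ω → E) (p : ℝ≥0 → E → Set E → ℝ≥0∞) : Prop where
  measurable : ∀ t, Measurable (Z t)
  markov : ∀ (s t : ℝ≥0) (A : Set E), MeasurableSet A →
    P⟦Z (s + t) ⁻¹' A | ⨆ r : Iic s, MeasurableSpace.comap (Z r) inferInstance⟧
      =ᵐ[P] fun ω => (p t (Z s ω) A).toReal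

/-- Consider the piecewise deterministic Markov process which follows the deterministic flow
`flow`, jumps with rate `rate z` when it is at `z`, and then chooses its new position according
to `jump z`. This is the probability that it makes exactly `n` jumps up to time `t` and is in
`A` at time `t`, if it starts from `z` (decomposition according to the time of the first jump). -/
def jumpTransition {E : Type*} [MeasurableSpace E] (flow : ℝ → E → E) (rate : E → ℝ)
    (jump : E → Measure E) : ℕ → ℝ → E → Set E → ℝ≥0∞
  | 0, t, z, A =>
      ENNReal.ofReal (Real.exp (-∫ v in (0 : ℝ)..t, rate (flow v z)))
        * A.indicator (fun _ => 1) (flow t z)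
  | n + 1, t, z, A =>
      ∫⁻ s in Ioc (0 : ℝ) t,
        ENNReal.ofReal (rate (flow s z) * Real.exp (-∫ v in (0 : ℝ)..s, rate (flow v z)))
          * ∫⁻ y, jumpTransition flow rate jump n (t - s) y A ∂(jump (flow s z))

/-- The transition function of the piecewise deterministic Markov process with the given flow,
jump rate and jump distribution. -/
def transition {E : Type*} [MeasurableSpace E] (flow : ℝ → E → E) (rate : E → ℝ)
    (jump : E → Measure E) (t : ℝ≥0) (z : E) (A : Set E) : ℝ≥0∞ :=
  ∑' n : ℕ, jumpTransition flow rate jump n t z A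

/-- The transition function of `(α, ξ)`: `ξ` has derivative `α`, and `α` changes its sign with
rate `w(α ξ)`. -/
def edgeTransition (w : ℝ → ℝ) : ℝ≥0 → ℤ × ℝ → Set (ℤ × ℝ) → ℝ≥0∞ :=
  transition (fun t z => (z.1, z.2 + t * z.1)) (fun z => w (z.1 * z.2))
    (fun z => Measure.dirac (-z.1, z.2))

/-- `Q(u, dv) = exp(-∫_u^v w(y) dy) w(v) dv` on `v ≥ u`. -/
def Q (w : ℝ → ℝ) (u : ℝ) : Measure ℝ :=
  (volume.restrict (Ici u)).withDensity
    (fun v => ENNReal.ofReal (Real.exp (-∫ y in u..v, w y) * w v))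

/-- The transition function of `η`: it decreases with unit speed, and from the position `u` it
jumps with rate `w(-u)` to a new position with distribution `Q(u, ·)`. -/
def etaTransition (w : ℝ → ℝ) : ℝ≥0 → ℝ → Set ℝ → ℝ≥0∞ :=
  transition (fun t u => u - t) (fun u => w (-u)) (Q w)

end RepellingWalk

end

/-!
For an edge `⟨k, k+1⟩` and the walk at one of its endpoints, let `u` be the local time at this
endpoint minus the local time at the other one. The walk crosses the edge with rate `w u`, and
while it stays where it is, `u` grows with unit speed; while it is away from the edge, `u` does not
change; and a crossing changes the sign of `u`. Hence, measured in the local time on the edge, the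
edge has a clock of its own, with hazard rate `w u`. If `-z` is the value of `u` just after a
crossing, then the value just before the next crossing is `nextPoint w (-z) e` with a standard
exponential variable `e`. So the switching points of `(α_k, ξ_k)` form the Markov chain
`z_{j+1} = nextPoint w (-z_j) e_j` with `z_0 = 0` (`chain`), and both `(α_k, ξ_k)` and the processes
`η_{k,±}` are explicit functions of it: `edgePath`, and `etaPath` of every other switching point
(`IsSwitching.edge_eq`, `IsSwitching.eta_eq`). It remains to prove that the variables of all
crossings of all edges are independent and standard exponential (`IsWalk.isExpArray_edgeVar`);
the Markov properties then follow from a statement about piecewise deterministic processes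
(`IsJumpChain.markov`).

At any time two clocks compete, those of the two edges at the position of the walk. By the lack of
memory of the exponential distribution, the competition does not change the joint law of the
exponential variables (`two_clocks`): the conditional tail probabilities of finitely many of the
variables, given the first `n` jumps, are a martingale (`IsWalk.lintegral_tailProb_succ`). So if the
variables that are revealed by the first `n` jumps are completed by independent ones, the array has
the right law (`IsWalk.isExpArray_completion`). The limit `n → ∞` gives the claim for the variables
of the walk itself, provided that every edge is crossed infinitely often.

This is the recurrence of the walk (`IsWalk.ae_tendsto_crossed`). The walk does not explode
(`IsWalk.ae_tendsto_jt`). If the local time at a site `j` is at most `s`, then the local times at the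
successive sites on each side of `j` are dominated by the Markov chain `l ↦ l + η(l)`, with
independent copies of `η` (`spread`, `IsSkeleton.le_totalSpread`). When this chain is absorbed at
`0`, the sum of all local times, which is the elapsed time, stays bounded; so the local time at `j`
cannot stay below `s` forever.

The absorption (`tendsto_aliveProb`) needs the long time behaviour of `η`. Since `w` is not constant,
`exp (δ x) + exp (-δ x)` is a Lyapunov function for small `δ` (`exists_drift`), and together with a
minorization this gives exponential convergence of the mean of `η(t)` (`HasDrift.exists_contraction`,
`HasDrift.exists_etaMean_limit`). The limit is zero. The local times at the two endpoints of an edge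
trace out a staircase, and reading it from one endpoint or from the other gives two inverse
functions, `s ↦ s + η(s)`, where `η` is the path through the even or through the odd switching points
(`lt_add_etaPath_iff`). The areas on both sides of the staircase fill a square
(`integral_min_add_integral_min`), and as both means of `η` have the same limit, this must vanish
(`HasDrift.exists_abs_etaMean_le`). Thus far from `0` the chain `l ↦ l + η(l)` is essentially a
centred random walk, for which the square root is superharmonic
(`HasDrift.exists_integral_sqrt_le`), and a maximum principle shows that it is absorbed
(`neverProb_eq_zero`).
-/


noncomputable section

open Filter
open scoped Topology

namespace RepellingWalk

/-! ### The cumulated rate and the exponential clock -/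

/-- The rate function is positive, non-decreasing and not constant. -/
class IsRate (w : ℝ → ℝ) : Prop where
  pos : ∀ u, 0 < w u
  mono : Monotone w
  nonconst : ∃ u v, w u ≠ w v

/-- The primitive `∫₀ˣ w` of the rate. -/
def cumRate (w : ℝ → ℝ) (x : ℝ) : ℝ := ∫ y in (0 : ℝ)..x, w y

@[simp] lemma cumRate_zero (w : ℝ → ℝ) : cumRate w 0 = 0 := by simp [cumRate]

section cumRate

variable (w : ℝ → ℝ) [hw : IsRate w]

lemma intervalIntegrable_rate (a b : ℝ) : IntervalIntegrable w volume a b :=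
  hw.mono.intervalIntegrable

lemma measurable_rate : Measurable w := hw.mono.measurable

lemma integral_rate (a b : ℝ) : ∫ y in a..b, w y = cumRate w b - cumRate w a := by
  unfold cumRate
  rw [intervalIntegral.integral_interval_sub_left (intervalIntegrable_rate w _ _)
    (intervalIntegrable_rate w _ _)]

lemma mul_sub_le_cumRate_sub {a b : ℝ} (hab : a ≤ b) :
    w a * (b - a) ≤ cumRate w b - cumRate w a := by
  rw [← integral_rate]
  have h := intervalIntegral.integral_mono_on hab (intervalIntegrable_const (c := w a) (μ := volume))
    (intervalIntegrable_rate w a b) (fun x hx => hw.mono hx.1)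
  simpa [mul_comm] using h

lemma cumRate_sub_le_mul_sub {a b : ℝ} (hab : a ≤ b) :
    cumRate w b - cumRate w a ≤ w b * (b - a) := by
  rw [← integral_rate]
  have h := intervalIntegral.integral_mono_on hab (intervalIntegrable_rate w a b)
    (intervalIntegrable_const (c := w b) (μ := volume)) (fun x hx => hw.mono hx.2)
  simpa [mul_comm] using h

lemma strictMono_cumRate : StrictMono (cumRate w) := fun a b hab => by
  have h := mul_sub_le_cumRate_sub w hab.le
  have := mul_pos (hw.pos a) (sub_pos.2 hab)
  linarith

lemma continuous_cumRate : Continuous (cumRate w) :=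
  intervalIntegral.continuous_primitive (intervalIntegrable_rate w) 0

lemma measurable_cumRate : Measurable (cumRate w) := (continuous_cumRate w).measurable

lemma tendsto_cumRate_atTop : Tendsto (cumRate w) atTop atTop := by
  have h : Tendsto (fun x : ℝ => w 0 * x) atTop atTop :=
    tendsto_id.const_mul_atTop (hw.pos 0)
  refine tendsto_atTop_mono' _ ?_ h
  filter_upwards [eventually_ge_atTop 0] with x hx
  simpa using mul_sub_le_cumRate_sub w hx

/-- The rate is the derivative of its primitive except on the countable set of its jumps. -/
lemma hasDerivAt_cumRate {x : ℝ} (hx : ContinuousAt w x) : HasDerivAt (cumRate w) (w x) x :=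
  intervalIntegral.integral_hasDerivAt_right (intervalIntegrable_rate w 0 x)
    (measurable_rate w).stronglyMeasurable.stronglyMeasurableAtFilter hx

lemma countable_discontinuity : {x | ¬ ContinuousAt w x}.Countable :=
  hw.mono.countable_not_continuousAt

/-- A fundamental theorem of calculus for `exp (-∫ w)` times a differentiable function: the
discontinuities of `w` do not matter. -/
lemma integral_exp_neg_cumRate (u : ℝ) {φ φ' : ℝ → ℝ} {a b : ℝ}
    (hφ : ∀ s, HasDerivAt φ (φ' s) s) (hφ' : Continuous φ') :
    ∫ s in a..b, Real.exp (-(cumRate w (u + s))) * (w (u + s) * φ s - φ' s)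
      = Real.exp (-(cumRate w (u + a))) * φ a - Real.exp (-(cumRate w (u + b))) * φ b := by
  have hcφ : Continuous φ := continuous_iff_continuousAt.2 fun s => (hφ s).continuousAt
  have hcG : Continuous fun s => Real.exp (-(cumRate w (u + s))) :=
    Real.continuous_exp.comp ((continuous_cumRate w).comp (continuous_const.add continuous_id)).neg
  have hint : IntervalIntegrable (fun s => w (u + s)) volume a b := by
    have : Monotone fun s => w (u + s) := fun x y hxy => hw.mono (by linarith)
    exact this.intervalIntegrable
  have key := MeasureTheory.integral_eq_of_hasDerivAt_off_countable
    (fun s => -(Real.exp (-(cumRate w (u + s))) * φ s))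
    (fun s => Real.exp (-(cumRate w (u + s))) * (w (u + s) * φ s - φ' s))
    (a := a) (b := b)
    (s := (fun s => u + s) ⁻¹' {x | ¬ ContinuousAt w x})
    ((countable_discontinuity w).preimage (add_right_injective u))
    (hcG.mul hcφ).neg.continuousOn ?_ ?_
  · rw [key]; ring
  · intro x hx
    have hc : ContinuousAt w (u + x) := by
      by_contra h; exact hx.2 h
    have h1 : HasDerivAt (fun s => cumRate w (u + s)) (w (u + x)) x := by
      have := (hasDerivAt_cumRate w hc).comp x ((hasDerivAt_id x).const_add u)
      rwa [mul_one] at this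
    have h2 := (h1.neg.exp.mul (hφ x)).neg
    convert! h2 using 1
    simp only [Pi.neg_apply]
    ring
  · have h1 : IntervalIntegrable (fun s => w (u + s) * φ s - φ' s) volume a b :=
      (hint.mul_continuousOn hcφ.continuousOn).sub (hφ'.intervalIntegrable _ _)
    exact h1.continuousOn_mul hcG.continuousOn

lemma lintegral_Ioc_exp_neg_cumRate (u : ℝ) {a b : ℝ} (hab : a ≤ b) :
    ∫⁻ s in Ioc a b, ENNReal.ofReal (w (u + s) * Real.exp (-(cumRate w (u + s))))
      = ENNReal.ofReal (Real.exp (-(cumRate w (u + a))) - Real.exp (-(cumRate w (u + b)))) := by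
  have h := integral_exp_neg_cumRate w u (φ := fun _ => 1) (φ' := fun _ => 0) (a := a) (b := b)
    (fun s => hasDerivAt_const s 1) continuous_const
  simp only [mul_one, sub_zero] at h
  have hint : IntervalIntegrable (fun s => w (u + s) * Real.exp (-(cumRate w (u + s)))) volume a b := by
    have : Monotone fun s => w (u + s) := fun x y hxy => hw.mono (by linarith)
    refine this.intervalIntegrable.mul_continuousOn (Continuous.continuousOn ?_)
    exact Real.continuous_exp.comp
      ((continuous_cumRate w).comp (continuous_const.add continuous_id)).neg
  rw [← h, intervalIntegral.integral_of_le hab, ofReal_integral_eq_lintegral_ofReal]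
  · simp_rw [mul_comm (Real.exp _)]
  · simp_rw [mul_comm (Real.exp _)]
    exact (intervalIntegrable_iff_integrableOn_Ioc_of_le hab).1 hint
  · exact Eventually.of_forall fun s => mul_nonneg (Real.exp_pos _).le (hw.pos _).le

lemma measurable_rate_mul_exp (u : ℝ) :
    Measurable fun s => ENNReal.ofReal (w (u + s) * Real.exp (-(cumRate w (u + s)))) := by
  have := measurable_rate w
  have := measurable_cumRate w
  fun_prop

lemma tendsto_exp_neg_cumRate (u : ℝ) :
    Tendsto (fun s => Real.exp (-(cumRate w (u + s)))) atTop (𝓝 0) :=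
  Real.tendsto_exp_neg_atTop_nhds_zero.comp
    ((tendsto_cumRate_atTop w).comp (tendsto_atTop_add_const_left _ u tendsto_id))

lemma lintegral_Ioi_exp_neg_cumRate (u a : ℝ) :
    ∫⁻ s in Ioi a, ENNReal.ofReal (w (u + s) * Real.exp (-(cumRate w (u + s))))
      = ENNReal.ofReal (Real.exp (-(cumRate w (u + a)))) := by
  have hU : Ioi a = ⋃ n : ℕ, Ioc a (a + n) := by
    ext x
    simp only [mem_Ioi, mem_iUnion, mem_Ioc, exists_and_left]
    refine ⟨fun h => ⟨h, ?_⟩, fun h => h.1⟩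
    obtain ⟨n, hn⟩ := exists_nat_ge (x - a)
    exact ⟨n, by linarith⟩
  have hmono : Monotone fun n : ℕ => Ioc a (a + n) := fun m n hmn =>
    Ioc_subset_Ioc_right (by gcongr)
  set f : ℝ → ℝ≥0∞ := fun s => ENNReal.ofReal (w (u + s) * Real.exp (-(cumRate w (u + s)))) with hf
  have h1 := tendsto_measure_iUnion_atTop (μ := volume.withDensity f) hmono
  rw [← hU, withDensity_apply _ measurableSet_Ioi] at h1
  refine tendsto_nhds_unique h1 ?_
  have h2 : ∀ n : ℕ, (volume.withDensity f) (Ioc a (a + n)) = ENNReal.ofReal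
      (Real.exp (-(cumRate w (u + a))) - Real.exp (-(cumRate w (u + (a + n))))) := fun n => by
    rw [withDensity_apply _ measurableSet_Ioc,
      lintegral_Ioc_exp_neg_cumRate w u (le_add_of_nonneg_right n.cast_nonneg)]
  simp only [Function.comp_def, h2]
  refine ENNReal.tendsto_ofReal ?_
  have h3 := (tendsto_exp_neg_cumRate w u).comp
    (tendsto_atTop_add_const_left _ a tendsto_natCast_atTop_atTop)
  simpa using h3.const_sub (Real.exp (-(cumRate w (u + a))))

/-- The probability that a clock with hazard rate `w(u + ·)` has not rung at time `v`. -/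
lemma lintegral_Ioi_rate_mul_exp (u a : ℝ) :
    ∫⁻ s in Ioi a, ENNReal.ofReal (w (u + s) * Real.exp (-(cumRate w (u + s) - cumRate w u)))
      = ENNReal.ofReal (Real.exp (-(cumRate w (u + a) - cumRate w u))) := by
  have h1 : ∀ s, Real.exp (-(cumRate w (u + s) - cumRate w u))
      = Real.exp (cumRate w u) * Real.exp (-(cumRate w (u + s))) := fun s => by
    rw [← Real.exp_add]; ring_nf
  simp_rw [h1, mul_left_comm (w _), ENNReal.ofReal_mul (Real.exp_pos _).le]
  rw [lintegral_const_mul _ (measurable_rate_mul_exp w u), lintegral_Ioi_exp_neg_cumRate]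

lemma integral_rate_add (u a b : ℝ) :
    ∫ y in a..b, w (u + y) = cumRate w (u + b) - cumRate w (u + a) := by
  rw [intervalIntegral.integral_comp_add_left, integral_rate]

/-! ### The first point of a Poisson process with intensity `w` -/

/-- The point `v ≥ u` with `∫_u^v w = e` (for `e ≥ 0`). If `e` has the standard exponential
distribution, this is the first point after `u` of a Poisson process with intensity `w`. -/
def nextPoint (w : ℝ → ℝ) (u e : ℝ) : ℝ := sInf {v | cumRate w u + max e 0 ≤ cumRate w v}

lemma exists_cumRate_eq (u : ℝ) {e : ℝ} (he : 0 ≤ e) : ∃ v, u ≤ v ∧ cumRate w v = cumRate w u + e := by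
  obtain ⟨b, hb⟩ := (tendsto_cumRate_atTop w).eventually_ge_atTop (cumRate w u + e) |>.exists
  have hub : u ≤ b := (strictMono_cumRate w).le_iff_le.1 (by linarith)
  obtain ⟨v, hv, hv2⟩ := intermediate_value_Icc hub (continuous_cumRate w).continuousOn
    (show cumRate w u + e ∈ Icc (cumRate w u) (cumRate w b) from ⟨by linarith, hb⟩)
  exact ⟨v, hv.1, hv2⟩

lemma cumRate_nextPoint (u e : ℝ) : cumRate w (nextPoint w u e) = cumRate w u + max e 0 := by
  obtain ⟨v, -, hv⟩ := exists_cumRate_eq w u (le_max_right e 0)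
  have : {v | cumRate w u + max e 0 ≤ cumRate w v} = Ici v := by
    ext x
    simp only [mem_ofPred_eq, ← hv, (strictMono_cumRate w).le_iff_le, mem_Ici]
  rw [nextPoint, this, csInf_Ici, hv]

lemma nextPoint_le_iff {u e v : ℝ} :
    nextPoint w u e ≤ v ↔ cumRate w u + max e 0 ≤ cumRate w v := by
  rw [← cumRate_nextPoint, (strictMono_cumRate w).le_iff_le]

lemma lt_nextPoint_iff {u e v : ℝ} :
    v < nextPoint w u e ↔ cumRate w v < cumRate w u + max e 0 := by
  rw [← cumRate_nextPoint, (strictMono_cumRate w).lt_iff_lt]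

lemma le_nextPoint_iff {u e v : ℝ} :
    v ≤ nextPoint w u e ↔ cumRate w v ≤ cumRate w u + max e 0 := by
  rw [← cumRate_nextPoint, (strictMono_cumRate w).le_iff_le]

lemma le_nextPoint (u e : ℝ) : u ≤ nextPoint w u e := by
  rw [le_nextPoint_iff]; linarith [le_max_right e 0]

lemma lt_nextPoint {u e : ℝ} (he : 0 < e) : u < nextPoint w u e := by
  rw [lt_nextPoint_iff]; linarith [le_max_left e 0]

/-- The inverse of `nextPoint w u`. -/
lemma nextPoint_cumRate_sub {u v : ℝ} (huv : u ≤ v) :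
    nextPoint w u (cumRate w v - cumRate w u) = v := by
  apply (strictMono_cumRate w).injective
  rw [cumRate_nextPoint, max_eq_left (sub_nonneg.2 ((strictMono_cumRate w).monotone huv))]
  ring

lemma measurable_nextPoint : Measurable fun p : ℝ × ℝ => nextPoint w p.1 p.2 := by
  refine measurable_of_Iic fun v => ?_
  have : (fun p : ℝ × ℝ => nextPoint w p.1 p.2) ⁻¹' Iic v
      = {p | cumRate w p.1 + max p.2 0 ≤ cumRate w v} := by
    ext p; simp [nextPoint_le_iff]
  rw [this]
  have := measurable_cumRate w
  exact measurableSet_le (by fun_prop) measurable_const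

end cumRate

/-! ### The exponential distribution -/

instance : IsProbabilityMeasure (expMeasure 1) := isProbabilityMeasure_expMeasure one_pos

lemma expMeasure_Iic (a : ℝ) :
    expMeasure 1 (Iic a) = ENNReal.ofReal (if 0 ≤ a then 1 - Real.exp (-a) else 0) := by
  have h := cdf_expMeasure_eq (r := 1) one_pos a
  rw [cdf_eq_real, measureReal_def] at h
  rw [← ENNReal.ofReal_toReal (measure_ne_top (expMeasure 1) (Iic a)), h, one_mul]

lemma expMeasure_Ioi {a : ℝ} (ha : 0 ≤ a) :
    expMeasure 1 (Ioi a) = ENNReal.ofReal (Real.exp (-a)) := by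
  rw [← compl_Iic, prob_compl_eq_one_sub measurableSet_Iic, expMeasure_Iic, if_pos ha,
    ← ENNReal.ofReal_one, ← ENNReal.ofReal_sub _ (by simpa using ha)]
  congr 1; ring

lemma expMeasure_Iic_zero : expMeasure 1 (Iic 0) = 0 := by simp [expMeasure_Iic]

lemma ae_pos_expMeasure : ∀ᵐ e ∂(expMeasure 1), 0 < e := by
  rw [ae_iff]
  simpa [← Iic_def] using expMeasure_Iic_zero

lemma expMeasure_eq : expMeasure 1
    = (volume.restrict (Ioi 0)).withDensity fun x => ENNReal.ofReal (Real.exp (-x)) := by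
  have h : expMeasure 1 = volume.withDensity (exponentialPDF 1) := rfl
  rw [h, ← withDensity_indicator measurableSet_Ioi]
  refine withDensity_congr_ae ?_
  have h0 : ∀ᵐ x : ℝ ∂volume, x ≠ 0 := by simp [ae_iff]
  filter_upwards [h0] with x hx
  rw [exponentialPDF_eq, indicator_apply]
  rcases lt_or_gt_of_ne hx with h | h
  · simp [not_le.2 h, not_lt.2 h.le]
  · simp [h, h.le]

section

variable (w : ℝ → ℝ) [hw : IsRate w]

lemma Q_Ioi {u v : ℝ} (huv : u ≤ v) :
    Q w u (Ioi v) = ENNReal.ofReal (Real.exp (-(cumRate w v - cumRate w u))) := by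
  rw [Q, withDensity_apply _ measurableSet_Ioi, Measure.restrict_restrict measurableSet_Ioi,
    inter_eq_left.2 (Ioi_subset_Ici huv)]
  have := lintegral_Ioi_rate_mul_exp w u (v - u)
  rw [add_sub_cancel] at this
  rw [← this]
  have h2 := (measurePreserving_add_left volume u).setLIntegral_comp_emb
    (measurableEmbedding_addLeft u) (fun v => ENNReal.ofReal (Real.exp (-∫ y in u..v, w y) * w v))
    (Ioi (v - u))
  rw [image_const_add_Ioi, add_sub_cancel] at h2
  rw [← h2]
  simp_rw [integral_rate, mul_comm]

omit hw in
lemma Q_Iio (u : ℝ) : Q w u (Iio u) = 0 := by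
  rw [Q, withDensity_apply _ measurableSet_Iio, Measure.restrict_restrict measurableSet_Iio]
  have : Iio u ∩ Ici u = ∅ := by ext x; simp
  simp [this]

omit hw in
instance (u : ℝ) : NullSingletonClass (Q w u) := by unfold Q; infer_instance

lemma measurable_nextPoint_right (u : ℝ) : Measurable (nextPoint w u) := by
  have h : Measurable fun e : ℝ => ((u, e) : ℝ × ℝ) := measurable_const.prodMk measurable_id
  have h2 := (measurable_nextPoint w).comp h
  simp only [Function.comp_def] at h2
  exact h2

/-- `Q(u, ·)` is the law of the first Poisson point after `u`. -/
lemma map_nextPoint (u : ℝ) : (expMeasure 1).map (nextPoint w u) = Q w u := by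
  have hm := measurable_nextPoint_right w u
  have hp : IsProbabilityMeasure ((expMeasure 1).map (nextPoint w u)) :=
    Measure.isProbabilityMeasure_map hm.aemeasurable
  have hI : ∀ v, (expMeasure 1).map (nextPoint w u) (Ioi v) = Q w u (Ioi v) := by
    intro v
    rw [Measure.map_apply hm measurableSet_Ioi]
    rcases le_total u v with huv | huv
    · rw [Q_Ioi w huv, ← expMeasure_Ioi (sub_nonneg.2 ((strictMono_cumRate w).monotone huv))]
      congr 1
      ext e
      have := (strictMono_cumRate w).monotone huv
      rw [mem_preimage, mem_Ioi, mem_Ioi, lt_nextPoint_iff, ← sub_lt_iff_lt_add', lt_max_iff,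
        or_iff_left (by linarith)]
    · have h1 : Q w u (Ioi v) = 1 := by
        have : Ioi v = Ioc v u ∪ Ioi u := (Ioc_union_Ioi_eq_Ioi huv).symm
        have h0 : Q w u (Ioc v u) = 0 := by
          rw [← Ioo_ae_eq_Ioc.measure_eq]
          exact measure_mono_null Ioo_subset_Iio_self (Q_Iio w u)
        have h2 := Q_Ioi w (le_refl u)
        simp only [sub_self, neg_zero, Real.exp_zero, ENNReal.ofReal_one] at h2
        apply le_antisymm
        · rw [this]; exact (measure_union_le _ _).trans (by rw [h0, h2, zero_add])
        · rw [← h2]; exact measure_mono (Ioi_subset_Ioi huv)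
      rw [h1]
      apply le_antisymm prob_le_one
      have h3 := prob_add_prob_compl (μ := expMeasure 1) (measurableSet_Iic (a := (0 : ℝ)))
      rw [expMeasure_Iic_zero, zero_add] at h3
      rw [← h3]
      refine measure_mono fun e he => ?_
      rw [compl_Iic] at he
      exact huv.trans_lt (lt_nextPoint w he)
  symm
  have hu : Q w u univ = 1 := by
    have h1 := hI (u - 1)
    have h2 : Q w u (Iic (u - 1)) = 0 :=
      measure_mono_null (fun x (hx : x ≤ u - 1) => show x < u by linarith) (Q_Iio w u)
    have h3 : Q w u univ = Q w u (Ioi (u - 1)) := by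
      rw [← Iic_union_Ioi (a := u - 1)]
      refine le_antisymm ((measure_union_le _ _).trans ?_) (measure_mono subset_union_right)
      rw [h2, zero_add]
    rw [h3, ← h1, Measure.map_apply hm measurableSet_Ioi]
    refine le_antisymm prob_le_one ?_
    rw [← measure_univ (μ := expMeasure 1)]
    refine measure_mono fun e _ => ?_
    rw [mem_preimage, mem_Ioi]
    linarith [le_nextPoint w u e]
  have : IsProbabilityMeasure (Q w u) := ⟨hu⟩
  refine Measure.ext_of_Iic _ _ fun a => ?_
  rw [← compl_Ioi, prob_compl_eq_one_sub measurableSet_Ioi, prob_compl_eq_one_sub measurableSet_Ioi,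
    hI]

instance (u : ℝ) : IsProbabilityMeasure (Q w u) := by
  rw [← map_nextPoint]
  exact Measure.isProbabilityMeasure_map
    (measurable_nextPoint_right w u).aemeasurable

lemma measurable_Q : Measurable (Q w) := by
  refine Measure.measurable_of_measurable_coe _ fun A hA => ?_
  simp_rw [← map_nextPoint]
  have : ∀ u, (expMeasure 1).map (nextPoint w u) A
      = expMeasure 1 (Prod.mk u ⁻¹' {p : ℝ × ℝ | nextPoint w p.1 p.2 ∈ A}) := fun u => by
    rw [Measure.map_apply (measurable_nextPoint_right w u) hA]; rfl
  simp_rw [this]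
  exact measurable_measure_prodMk_left (measurable_nextPoint w hA)

lemma lintegral_nextPoint (u : ℝ) {f : ℝ → ℝ≥0∞} (hf : Measurable f) :
    ∫⁻ e, f (nextPoint w u e) ∂(expMeasure 1) = ∫⁻ y, f y ∂(Q w u) := by
  rw [← map_nextPoint, lintegral_map hf (measurable_nextPoint_right w u)]

lemma lintegral_Q (u : ℝ) {f : ℝ → ℝ≥0∞} (hf : Measurable f) :
    ∫⁻ y, f y ∂(Q w u) = ∫⁻ s in Ioi (0 : ℝ),
      ENNReal.ofReal (w (u + s) * Real.exp (-(cumRate w (u + s) - cumRate w u))) * f (u + s) := by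
  have hw' := measurable_rate w
  have hG := measurable_cumRate w
  rw [Q, lintegral_withDensity_eq_lintegral_mul _ (by simp_rw [integral_rate]; fun_prop) hf,
    setLIntegral_congr (Ioi_ae_eq_Ici (a := u)).symm]
  have h2 := (measurePreserving_add_left volume u).setLIntegral_comp_emb
    (measurableEmbedding_addLeft u)
    (((fun v => ENNReal.ofReal (Real.exp (-∫ y in u..v, w y) * w v))) * f) (Ioi 0)
  rw [image_const_add_Ioi, add_zero] at h2
  rw [← h2]
  simp_rw [Pi.mul_apply, integral_rate, mul_comm (Real.exp _)]

end

/-! ### Piecewise deterministic Markov processes -/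

lemma measurableSet_and {α : Type*} [MeasurableSpace α] {p q : α → Prop}
    (hp : MeasurableSet {a | p a}) (hq : MeasurableSet {a | q a}) :
    MeasurableSet {a | p a ∧ q a} := by
  rw [ofPred_and]; exact hp.inter hq

section Jump

variable {E : Type*} [MeasurableSpace E] (flow : ℝ → E → E) (rate : E → ℝ) (jump : E → Measure E)

/-- The probability that the process with the given flow and jump rate, started from `z`, does not
jump before time `t`. -/
def survival (t : ℝ) (z : E) : ℝ := Real.exp (-∫ v in (0 : ℝ)..t, rate (flow v z))

/-- The expectation of `f` at time `t`, on the event that there are exactly `n` jumps up to time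
`t`: this is `jumpTransition` with a function in place of a set. -/
def jumpOp : ℕ → ℝ → E → (E → ℝ≥0∞) → ℝ≥0∞
  | 0, t, z, f => ENNReal.ofReal (survival flow rate t z) * f (flow t z)
  | n + 1, t, z, f =>
      ∫⁻ s in Ioc (0 : ℝ) t, ENNReal.ofReal (rate (flow s z) * survival flow rate s z)
          * ∫⁻ y, jumpOp n (t - s) y f ∂(jump (flow s z))

lemma jumpTransition_eq_jumpOp (n : ℕ) (t : ℝ) (z : E) (A : Set E) :
    jumpTransition flow rate jump n t z A = jumpOp flow rate jump n t z (A.indicator fun _ => 1) := by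
  induction n generalizing t z with
  | zero => rfl
  | succ n ih => simp only [jumpTransition, jumpOp, ih, survival]

/-- The regularity of the data of a piecewise deterministic Markov process which is used below. -/
structure IsJumpData : Prop where
  measurable_flow : Measurable fun p : ℝ × E => flow p.1 p.2
  flow_zero : ∀ z, flow 0 z = z
  flow_add : ∀ s t z, flow (s + t) z = flow t (flow s z)
  measurable_rate : Measurable rate
  integrable : ∀ z a b, IntervalIntegrable (fun v => rate (flow v z)) volume a b
  measurable_jump : Measurable jump
  prob_jump : ∀ z, IsProbabilityMeasure (jump z)

variable {flow rate jump} (h : IsJumpData flow rate jump)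
include h

omit [MeasurableSpace E] h in
lemma survival_pos (t : ℝ) (z : E) : 0 < survival flow rate t z := Real.exp_pos _

lemma IsJumpData.survival_add (a s : ℝ) (z : E) :
    survival flow rate (a + s) z = survival flow rate a z * survival flow rate s (flow a z) := by
  rw [survival, survival, survival, ← Real.exp_add]
  congr 1
  simp_rw [← h.flow_add]
  rw [intervalIntegral.integral_comp_add_left (fun v => rate (flow v z)), add_zero,
    ← intervalIntegral.integral_add_adjacent_intervals (h.integrable z 0 a) (h.integrable z a _)]
  ring

lemma IsJumpData.measurable_survival : Measurable fun p : ℝ × E => survival flow rate p.1 p.2 := by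
  have hr : Measurable fun q : (ℝ × E) × ℝ => rate (flow q.2 q.1.2) :=
    h.measurable_rate.comp (h.measurable_flow.comp (by fun_prop : Measurable fun q : (ℝ × E) × ℝ => (q.2, q.1.2)))
  have key : ∀ S : Set ((ℝ × E) × ℝ), MeasurableSet S →
      Measurable fun p : ℝ × E => ∫ v, S.indicator (fun q => rate (flow q.2 q.1.2)) (p, v) := fun S hS =>
    ((hr.indicator hS).stronglyMeasurable.integral_prod_right' (ν := volume)).measurable
  have h1 := key {q | 0 < q.2 ∧ q.2 ≤ q.1.1} (measurableSet_and
    (measurableSet_lt (by fun_prop) (by fun_prop)) (measurableSet_le (by fun_prop) (by fun_prop)))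
  have h2 := key {q | q.1.1 < q.2 ∧ q.2 ≤ 0} (measurableSet_and
    (measurableSet_lt (by fun_prop) (by fun_prop)) (measurableSet_le (by fun_prop) (by fun_prop)))
  have h3 : (fun p : ℝ × E => survival flow rate p.1 p.2) = fun p => Real.exp
      (-((∫ v, {q : (ℝ × E) × ℝ | 0 < q.2 ∧ q.2 ≤ q.1.1}.indicator (fun q => rate (flow q.2 q.1.2)) (p, v))
        - ∫ v, {q : (ℝ × E) × ℝ | q.1.1 < q.2 ∧ q.2 ≤ 0}.indicator (fun q => rate (flow q.2 q.1.2)) (p, v))) := by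
    ext p
    rw [survival, intervalIntegral, ← integral_indicator measurableSet_Ioc,
      ← integral_indicator measurableSet_Ioc]
    rfl
  rw [h3]
  exact (h1.sub h2).neg.exp

lemma IsJumpData.measurable_lintegral_jump {α : Type*} [MeasurableSpace α] {φ : α → E}
    (hφ : Measurable φ) {F : α → E → ℝ≥0∞} (hF : Measurable fun p : α × E => F p.1 p.2) :
    Measurable fun a => ∫⁻ y, F a y ∂(jump (φ a)) := by
  have hp : IsMarkovKernel (⟨jump, h.measurable_jump⟩ : Kernel E E) := ⟨h.prob_jump⟩
  exact Measurable.lintegral_kernel_prod_right' (κ := (⟨jump, h.measurable_jump⟩ : Kernel E E).comap φ hφ) hF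

/-- The density of the time of the first jump. -/
lemma IsJumpData.measurable_density {α : Type*} [MeasurableSpace α] {σ : α → ℝ} {φ : α → E}
    (hσ : Measurable σ) (hφ : Measurable φ) : Measurable fun a =>
      ENNReal.ofReal (rate (flow (σ a) (φ a)) * survival flow rate (σ a) (φ a)) :=
  ((h.measurable_rate.comp (h.measurable_flow.comp (hσ.prodMk hφ))).mul
    (h.measurable_survival.comp (hσ.prodMk hφ))).ennreal_ofReal

lemma IsJumpData.measurable_jumpOp (n : ℕ) {f : E → ℝ≥0∞} (hf : Measurable f) :
    Measurable fun p : ℝ × E => jumpOp flow rate jump n p.1 p.2 f := by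
  induction n with
  | zero => exact h.measurable_survival.ennreal_ofReal.mul (hf.comp h.measurable_flow)
  | succ n ih =>
    have hS : MeasurableSet {q : (ℝ × E) × ℝ | 0 < q.2 ∧ q.2 ≤ q.1.1} :=
      measurableSet_and (measurableSet_lt (by fun_prop) (by fun_prop))
        (measurableSet_le (by fun_prop) (by fun_prop))
    have hm : Measurable fun q : (ℝ × E) × ℝ =>
        ENNReal.ofReal (rate (flow q.2 q.1.2) * survival flow rate q.2 q.1.2)
          * ∫⁻ y, jumpOp flow rate jump n (q.1.1 - q.2) y f ∂(jump (flow q.2 q.1.2)) := by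
      refine (h.measurable_density measurable_snd (by fun_prop)).mul ?_
      refine h.measurable_lintegral_jump (φ := fun q : (ℝ × E) × ℝ => flow q.2 q.1.2)
        (h.measurable_flow.comp (by fun_prop : Measurable fun q : (ℝ × E) × ℝ => (q.2, q.1.2)))
        (F := fun q y => jumpOp flow rate jump n (q.1.1 - q.2) y f) ?_
      exact ih.comp (by fun_prop : Measurable fun q : ((ℝ × E) × ℝ) × E => (q.1.1.1 - q.1.2, q.2))
    have := (hm.indicator hS).lintegral_prod_right' (ν := volume)
    convert this using 2 with p
    rw [jumpOp, ← lintegral_indicator measurableSet_Ioc]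
    rfl

lemma IsJumpData.measurable_tsum_jumpOp {f : E → ℝ≥0∞} (hf : Measurable f) :
    Measurable fun p : ℝ × E => ∑' n, jumpOp flow rate jump n p.1 p.2 f :=
  Measurable.tsum fun n => h.measurable_jumpOp n hf

/-- Absence of jumps up to time `a` moves the starting point along the flow. -/
lemma IsJumpData.survival_mul_jumpOp_zero (a c : ℝ) (z : E) (f : E → ℝ≥0∞) :
    ENNReal.ofReal (survival flow rate a z) * jumpOp flow rate jump 0 c (flow a z) f
      = jumpOp flow rate jump 0 (a + c) z f := by
  simp only [jumpOp]
  rw [h.survival_add, ENNReal.ofReal_mul (survival_pos a z).le, h.flow_add, mul_assoc]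

lemma IsJumpData.survival_mul_jumpOp_succ (n : ℕ) (a c : ℝ) (z : E) (f : E → ℝ≥0∞) :
    ENNReal.ofReal (survival flow rate a z) * jumpOp flow rate jump (n + 1) c (flow a z) f
      = ∫⁻ s in Ioc a (a + c), ENNReal.ofReal (rate (flow s z) * survival flow rate s z)
          * ∫⁻ y, jumpOp flow rate jump n (a + c - s) y f ∂(jump (flow s z)) := by
  have h2 := (measurePreserving_add_left volume a).setLIntegral_comp_emb
    (measurableEmbedding_addLeft a)
    (fun s => ENNReal.ofReal (rate (flow s z) * survival flow rate s z)
          * ∫⁻ y, jumpOp flow rate jump n (a + c - s) y f ∂(jump (flow s z))) (Ioc 0 c)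
  rw [image_const_add_Ioc, add_zero] at h2
  rw [← h2, jumpOp, ← lintegral_const_mul']
  · refine lintegral_congr fun s => ?_
    rw [h.survival_add, ← h.flow_add, ← mul_assoc, ← ENNReal.ofReal_mul (survival_pos a z).le]
    congr 2
    · ring
    · congr 1 with y; congr 1; ring
  · exact ENNReal.ofReal_ne_top

end Jump

/-- `(Tₙ, Zₙ)` are the successive jump times of a piecewise deterministic process and its
positions right after the jumps; `𝒢 n` is the information up to the `n`-th jump. -/
structure IsJumpChain {Ω E : Type*} [MeasurableSpace Ω] [MeasurableSpace E] (P : Measure Ω)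
    (flow : ℝ → E → E) (rate : E → ℝ) (jump : E → Measure E) (𝒢 : ℕ → MeasurableSpace Ω)
    (T : ℕ → Ω → ℝ) (Z : ℕ → Ω → E) : Prop where
  mono : Monotone 𝒢
  le : ∀ n, 𝒢 n ≤ (inferInstance : MeasurableSpace Ω)
  time_zero : ∀ᵐ ω ∂P, T 0 ω = 0
  measurable_time : ∀ n, Measurable[𝒢 n] (T n)
  measurable_pos : ∀ n, Measurable[𝒢 n] (Z n)
  time_mono : ∀ᵐ ω ∂P, Monotone fun n => T n ω
  time_tendsto : ∀ᵐ ω ∂P, Tendsto (fun n => T n ω) atTop atTop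
  -- the next jump takes place almost surely, and its time has the tail `survival`
  tail : ∀ᵐ ω ∂P, ∀ n, ∀ v, 0 ≤ v → ∫⁻ s in Ioi v,
    ENNReal.ofReal (rate (flow s (Z n ω)) * survival flow rate s (Z n ω))
      = ENNReal.ofReal (survival flow rate v (Z n ω))
  -- given `𝒢 n`, the law of the next waiting time and of the position after it
  step : ∀ n B, MeasurableSet[𝒢 n] B → ∀ F : (ℝ × E) × ℝ × E → ℝ≥0∞, Measurable F →
    ∫⁻ ω in B, F ((T n ω, Z n ω), T (n + 1) ω - T n ω, Z (n + 1) ω) ∂P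
      = ∫⁻ ω in B, (∫⁻ s in Ioi (0 : ℝ),
          ENNReal.ofReal (rate (flow s (Z n ω)) * survival flow rate s (Z n ω))
            * ∫⁻ y, F ((T n ω, Z n ω), s, y) ∂(jump (flow s (Z n ω)))) ∂P

/-- A measurable version of a conditional probability is recognized by its integrals. -/
lemma condExp_indicator_eq_toReal {Ω : Type*} {m mΩ : MeasurableSpace Ω} {P : Measure Ω}
    [IsProbabilityMeasure P] (hle : m ≤ mΩ) {S : Set Ω} (hS : MeasurableSet S) {g : Ω → ℝ≥0∞}
    (hg : Measurable[m] g) (key : ∀ B, MeasurableSet[m] B → ∫⁻ ω in B, g ω ∂P = P (B ∩ S)) :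
    P⟦S | m⟧ =ᵐ[P] fun ω => (g ω).toReal := by
  have hg' : Measurable g := hg.mono hle le_rfl
  have huniv : ∫⁻ ω, g ω ∂P ≠ ∞ := by
    have := key univ MeasurableSet.univ
    rw [setLIntegral_univ] at this
    rw [this]
    exact measure_ne_top _ _
  have hfin : ∀ᵐ ω ∂P, g ω < ∞ := ae_lt_top hg' huniv
  have hint : Integrable (fun ω => (g ω).toReal) P :=
    integrable_toReal_of_lintegral_ne_top hg'.aemeasurable huniv
  symm
  refine ae_eq_condExp_of_forall_setIntegral_eq hle ?_ (fun B _ _ => hint.integrableOn) ?_ ?_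
  · exact (integrable_const (1 : ℝ)).indicator hS
  · intro B hB _
    rw [integral_toReal hg'.aemeasurable (ae_restrict_of_ae hfin), key B hB,
      integral_indicator hS, integral_const, smul_eq_mul, mul_one,
      Measure.restrict_restrict hS, measureReal_restrict_apply MeasurableSet.univ, univ_inter,
      measureReal_def, inter_comm]
  · exact (hg.ennreal_toReal.stronglyMeasurable).aestronglyMeasurable

section Markov

variable {Ω E : Type*} [mΩ : MeasurableSpace Ω] [MeasurableSpace E] {P : Measure Ω}
  {flow : ℝ → E → E} {rate : E → ℝ} {jump : E → Measure E}
  {𝒢 : ℕ → MeasurableSpace Ω} {T : ℕ → Ω → ℝ} {Z : ℕ → Ω → E}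
  (h : IsJumpData flow rate jump) (hc : IsJumpChain P flow rate jump 𝒢 T Z)
include h hc

/-- The expectation at time `b` on the event that there are `m` jumps between the `n`-th one and
time `b`. As in the definition of `jumpOp`, the first of these jumps is split off. -/
lemma IsJumpChain.setLIntegral_eq_jumpOp (m n : ℕ) {B : Set Ω} (hB : MeasurableSet[𝒢 n] B) (b : ℝ)
    (hb : ∀ ω ∈ B, T n ω ≤ b) {f : E → ℝ≥0∞} (hf : Measurable f) :
    ∫⁻ ω in B ∩ {ω | T (n + m) ω ≤ b ∧ b < T (n + m + 1) ω}, f (flow (b - T (n + m) ω) (Z (n + m) ω)) ∂P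
      = ∫⁻ ω in B, jumpOp flow rate jump m (b - T n ω) (Z n ω) f ∂P := by
  have hT : ∀ n, Measurable (T n) := fun n => (hc.measurable_time n).mono (hc.le n) le_rfl
  have hZ : ∀ n, Measurable (Z n) := fun n => (hc.measurable_pos n).mono (hc.le n) le_rfl
  have hp := h.prob_jump
  induction m generalizing n B with
  | zero =>
    have hB' := hc.le n _ hB
    have h1 := hc.step n B hB (fun q => {q : (ℝ × E) × ℝ × E | b < q.1.1 + q.2.1}.indicator
      (fun q => f (flow (b - q.1.1) q.1.2)) q) (by
        refine Measurable.indicator (hf.comp (h.measurable_flow.comp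
          (by fun_prop : Measurable fun q : (ℝ × E) × ℝ × E => (b - q.1.1, q.1.2))))
          (measurableSet_lt ?_ ?_) <;> fun_prop)
    have h2 : ∀ ω, (B ∩ {ω | T (n + 0) ω ≤ b ∧ b < T (n + 0 + 1) ω}).indicator
        (fun ω => f (flow (b - T (n + 0) ω) (Z (n + 0) ω))) ω = B.indicator (fun ω =>
          {q : (ℝ × E) × ℝ × E | b < q.1.1 + q.2.1}.indicator (fun q => f (flow (b - q.1.1) q.1.2))
            ((T n ω, Z n ω), T (n + 1) ω - T n ω, Z (n + 1) ω)) ω := by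
      intro ω
      by_cases hω : ω ∈ B
      · by_cases h3 : b < T (n + 1) ω <;> simp [indicator_apply, hω, hb ω hω, h3]
      · simp [indicator_apply, hω]
    rw [← lintegral_indicator (hB'.inter (measurableSet_and (measurableSet_le (hT _) measurable_const)
      (measurableSet_lt measurable_const (hT _)))), lintegral_congr h2, lintegral_indicator hB', h1]
    refine setLIntegral_congr_fun_ae hB' ?_
    filter_upwards [hc.tail] with ω hω hωB
    have h4 : ∀ s, ∫⁻ y, {q : (ℝ × E) × ℝ × E | b < q.1.1 + q.2.1}.indicator
        (fun q => f (flow (b - q.1.1) q.1.2)) ((T n ω, Z n ω), s, y) ∂(jump (flow s (Z n ω)))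
        = (Ioi (b - T n ω)).indicator (fun _ => f (flow (b - T n ω) (Z n ω))) s := by
      intro s
      have : ∀ y, {q : (ℝ × E) × ℝ × E | b < q.1.1 + q.2.1}.indicator
        (fun q => f (flow (b - q.1.1) q.1.2)) ((T n ω, Z n ω), s, y)
          = (Ioi (b - T n ω)).indicator (fun _ => f (flow (b - T n ω) (Z n ω))) s := fun y => by
        simp [indicator_apply, sub_lt_iff_lt_add']
      simp [this]
    simp_rw [h4]
    have h5 : 0 ≤ b - T n ω := sub_nonneg.2 (hb ω hωB)
    rw [jumpOp, ← hω n _ h5, ← lintegral_mul_const _ (h.measurable_density measurable_id' measurable_const)]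
    have h6 : ∀ s, ENNReal.ofReal (rate (flow s (Z n ω)) * survival flow rate s (Z n ω)) *
        (Ioi (b - T n ω)).indicator (fun _ => f (flow (b - T n ω) (Z n ω))) s
        = (Ioi (b - T n ω)).indicator (fun s => ENNReal.ofReal (rate (flow s (Z n ω)) * survival flow rate s (Z n ω))
          * f (flow (b - T n ω) (Z n ω))) s := fun s => by
      simp only [indicator_apply]; split_ifs <;> simp
    simp_rw [h6]
    rw [setLIntegral_indicator measurableSet_Ioi, inter_eq_left.2 (Ioi_subset_Ioi h5)]
  | succ m ih =>
    have hB' := hc.le n _ hB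
    have hB1 : MeasurableSet[𝒢 (n + 1)] (B ∩ {ω | T (n + 1) ω ≤ b}) :=
      (hc.mono n.le_succ _ hB).inter (hc.measurable_time (n + 1) measurableSet_Iic)
    have h1 := ih (n + 1) hB1 (fun ω hω => hω.2)
    have hae : (B ∩ {ω | T (n + (m + 1)) ω ≤ b ∧ b < T (n + (m + 1) + 1) ω} : Set Ω)
        =ᵐ[P] (B ∩ {ω | T (n + 1) ω ≤ b} ∩ {ω | T (n + 1 + m) ω ≤ b ∧ b < T (n + 1 + m + 1) ω} : Set Ω) := by
      rw [Filter.eventuallyEq_set]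
      filter_upwards [hc.time_mono] with ω hω
      simp only [mem_inter_iff, mem_ofPred_eq]
      rw [show n + (m + 1) = n + 1 + m by ring]
      have : T (n + 1) ω ≤ T (n + 1 + m) ω := hω (by lia)
      constructor
      · rintro ⟨h1, h2, h3⟩; exact ⟨⟨h1, this.trans h2⟩, h2, h3⟩
      · rintro ⟨⟨h1, -⟩, h2, h3⟩; exact ⟨h1, h2, h3⟩
    rw [setLIntegral_congr hae, show n + (m + 1) = n + 1 + m by ring, h1]
    have hF : Measurable fun q : (ℝ × E) × ℝ × E => {q : (ℝ × E) × ℝ × E | q.1.1 + q.2.1 ≤ b}.indicator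
        (fun q => jumpOp flow rate jump m (b - q.1.1 - q.2.1) q.2.2 f) q := by
      refine Measurable.indicator ((h.measurable_jumpOp m hf).comp
        (by fun_prop : Measurable fun q : (ℝ × E) × ℝ × E => (b - q.1.1 - q.2.1, q.2.2))) (measurableSet_le ?_ ?_) <;> fun_prop
    have h2 := hc.step n B hB _ hF
    have h3 : ∀ ω, (B ∩ {ω | T (n + 1) ω ≤ b}).indicator
        (fun ω => jumpOp flow rate jump m (b - T (n + 1) ω) (Z (n + 1) ω) f) ω
        = B.indicator (fun ω => {q : (ℝ × E) × ℝ × E | q.1.1 + q.2.1 ≤ b}.indicator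
        (fun q => jumpOp flow rate jump m (b - q.1.1 - q.2.1) q.2.2 f)
          ((T n ω, Z n ω), T (n + 1) ω - T n ω, Z (n + 1) ω)) ω := by
      intro ω
      by_cases hω : ω ∈ B
      · by_cases h3 : T (n + 1) ω ≤ b <;> simp [indicator_apply, hω, h3]
      · simp [indicator_apply, hω]
    rw [← lintegral_indicator (hc.le _ _ hB1), lintegral_congr h3, lintegral_indicator hB', h2]
    refine lintegral_congr fun ω => ?_
    rw [jumpOp]
    have h6 : ∀ s, ENNReal.ofReal (rate (flow s (Z n ω)) * survival flow rate s (Z n ω)) *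
        ∫⁻ y, {q : (ℝ × E) × ℝ × E | q.1.1 + q.2.1 ≤ b}.indicator
        (fun q => jumpOp flow rate jump m (b - q.1.1 - q.2.1) q.2.2 f) ((T n ω, Z n ω), s, y) ∂(jump (flow s (Z n ω)))
        = (Iic (b - T n ω)).indicator (fun s => ENNReal.ofReal (rate (flow s (Z n ω)) * survival flow rate s (Z n ω))
          * ∫⁻ y, jumpOp flow rate jump m (b - T n ω - s) y f ∂(jump (flow s (Z n ω)))) s := fun s => by
      by_cases hs : s ≤ b - T n ω
      · have hs' : T n ω + s ≤ b := by linarith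
        simp [hs, hs']
      · have hs' : ¬ T n ω + s ≤ b := fun h => hs (by linarith)
        simp [hs, hs']
    simp_rw [h6]
    rw [setLIntegral_indicator measurableSet_Iic, inter_comm, Ioi_inter_Iic]

/-- The Markov property at time `a`, on the event that there are `n` jumps up to time `a`, and
with `m` further jumps up to time `b`. -/
lemma IsJumpChain.setLIntegral_eq_survival_mul (m n : ℕ) {B : Set Ω} (hB : MeasurableSet[𝒢 n] B)
    {a b : ℝ} (hab : a ≤ b) (ha : ∀ ω ∈ B, T n ω ≤ a) {f : E → ℝ≥0∞} (hf : Measurable f) :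
    ∫⁻ ω in B ∩ {ω | a < T (n + 1) ω} ∩ {ω | T (n + m) ω ≤ b ∧ b < T (n + m + 1) ω},
        f (flow (b - T (n + m) ω) (Z (n + m) ω)) ∂P
      = ∫⁻ ω in B, ENNReal.ofReal (survival flow rate (a - T n ω) (Z n ω)) *
          jumpOp flow rate jump m (b - a) (flow (a - T n ω) (Z n ω)) f ∂P := by
  have hT : ∀ n, Measurable (T n) := fun n => (hc.measurable_time n).mono (hc.le n) le_rfl
  have hZ : ∀ n, Measurable (Z n) := fun n => (hc.measurable_pos n).mono (hc.le n) le_rfl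
  have hB' := hc.le n _ hB
  cases m with
  | zero =>
    have h1 := hc.setLIntegral_eq_jumpOp h 0 n hB b (fun ω hω => (ha ω hω).trans hab) hf
    have h2 : B ∩ {ω | a < T (n + 1) ω} ∩ {ω | T (n + 0) ω ≤ b ∧ b < T (n + 0 + 1) ω}
        = B ∩ {ω | T (n + 0) ω ≤ b ∧ b < T (n + 0 + 1) ω} := by
      ext ω
      constructor
      · rintro ⟨⟨h1, -⟩, h2⟩; exact ⟨h1, h2⟩
      · rintro ⟨h1, h2⟩; exact ⟨⟨h1, hab.trans_lt h2.2⟩, h2⟩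
    rw [h2, h1]
    refine lintegral_congr fun ω => ?_
    rw [h.survival_mul_jumpOp_zero]
    congr 1; ring
  | succ m =>
    have hB1 : MeasurableSet[𝒢 (n + 1)] (B ∩ {ω | a < T (n + 1) ω} ∩ {ω | T (n + 1) ω ≤ b}) :=
      ((hc.mono n.le_succ _ hB).inter (hc.measurable_time (n + 1) measurableSet_Ioi)).inter
        (hc.measurable_time (n + 1) measurableSet_Iic)
    have h1 := hc.setLIntegral_eq_jumpOp h m (n + 1) hB1 b (fun ω hω => hω.2) hf
    have hae : (B ∩ {ω | a < T (n + 1) ω} ∩ {ω | T (n + (m + 1)) ω ≤ b ∧ b < T (n + (m + 1) + 1) ω} : Set Ω)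
        =ᵐ[P] (B ∩ {ω | a < T (n + 1) ω} ∩ {ω | T (n + 1) ω ≤ b} ∩
          {ω | T (n + 1 + m) ω ≤ b ∧ b < T (n + 1 + m + 1) ω} : Set Ω) := by
      rw [Filter.eventuallyEq_set]
      filter_upwards [hc.time_mono] with ω hω
      simp only [mem_inter_iff, mem_ofPred_eq]
      rw [show n + (m + 1) = n + 1 + m by ring]
      have : T (n + 1) ω ≤ T (n + 1 + m) ω := hω (by lia)
      constructor
      · rintro ⟨h1, h2, h3⟩; exact ⟨⟨h1, this.trans h2⟩, h2, h3⟩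
      · rintro ⟨⟨h1, -⟩, h2, h3⟩; exact ⟨h1, h2, h3⟩
    rw [setLIntegral_congr hae, show n + (m + 1) = n + 1 + m by ring, h1]
    have hF : Measurable fun q : (ℝ × E) × ℝ × E =>
        {q : (ℝ × E) × ℝ × E | a < q.1.1 + q.2.1 ∧ q.1.1 + q.2.1 ≤ b}.indicator
        (fun q => jumpOp flow rate jump m (b - q.1.1 - q.2.1) q.2.2 f) q := by
      refine Measurable.indicator ((h.measurable_jumpOp m hf).comp
        (by fun_prop : Measurable fun q : (ℝ × E) × ℝ × E => (b - q.1.1 - q.2.1, q.2.2)))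
        (measurableSet_and (measurableSet_lt ?_ ?_) (measurableSet_le ?_ ?_)) <;> fun_prop
    have h2 := hc.step n B hB _ hF
    have h3 : ∀ ω, (B ∩ {ω | a < T (n + 1) ω} ∩ {ω | T (n + 1) ω ≤ b}).indicator
        (fun ω => jumpOp flow rate jump m (b - T (n + 1) ω) (Z (n + 1) ω) f) ω
        = B.indicator (fun ω => {q : (ℝ × E) × ℝ × E | a < q.1.1 + q.2.1 ∧ q.1.1 + q.2.1 ≤ b}.indicator
        (fun q => jumpOp flow rate jump m (b - q.1.1 - q.2.1) q.2.2 f)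
          ((T n ω, Z n ω), T (n + 1) ω - T n ω, Z (n + 1) ω)) ω := by
      intro ω
      by_cases hω : ω ∈ B
      · by_cases h3 : T (n + 1) ω ≤ b <;> by_cases h4 : a < T (n + 1) ω <;>
          simp [indicator_apply, hω, h3, h4]
      · simp [indicator_apply, hω]
    rw [← lintegral_indicator (hc.le _ _ hB1), lintegral_congr h3, lintegral_indicator hB', h2]
    refine setLIntegral_congr_fun hB' fun ω hω => ?_
    rw [h.survival_mul_jumpOp_succ]
    have h6 : ∀ s, ENNReal.ofReal (rate (flow s (Z n ω)) * survival flow rate s (Z n ω)) *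
        ∫⁻ y, {q : (ℝ × E) × ℝ × E | a < q.1.1 + q.2.1 ∧ q.1.1 + q.2.1 ≤ b}.indicator
        (fun q => jumpOp flow rate jump m (b - q.1.1 - q.2.1) q.2.2 f) ((T n ω, Z n ω), s, y) ∂(jump (flow s (Z n ω)))
        = (Ioc (a - T n ω) (b - T n ω)).indicator
          (fun s => ENNReal.ofReal (rate (flow s (Z n ω)) * survival flow rate s (Z n ω))
          * ∫⁻ y, jumpOp flow rate jump m (b - T n ω - s) y f ∂(jump (flow s (Z n ω)))) s := fun s => by
      by_cases hs : s ∈ Ioc (a - T n ω) (b - T n ω)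
      · have hs' : a < T n ω + s ∧ T n ω + s ≤ b := ⟨by linarith [hs.1], by linarith [hs.2]⟩
        simp [hs, hs']
      · have hs' : ¬ (a < T n ω + s ∧ T n ω + s ≤ b) :=
          fun h => hs ⟨by linarith [h.1], by linarith [h.2]⟩
        simp only [indicator_apply, hs, mem_ofPred_eq, hs']
        simp
    simp_rw [h6]
    have h7 : Ioc (a - T n ω) (b - T n ω) ⊆ Ioi 0 := fun s hs => by
      have := ha ω hω; have := hs.1; rw [mem_Ioi]; linarith
    rw [setLIntegral_indicator measurableSet_Ioc, inter_eq_left.2 h7,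
      show a - T n ω + (b - a) = b - T n ω by ring]

omit h in
/-- There is no accumulation of jumps, so that an integral can be split according to the number of
jumps up to time `a`. -/
lemma IsJumpChain.lintegral_eq_tsum (n : ℕ) {a : ℝ} {B : Set Ω} (hB : MeasurableSet B)
    (hBa : ∀ ω ∈ B, T n ω ≤ a) (φ : Ω → ℝ≥0∞) :
    ∫⁻ ω in B, φ ω ∂P = ∑' m, ∫⁻ ω in B ∩ {ω | T (n + m) ω ≤ a ∧ a < T (n + m + 1) ω}, φ ω ∂P := by
  have hT : ∀ n, Measurable (T n) := fun n => (hc.measurable_time n).mono (hc.le n) le_rfl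
  have hm : ∀ m, MeasurableSet (B ∩ {ω | T (n + m) ω ≤ a ∧ a < T (n + m + 1) ω}) := fun m =>
    hB.inter (measurableSet_and (measurableSet_le (hT _) measurable_const)
      (measurableSet_lt measurable_const (hT _)))
  have hd : Pairwise (Function.onFun (AEDisjoint P)
      fun m => B ∩ {ω | T (n + m) ω ≤ a ∧ a < T (n + m + 1) ω}) := by
    intro m m' hmm
    rw [Function.onFun, AEDisjoint, measure_eq_zero_iff_ae_notMem]
    filter_upwards [hc.time_mono] with ω hω
    rintro ⟨⟨-, h1, h2⟩, -, h3, h4⟩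
    rcases lt_or_gt_of_ne hmm with h | h
    · exact absurd (hω (show n + m + 1 ≤ n + m' by lia)) (not_le.2 (h3.trans_lt h2))
    · exact absurd (hω (show n + m' + 1 ≤ n + m by lia)) (not_le.2 (h1.trans_lt h4))
  rw [← lintegral_iUnion₀ (fun m => (hm m).nullMeasurableSet) hd]
  refine setLIntegral_congr ?_
  rw [Filter.eventuallyEq_set]
  filter_upwards [hc.time_mono, hc.time_tendsto] with ω h1 h2
  rw [← inter_iUnion, mem_inter_iff, iff_self_and]
  intro hω
  have hex : ∃ m, a < T (n + m + 1) ω := by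
    obtain ⟨N, hN⟩ := (h2.eventually_gt_atTop a).exists
    exact ⟨N, hN.trans_le (h1 (by lia))⟩
  classical
  refine mem_iUnion.2 ⟨Nat.find hex, ?_, Nat.find_spec hex⟩
  rcases Nat.eq_zero_or_pos (Nat.find hex) with h0 | h0
  · rw [h0]; exact hBa ω hω
  · have := Nat.find_min hex (Nat.sub_one_lt h0.ne')
    rw [not_lt, show n + (Nat.find hex - 1) + 1 = n + Nat.find hex by lia] at this
    exact this

variable {Y : ℝ≥0 → Ω → E}
  (hY : ∀ᵐ ω ∂P, ∀ n (t : ℝ≥0), T n ω ≤ t → t < T (n + 1) ω → Y t ω = flow (t - T n ω) (Z n ω))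
include hY

/-- The Markov property at time `a`, on the event that there are `n` jumps up to time `a`. -/
lemma IsJumpChain.setLIntegral_markov (n : ℕ) {B : Set Ω} (hB : MeasurableSet[𝒢 n] B)
    {a b : ℝ≥0} (hab : a ≤ b) {f : E → ℝ≥0∞} (hf : Measurable f) :
    ∫⁻ ω in B ∩ {ω | T n ω ≤ a ∧ a < T (n + 1) ω}, f (Y b ω) ∂P
      = ∫⁻ ω in B ∩ {ω | T n ω ≤ a ∧ a < T (n + 1) ω},
          (∑' m, jumpOp flow rate jump m (b - a) (Y a ω) f) ∂P := by
  have hT : ∀ n, Measurable (T n) := fun n => (hc.measurable_time n).mono (hc.le n) le_rfl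
  have hZ : ∀ n, Measurable (Z n) := fun n => (hc.measurable_pos n).mono (hc.le n) le_rfl
  have hflow : ∀ (c : ℝ) n, Measurable fun ω => flow (c - T n ω) (Z n ω) := fun c n =>
    h.measurable_flow.comp ((measurable_const.sub (hT n)).prodMk (hZ n))
  have hB' := hc.le n _ hB
  have hab' : (a : ℝ) ≤ b := by exact_mod_cast hab
  have hBa : MeasurableSet[𝒢 n] (B ∩ {ω | T n ω ≤ a}) :=
    hB.inter (hc.measurable_time n measurableSet_Iic)
  have hset : B ∩ {ω | T n ω ≤ a ∧ a < T (n + 1) ω} = B ∩ {ω | T n ω ≤ a} ∩ {ω | a < T (n + 1) ω} := by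
    ext ω; simp only [mem_inter_iff, mem_ofPred_eq]; tauto
  have hmset : MeasurableSet (B ∩ {ω | T n ω ≤ a} ∩ {ω | a < T (n + 1) ω}) :=
    (hc.le n _ hBa).inter (measurableSet_lt measurable_const (hT _))
  have hmN : ∀ k, MeasurableSet {ω | T k ω ≤ b ∧ b < T (k + 1) ω} := fun k =>
    measurableSet_and (measurableSet_le (hT _) measurable_const) (measurableSet_lt measurable_const (hT _))
  -- the left hand side
  have h1 : ∫⁻ ω in B ∩ {ω | T n ω ≤ a} ∩ {ω | a < T (n + 1) ω}, f (Y b ω) ∂P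
      = ∑' m, ∫⁻ ω in B ∩ {ω | T n ω ≤ a}, ENNReal.ofReal (survival flow rate (a - T n ω) (Z n ω)) *
          jumpOp flow rate jump m (b - a) (flow (a - T n ω) (Z n ω)) f ∂P := by
    rw [hc.lintegral_eq_tsum n (a := b) hmset (fun ω hω => hω.1.2.trans hab')]
    congr 1 with m
    rw [← hc.setLIntegral_eq_survival_mul h m n hBa hab' (fun ω hω => hω.2) hf]
    refine setLIntegral_congr_fun_ae (hmset.inter (hmN _)) ?_
    filter_upwards [hY] with ω hω hωm
    rw [hω (n + m) b hωm.2.1 hωm.2.2]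
  -- the right hand side
  have h2 : ∫⁻ ω in B ∩ {ω | T n ω ≤ a} ∩ {ω | a < T (n + 1) ω},
        (∑' m, jumpOp flow rate jump m (b - a) (Y a ω) f) ∂P
      = ∫⁻ ω in B ∩ {ω | T n ω ≤ a}, ENNReal.ofReal (survival flow rate (a - T n ω) (Z n ω)) *
          (∑' m, jumpOp flow rate jump m (b - a) (flow (a - T n ω) (Z n ω)) f) ∂P := by
    -- the case `a = b` of the same lemma, with no further jump
    have h3 := hc.setLIntegral_eq_survival_mul h 0 n hBa (le_refl (a : ℝ)) (fun ω hω => hω.2)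
      (f := fun z => ∑' m, jumpOp flow rate jump m (b - a) z f)
      ((h.measurable_tsum_jumpOp hf).comp (by fun_prop : Measurable fun z : E => ((b - a : ℝ), z)))
    have h4 : B ∩ {ω | T n ω ≤ a} ∩ {ω | a < T (n + 1) ω} ∩ {ω | T (n + 0) ω ≤ a ∧ a < T (n + 0 + 1) ω}
        = B ∩ {ω | T n ω ≤ a} ∩ {ω | a < T (n + 1) ω} := by
      ext ω; simp only [mem_inter_iff, mem_ofPred_eq, add_zero]; tauto
    rw [h4] at h3
    simp only [jumpOp.eq_1, sub_self, h.flow_zero, add_zero] at h3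
    simp only [survival, intervalIntegral.integral_same, neg_zero, Real.exp_zero, ENNReal.ofReal_one, one_mul] at h3 ⊢
    rw [← h3]
    refine setLIntegral_congr_fun_ae hmset ?_
    filter_upwards [hY] with ω hω hωm
    rw [hω n a hωm.1.2 hωm.2]
  rw [hset, h1, h2, ← lintegral_tsum]
  · simp_rw [ENNReal.tsum_mul_left]
  · intro m
    refine (Measurable.mul ?_ ?_).aemeasurable
    · exact (h.measurable_survival.comp ((measurable_const.sub (hT n)).prodMk (hZ n))).ennreal_ofReal
    · exact (h.measurable_jumpOp m hf).comp (measurable_const.prodMk (hflow _ _))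

/-- The sets which, on the event that there are `n` jumps up to time `s`, coincide with a set that
is determined by the first `n` jumps. -/
abbrev IsJumpChain.traceSpace (P : Measure Ω) (𝒢 : ℕ → MeasurableSpace Ω) (T : ℕ → Ω → ℝ) (s : ℝ) :
    MeasurableSpace Ω where
  MeasurableSet' B := ∀ n, ∃ B', MeasurableSet[𝒢 n] B' ∧
    ∀ᵐ ω ∂P, T n ω ≤ s → s < T (n + 1) ω → (ω ∈ B ↔ ω ∈ B')
  measurableSet_empty n := ⟨∅, @MeasurableSet.empty Ω (𝒢 n), by simp⟩
  measurableSet_compl B hB n := by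
    obtain ⟨B', h1, h2⟩ := hB n
    refine ⟨B'ᶜ, h1.compl, ?_⟩
    filter_upwards [h2] with ω hω h3 h4
    rw [mem_compl_iff, mem_compl_iff, hω h3 h4]
  measurableSet_iUnion B hB n := by
    choose B' h1 h2 using fun i => hB i n
    refine ⟨⋃ i, B' i, MeasurableSet.iUnion h1, ?_⟩
    filter_upwards [ae_all_iff.2 h2] with ω hω h3 h4
    simp only [mem_iUnion, hω _ h3 h4]

/-- If there are `n` jumps up to time `s`, then the values up to time `s` are determined by the
first `n` jumps. -/
lemma IsJumpChain.comap_le_traceSpace {r s : ℝ≥0} (hrs : r ≤ s) :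
    MeasurableSpace.comap (Y r) inferInstance ≤ IsJumpChain.traceSpace P 𝒢 T s := by
  rintro _ ⟨C, hC, rfl⟩ n
  have hT : ∀ {m}, m ≤ n → Measurable[𝒢 n] (T m) := fun hmn =>
    (hc.measurable_time _).mono (hc.mono hmn) le_rfl
  have hZ : ∀ {m}, m ≤ n → Measurable[𝒢 n] (Z m) := fun hmn =>
    (hc.measurable_pos _).mono (hc.mono hmn) le_rfl
  have hfl : ∀ {m}, m ≤ n → MeasurableSet[𝒢 n] {ω | flow (r - T m ω) (Z m ω) ∈ C} := fun hmn =>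
    (h.measurable_flow.comp ((measurable_const.sub (hT hmn)).prodMk (hZ hmn))) hC
  have hI : ∀ {m}, m ≤ n → MeasurableSet[𝒢 n] {ω | T m ω ≤ r} := fun hmn => hT hmn measurableSet_Iic
  have hJ : ∀ {m}, m ≤ n → MeasurableSet[𝒢 n] {ω | r < T m ω} := fun hmn => hT hmn measurableSet_Ioi
  -- the value at time `r` lies on one of the first `n` pieces, or on the last one
  refine ⟨(⋃ m : Fin n, {ω | T m ω ≤ r} ∩ {ω | r < T (m + 1) ω} ∩ {ω | flow (r - T m ω) (Z m ω) ∈ C})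
    ∪ {ω | T n ω ≤ r} ∩ {ω | flow (r - T n ω) (Z n ω) ∈ C}, ?_, ?_⟩
  · refine MeasurableSet.union (MeasurableSet.iUnion fun m => ?_) ((hI le_rfl).inter (hfl le_rfl))
    exact ((hI m.2.le).inter (hJ m.2)).inter (hfl m.2.le)
  · have hrs' : (r : ℝ) ≤ s := by exact_mod_cast hrs
    filter_upwards [hY, hc.time_mono, hc.time_tendsto, hc.time_zero] with ω h1 h2 h3 h4 h5 h6
    simp only [mem_preimage, mem_union, mem_iUnion, mem_inter_iff, mem_ofPred_eq]
    constructor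
    · intro hC
      by_cases hn : T n ω ≤ r
      · right
        refine ⟨hn, ?_⟩
        rwa [← h1 n r hn (hrs'.trans_lt h6)]
      · left
        classical
        have hex : ∃ m, r < T (m + 1) ω := by
          obtain ⟨N, hN⟩ := (h3.eventually_gt_atTop (r : ℝ)).exists
          exact ⟨N, hN.trans_le (h2 (by lia))⟩
        have hlow : T (Nat.find hex) ω ≤ r := by
          rcases Nat.eq_zero_or_pos (Nat.find hex) with h0 | h0
          · rw [h0, h4]; exact r.2
          · have := Nat.find_min hex (Nat.sub_one_lt h0.ne')
            rwa [not_lt, show (Nat.find hex - 1) + 1 = Nat.find hex by lia] at this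
        have hlt : Nat.find hex < n := by
          by_contra hle
          exact hn ((h2 (not_lt.1 hle)).trans hlow)
        refine ⟨⟨Nat.find hex, hlt⟩, ⟨hlow, Nat.find_spec hex⟩, ?_⟩
        rwa [← h1 _ r hlow (Nat.find_spec hex)]
    · rintro (⟨m, ⟨h7, h8⟩, h9⟩ | ⟨h7, h9⟩)
      · rwa [h1 m r h7 h8]
      · rwa [h1 n r h7 (hrs'.trans_lt h6)]

/-- The Markov property at time `a`: the events of the past are split according to the number of
jumps up to time `a`. -/
lemma IsJumpChain.setLIntegral_markov_traceSpace {a b : ℝ≥0} (hab : a ≤ b) {B : Set Ω}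
    (hB : MeasurableSet[IsJumpChain.traceSpace P 𝒢 T a] B) (hBm : MeasurableSet B)
    {f : E → ℝ≥0∞} (hf : Measurable f) :
    ∫⁻ ω in B, f (Y b ω) ∂P = ∫⁻ ω in B, (∑' m, jumpOp flow rate jump m (b - a) (Y a ω) f) ∂P := by
  have h0 : ∀ φ : Ω → ℝ≥0∞, ∫⁻ ω in B, φ ω ∂P
      = ∑' m, ∫⁻ ω in B ∩ {ω | T m ω ≤ a ∧ a < T (m + 1) ω}, φ ω ∂P := fun φ => by
    have hT0 : Measurable (T 0) := (hc.measurable_time 0).mono (hc.le 0) le_rfl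
    have h1 := hc.lintegral_eq_tsum 0 (a := a) (B := B ∩ {ω | T 0 ω ≤ a})
      (hBm.inter (measurableSet_le hT0 measurable_const)) (fun ω hω => hω.2) φ
    have hae : (B ∩ {ω | T 0 ω ≤ a} : Set Ω) =ᵐ[P] B := by
      rw [Filter.eventuallyEq_set]
      filter_upwards [hc.time_zero] with ω hω
      simp [hω]
    rw [setLIntegral_congr hae] at h1
    rw [h1]
    congr 1 with m
    rw [zero_add]
    refine setLIntegral_congr ?_
    exact hae.inter (EventuallyEq.refl _ _)
  rw [h0, h0]
  congr 1 with n
  obtain ⟨B', h1, h2⟩ := hB n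
  have hae : (B ∩ {ω | T n ω ≤ a ∧ a < T (n + 1) ω} : Set Ω)
      =ᵐ[P] (B' ∩ {ω | T n ω ≤ a ∧ a < T (n + 1) ω} : Set Ω) := by
    rw [Filter.eventuallyEq_set]
    filter_upwards [h2] with ω hω
    simp only [mem_inter_iff, mem_ofPred_eq]
    constructor
    · rintro ⟨h3, h4, h5⟩; exact ⟨(hω h4 h5).1 h3, h4, h5⟩
    · rintro ⟨h3, h4, h5⟩; exact ⟨(hω h4 h5).2 h3, h4, h5⟩
  rw [setLIntegral_congr hae, setLIntegral_congr hae, hc.setLIntegral_markov h hY n h1 hab hf]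

/-- The Chapman–Kolmogorov equation along the process. -/
lemma IsJumpChain.lintegral_markov {a b : ℝ≥0} (hab : a ≤ b) {f : E → ℝ≥0∞} (hf : Measurable f) :
    ∫⁻ ω, f (Y b ω) ∂P = ∫⁻ ω, (∑' m, jumpOp flow rate jump m (b - a) (Y a ω) f) ∂P := by
  have := hc.setLIntegral_markov_traceSpace h hY hab (B := univ) MeasurableSet.univ MeasurableSet.univ hf
  simpa using this

/-- A process which follows the flow between the jumps of a jump chain is a Markov process. -/
theorem IsJumpChain.markov [IsProbabilityMeasure P] (hYm : ∀ t, Measurable (Y t)) :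
    IsMarkovProcess P Y (transition flow rate jump) := by
  refine ⟨hYm, fun s t A hA => ?_⟩
  have hle : (⨆ r : Iic s, MeasurableSpace.comap (Y r) inferInstance) ≤ mΩ :=
    iSup_le fun r => (hYm r).comap_le
  have htr : (⨆ r : Iic s, MeasurableSpace.comap (Y r) inferInstance)
      ≤ IsJumpChain.traceSpace P 𝒢 T s :=
    iSup_le fun r => hc.comap_le_traceSpace h hY r.2
  have hf : Measurable (A.indicator fun _ => (1 : ℝ≥0∞)) := measurable_one.indicator hA
  have htrans : ∀ z, transition flow rate jump t z A
      = ∑' k, jumpOp flow rate jump k t z (A.indicator fun _ => 1) := fun z => by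
    simp only [transition, jumpTransition_eq_jumpOp]
  refine condExp_indicator_eq_toReal hle (hYm _ hA) ?_ fun B hB => ?_
  · simp_rw [htrans]
    have h1 : Measurable[⨆ r : Iic s, MeasurableSpace.comap (Y r) inferInstance] (Y s) := by
      rw [measurable_iff_comap_le]
      exact le_iSup (fun r : Iic s => MeasurableSpace.comap (Y r) inferInstance) ⟨s, le_refl s⟩
    exact ((h.measurable_tsum_jumpOp hf).comp (by fun_prop : Measurable fun z : E => ((t : ℝ), z))).comp h1
  · have h1 := hc.setLIntegral_markov_traceSpace h hY (le_add_right (le_refl s) : s ≤ s + t) (htr B hB) (hle B hB) hf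
    simp_rw [htrans]
    rw [NNReal.coe_add, add_sub_cancel_left] at h1
    rw [← h1, inter_comm, ← Measure.restrict_apply (hYm _ hA), ← lintegral_indicator_one (hYm _ hA)]
    rfl

end Markov

/-! ### The chain of switching points of an edge -/

/-- The successive switching points of an edge process, in the coordinate `u = α ξ`: between two
switches `u` grows with unit speed, and it changes its sign when `α` does. The chain is driven by
the exponential variables `e`. -/
def chain (w : ℝ → ℝ) (x : ℝ) (e : ℕ → ℝ) : ℕ → ℝ
  | 0 => x
  | n + 1 => nextPoint w (-(chain w x e n)) (e n)

/-- The number `m` of the interval `[Tₘ, Tₘ₊₁)` which contains `t`. -/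
def stepIndex (T : ℕ → ℝ) (t : ℝ) : ℕ := sInf {m | t < T (m + 1)}

lemma stepIndex_eq {T : ℕ → ℝ} (hT : Monotone T) {t : ℝ} {m : ℕ} (h1 : T m ≤ t) (h2 : t < T (m + 1)) :
    stepIndex T t = m := by
  refine le_antisymm (Nat.sInf_le h2) (le_csInf ⟨m, h2⟩ fun k hk => ?_)
  by_contra hlt
  exact absurd (hT (show k + 1 ≤ m by lia)) (not_le.2 (h1.trans_lt hk))

lemma stepIndex_spec {T : ℕ → ℝ} (hT : Tendsto T atTop atTop) {t : ℝ} (h0 : T 0 ≤ t) :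
    T (stepIndex T t) ≤ t ∧ t < T (stepIndex T t + 1) := by
  have hne : {m | t < T (m + 1)}.Nonempty :=
    (((tendsto_add_atTop_iff_nat 1).2 hT).eventually_gt_atTop t).exists
  refine ⟨?_, Nat.sInf_mem hne⟩
  rcases Nat.eq_zero_or_pos (stepIndex T t) with h | h
  · rw [h]; exact h0
  · have := Nat.notMem_of_lt_sInf (show stepIndex T t - 1 < sInf {m | t < T (m + 1)} from Nat.sub_one_lt h.ne')
    rw [mem_ofPred_eq, not_lt, Nat.sub_add_cancel h] at this
    exact this

lemma measurable_stepIndex {α : Type*} [MeasurableSpace α] {T : ℕ → α → ℝ} (hT : ∀ n, Measurable (T n))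
    {t : α → ℝ} (ht : Measurable t) : Measurable fun a => stepIndex (fun n => T n a) (t a) := by
  have hS : ∀ j, MeasurableSet {a | t a < T (j + 1) a} := fun j => measurableSet_lt ht (hT _)
  refine measurable_to_countable' fun k => ?_
  have key : (fun a => stepIndex (fun n => T n a) (t a)) ⁻¹' {k}
      = ({a | t a < T (k + 1) a} ∩ ⋂ j ∈ Finset.range k, {a | t a < T (j + 1) a}ᶜ)
        ∪ {a | k = 0} ∩ ⋂ j, {a | t a < T (j + 1) a}ᶜ := by
    ext a
    simp only [mem_preimage, mem_singleton_iff, mem_union, mem_inter_iff, mem_ofPred_eq, mem_iInter,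
      mem_compl_iff, Finset.mem_range, stepIndex]
    constructor
    · rintro rfl
      by_cases hne : {m | t a < T (m + 1) a}.Nonempty
      · exact Or.inl ⟨Nat.sInf_mem hne, fun j hj => Nat.notMem_of_lt_sInf hj⟩
      · rw [not_nonempty_iff_eq_empty] at hne
        exact Or.inr ⟨by simp [hne], fun j hj => by
          have : j ∈ {m | t a < T (m + 1) a} := hj
          simp [hne] at this⟩
    · rintro (⟨h1, h2⟩ | ⟨h1, h2⟩)
      · refine le_antisymm (Nat.sInf_le h1) (le_csInf ⟨k, h1⟩ fun j hj => ?_)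
        by_contra hlt
        exact h2 j (not_le.1 hlt) hj
      · have : {m | t a < T (m + 1) a} = ∅ := eq_empty_of_forall_notMem h2
        simp [this, h1]
  rw [key]
  exact ((hS k).inter (Finset.measurableSet_biInter _ fun j _ => (hS j).compl)).union
    ((MeasurableSet.const _).inter (MeasurableSet.iInter fun j => (hS j).compl))

/-- The beginning of the `m`-th interval between two jumps of `etaPath z`. -/
def etaTime (z : ℕ → ℝ) (m : ℕ) : ℝ := ∑ i ∈ Finset.range (2 * m), z i

/-- The path which jumps to `z₀, z₂, z₄, …` and has unit negative speed between the jumps, from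
`z₂ₘ` down to `-z₂ₘ₊₁`. -/
def etaPath (z : ℕ → ℝ) (t : ℝ) : ℝ :=
  z (2 * stepIndex (etaTime z) t) - (t - etaTime z (stepIndex (etaTime z) t))

/-- The time of the `m`-th switch of the edge process. -/
def edgeSwitch (z : ℕ → ℝ) (m : ℕ) : ℝ := ∑ i ∈ Finset.range m, (z i + z (i + 1))

/-- The state right after the `m`-th switch of the edge process which has the sign `a` initially. -/
def edgeState (a : ℤ) (z : ℕ → ℝ) (m : ℕ) : ℤ × ℝ := (a * (-1) ^ m, -((a * (-1) ^ m : ℤ) : ℝ) * z m)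

/-- The flow of the edge processes. -/
def edgeFlow (t : ℝ) (z : ℤ × ℝ) : ℤ × ℝ := (z.1, z.2 + t * z.1)

/-- The path of the edge process with switching points `z` and initial sign `a`. -/
def edgePath (a : ℤ) (z : ℕ → ℝ) (t : ℝ) : ℤ × ℝ :=
  edgeFlow (t - edgeSwitch z (stepIndex (edgeSwitch z) t)) (edgeState a z (stepIndex (edgeSwitch z) t))

lemma etaTime_succ (z : ℕ → ℝ) (m : ℕ) :
    etaTime z (m + 1) = etaTime z m + (z (2 * m) + z (2 * m + 1)) := by
  rw [etaTime, etaTime, mul_add, mul_one, Finset.sum_range_succ, Finset.sum_range_succ, add_assoc]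

@[simp] lemma etaTime_zero (z : ℕ → ℝ) : etaTime z 0 = 0 := by simp [etaTime]

lemma edgeSwitch_succ (z : ℕ → ℝ) (m : ℕ) :
    edgeSwitch z (m + 1) = edgeSwitch z m + (z m + z (m + 1)) := by
  rw [edgeSwitch, edgeSwitch, Finset.sum_range_succ]

@[simp] lemma edgeSwitch_zero (z : ℕ → ℝ) : edgeSwitch z 0 = 0 := by simp [edgeSwitch]

lemma monotone_etaTime {z : ℕ → ℝ} (hz : ∀ n, 0 ≤ z n + z (n + 1)) : Monotone (etaTime z) :=
  monotone_nat_of_le_succ fun m => by rw [etaTime_succ]; linarith [hz (2 * m)]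

lemma monotone_edgeSwitch {z : ℕ → ℝ} (hz : ∀ n, 0 ≤ z n + z (n + 1)) : Monotone (edgeSwitch z) :=
  monotone_nat_of_le_succ fun m => by rw [edgeSwitch_succ]; linarith [hz m]

section

variable (w : ℝ → ℝ) [hw : IsRate w]

lemma chain_add_nonneg (x : ℝ) (e : ℕ → ℝ) (n : ℕ) : 0 ≤ chain w x e n + chain w x e (n + 1) := by
  have := le_nextPoint w (-(chain w x e n)) (e n)
  rw [chain]; linarith

lemma chain_add_pos (x : ℝ) {e : ℕ → ℝ} {n : ℕ} (he : 0 < e n) :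
    0 < chain w x e n + chain w x e (n + 1) := by
  have := lt_nextPoint w (u := -(chain w x e n)) he
  rw [chain]; linarith

/-- If infinitely many of the variables which drive the even steps are large, the process has only
finitely many jumps in a bounded time. -/
lemma tendsto_etaTime {z e : ℕ → ℝ} (hz : ∀ n, z (n + 1) = nextPoint w (-(z n)) (e n))
    (he : ∃ᶠ m in atTop, 1 < e (2 * m)) : Tendsto (etaTime z) atTop atTop := by
  have hz0 : ∀ n, 0 ≤ z n + z (n + 1) := fun n => by
    have := le_nextPoint w (-(z n)) (e n)
    rw [hz]; linarith
  have hmono := monotone_etaTime hz0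
  by_contra hcon
  have hbd : ∃ B, ∀ m, etaTime z m ≤ B := by
    by_contra h
    push Not at h
    exact hcon (tendsto_atTop_atTop_of_monotone hmono fun b => (h b).imp fun _ h => h.le)
  obtain ⟨B, hB⟩ := hbd
  have hconv := tendsto_atTop_ciSup hmono ⟨B, by rintro _ ⟨m, rfl⟩; exact hB m⟩
  -- if the times are bounded, then the lengths of the steps tend to `0`; but a driving variable
  -- `e > 1` and the bound of `w` on the range of the path force steps of a definite length
  have hdiff : Tendsto (fun m => etaTime z (m + 1) - etaTime z m) atTop (𝓝 0) := by
    simpa using ((tendsto_add_atTop_iff_nat 1).2 hconv).sub hconv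
  -- the path starts from `z 0` and has only the unit negative drift and upward jumps
  have hheight : ∀ m, z 0 ≤ etaTime z m + z (2 * m) := by
    intro m
    induction m with
    | zero => simp
    | succ m ih =>
      rw [etaTime_succ, mul_add, mul_one]
      linarith [hz0 (2 * m + 1)]
  have hwpos := hw.pos (B - z 0)
  have hsmall := hdiff.eventually_lt_const (inv_pos.2 hwpos)
  obtain ⟨m, hm1, hm2⟩ := (he.and_eventually hsmall).exists
  have h1 : z (2 * m + 1) ≤ B - z 0 := by
    have := hB (m + 1); rw [etaTime_succ] at this; linarith [hheight m]
  have h2 : e (2 * m) ≤ cumRate w (z (2 * m + 1)) - cumRate w (-z (2 * m)) := by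
    rw [hz, cumRate_nextPoint]; linarith [le_max_left (e (2 * m)) 0]
  have h3 := cumRate_sub_le_mul_sub w (show -z (2 * m) ≤ z (2 * m + 1) by linarith [hz0 (2 * m)])
  rw [etaTime_succ, add_sub_cancel_left] at hm2
  have h4 : w (z (2 * m + 1)) * (z (2 * m + 1) - -z (2 * m)) ≤ w (B - z 0) * (z (2 * m) + z (2 * m + 1)) := by
    have := hw.mono h1
    have := hz0 (2 * m)
    rw [sub_neg_eq_add, add_comm (z (2 * m + 1))]
    gcongr
  have h5 : w (B - z 0) * (z (2 * m) + z (2 * m + 1)) < 1 := by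
    rw [← mul_inv_cancel₀ hwpos.ne']
    gcongr
  linarith

/-- The condition on the driving variables which excludes an accumulation of jumps. -/
def Regular (e : ℕ → ℝ) : Prop :=
  (∀ n, 0 < e n) ∧ (∃ᶠ m in atTop, 1 < e (2 * m)) ∧ (∃ᶠ m in atTop, 1 < e (2 * m + 1))

lemma tendsto_etaTime_chain (x : ℝ) {e : ℕ → ℝ} (he : Regular e) :
    Tendsto (etaTime (chain w x e)) atTop atTop :=
  tendsto_etaTime w (e := e) (fun _ => rfl) he.2.1

lemma tendsto_etaTime_chain_succ (x : ℝ) {e : ℕ → ℝ} (he : Regular e) :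
    Tendsto (etaTime fun n => chain w x e (n + 1)) atTop atTop :=
  tendsto_etaTime w (e := fun n => e (n + 1)) (fun _ => rfl) he.2.2

lemma edgeSwitch_two_mul (z : ℕ → ℝ) (m : ℕ) :
    edgeSwitch z (2 * m) = etaTime z m + etaTime (fun n => z (n + 1)) m := by
  rw [edgeSwitch, etaTime, etaTime, Finset.sum_add_distrib]

lemma tendsto_edgeSwitch_chain (x : ℝ) {e : ℕ → ℝ} (he : Regular e) :
    Tendsto (edgeSwitch (chain w x e)) atTop atTop := by
  refine tendsto_atTop_atTop_of_monotone (monotone_edgeSwitch (chain_add_nonneg w x e)) fun b => ?_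
  obtain ⟨m, h1, h2⟩ := (((tendsto_etaTime_chain w x he).eventually_ge_atTop b).and
    ((tendsto_etaTime_chain_succ w x he).eventually_ge_atTop 0)).exists
  exact ⟨2 * m, by rw [edgeSwitch_two_mul]; linarith⟩

lemma measurable_chain {α : Type*} [MeasurableSpace α] {x : α → ℝ} (hx : Measurable x)
    {e : ℕ → α → ℝ} (n : ℕ) (he : ∀ i < n, Measurable (e i)) :
    Measurable fun a => chain w (x a) (fun i => e i a) n := by
  induction n with
  | zero => exact hx
  | succ n ih =>
    have h1 := (ih fun i hi => he i (by lia)).neg.prodMk (he n (by lia))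
    have h2 := (measurable_nextPoint w).comp h1
    simp only [Function.comp_def] at h2
    exact h2

end

/-! ### Sequences of independent exponential variables -/

/-- A sequence of independent standard exponential variables. -/
structure IsExpSeq {Ω : Type*} [MeasurableSpace Ω] (P : Measure Ω) (e : ℕ → Ω → ℝ) : Prop where
  measurable : ∀ n, Measurable (e n)
  indep : iIndepFun e P
  law : ∀ n, P.map (e n) = expMeasure 1

/-- Integrating out variables which are independent of the past. -/
lemma setLIntegral_of_indep {Ω : Type*} {𝒢 mΩ : MeasurableSpace Ω} {P : Measure Ω}
    [IsProbabilityMeasure P] (hle : 𝒢 ≤ mΩ) {α β : Type*} [MeasurableSpace α]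
    [MeasurableSpace β] {Y : Ω → β} (hY : Measurable Y)
    (hind : Indep 𝒢 (MeasurableSpace.comap Y inferInstance) P) {ζ : Ω → α} (hζ : Measurable[𝒢] ζ)
    {B : Set Ω} (hB : MeasurableSet[𝒢] B) {F : α × β → ℝ≥0∞} (hF : Measurable F) :
    ∫⁻ ω in B, F (ζ ω, Y ω) ∂P = ∫⁻ ω in B, (∫⁻ y, F (ζ ω, y) ∂(P.map Y)) ∂P := by
  have hprob : IsProbabilityMeasure (P.map Y) := Measure.isProbabilityMeasure_map hY.aemeasurable
  have hb : Measurable[𝒢] (B.indicator fun _ => (1 : ℝ≥0∞)) := (@measurable_const _ _ _ 𝒢 1).indicator hB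
  have hζ' : Measurable[𝒢] fun ω => (ζ ω, B.indicator (fun _ => (1 : ℝ≥0∞)) ω) := hζ.prodMk hb
  have h1 : IndepFun (fun ω => (ζ ω, B.indicator (fun _ => (1 : ℝ≥0∞)) ω)) Y P :=
    indep_of_indep_of_le_left hind hζ'.comap_le
  have hm := hζ'.mono hle le_rfl
  rw [indepFun_iff_map_prod_eq_prod_map_map hm.aemeasurable hY.aemeasurable] at h1
  have hH : Measurable fun q : (α × ℝ≥0∞) × β => q.1.2 * F (q.1.1, q.2) := by fun_prop
  have h2 := lintegral_map hH (hm.prodMk hY) (μ := P)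
  rw [h1, lintegral_prod _ hH.aemeasurable, lintegral_map (by fun_prop) hm] at h2
  have hB' := hle _ hB
  have hind : ∀ (φ : Ω → ℝ≥0∞) ω, B.indicator (fun _ => (1 : ℝ≥0∞)) ω * φ ω = B.indicator φ ω := by
    intro φ ω; by_cases h : ω ∈ B <;> simp [h]
  simp only [hind (fun ω => F (ζ ω, Y ω))] at h2
  rw [lintegral_indicator hB'] at h2
  rw [← h2, ← lintegral_indicator hB']
  refine lintegral_congr fun ω => ?_
  rw [← hind (fun ω => ∫⁻ y, F (ζ ω, y) ∂(P.map Y)), ← lintegral_const_mul _ (by fun_prop)]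

section ExpSeq

variable {Ω : Type*} [mΩ : MeasurableSpace Ω] {P : Measure Ω} [IsProbabilityMeasure P]
  {e : ℕ → Ω → ℝ} (he : IsExpSeq P e)
include he

lemma IsExpSeq.ae_regular : ∀ᵐ ω ∂P, Regular fun n => e n ω := by
  have h1 : ∀ᵐ ω ∂P, ∀ n, 0 < e n ω := ae_all_iff.2 fun n => by
    have := ae_pos_expMeasure
    rw [← he.law n] at this
    exact ae_of_ae_map (he.measurable n).aemeasurable this
  have h2 : ∀ φ : ℕ → ℕ, Function.Injective φ → ∀ᵐ ω ∂P, ∃ᶠ m in atTop, 1 < e (φ m) ω := by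
    intro φ hφ
    have hm : ∀ m, MeasurableSet (e (φ m) ⁻¹' Ioi 1) := fun m => he.measurable _ measurableSet_Ioi
    have hP : ∀ m, P (e (φ m) ⁻¹' Ioi 1) = ENNReal.ofReal (Real.exp (-1)) := fun m => by
      rw [← Measure.map_apply (he.measurable _) measurableSet_Ioi, he.law, expMeasure_Ioi zero_le_one]
    have hind : iIndepSet (fun m => e (φ m) ⁻¹' Ioi 1) P := by
      rw [iIndepSet_iff_meas_biInter hm]
      intro S
      exact (he.indep.precomp hφ).measure_inter_preimage_eq_mul S (fun _ _ => measurableSet_Ioi)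
    have h3 := measure_limsup_eq_one hm hind (by
      simp_rw [hP]
      exact ENNReal.tsum_const_eq_top_of_ne_zero (by simp [Real.exp_pos]))
    have h4 : ∀ᵐ ω ∂P, ω ∈ limsup (fun m => e (φ m) ⁻¹' Ioi 1) atTop :=
      (prob_compl_eq_zero_iff (MeasurableSet.measurableSet_limsup hm)).2 h3
    filter_upwards [h4] with ω hω
    rw [mem_limsup_iff_frequently_mem] at hω
    exact hω
  filter_upwards [h1, h2 (fun m => 2 * m) (fun a b h => by simpa using h),
    h2 (fun m => 2 * m + 1) (fun a b h => by simpa using h)] with ω a b c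
  exact ⟨a, b, c⟩

/-- The information carried by the first `n` variables. -/
abbrev pastSpace (e : ℕ → Ω → ℝ) (n : ℕ) : MeasurableSpace Ω :=
  ⨆ i ∈ {i | i < n}, MeasurableSpace.comap (e i) inferInstance

omit [IsProbabilityMeasure P] in
lemma IsExpSeq.pastSpace_le (n : ℕ) : pastSpace e n ≤ mΩ :=
  iSup₂_le fun i _ => (he.measurable i).comap_le

omit he mΩ in
lemma pastSpace_mono : Monotone (pastSpace e) := fun _ _ hmn =>
  biSup_mono fun _ hi => lt_of_lt_of_le hi hmn

omit he mΩ in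
lemma measurable_pastSpace {i n : ℕ} (hi : i < n) : Measurable[pastSpace e n] (e i) := by
  rw [measurable_iff_comap_le]
  exact le_iSup₂ (f := fun i (_ : i ∈ {i | i < n}) => MeasurableSpace.comap (e i) inferInstance) i hi

lemma IsExpSeq.setLIntegral_one {n : ℕ} {α : Type*} [MeasurableSpace α] {ζ : Ω → α}
    (hζ : Measurable[pastSpace e n] ζ) {B : Set Ω} (hB : MeasurableSet[pastSpace e n] B)
    {F : α × ℝ → ℝ≥0∞} (hF : Measurable F) :
    ∫⁻ ω in B, F (ζ ω, e n ω) ∂P = ∫⁻ ω in B, (∫⁻ y, F (ζ ω, y) ∂(expMeasure 1)) ∂P := by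
  rw [← he.law n]
  refine setLIntegral_of_indep (he.pastSpace_le n) (he.measurable n) ?_ hζ hB hF
  have h1 := indep_iSup_of_disjoint (fun i => (he.measurable i).comap_le) he.indep
    (S := {i | i < n}) (T := {n}) (by simp)
  simp only [mem_singleton_iff, iSup_iSup_eq_left] at h1
  exact h1

lemma IsExpSeq.setLIntegral_two {n : ℕ} {α : Type*} [MeasurableSpace α] {ζ : Ω → α}
    (hζ : Measurable[pastSpace e n] ζ) {B : Set Ω} (hB : MeasurableSet[pastSpace e n] B)
    {F : α × ℝ × ℝ → ℝ≥0∞} (hF : Measurable F) :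
    ∫⁻ ω in B, F (ζ ω, e n ω, e (n + 1) ω) ∂P
      = ∫⁻ ω in B, (∫⁻ y, ∫⁻ y', F (ζ ω, y, y') ∂(expMeasure 1) ∂(expMeasure 1)) ∂P := by
  have hmono : pastSpace e n ≤ pastSpace e (n + 1) := pastSpace_mono (Nat.le_succ n)
  have h1 := he.setLIntegral_one (n := n + 1) (ζ := fun ω => (ζ ω, e n ω))
    ((hζ.mono hmono le_rfl).prodMk (measurable_pastSpace (Nat.lt_succ_self n))) (hmono _ hB)
    (F := fun q : (α × ℝ) × ℝ => F (q.1.1, q.1.2, q.2)) (by fun_prop)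
  rw [h1]
  have h2 := he.setLIntegral_one hζ hB
    (F := fun q : α × ℝ => ∫⁻ y', F (q.1, q.2, y') ∂(expMeasure 1)) (by
      exact Measurable.lintegral_prod_right' (f := fun q : (α × ℝ) × ℝ => F (q.1.1, q.1.2, q.2)) (by fun_prop))
  exact h2

end ExpSeq

/-! ### The jump chains of `η` and of the edge processes -/

/-- The flow of `η`. -/
def etaFlow (t u : ℝ) : ℝ := u - t

/-- The jump rate of `η`. -/
def etaRate (w : ℝ → ℝ) (u : ℝ) : ℝ := w (-u)

/-- The jump rate of the edge processes. -/
abbrev edgeRate (w : ℝ → ℝ) (z : ℤ × ℝ) : ℝ := w (z.1 * z.2)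

/-- The jump distribution of the edge processes. -/
abbrev edgeJump (z : ℤ × ℝ) : Measure (ℤ × ℝ) := Measure.dirac (-z.1, z.2)

section

variable (w : ℝ → ℝ) [hw : IsRate w]

lemma isJumpData_eta : IsJumpData etaFlow (etaRate w) (Q w) where
  measurable_flow := by unfold etaFlow; fun_prop
  flow_zero z := sub_zero z
  flow_add s t z := by simp only [etaFlow]; ring
  measurable_rate := (measurable_rate w).comp measurable_neg
  integrable z a b := by
    have : Monotone fun v => etaRate w (etaFlow v z) := fun u v huv =>
      hw.mono (by simp only [etaFlow]; linarith)
    exact this.intervalIntegrable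
  measurable_jump := measurable_Q w
  prob_jump z := inferInstance

lemma isJumpData_edge : IsJumpData edgeFlow (edgeRate w) edgeJump where
  measurable_flow := by unfold edgeFlow; fun_prop
  flow_zero z := by simp [edgeFlow]
  flow_add s t z := by simp only [edgeFlow, Prod.mk.injEq, true_and]; ring
  measurable_rate := (measurable_rate w).comp (by fun_prop)
  integrable z a b := by
    have : Monotone fun v => edgeRate w (edgeFlow v z) := fun u v huv => hw.mono (by
      simp only [edgeFlow]
      nlinarith [mul_nonneg (sub_nonneg.2 huv) (mul_self_nonneg (z.1 : ℝ))])
    exact this.intervalIntegrable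
  measurable_jump := Measure.measurable_dirac.comp (by fun_prop)
  prob_jump z := inferInstance

lemma survival_eta (t x : ℝ) :
    survival etaFlow (etaRate w) t x = Real.exp (-(cumRate w (-x + t) - cumRate w (-x))) := by
  have h : ∀ v : ℝ, etaRate w (etaFlow v x) = w (-x + v) := fun v => by
    simp only [etaRate, etaFlow]; congr 1; ring
  simp only [survival, h]
  rw [integral_rate_add, add_zero]

omit hw in
lemma etaRate_flow (t x : ℝ) : etaRate w (etaFlow t x) = w (-x + t) := by
  simp only [etaRate, etaFlow]; congr 1; ring

omit hw in
lemma edgeRate_flow {σ : ℤ} (hσ : σ * σ = 1) (t x : ℝ) :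
    edgeRate w (edgeFlow t (σ, -(σ : ℝ) * x)) = w (-x + t) := by
  have h : (σ : ℝ) * σ = 1 := by exact_mod_cast hσ
  simp only [edgeRate, edgeFlow]
  congr 1
  linear_combination (t - x) * h

lemma survival_edge {σ : ℤ} (hσ : σ * σ = 1) (t x : ℝ) :
    survival edgeFlow (edgeRate w) t (σ, -(σ : ℝ) * x)
      = Real.exp (-(cumRate w (-x + t) - cumRate w (-x))) := by
  simp only [survival, edgeRate_flow w hσ]
  rw [integral_rate_add, add_zero]

omit hw in
lemma chain_succ (x : ℝ) (e : ℕ → ℝ) (n : ℕ) :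
    chain w x e (n + 1) = nextPoint w (-(chain w x e n)) (e n) := rfl

omit hw in
lemma chain_add (x : ℝ) (e : ℕ → ℝ) (p n : ℕ) :
    chain w x e (n + p) = chain w (chain w x e p) (fun i => e (i + p)) n := by
  induction n with
  | zero => rw [zero_add]; rfl
  | succ n ih => rw [add_right_comm, chain_succ, chain_succ, ih]

variable {Ω : Type*} [mΩ : MeasurableSpace Ω] {P : Measure Ω} [IsProbabilityMeasure P]
  {e : ℕ → Ω → ℝ} (he : IsExpSeq P e) (x : ℝ)

omit mΩ in
lemma measurable_chain_pastSpace {i n : ℕ} (hi : i ≤ n) :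
    Measurable[pastSpace e n] fun ω => chain w x (fun j => e j ω) i :=
  @measurable_chain w hw Ω (pastSpace e n) (fun _ => x) (@measurable_const _ _ _ (pastSpace e n) x) e i
    fun _ hj => measurable_pastSpace (hj.trans_le hi)

include he in
/-- In terms of `u = α ξ`, an edge process that switches at `z n` starts from `u = -z n` and moves
up with unit speed until the next point `z (n + 1)` of the chain. -/
lemma IsExpSeq.isJumpChain_edge {a : ℤ} (ha : a * a = 1) :
    IsJumpChain P edgeFlow (edgeRate w) edgeJump (pastSpace e)
      (fun n ω => edgeSwitch (chain w x fun i => e i ω) n)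
      (fun n ω => edgeState a (chain w x fun i => e i ω) n) := by
  have hσ : ∀ n : ℕ, (a * (-1) ^ n) * (a * (-1) ^ n) = 1 := fun n => by
    rw [mul_mul_mul_comm, ha, ← mul_pow]; simp
  refine ⟨pastSpace_mono, he.pastSpace_le, by simp, fun n => ?_, fun n => ?_, ?_, ?_, ?_, ?_⟩
  · exact @Finset.measurable_fun_sum _ _ _ _ _ _ (pastSpace e n) _ _ fun i hi =>
      (measurable_chain_pastSpace w x (Finset.mem_range.1 hi).le).add
        (measurable_chain_pastSpace w x (Finset.mem_range.1 hi))
  · exact (@measurable_const _ _ _ (pastSpace e n) _).prodMk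
      ((measurable_chain_pastSpace w x le_rfl).const_mul _)
  · exact ae_of_all _ fun ω => monotone_edgeSwitch (chain_add_nonneg w x _)
  · filter_upwards [he.ae_regular] with ω hω using tendsto_edgeSwitch_chain w x hω
  · refine ae_of_all _ fun ω n v hv => ?_
    simp only [edgeState, edgeRate_flow w (hσ n), survival_edge w (hσ n)]
    exact lintegral_Ioi_rate_mul_exp w _ v
  · intro n B hB F hF
    set z : ℕ → Ω → ℝ := fun n ω => chain w x (fun i => e i ω) n with hz
    have hT : Measurable[pastSpace e n] fun ω => edgeSwitch (chain w x fun i => e i ω) n :=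
      @Finset.measurable_fun_sum _ _ _ _ _ _ (pastSpace e n) _ _ fun i hi =>
        (measurable_chain_pastSpace w x (Finset.mem_range.1 hi).le).add
          (measurable_chain_pastSpace w x (Finset.mem_range.1 hi))
    have hζ := hT.prodMk (measurable_chain_pastSpace w x (e := e) (le_refl n))
    have hn := measurable_nextPoint w
    have hn' : Measurable fun q : (ℝ × ℝ) × ℝ => nextPoint w (-q.1.2) q.2 := by
      have := hn.comp (by fun_prop : Measurable fun q : (ℝ × ℝ) × ℝ => (-q.1.2, q.2))
      simp only [Function.comp_def] at this
      exact this
    set σ : ℤ := a * (-1) ^ n with hσn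
    have hH : Measurable fun q : (ℝ × ℝ) × ℝ => F ((q.1.1, (σ, -(σ : ℝ) * q.1.2)), q.1.2 + q.2,
      (-σ, (σ : ℝ) * q.2)) := by fun_prop
    have h1 := he.setLIntegral_one hζ hB (hH.comp (measurable_fst.prodMk hn'))
    have hs : ∀ ω, edgeState a (chain w x fun i => e i ω) (n + 1)
        = (-σ, (σ : ℝ) * nextPoint w (-(z n ω)) (e n ω)) := fun ω => by
      simp only [edgeState, pow_succ, hσn, hz, chain_succ]
      push_cast
      ext <;> simp
    simp only [Function.comp_def] at h1
    simp only [edgeSwitch_succ, add_sub_cancel_left, hs]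
    refine h1.trans (lintegral_congr fun ω => ?_)
    have hσσ : σ * σ = 1 := hσ n
    simp only [edgeState, ← hσn, edgeRate_flow w hσσ, survival_edge w hσσ]
    have hm : Measurable fun y : ℝ => F ((edgeSwitch (chain w x fun i => e i ω) n,
        (σ, -(σ : ℝ) * z n ω)), z n ω + y, (-σ, (σ : ℝ) * y)) := by fun_prop
    -- the distribution of the next point is `Q (-z n)`; its density, as a function of the waiting
    -- time, is the density of the first jump
    have h2 := lintegral_nextPoint w (-(z n ω)) hm
    rw [lintegral_Q w _ hm] at h2
    refine h2.trans (lintegral_congr fun s => ?_)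
    rw [lintegral_dirac' _ (by fun_prop)]
    have e1 : z n ω + (-z n ω + s) = s := by ring
    have e2 : -(σ : ℝ) * z n ω + s * σ = σ * (-z n ω + s) := by ring
    simp only [edgeFlow, e1]
    simp only [hz] at e2 ⊢
    rw [e2]

include he in
/-- One jump of `η` corresponds to two steps of the chain: from `z (2n + p)` the process moves
down to `-z (2n + p + 1)`, and from there it jumps to `z (2n + p + 2)`. The distribution of the
last point is `Q (-z (2n + p + 1))`. -/
lemma IsExpSeq.isJumpChain_eta (p : ℕ) :
    IsJumpChain P etaFlow (etaRate w) (Q w) (fun n => pastSpace e (2 * n + p))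
      (fun n ω => etaTime (fun i => chain w x (fun j => e j ω) (i + p)) n)
      (fun n ω => chain w x (fun j => e j ω) (2 * n + p)) := by
  have hT : ∀ n, Measurable[pastSpace e (2 * n + p)] fun ω =>
      etaTime (fun i => chain w x (fun j => e j ω) (i + p)) n := fun n =>
    @Finset.measurable_fun_sum _ _ _ _ _ _ (pastSpace e (2 * n + p)) _ _ fun i hi =>
      measurable_chain_pastSpace w x (by have := Finset.mem_range.1 hi; lia)
  refine ⟨fun m n hmn => pastSpace_mono (by lia), fun n => he.pastSpace_le _, by simp, hT,
    fun n => measurable_chain_pastSpace w x le_rfl, ?_, ?_, ?_, ?_⟩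
  · refine ae_of_all _ fun ω => monotone_etaTime fun n => ?_
    have := chain_add_nonneg w x (fun j => e j ω) (n + p)
    rwa [add_right_comm] at this
  · filter_upwards [he.ae_regular] with ω hω
    refine tendsto_etaTime w (e := fun i => e (i + p) ω) (fun n => ?_) ?_
    · rw [add_right_comm, chain_succ]
    · rcases Nat.even_or_odd' p with ⟨q, rfl | rfl⟩
      · have h := hω.2.1
        rw [← map_add_atTop_eq_nat q, frequently_map] at h
        simpa only [mul_add] using h
      · have h := hω.2.2
        rw [← map_add_atTop_eq_nat q, frequently_map] at h
        simpa only [mul_add, add_assoc] using h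
  · refine ae_of_all _ fun ω n v hv => ?_
    simp only [etaRate_flow, survival_eta]
    exact lintegral_Ioi_rate_mul_exp w _ v
  · intro n B hB F hF
    set z : ℕ → Ω → ℝ := fun n ω => chain w x (fun i => e i ω) n with hz
    have hζ := (hT n).prodMk (measurable_chain_pastSpace w x (e := e) (le_refl (2 * n + p)))
    have hn := measurable_nextPoint w
    have hn1 : Measurable fun q : (ℝ × ℝ) × ℝ × ℝ => nextPoint w (-q.1.2) q.2.1 := by
      have := hn.comp (by fun_prop : Measurable fun q : (ℝ × ℝ) × ℝ × ℝ => (-q.1.2, q.2.1))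
      simp only [Function.comp_def] at this
      exact this
    have hn2 : Measurable fun q : (ℝ × ℝ) × ℝ × ℝ => nextPoint w (-nextPoint w (-q.1.2) q.2.1) q.2.2 := by
      have := hn.comp (by fun_prop :
        Measurable fun q : (ℝ × ℝ) × ℝ × ℝ => (-nextPoint w (-q.1.2) q.2.1, q.2.2))
      simp only [Function.comp_def] at this
      exact this
    have hH : Measurable fun q : (ℝ × ℝ) × ℝ × ℝ => F ((q.1.1, q.1.2), q.1.2 + q.2.1, q.2.2) := by fun_prop
    have h1 := he.setLIntegral_two hζ hB (hH.comp (measurable_fst.prodMk (hn1.prodMk hn2)))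
    simp only [Function.comp_def] at h1
    have i1 : ∀ ω, chain w x (fun j => e j ω) (2 * n + 1 + p)
        = nextPoint w (-(z (2 * n + p) ω)) (e (2 * n + p) ω) := fun ω => by
      rw [show 2 * n + 1 + p = 2 * n + p + 1 by ring, chain_succ]
    have i2 : ∀ ω, chain w x (fun j => e j ω) (2 * (n + 1) + p)
        = nextPoint w (-nextPoint w (-(z (2 * n + p) ω)) (e (2 * n + p) ω)) (e (2 * n + p + 1) ω) := fun ω => by
      rw [show 2 * (n + 1) + p = 2 * n + 1 + p + 1 by ring, chain_succ, i1,
        show 2 * n + 1 + p = 2 * n + p + 1 by ring]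
    simp only [etaTime_succ, add_sub_cancel_left, i1, i2]
    refine h1.trans (lintegral_congr fun ω => ?_)
    set T := etaTime (fun i => chain w x (fun j => e j ω) (i + p)) n
    set ζ := chain w x (fun j => e j ω) (2 * n + p)
    have hm : ∀ v : ℝ, Measurable fun y : ℝ => F ((T, ζ), ζ + v, y) := fun v => by fun_prop
    simp only [fun v => lintegral_nextPoint w (-v) (hm v)]
    have hm2 : Measurable fun v : ℝ => ∫⁻ y, F ((T, ζ), ζ + v, y) ∂(Q w (-v)) :=
      (isJumpData_eta w).measurable_lintegral_jump (φ := fun v : ℝ => -v) (by fun_prop) (by fun_prop)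
    rw [lintegral_nextPoint w (-ζ) hm2, lintegral_Q w _ hm2]
    refine lintegral_congr fun s => ?_
    have e1 : ζ + (-ζ + s) = s := by ring
    have e2 : -(-ζ + s) = etaFlow s ζ := by simp only [etaFlow]; ring
    rw [etaRate_flow, survival_eta, e1, e2]

lemma etaPath_eq_etaFlow (z : ℕ → ℝ) (hz : ∀ n, 0 ≤ z n + z (n + 1)) (n : ℕ) {t : ℝ}
    (h1 : etaTime z n ≤ t) (h2 : t < etaTime z (n + 1)) :
    etaPath z t = etaFlow (t - etaTime z n) (z (2 * n)) := by
  rw [etaPath, stepIndex_eq (monotone_etaTime hz) h1 h2, etaFlow]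

lemma measurable_etaPath {α : Type*} [MeasurableSpace α] {z : ℕ → α → ℝ} (hz : ∀ n, Measurable (z n))
    {t : α → ℝ} (ht : Measurable t) : Measurable fun a => etaPath (fun n => z n a) (t a) := by
  have hT : ∀ n, Measurable fun a => etaTime (fun n => z n a) n := fun n =>
    Finset.measurable_fun_sum _ fun i _ => hz i
  have hN := measurable_stepIndex hT ht
  have h : Measurable fun q : ℕ × α => z (2 * q.1) q.2 - (t q.2 - etaTime (fun n => z n q.2) q.1) :=
    measurable_from_prod_countable_right fun n => (hz (2 * n)).sub (ht.sub (hT n))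
  exact h.comp (hN.prodMk measurable_id)

lemma measurable_edgePath {α : Type*} [MeasurableSpace α] (b : ℤ) {z : ℕ → α → ℝ}
    (hz : ∀ n, Measurable (z n)) {t : α → ℝ} (ht : Measurable t) :
    Measurable fun a => edgePath b (fun n => z n a) (t a) := by
  have hT : ∀ n, Measurable fun a => edgeSwitch (fun n => z n a) n := fun n =>
    Finset.measurable_fun_sum _ fun i _ => (hz i).add (hz (i + 1))
  have hN := measurable_stepIndex hT ht
  have hflow : Measurable fun p : ℝ × ℤ × ℝ => edgeFlow p.1 p.2 := by unfold edgeFlow; fun_prop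
  have h : Measurable fun q : ℕ × α => edgeFlow (t q.2 - edgeSwitch (fun n => z n q.2) q.1)
      (edgeState b (fun n => z n q.2) q.1) :=
    measurable_from_prod_countable_right fun n =>
      hflow.comp ((ht.sub (hT n)).prodMk ((measurable_const (a := b * (-1) ^ n)).prodMk
        ((hz n).const_mul (-((b * (-1) ^ n : ℤ) : ℝ)))))
  exact h.comp (hN.prodMk measurable_id)

include he in
omit [IsProbabilityMeasure P] in
lemma IsExpSeq.measurable_chain (n : ℕ) : Measurable fun ω => chain w x (fun j => e j ω) n :=
  RepellingWalk.measurable_chain w measurable_const n fun i _ => he.measurable i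

end

/-! ### The transition kernels of `η` -/

/-- The law of a sequence of independent standard exponential variables. -/
def expSeqMeasure : Measure (ℕ → ℝ) := Measure.infinitePi fun _ => expMeasure 1

instance : IsProbabilityMeasure expSeqMeasure := by unfold expSeqMeasure; infer_instance

lemma isExpSeq_expSeqMeasure : IsExpSeq expSeqMeasure fun n e => e n where
  measurable n := measurable_pi_apply n
  indep := iIndepFun_infinitePi (P := fun _ : ℕ => expMeasure 1) (X := fun _ x => x) fun _ => measurable_id
  law n := Measure.infinitePi_map_eval _ n

lemma IsExpSeq.map_eq {Ω : Type*} [MeasurableSpace Ω] {P : Measure Ω} [IsProbabilityMeasure P]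
    {e : ℕ → Ω → ℝ} (he : IsExpSeq P e) : P.map (fun ω n => e n ω) = expSeqMeasure := by
  have h := (iIndepFun_iff_map_fun_eq_infinitePi_map he.measurable).1 he.indep
  rw [h, expSeqMeasure]
  congr 1
  ext1 n
  exact he.law n

/-- The law at time `t` of the process which follows the dynamics of `η` and starts from `x`. -/
def etaKernel (w : ℝ → ℝ) (t x : ℝ) : Measure ℝ :=
  expSeqMeasure.map fun e => etaPath (chain w x e) t

section

variable (w : ℝ → ℝ) [hw : IsRate w]

lemma measurable_etaPath_chain {α : Type*} [MeasurableSpace α] {x t : α → ℝ} (hx : Measurable x)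
    (ht : Measurable t) {e : α → ℕ → ℝ} (he : Measurable e) :
    Measurable fun a => etaPath (chain w (x a) (e a)) (t a) :=
  measurable_etaPath (fun n => measurable_chain w hx (e := fun i a => e a i) n fun i _ =>
    (measurable_pi_apply i).comp he) ht

instance (t x : ℝ) : IsProbabilityMeasure (etaKernel w t x) :=
  Measure.isProbabilityMeasure_map
    (measurable_etaPath_chain w measurable_const measurable_const measurable_id).aemeasurable

lemma lintegral_etaKernel (t x : ℝ) {f : ℝ → ℝ≥0∞} (hf : Measurable f) :
    ∫⁻ y, f y ∂(etaKernel w t x) = ∫⁻ e, f (etaPath (chain w x e) t) ∂expSeqMeasure :=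
  lintegral_map hf (measurable_etaPath_chain w measurable_const measurable_const measurable_id)

lemma measurable_lintegral_etaKernel {α : Type*} [MeasurableSpace α] {x t : α → ℝ} (hx : Measurable x)
    (ht : Measurable t) {f : α → ℝ → ℝ≥0∞} (hf : Measurable fun p : α × ℝ => f p.1 p.2) :
    Measurable fun a => ∫⁻ y, f a y ∂(etaKernel w (t a) (x a)) := by
  have h1 : ∀ a, ∫⁻ y, f a y ∂(etaKernel w (t a) (x a))
      = ∫⁻ e, f a (etaPath (chain w (x a) e) (t a)) ∂expSeqMeasure := fun a =>
    lintegral_etaKernel w _ _ (hf.comp (by fun_prop : Measurable fun y : ℝ => (a, y)))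
  simp only [h1]
  refine Measurable.lintegral_prod_right' (f := fun p : α × (ℕ → ℝ) => f p.1 (etaPath (chain w (x p.1) p.2) (t p.1))) ?_
  exact hf.comp (measurable_fst.prodMk (measurable_etaPath_chain w (hx.comp measurable_fst)
    (ht.comp measurable_fst) measurable_snd))

lemma measurable_etaKernel (t : ℝ) : Measurable (etaKernel w t) := by
  refine Measure.measurable_of_measurable_coe _ fun A hA => ?_
  have := measurable_lintegral_etaKernel w (x := fun x : ℝ => x) (t := fun _ => t) measurable_id
    measurable_const (f := fun _ y => A.indicator 1 y)
    ((measurable_one.indicator hA).comp measurable_snd)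
  simpa [lintegral_indicator_one hA] using this

lemma etaPath_zero {z : ℕ → ℝ} (hz : ∀ n, 0 ≤ z n + z (n + 1)) (h0 : 0 < z 0 + z 1) :
    etaPath z 0 = z 0 := by
  rw [etaPath_eq_etaFlow z hz 0 (by simp) (by simpa [etaTime_succ] using h0)]
  simp [etaFlow]

lemma lintegral_etaKernel_add (s t : ℝ≥0) (x : ℝ) {f : ℝ → ℝ≥0∞} (hf : Measurable f) :
    ∫⁻ y, f y ∂(etaKernel w (s + t : ℝ≥0) x)
      = ∫⁻ y, (∑' m, jumpOp etaFlow (etaRate w) (Q w) m t y f) ∂(etaKernel w s x) := by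
  have hc := isExpSeq_expSeqMeasure.isJumpChain_eta w x 0
  have hm : Measurable fun y => ∑' m, jumpOp etaFlow (etaRate w) (Q w) m t y f :=
    ((isJumpData_eta w).measurable_tsum_jumpOp hf).comp (by fun_prop : Measurable fun y : ℝ => ((t : ℝ), y))
  rw [lintegral_etaKernel w _ _ hf, lintegral_etaKernel w _ _ hm]
  have h := hc.lintegral_markov (isJumpData_eta w)
    (Y := fun (t : ℝ≥0) e => etaPath (chain w x e) t) ?_ (le_add_right (le_refl s) : s ≤ s + t) hf
  · rw [h, NNReal.coe_add, add_sub_cancel_left]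
  · exact ae_of_all _ fun e n t h1 h2 => etaPath_eq_etaFlow _ (chain_add_nonneg w x _) n h1 h2

lemma etaKernel_zero (x : ℝ) : etaKernel w 0 x = Measure.dirac x := by
  have h : (fun e => etaPath (chain w x e) 0) =ᵐ[expSeqMeasure] fun _ => x := by
    filter_upwards [isExpSeq_expSeqMeasure.ae_regular] with e he
    exact etaPath_zero (chain_add_nonneg w x e) (chain_add_pos w x (he.1 0))
  rw [etaKernel, Measure.map_congr h, Measure.map_const]
  simp

lemma lintegral_etaKernel_eq_tsum (t : ℝ≥0) (x : ℝ) {f : ℝ → ℝ≥0∞} (hf : Measurable f) :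
    ∫⁻ y, f y ∂(etaKernel w t x) = ∑' m, jumpOp etaFlow (etaRate w) (Q w) m t x f := by
  have h := lintegral_etaKernel_add w 0 t x hf
  have hm : Measurable fun y => ∑' m, jumpOp etaFlow (etaRate w) (Q w) m t y f :=
    ((isJumpData_eta w).measurable_tsum_jumpOp hf).comp (by fun_prop : Measurable fun y : ℝ => ((t : ℝ), y))
  rwa [zero_add, NNReal.coe_zero, etaKernel_zero, lintegral_dirac' _ hm] at h

/-- The Chapman–Kolmogorov equation. -/
lemma lintegral_etaKernel_add' (s t : ℝ≥0) (x : ℝ) {f : ℝ → ℝ≥0∞} (hf : Measurable f) :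
    ∫⁻ y, f y ∂(etaKernel w (s + t : ℝ≥0) x)
      = ∫⁻ y, (∫⁻ z, f z ∂(etaKernel w t y)) ∂(etaKernel w s x) := by
  rw [lintegral_etaKernel_add w s t x hf]
  simp only [lintegral_etaKernel_eq_tsum w t _ hf]

end

/-! ### A Lyapunov function -/

/-- A supersolution of the renewal equation bounds the expectations along the process. -/
lemma IsJumpData.tsum_jumpOp_le {E : Type*} [MeasurableSpace E] {flow : ℝ → E → E} {rate : E → ℝ}
    {jump : E → Measure E} (h : IsJumpData flow rate jump) {f : E → ℝ≥0∞} (hf : Measurable f)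
    {U : ℝ → E → ℝ≥0∞}
    (hU : ∀ t, 0 ≤ t → ∀ z, ENNReal.ofReal (survival flow rate t z) * f (flow t z)
      + ∫⁻ s in Ioc (0 : ℝ) t, ENNReal.ofReal (rate (flow s z) * survival flow rate s z)
          * ∫⁻ y, U (t - s) y ∂(jump (flow s z)) ≤ U t z) {t : ℝ} (ht : 0 ≤ t) (z : E) :
    ∑' n, jumpOp flow rate jump n t z f ≤ U t z := by
  refine ENNReal.tsum_le_of_sum_range_le fun N => ?_
  induction N generalizing t z with
  | zero => simp
  | succ N ih =>
    rw [Finset.sum_range_succ', add_comm]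
    refine le_trans ?_ (hU t ht z)
    simp only [jumpOp]
    gcongr
    have hm : ∀ n, Measurable fun s => ENNReal.ofReal (rate (flow s z) * survival flow rate s z)
        * ∫⁻ y, jumpOp flow rate jump n (t - s) y f ∂(jump (flow s z)) := fun n => by
      refine (h.measurable_density measurable_id measurable_const).mul ?_
      refine h.measurable_lintegral_jump (φ := fun s => flow s z) ?_ ?_
      · exact h.measurable_flow.comp (by fun_prop : Measurable fun s : ℝ => (s, z))
      · exact (h.measurable_jumpOp n hf).comp (by fun_prop : Measurable fun p : ℝ × E => (t - p.1, p.2))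
    rw [← lintegral_finsetSum _ fun n _ => hm n]
    refine setLIntegral_mono' measurableSet_Ioc fun s hs => ?_
    rw [← Finset.mul_sum, ← lintegral_finsetSum]
    · gcongr with y
      exact ih (sub_nonneg.2 hs.2) y
    · intro n _
      exact (h.measurable_jumpOp n hf).comp (by fun_prop : Measurable fun y : E => (t - s, y))

lemma lintegral_exp_mul_expMeasure {a : ℝ} (ha : a < 1) :
    ∫⁻ e, ENNReal.ofReal (Real.exp (a * e)) ∂(expMeasure 1) = ENNReal.ofReal (1 / (1 - a)) := by
  rw [expMeasure_eq, lintegral_withDensity_eq_lintegral_mul _ (by fun_prop) (by fun_prop)]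
  have h1 : ∀ x : ℝ, ((fun x => ENNReal.ofReal (Real.exp (-x))) * fun e => ENNReal.ofReal (Real.exp (a * e))) x
      = ENNReal.ofReal (Real.exp ((a - 1) * x)) := fun x => by
    rw [Pi.mul_apply, ← ENNReal.ofReal_mul (Real.exp_pos _).le, ← Real.exp_add]
    ring_nf
  simp only [h1]
  rw [← ofReal_integral_eq_lintegral_ofReal (integrableOn_exp_mul_Ioi (by linarith) 0)
    (Eventually.of_forall fun x => (Real.exp_pos _).le), integral_exp_mul_Ioi (by linarith)]
  congr 1
  rw [mul_zero, Real.exp_zero, neg_div, ← div_neg, neg_sub]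

section

variable (w : ℝ → ℝ) [hw : IsRate w]

lemma nextPoint_le_max_add {x a e : ℝ} (he : 0 ≤ e) : nextPoint w x e ≤ max x a + e / w a := by
  have hwa := hw.pos a
  rw [nextPoint_le_iff, max_eq_left he]
  have h1 := mul_sub_le_cumRate_sub w (show max x a ≤ max x a + e / w a by
    have := div_nonneg he hwa.le; linarith)
  have h2 := (strictMono_cumRate w).monotone (le_max_left x a)
  have h3 : w a * (e / w a) ≤ w (max x a) * (e / w a) :=
    mul_le_mul_of_nonneg_right (hw.mono (le_max_right _ _)) (div_nonneg he hwa.le)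
  rw [mul_div_cancel₀ _ hwa.ne'] at h3
  rw [add_sub_cancel_left] at h1
  linarith

lemma min_le_nextPoint {x b e : ℝ} (he : 0 ≤ e) : min (x + e / w b) b ≤ nextPoint w x e := by
  have hwb := hw.pos b
  by_contra! hlt
  obtain ⟨h1, h2⟩ := lt_min_iff.1 hlt
  have h3 := cumRate_sub_le_mul_sub w (le_nextPoint w x e)
  rw [cumRate_nextPoint, max_eq_left he, add_sub_cancel_left] at h3
  have h4 := mul_le_mul_of_nonneg_right (hw.mono h2.le) (sub_nonneg.2 (le_nextPoint w x e))
  have h5 : e / w b ≤ nextPoint w x e - x := by rw [div_le_iff₀ hwb]; linarith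
  linarith

/-- The function `x ↦ 2 cosh (δ x)`, whose expectation decreases along `η` when it is large. -/
def lyapunov (δ x : ℝ) : ℝ := Real.exp (δ * x) + Real.exp (-(δ * x))

lemma lyapunov_pos (δ x : ℝ) : 0 < lyapunov δ x := add_pos (Real.exp_pos _) (Real.exp_pos _)

/-- A bound on the expectation of `lyapunov δ` after a jump from `x`. -/
def lyapunovJump (w : ℝ → ℝ) (δ a x : ℝ) : ℝ :=
  Real.exp (δ * max x a) * (w a / (w a - δ)) + (Real.exp (-(δ * x)) * (w (-a) / (w (-a) + δ)) + Real.exp (δ * a))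

/-- A bound for the mean of the Lyapunov function after a jump. To the right of `a` the
distribution `Q x` is compared with an exponential distribution of rate `w a`, and to the left of
`-a` with one of rate `w (-a)`. -/
lemma lintegral_Q_lyapunov_le {δ a : ℝ} (hδ : 0 < δ) (hδa : δ < w a) (x : ℝ) :
    ∫⁻ y, ENNReal.ofReal (lyapunov δ y) ∂(Q w x) ≤ ENNReal.ofReal (lyapunovJump w δ a x) := by
  have hwa := hw.pos a
  have hwb := hw.pos (-a)
  rw [← lintegral_nextPoint w x (by unfold lyapunov; fun_prop)]
  have h1 : ∀ᵐ e ∂(expMeasure 1), ENNReal.ofReal (lyapunov δ (nextPoint w x e))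
      ≤ ENNReal.ofReal (Real.exp (δ * max x a)) * ENNReal.ofReal (Real.exp (δ / w a * e))
        + (ENNReal.ofReal (Real.exp (-(δ * x))) * ENNReal.ofReal (Real.exp (-(δ / w (-a)) * e))
          + ENNReal.ofReal (Real.exp (δ * a))) := by
    filter_upwards [ae_pos_expMeasure] with e he
    rw [← ENNReal.ofReal_mul (Real.exp_pos _).le, ← ENNReal.ofReal_mul (Real.exp_pos _).le,
      ← ENNReal.ofReal_add (by positivity) (by positivity),
      ← ENNReal.ofReal_add (by positivity) (by positivity), ← Real.exp_add, ← Real.exp_add]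
    refine ENNReal.ofReal_le_ofReal (add_le_add ?_ ?_)
    · rw [Real.exp_le_exp]
      have := mul_le_mul_of_nonneg_left (nextPoint_le_max_add w (x := x) (a := a) he.le) hδ.le
      calc _ ≤ _ := this
        _ = _ := by ring
    · rcases le_total (x + e / w (-a)) (-a) with h | h
      · have h2 := min_le_nextPoint w (x := x) (b := -a) he.le
        rw [min_eq_left h] at h2
        refine le_add_of_le_of_nonneg (Real.exp_le_exp.2 ?_) (Real.exp_pos _).le
        have := mul_le_mul_of_nonneg_left h2 hδ.le
        calc _ ≤ -(δ * (x + e / w (-a))) := neg_le_neg this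
          _ = _ := by ring
      · have h2 := min_le_nextPoint w (x := x) (b := -a) he.le
        rw [min_eq_right h] at h2
        refine le_add_of_nonneg_of_le (Real.exp_pos _).le (Real.exp_le_exp.2 ?_)
        nlinarith
  refine (lintegral_mono_ae h1).trans_eq ?_
  rw [lintegral_add_left (by fun_prop), lintegral_const_mul _ (by fun_prop),
    lintegral_add_left (by fun_prop), lintegral_const_mul _ (by fun_prop), lintegral_const, measure_univ, mul_one,
    lintegral_exp_mul_expMeasure (by rw [div_lt_one hwa]; exact hδa),
    lintegral_exp_mul_expMeasure (by have := div_pos hδ hwb; linarith),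
    ← ENNReal.ofReal_mul (Real.exp_pos _).le, ← ENNReal.ofReal_mul (Real.exp_pos _).le]
  have e1 : 1 / (1 - δ / w a) = w a / (w a - δ) := by
    have : w a - δ ≠ 0 := by linarith
    field_simp
  have e2 : 1 / (1 - -(δ / w (-a))) = w (-a) / (w (-a) + δ) := by
    have h : 0 < 1 - -(δ / w (-a)) := by have := div_pos hδ hwb; linarith
    rw [div_eq_div_iff h.ne' (by linarith)]
    field_simp
    ring
  have p1 : 0 ≤ w a / (w a - δ) := div_nonneg hwa.le (by linarith)
  have p2 : 0 ≤ w (-a) / (w (-a) + δ) := div_nonneg hwb.le (by linarith)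
  rw [e1, e2, ← ENNReal.ofReal_add (by positivity) (by positivity),
    ← ENNReal.ofReal_add (by positivity) (by positivity), lyapunovJump]

/-- The only use of the assumption that the rate is not constant: for a constant rate, the process
`η` has no restoring drift. -/
lemma exists_rate_lt : ∃ a, 0 ≤ a ∧ w (-a) < w a := by
  obtain ⟨u, v, huv⟩ := hw.nonconst
  have key : ∀ u v, w u < w v → ∃ a, 0 ≤ a ∧ w (-a) < w a := fun u v h =>
    ⟨max |u| |v|, le_max_of_le_left (abs_nonneg u),
      (hw.mono (show -max |u| |v| ≤ u by linarith [neg_abs_le u, le_max_left |u| |v|])).trans_lt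
        (h.trans_le (hw.mono ((le_abs_self v).trans (le_max_right _ _))))⟩
  rcases lt_or_gt_of_ne huv with h | h
  · exact key u v h
  · exact key v u h

omit hw in
/-- The drift condition far to the right, where `B ≤ 1` and the rate `ρ` is at most `m`. -/
lemma drift_right {m p δ c A B M ρ : ℝ} (hm : 0 < m) (hδ : 0 < δ) (hpm : p = m + 4 * δ)
    (hc : c = δ * δ / p) (hA : 0 < A) (hB : 0 < B) (hB1 : B ≤ 1) (hM : 0 < M) (hρ : 0 < ρ) (hρm : ρ ≤ m) :
    ρ * (A * (p / (p - δ)) + (B * (m / (m + δ)) + M) - (A + B)) - δ * (A - B)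
      ≤ -c * (A + B) + (m * M + δ + c) := by
  have hp0 : 0 < p := by linarith
  have hpδ : 0 < p - δ := by linarith
  have hmδ : 0 < m + δ := by linarith
  have hc0 : 0 < c := by rw [hc]; positivity
  have e1 : p / (p - δ) = 1 + δ / (p - δ) := by field_simp; ring
  have e2 : m / (m + δ) = 1 - δ / (m + δ) := by field_simp; ring
  have hq : 0 < B * (δ / (m + δ)) := by positivity
  have hq' : 0 < A * (δ / (p - δ)) := by positivity
  have h2 : A * (p / (p - δ)) + (B * (m / (m + δ)) + M) - (A + B) ≤ A * (δ / (p - δ)) + M := by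
    rw [e1, e2]; linarith
  have h3 : ρ * (A * (p / (p - δ)) + (B * (m / (m + δ)) + M) - (A + B)) ≤ m * (A * (δ / (p - δ)) + M) :=
    (mul_le_mul_of_nonneg_left h2 hρ.le).trans (mul_le_mul_of_nonneg_right hρm (by linarith))
  have h4 : m * (δ / (p - δ)) - δ ≤ -c := by
    have : m * (δ / (p - δ)) - δ = -(δ * (3 * δ) / (p - δ)) := by
      field_simp; linarith
    rw [this, neg_le_neg_iff, hc, div_le_div_iff₀ hp0 hpδ]
    have h5 : p - δ ≤ 3 * p := by linarith
    calc δ * δ * (p - δ) ≤ δ * δ * (3 * p) := by gcongr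
      _ = _ := by ring
  have h5 := mul_le_mul_of_nonneg_left h4 hA.le
  have h6 := mul_le_mul_of_nonneg_left hB1 hδ.le
  have h7 := mul_le_mul_of_nonneg_left hB1 hc0.le
  linarith

omit hw in
/-- The drift condition far to the left, where the rate `ρ` is at least `p` and `B` is so large that
the bounded part `C` of the jump is negligible. -/
lemma drift_left {m p δ c A B M C Y ρ : ℝ} (hm : 0 < m) (hδ : 0 < δ) (hpm : p = m + 4 * δ)
    (hc : c = δ * δ / p) (hA : 0 < A) (hB : 0 < B) (hAM : A ≤ M) (hρ : p ≤ ρ)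
    (hC : C = M * (p / (p - δ)) + M) (hY : Y = C * (m + δ) * p / (2 * δ * δ)) (hBY : Y ≤ B) :
    ρ * (M * (p / (p - δ)) + (B * (m / (m + δ)) + M) - (A + B)) - δ * (A - B)
      ≤ -c * (A + B) + c * M := by
  have hp0 : 0 < p := by linarith
  have hmδ : 0 < m + δ := by linarith
  have hc0 : 0 < c := by rw [hc]; positivity
  have e2 : m / (m + δ) = 1 - δ / (m + δ) := by field_simp; ring
  have h2 : M * (p / (p - δ)) + (B * (m / (m + δ)) + M) - (A + B) ≤ C - B * (δ / (m + δ)) := by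
    rw [e2, hC]; linarith
  have h5 : C ≤ (2 * δ / p) * (B * (δ / (m + δ))) := by
    have : C = (2 * δ / p) * (Y * (δ / (m + δ))) := by rw [hY]; field_simp
    rw [this]
    gcongr
  have h6 : C - B * (δ / (m + δ)) ≤ -((m + 2 * δ) / p * (B * (δ / (m + δ)))) := by
    have : (m + 2 * δ) / p = 1 - 2 * δ / p := by field_simp; linarith
    rw [this]; linarith
  have h7 : ρ * (C - B * (δ / (m + δ))) ≤ -((m + 2 * δ) * (B * (δ / (m + δ)))) := by
    have h8 : 0 ≤ (m + 2 * δ) / p * (B * (δ / (m + δ))) := by positivity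
    have h9 := mul_le_mul_of_nonneg_left h6 (hp0.le.trans hρ)
    have h10 := mul_le_mul_of_nonneg_right hρ h8
    have : p * ((m + 2 * δ) / p * (B * (δ / (m + δ)))) = (m + 2 * δ) * (B * (δ / (m + δ))) := by
      field_simp
    linarith
  have h8 : δ - (m + 2 * δ) * (δ / (m + δ)) ≤ -c := by
    have : δ - (m + 2 * δ) * (δ / (m + δ)) = -(δ * δ / (m + δ)) := by field_simp; ring
    rw [this, neg_le_neg_iff, hc]
    gcongr
    linarith
  have h9 := mul_le_mul_of_nonneg_left h8 hB.le
  have h10 := mul_le_mul_of_nonneg_left hAM hc0.le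
  have h11 := mul_le_mul_of_nonneg_left h2 (hp0.le.trans hρ)
  have h12 := mul_pos hδ hA
  linarith

/-- The drift condition: the generator of `η` applied to `lyapunov δ` is at most
`-c • lyapunov δ + K`. -/
lemma exists_drift : ∃ δ a c K, 0 < δ ∧ δ < w a ∧ 0 < c ∧ 0 < K ∧ ∀ x,
    w (-x) * (lyapunovJump w δ a x - lyapunov δ x) - δ * (Real.exp (δ * x) - Real.exp (-(δ * x)))
      ≤ -c * lyapunov δ x + K := by
  -- with `m = w (-a) < w a = p`, the rate of `η` is at most `m` on the right of `a` and at least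
  -- `p` on the left of `-a`; the mean size of a jump is at most `1 / p` on the right, and at
  -- least about `1 / m` on the far left, which gives a drift towards `0` on both sides
  obtain ⟨a, ha0, ha⟩ := exists_rate_lt w
  obtain ⟨p, hp⟩ : ∃ p, p = w a := ⟨_, rfl⟩
  obtain ⟨m, hm⟩ : ∃ m, m = w (-a) := ⟨_, rfl⟩
  have hm0 : 0 < m := hm ▸ hw.pos _
  have hp0 : 0 < p := hp ▸ hw.pos _
  rw [← hp, ← hm] at ha
  obtain ⟨δ, hδ⟩ : ∃ δ, δ = (p - m) / 4 := ⟨_, rfl⟩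
  have hδ0 : 0 < δ := by rw [hδ]; linarith
  have hpm : p = m + 4 * δ := by rw [hδ]; ring
  obtain ⟨M, hM⟩ : ∃ M, M = Real.exp (δ * a) := ⟨_, rfl⟩
  have hM0 : 0 < M := hM ▸ Real.exp_pos _
  obtain ⟨C, hC⟩ : ∃ C, C = M * (p / (p - δ)) + M := ⟨_, rfl⟩
  have hpδ : 0 < p - δ := by linarith
  have hmδ : 0 < m + δ := by linarith
  have hMC : M ≤ C := by rw [hC]; have : 0 < M * (p / (p - δ)) := by positivity
                         linarith
  -- beyond this value of `exp (-δ x)`, the bounded part of the jump is negligible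
  obtain ⟨Y, hY⟩ : ∃ Y, Y = C * (m + δ) * p / (2 * δ * δ) := ⟨_, rfl⟩
  have hC0 : 0 < C := by linarith
  have hY0 : 0 < Y := by rw [hY]; positivity
  have hr0 : 0 < w (Real.log Y / δ) := hw.pos _
  obtain ⟨c, hc⟩ : ∃ c, c = δ * δ / p := ⟨_, rfl⟩
  have hc0 : 0 < c := by rw [hc]; positivity
  have hK1 : 0 < m * M + δ + c := by positivity
  have hK2 : 0 < c * M := by positivity
  have hK3 : 0 < w (Real.log Y / δ) * C + δ * Y + c * Y := by positivity
  refine ⟨δ, a, c, m * M + δ + c + (c * M + (w (Real.log Y / δ) * C + δ * Y + c * Y)), hδ0,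
    by linarith, hc0, by linarith, fun x => ?_⟩
  have hA0 : 0 < Real.exp (δ * x) := Real.exp_pos _
  have hB0 : 0 < Real.exp (-(δ * x)) := Real.exp_pos _
  have hrx : 0 < w (-x) := hw.pos _
  rw [lyapunovJump, lyapunov, ← hp, ← hm, ← hM]
  -- three regions: `x ≥ a`, then `x ≤ a` where `exp (-δ x) ≤ Y`, where everything is bounded, and
  -- the far left
  rcases le_total a x with hx | hx
  · have hB1 : Real.exp (-(δ * x)) ≤ 1 := Real.exp_le_one_iff.2
      (by have := mul_nonneg hδ0.le (ha0.trans hx); linarith)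
    rw [max_eq_left hx]
    have := drift_right hm0 hδ0 hpm hc hA0 hB0 hB1 hM0 hrx (hm ▸ hw.mono (by linarith))
    linarith
  · have hAM : Real.exp (δ * x) ≤ M := hM ▸ Real.exp_le_exp.2 (mul_le_mul_of_nonneg_left hx hδ0.le)
    rw [max_eq_right hx, ← hM]
    rcases le_total (Real.exp (-(δ * x))) Y with hBY | hBY
    · have h4 : w (-x) ≤ w (Real.log Y / δ) := by
        refine hw.mono ?_
        rw [le_div_iff₀ hδ0, Real.le_log_iff_exp_le hY0]
        calc _ = Real.exp (-(δ * x)) := by ring_nf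
          _ ≤ _ := hBY
      have h2 : M * (p / (p - δ)) + (Real.exp (-(δ * x)) * (m / (m + δ)) + M)
          - (Real.exp (δ * x) + Real.exp (-(δ * x))) ≤ C := by
        have : m / (m + δ) ≤ 1 := by rw [div_le_one hmδ]; linarith
        have := mul_le_mul_of_nonneg_left this hB0.le
        linarith
      have h5 := (mul_le_mul_of_nonneg_left h2 hrx.le).trans (mul_le_mul_of_nonneg_right h4 hC0.le)
      have h6 := mul_le_mul_of_nonneg_left hBY hδ0.le
      have h7 := mul_le_mul_of_nonneg_left hBY hc0.le
      have h8 := mul_le_mul_of_nonneg_left hAM hc0.le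
      have h9 := mul_pos hδ0 hA0
      linarith
    · have h4 : p ≤ w (-x) := by
        rw [hp]
        refine hw.mono ?_
        by_contra! hlt
        have h5 : M < Y := by
          have h7 : 2 * δ * δ < (m + δ) * p := by
            have : 4 * δ ≤ p := by linarith
            have h8 : δ * (4 * δ) ≤ (m + δ) * p := by gcongr; linarith
            have h9 := mul_pos hδ0 hδ0
            linarith
          rw [hY, lt_div_iff₀ (by positivity)]
          calc M * (2 * δ * δ) ≤ C * (2 * δ * δ) := by gcongr
            _ < C * ((m + δ) * p) := by gcongr
            _ = C * (m + δ) * p := by ring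
        have h6 : Real.exp (-(δ * x)) ≤ M := hM ▸ Real.exp_le_exp.2
          (by have := mul_le_mul_of_nonneg_left hlt.le hδ0.le; linarith)
        linarith
      have := drift_left hm0 hδ0 hpm hc hA0 hB0 hAM h4 hC hY hBY
      linarith

/-- The fundamental theorem of calculus along the flow of `η`, with the probability of no jump as
a factor. -/
lemma lintegral_survival_eta (x : ℝ) {φ φ' : ℝ → ℝ} {t : ℝ} (ht : 0 ≤ t)
    (hφ : ∀ s, HasDerivAt φ (φ' s) s) (hφ' : Continuous φ')
    (hpos : ∀ s, 0 ≤ s → s ≤ t → 0 ≤ w (-x + s) * φ s - φ' s) :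
    ∫⁻ s in Ioc (0 : ℝ) t, ENNReal.ofReal (survival etaFlow (etaRate w) s x * (w (-x + s) * φ s - φ' s))
      = ENNReal.ofReal (φ 0 - survival etaFlow (etaRate w) t x * φ t) ∧
    0 ≤ φ 0 - survival etaFlow (etaRate w) t x * φ t := by
  have hcφ : Continuous φ := continuous_iff_continuousAt.2 fun s => (hφ s).continuousAt
  have h1 : ∀ s, survival etaFlow (etaRate w) s x
      = Real.exp (cumRate w (-x)) * Real.exp (-(cumRate w (-x + s))) := fun s => by
    rw [survival_eta, ← Real.exp_add]; ring_nf
  have h2 := integral_exp_neg_cumRate w (-x) (a := 0) (b := t) hφ hφ'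
  have hint : IntervalIntegrable (fun s => survival etaFlow (etaRate w) s x * (w (-x + s) * φ s - φ' s))
      volume 0 t := by
    have h3 : Monotone fun s => w (-x + s) := fun a b hab => hw.mono (by linarith)
    have h4 : IntervalIntegrable (fun s => w (-x + s) * φ s - φ' s) volume 0 t :=
      (h3.intervalIntegrable.mul_continuousOn hcφ.continuousOn).sub (hφ'.intervalIntegrable _ _)
    refine h4.continuousOn_mul (Continuous.continuousOn ?_)
    simp only [h1]
    exact continuous_const.mul (Real.continuous_exp.comp
      ((continuous_cumRate w).comp (continuous_const.add continuous_id)).neg)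
  have hnn : ∀ᵐ s ∂volume.restrict (Ioc 0 t),
      0 ≤ survival etaFlow (etaRate w) s x * (w (-x + s) * φ s - φ' s) :=
    (ae_restrict_iff' measurableSet_Ioc).2 (ae_of_all _ fun s hs =>
      mul_nonneg (survival_pos _ _).le (hpos s hs.1.le hs.2))
  have hval : ∫ s in Ioc 0 t, survival etaFlow (etaRate w) s x * (w (-x + s) * φ s - φ' s)
      = φ 0 - survival etaFlow (etaRate w) t x * φ t := by
    rw [← intervalIntegral.integral_of_le ht]
    simp only [h1, mul_assoc]
    rw [intervalIntegral.integral_const_mul, h2, mul_sub, ← mul_assoc, ← Real.exp_add]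
    simp
  rw [← hval]
  exact ⟨(ofReal_integral_eq_lintegral_ofReal
    ((intervalIntegrable_iff_integrableOn_Ioc_of_le ht).1 hint) hnn).symm, integral_nonneg_of_ae hnn⟩

/-- The expectation of the Lyapunov function decreases exponentially, up to a constant. -/
lemma exists_lyapunov_bound : ∃ δ c K, 0 < δ ∧ 0 < c ∧ 0 < K ∧
    ∫⁻ y, ENNReal.ofReal (lyapunov δ y) ∂(Q w 0) < ∞ ∧ ∀ (t : ℝ≥0) (x : ℝ),
    ∫⁻ y, ENNReal.ofReal (lyapunov δ y) ∂(etaKernel w t x)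
      ≤ ENNReal.ofReal (Real.exp (-c * t) * lyapunov δ x + K) := by
  obtain ⟨δ, a, c, K, hδ, hδa, hc, hK, hdrift⟩ := exists_drift w
  refine ⟨δ, c, K / c, hδ, hc, by positivity,
    (lintegral_Q_lyapunov_le w hδ hδa 0).trans_lt ENNReal.ofReal_lt_top, fun t x => ?_⟩
  have hVm : Measurable fun y => ENNReal.ofReal (lyapunov δ y) := by unfold lyapunov; fun_prop
  rw [lintegral_etaKernel_eq_tsum w t x hVm]
  -- `U` is a supersolution of the backward equation, because of the drift condition
  set U : ℝ → ℝ → ℝ := fun t x => Real.exp (-c * t) * lyapunov δ x + K / c * (1 - Real.exp (-c * t)) with hU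
  have hle := (isJumpData_eta w).tsum_jumpOp_le hVm (U := fun t x => ENNReal.ofReal (U t x)) ?_ t.2 x
  · refine hle.trans (ENNReal.ofReal_le_ofReal ?_)
    have : 0 < K / c * Real.exp (-c * t) := by positivity
    simp only [hU, NNReal.val_eq_coe]
    linarith
  intro t ht x
  -- the derivative along the flow
  set φ : ℝ → ℝ := fun s => U (t - s) (x - s) with hφ
  set φ' : ℝ → ℝ := fun s => Real.exp (-c * (t - s)) * (c * lyapunov δ (x - s)
    - δ * (Real.exp (δ * (x - s)) - Real.exp (-(δ * (x - s)))) - K) with hφ'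
  have hder : ∀ s, HasDerivAt φ (φ' s) s := by
    intro s
    have d0 : HasDerivAt (fun s => Real.exp (-c * (t - s))) (Real.exp (-c * (t - s)) * (-c * -1)) s :=
      (((hasDerivAt_id s).const_sub t).const_mul (-c)).exp
    have d1 : HasDerivAt (fun s => Real.exp (δ * (x - s))) (Real.exp (δ * (x - s)) * (δ * -1)) s :=
      (((hasDerivAt_id s).const_sub x).const_mul δ).exp
    have d2 : HasDerivAt (fun s => Real.exp (-(δ * (x - s)))) (Real.exp (-(δ * (x - s))) * -(δ * -1)) s :=
      (((hasDerivAt_id s).const_sub x).const_mul δ).neg.exp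
    have d3 := (d0.mul (d1.add d2)).add ((d0.const_sub 1).const_mul (K / c))
    convert! d3 using 1
    simp only [hφ', lyapunov, Pi.add_apply]
    field_simp
    ring
  have hcont : Continuous φ' := by simp only [hφ', lyapunov]; fun_prop
  have hjump : ∀ s, s ≤ t → ∫⁻ y, ENNReal.ofReal (U (t - s) y) ∂(Q w (x - s))
      ≤ ENNReal.ofReal (Real.exp (-c * (t - s)) * lyapunovJump w δ a (x - s)
        + K / c * (1 - Real.exp (-c * (t - s)))) := by
    intro s hs
    have h0 : 0 ≤ K / c * (1 - Real.exp (-c * (t - s))) := by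
      refine mul_nonneg (by positivity) (sub_nonneg.2 (Real.exp_le_one_iff.2 ?_))
      have := mul_nonneg hc.le (sub_nonneg.2 hs); linarith
    have hJ : 0 ≤ lyapunovJump w δ a (x - s) := by
      have := hw.pos a; have := hw.pos (-a)
      have : 0 ≤ w a / (w a - δ) := div_nonneg (hw.pos a).le (by linarith)
      unfold lyapunovJump; positivity
    have h1 : ∀ y, ENNReal.ofReal (U (t - s) y) = ENNReal.ofReal (Real.exp (-c * (t - s)))
        * ENNReal.ofReal (lyapunov δ y) + ENNReal.ofReal (K / c * (1 - Real.exp (-c * (t - s)))) := fun y => by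
      rw [← ENNReal.ofReal_mul (Real.exp_pos _).le,
        ← ENNReal.ofReal_add (mul_nonneg (Real.exp_pos _).le (lyapunov_pos δ y).le) h0]
    simp only [h1]
    rw [lintegral_add_right _ measurable_const, lintegral_const_mul _ hVm, lintegral_const, measure_univ,
      mul_one, ENNReal.ofReal_add (mul_nonneg (Real.exp_pos _).le hJ) h0, ENNReal.ofReal_mul (Real.exp_pos _).le]
    gcongr
    exact lintegral_Q_lyapunov_le w hδ hδa _
  have hkey : ∀ s, w (-x + s) * (Real.exp (-c * (t - s)) * lyapunovJump w δ a (x - s)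
        + K / c * (1 - Real.exp (-c * (t - s)))) ≤ w (-x + s) * φ s - φ' s := by
    intro s
    have h1 := mul_le_mul_of_nonneg_left (hdrift (x - s)) (Real.exp_pos (-c * (t - s))).le
    rw [show -(x - s) = -x + s by ring] at h1
    simp only [hφ, hφ', hU]
    linarith
  have hnn : ∀ s, s ≤ t → 0 ≤ Real.exp (-c * (t - s)) * lyapunovJump w δ a (x - s)
        + K / c * (1 - Real.exp (-c * (t - s))) := by
    intro s hs
    refine add_nonneg (mul_nonneg (Real.exp_pos _).le ?_)
      (mul_nonneg (by positivity) (sub_nonneg.2 (Real.exp_le_one_iff.2 ?_)))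
    · have := hw.pos a; have := hw.pos (-a)
      have : 0 ≤ w a / (w a - δ) := div_nonneg (hw.pos a).le (by linarith)
      unfold lyapunovJump; positivity
    · have := mul_nonneg hc.le (sub_nonneg.2 hs); linarith
  have hS := lintegral_survival_eta w x ht hder hcont fun s _ hs =>
    (mul_nonneg (hw.pos _).le (hnn s hs)).trans (hkey s)
  have hint : ∫⁻ s in Ioc (0 : ℝ) t, ENNReal.ofReal (etaRate w (etaFlow s x) * survival etaFlow (etaRate w) s x)
        * ∫⁻ y, ENNReal.ofReal (U (t - s) y) ∂(Q w (etaFlow s x))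
      ≤ ENNReal.ofReal (φ 0 - survival etaFlow (etaRate w) t x * φ t) := by
    rw [← hS.1]
    refine setLIntegral_mono' measurableSet_Ioc fun s hs => ?_
    refine (mul_le_mul_right (hjump s hs.2) _).trans ?_
    rw [etaRate_flow, ← ENNReal.ofReal_mul (mul_nonneg (hw.pos _).le (survival_pos _ _).le)]
    refine ENNReal.ofReal_le_ofReal ?_
    rw [mul_comm (w _), mul_assoc]
    exact mul_le_mul_of_nonneg_left (hkey s) (survival_pos _ _).le
  refine (add_le_add_right hint _).trans ?_
  have h0 : φ t = lyapunov δ (x - t) := by simp [hφ, hU]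
  have h00 : φ 0 = U t x := by simp [hφ]
  have hV := (lyapunov_pos δ (x - t)).le
  rw [etaFlow, ← ENNReal.ofReal_mul (survival_pos _ _).le,
    ← ENNReal.ofReal_add (mul_nonneg (survival_pos _ _).le hV) hS.2, h0, h00]
  exact ENNReal.ofReal_le_ofReal (by linarith)

end

/-! ### Exponential convergence -/

section

variable (w : ℝ → ℝ) [hw : IsRate w]

/-- The paths with exactly one jump before time `1` give the law at time `1` a density which is
bounded below, locally uniformly in the starting point. -/
lemma exists_minorization (R : ℝ) (hR : 0 ≤ R) : ∃ κ : ℝ, 0 < κ ∧ ∀ x, |x| ≤ R → ∀ A, MeasurableSet A →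
    ENNReal.ofReal κ * volume.restrict (Icc (R - 1) R) A ≤ etaKernel w 1 x A := by
  set q := Real.exp (-(cumRate w (R + 1) - cumRate w (-(R + 1)))) with hq
  have hq0 : 0 < q := Real.exp_pos _
  have hG := (strictMono_cumRate w).monotone
  have hqle : ∀ a b, -(R + 1) ≤ a → b ≤ R + 1 → q ≤ Real.exp (-(cumRate w b - cumRate w a)) := fun a b ha hb =>
    Real.exp_le_exp.2 (by linarith [hG ha, hG hb])
  have hw1 := hw.pos (-R)
  have hw2 := hw.pos (R - 1)
  refine ⟨w (-R) * q * (q * w (R - 1) * q), by positivity, fun x hx A hA => ?_⟩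
  have hx1 := neg_le_of_abs_le hx
  have hx2 := le_of_abs_le hx
  have hind : Measurable (A.indicator fun _ => (1 : ℝ≥0∞)) := measurable_one.indicator hA
  have h1 : etaKernel w 1 x A
      = ∑' m, jumpOp etaFlow (etaRate w) (Q w) m (1 : ℝ) x (A.indicator fun _ => 1) := by
    have := lintegral_etaKernel_eq_tsum w 1 x hind
    rw [NNReal.coe_one] at this
    rw [← this]
    exact (lintegral_indicator_one hA).symm
  rw [h1]
  refine le_trans ?_ (ENNReal.le_tsum 1)
  simp only [jumpOp]
  set g : ℝ → ℝ≥0∞ := (A ∩ Icc (R - 1) R).indicator fun _ => 1 with hg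
  have hgm : Measurable g := measurable_one.indicator (hA.inter measurableSet_Icc)
  have hgv : ∫⁻ y, g y = volume.restrict (Icc (R - 1) R) A := by
    rw [Measure.restrict_apply hA, hg]
    exact lintegral_indicator_one (hA.inter measurableSet_Icc)
  have hinner : ∀ s, 0 < s → s ≤ 1 → ENNReal.ofReal (q * w (R - 1) * q) * volume.restrict (Icc (R - 1) R) A
      ≤ ∫⁻ y, ENNReal.ofReal (survival etaFlow (etaRate w) (1 - s) y)
        * A.indicator (fun _ => (1 : ℝ≥0∞)) (etaFlow (1 - s) y) ∂(Q w (etaFlow s x)) := by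
    intro s hs0 hs1
    have hm : Measurable fun y => ENNReal.ofReal (survival etaFlow (etaRate w) (1 - s) y)
        * A.indicator (fun _ => (1 : ℝ≥0∞)) (etaFlow (1 - s) y) := by
      refine Measurable.mul ?_ (hind.comp (by unfold etaFlow; fun_prop))
      exact ((isJumpData_eta w).measurable_survival.comp
        (by fun_prop : Measurable fun y : ℝ => (1 - s, y))).ennreal_ofReal
    have hw' := measurable_rate w
    have hG' := measurable_cumRate w
    rw [← hgv, ← lintegral_sub_right_eq_self g (1 - s), ← lintegral_const_mul _ (by fun_prop), Q,
      lintegral_withDensity_eq_lintegral_mul _ (by simp_rw [integral_rate]; fun_prop) hm,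
      ← lintegral_indicator measurableSet_Ici]
    refine lintegral_mono fun y => ?_
    by_cases hy : y - (1 - s) ∈ A ∩ Icc (R - 1) R
    · obtain ⟨hyA, hy1, hy2⟩ := hy
      have hmem : y ∈ Ici (etaFlow s x) := by simp only [etaFlow, mem_Ici]; linarith
      rw [indicator_of_mem hmem, Pi.mul_apply]
      have e1 : g (y - (1 - s)) = 1 := indicator_of_mem (by exact ⟨hyA, hy1, hy2⟩) _
      have e2 : A.indicator (fun _ => (1 : ℝ≥0∞)) (etaFlow (1 - s) y) = 1 := indicator_of_mem hyA _
      rw [e1, e2, mul_one, mul_one, integral_rate, survival_eta, ENNReal.ofReal_mul (by positivity)]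
      refine mul_le_mul' (ENNReal.ofReal_le_ofReal (mul_le_mul ?_ ?_ hw2.le (Real.exp_pos _).le))
        (ENNReal.ofReal_le_ofReal ?_)
      · exact hqle _ _ (by simp only [etaFlow]; linarith) (by linarith)
      · exact hw.mono (by linarith)
      · exact hqle _ _ (by linarith) (by linarith)
    · have : g (y - (1 - s)) = 0 := indicator_of_notMem hy _
      simp [this]
  calc ENNReal.ofReal (w (-R) * q * (q * w (R - 1) * q)) * volume.restrict (Icc (R - 1) R) A
      = ∫⁻ s in Ioc (0 : ℝ) 1, ENNReal.ofReal (w (-R) * q) *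
          (ENNReal.ofReal (q * w (R - 1) * q) * volume.restrict (Icc (R - 1) R) A) := by
        rw [setLIntegral_const, Real.volume_Ioc, sub_zero, ENNReal.ofReal_one, mul_one,
          ENNReal.ofReal_mul (by positivity), mul_assoc]
    _ ≤ _ := by
        refine setLIntegral_mono' measurableSet_Ioc fun s hs => ?_
        refine mul_le_mul' (ENNReal.ofReal_le_ofReal ?_) (hinner s hs.1 hs.2)
        rw [etaRate_flow, survival_eta]
        refine mul_le_mul (hw.mono (by linarith [hs.1])) ?_ hq0.le (hw.pos _).le
        exact hqle _ _ (by linarith) (by linarith [hs.2])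

end

/-- Comparison of two integrals by the product coupling. -/
lemma abs_integral_sub_integral_le {μ₁ μ₂ : Measure ℝ} [IsFiniteMeasure μ₁] [IsFiniteMeasure μ₂] {m s β : ℝ}
    (h1 : μ₁.real univ = m) (h2 : μ₂.real univ = m) {V f : ℝ → ℝ} (hV1 : Integrable V μ₁) (hV2 : Integrable V μ₂)
    (hf1 : Integrable f μ₁) (hf2 : Integrable f μ₂)
    (hf : ∀ a b, |f a - f b| ≤ s * (2 + β * V a + β * V b)) :
    |∫ a, f a ∂μ₁ - ∫ b, f b ∂μ₂| ≤ s * (2 * m + β * (∫ a, V a ∂μ₁ + ∫ b, V b ∂μ₂)) := by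
  have hm : 0 ≤ m := h1 ▸ measureReal_nonneg
  rcases hm.eq_or_lt with rfl | hm
  · rw [measureReal_eq_zero_iff, Measure.measure_univ_eq_zero] at h1 h2
    simp [h1, h2]
  have i1 : ∀ a, ∫ b, (f a - f b) ∂μ₂ = m * f a - ∫ b, f b ∂μ₂ := fun a => by
    rw [integral_sub (integrable_const _) hf2, integral_const, h2, smul_eq_mul]
  have i2 : ∫ a, (∫ b, (f a - f b) ∂μ₂) ∂μ₁ = m * (∫ a, f a ∂μ₁ - ∫ b, f b ∂μ₂) := by
    simp only [i1]
    rw [integral_sub (hf1.const_mul _) (integrable_const _), integral_const, h1, smul_eq_mul,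
      integral_const_mul]
    ring
  have j1 : ∀ a, ∫ b, s * (2 + β * V a + β * V b) ∂μ₂ = s * (m * (2 + β * V a) + β * ∫ b, V b ∂μ₂) := fun a => by
    rw [integral_const_mul, integral_add (integrable_const _) (hV2.const_mul _), integral_const, h2,
      smul_eq_mul, integral_const_mul]
  have j2 : ∫ a, (∫ b, s * (2 + β * V a + β * V b) ∂μ₂) ∂μ₁
      = m * (s * (2 * m + β * (∫ a, V a ∂μ₁ + ∫ b, V b ∂μ₂))) := by
    simp only [j1]
    have hVi : Integrable (fun a => 2 + β * V a) μ₁ := (integrable_const _).add (hV1.const_mul _)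
    rw [integral_const_mul, integral_add (hVi.const_mul _) (integrable_const _), integral_const_mul, integral_add (integrable_const _) (hV1.const_mul _),
      integral_const, integral_const, h1, smul_eq_mul, smul_eq_mul, integral_const_mul]
    ring
  have hjint : Integrable (fun a => ∫ b, s * (2 + β * V a + β * V b) ∂μ₂) μ₁ := by
    simp only [j1]
    exact ((((integrable_const _).add (hV1.const_mul _)).const_mul _).add (integrable_const _)).const_mul _
  have key : |∫ a, (∫ b, (f a - f b) ∂μ₂) ∂μ₁| ≤ ∫ a, (∫ b, s * (2 + β * V a + β * V b) ∂μ₂) ∂μ₁ := by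
    rw [← Real.norm_eq_abs]
    refine norm_integral_le_of_norm_le hjint (ae_of_all _ fun a => ?_)
    refine norm_integral_le_of_norm_le ?_ (ae_of_all _ fun b => hf a b)
    exact ((integrable_const _).add (hV2.const_mul _)).const_mul _
  rw [i2, j2, abs_mul, abs_of_pos hm] at key
  exact le_of_mul_le_mul_left key hm

/-- Comparison of two integrals when the measures have a common part of mass `κ`. -/
lemma abs_integral_sub_integral_le_of_minorization {μ₁ μ₂ ν : Measure ℝ} [IsProbabilityMeasure μ₁]
    [IsProbabilityMeasure μ₂] [IsProbabilityMeasure ν] {κ s β : ℝ} (hκ : 0 ≤ κ) (hs : 0 ≤ s) (hβ : 0 ≤ β)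
    (h1 : ENNReal.ofReal κ • ν ≤ μ₁) (h2 : ENNReal.ofReal κ • ν ≤ μ₂) {V f : ℝ → ℝ} (hV0 : ∀ a, 0 ≤ V a)
    (hV1 : Integrable V μ₁) (hV2 : Integrable V μ₂) (hf1 : Integrable f μ₁) (hf2 : Integrable f μ₂)
    (hf : ∀ a b, |f a - f b| ≤ s * (2 + β * V a + β * V b)) :
    |∫ a, f a ∂μ₁ - ∫ b, f b ∂μ₂| ≤ s * (2 * (1 - κ) + β * (∫ a, V a ∂μ₁ + ∫ b, V b ∂μ₂)) := by
  have key : ∀ μ : Measure ℝ, IsProbabilityMeasure μ → ENNReal.ofReal κ • ν ≤ μ →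
      ∃ μ' : Measure ℝ, IsFiniteMeasure μ' ∧ μ' ≤ μ ∧ μ = μ' + ENNReal.ofReal κ • ν ∧ μ'.real univ = 1 - κ := by
    intro μ _ hle
    have hfin : IsFiniteMeasure (ENNReal.ofReal κ • ν) := isFiniteMeasure_of_le μ hle
    have he := Measure.sub_add_cancel_of_le hle
    refine ⟨μ - ENNReal.ofReal κ • ν, inferInstance, Measure.sub_le, he.symm, ?_⟩
    have h := congrArg (fun ρ : Measure ℝ => ρ.real univ) he
    simp only [measureReal_def, Measure.add_apply, measure_univ, ENNReal.toReal_one] at h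
    rw [ENNReal.toReal_add (measure_ne_top _ _) (measure_ne_top _ _)] at h
    simp only [Measure.smul_apply, measure_univ, smul_eq_mul, mul_one, ENNReal.toReal_ofReal hκ] at h
    rw [measureReal_def]
    linarith
  obtain ⟨μ₁', _, hle1, he1, hm1⟩ := key μ₁ inferInstance h1
  obtain ⟨μ₂', _, hle2, he2, hm2⟩ := key μ₂ inferInstance h2
  have hfν : Integrable f (ENNReal.ofReal κ • ν) := hf1.mono_measure h1
  have hsub : ∫ a, f a ∂μ₁ - ∫ b, f b ∂μ₂ = ∫ a, f a ∂μ₁' - ∫ b, f b ∂μ₂' := by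
    conv_lhs => rw [he1, he2]
    rw [integral_add_measure (hf1.mono_measure hle1) hfν, integral_add_measure (hf2.mono_measure hle2) hfν]
    ring
  rw [hsub]
  refine (abs_integral_sub_integral_le hm1 hm2 (hV1.mono_measure hle1) (hV2.mono_measure hle2)
    (hf1.mono_measure hle1) (hf2.mono_measure hle2) hf).trans ?_
  have i1 := integral_mono_measure hle1 (ae_of_all _ hV0) hV1
  have i2 := integral_mono_measure hle2 (ae_of_all _ hV0) hV2
  gcongr

section

variable (w : ℝ → ℝ) [hw : IsRate w]

lemma measurable_lyapunov (δ : ℝ) : Measurable (lyapunov δ) := by unfold lyapunov; fun_prop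

lemma one_add_abs_le_lyapunov (δ x : ℝ) : 1 + δ * |x| ≤ lyapunov δ x := by
  have h : ∀ y, 1 + δ * y ≤ Real.exp (δ * y) + Real.exp (-(δ * y)) := fun y => by
    have h1 := Real.add_one_le_exp (δ * y)
    have h2 := Real.exp_pos (-(δ * y))
    linarith
  rcases abs_cases x with ⟨h1, h2⟩ | ⟨h1, h2⟩
  · rw [h1]; exact h x
  · rw [h1, lyapunov, add_comm (Real.exp _)]
    have := h (-x)
    simpa only [mul_neg, neg_neg] using this

/-- The constants of the exponential convergence: `lyapunov δ` satisfies a drift condition. -/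
structure HasDrift (w : ℝ → ℝ) (δ c K : ℝ) : Prop where
  δ_pos : 0 < δ
  c_pos : 0 < c
  K_pos : 0 < K
  jump : ∫⁻ y, ENNReal.ofReal (lyapunov δ y) ∂(Q w 0) < ∞
  drift : ∀ (t : ℝ≥0) (x : ℝ), ∫⁻ y, ENNReal.ofReal (lyapunov δ y) ∂(etaKernel w t x)
      ≤ ENNReal.ofReal (Real.exp (-c * t) * lyapunov δ x + K)

lemma exists_hasDrift : ∃ δ c K, HasDrift w δ c K := by
  obtain ⟨δ, c, K, h1, h2, h3, h4, h5⟩ := exists_lyapunov_bound w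
  exact ⟨δ, c, K, h1, h2, h3, h4, h5⟩

variable {w} {δ c K : ℝ} (hd : HasDrift w δ c K)
include hd

omit hw in
lemma HasDrift.integrable (t : ℝ≥0) (x : ℝ) : Integrable (lyapunov δ) (etaKernel w t x) := by
  refine ⟨(measurable_lyapunov δ).aestronglyMeasurable, ?_⟩
  rw [hasFiniteIntegral_iff_ofReal (ae_of_all _ fun y => (lyapunov_pos δ y).le)]
  exact (hd.drift t x).trans_lt ENNReal.ofReal_lt_top

omit hw in
lemma HasDrift.integral_le (t : ℝ≥0) (x : ℝ) :
    ∫ y, lyapunov δ y ∂(etaKernel w t x) ≤ Real.exp (-c * t) * lyapunov δ x + K := by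
  rw [integral_eq_lintegral_of_nonneg_ae (ae_of_all _ fun y => (lyapunov_pos δ y).le)
    (measurable_lyapunov δ).aestronglyMeasurable]
  refine ENNReal.toReal_le_of_le_ofReal ?_ (hd.drift t x)
  have := lyapunov_pos δ x
  have := hd.K_pos
  positivity

omit hw in
lemma HasDrift.integral_le' (t : ℝ≥0) (x : ℝ) :
    ∫ y, lyapunov δ y ∂(etaKernel w t x) ≤ lyapunov δ x + K := by
  refine (hd.integral_le t x).trans ?_
  have h1 : Real.exp (-c * t) ≤ 1 := Real.exp_le_one_iff.2 (by
    have := mul_nonneg hd.c_pos.le t.2; simp only [NNReal.val_eq_coe] at this; linarith)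
  have := mul_le_mul_of_nonneg_right h1 (lyapunov_pos δ x).le
  linarith

/-- The functions whose oscillation is bounded by `2 + β V(a) + β V(b)`, up to the factor `s`. -/
def HasOsc (δ β s : ℝ) (f : ℝ → ℝ) : Prop :=
  Measurable f ∧ ∀ a b, |f a - f b| ≤ s * (2 + β * lyapunov δ a + β * lyapunov δ b)

omit hw in
lemma HasDrift.integrable_of_hasOsc [hw : IsRate w] {β s : ℝ} {f : ℝ → ℝ} (hf : HasOsc δ β s f) (t : ℝ≥0) (x : ℝ) :
    Integrable f (etaKernel w t x) := by
  have h1 : Integrable (fun a => |f 0| + s * (2 + β * lyapunov δ a + β * lyapunov δ 0)) (etaKernel w t x) :=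
    (integrable_const _).add (((((integrable_const _).add ((hd.integrable t x).const_mul _)).add
      (integrable_const _))).const_mul _)
  refine h1.mono' hf.1.aestronglyMeasurable (ae_of_all _ fun a => ?_)
  have h2 := hf.2 a 0
  rw [Real.norm_eq_abs]
  have := abs_sub_abs_le_abs_sub (f a) (f 0)
  linarith

omit hd in
lemma measurable_integral_etaKernel {f : ℝ → ℝ} (hf : Measurable f) (t : ℝ) :
    Measurable fun x => ∫ y, f y ∂(etaKernel w t x) := by
  have : IsMarkovKernel (⟨etaKernel w t, measurable_etaKernel w t⟩ : Kernel ℝ ℝ) := ⟨fun x =>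
    (inferInstance : IsProbabilityMeasure (etaKernel w t x))⟩
  exact (hf.stronglyMeasurable.integral_kernel
    (κ := (⟨etaKernel w t, measurable_etaKernel w t⟩ : Kernel ℝ ℝ))).measurable

/-- The unit time step contracts the oscillation. -/
lemma HasDrift.exists_contraction : ∃ β r, 0 < β ∧ 0 < r ∧ r < 1 ∧ ∀ s, 0 ≤ s → ∀ f, HasOsc δ β s f →
    HasOsc δ β (r * s) fun x => ∫ y, f y ∂(etaKernel w 1 x) := by
  set γ := Real.exp (-c) with hγ
  have hγ0 : 0 < γ := Real.exp_pos _
  have hγ1 : γ < 1 := (Real.exp_lt_exp.2 (by linarith [hd.c_pos] : -c < 0)).trans_eq Real.exp_zero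
  have hK := hd.K_pos
  have hδ := hd.δ_pos
  have hγ' : 0 < 1 - γ := by linarith
  set R₀ := 4 * K / (1 - γ) with hR0
  have hR0p : 0 < R₀ := by positivity
  set R := R₀ / δ with hR
  have hRp : 0 ≤ R := by positivity
  obtain ⟨κ, hκ, hmin⟩ := exists_minorization w R hRp
  have hν : IsProbabilityMeasure (volume.restrict (Icc (R - 1) R)) := ⟨by simp⟩
  have hκ1 : κ ≤ 1 := by
    have h := hmin 0 (by simpa using hRp) univ MeasurableSet.univ
    rw [measure_univ, mul_one, measure_univ, ENNReal.ofReal_le_one] at h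
    exact h
  set β := κ / (2 * K) with hβ
  have hβ0 : 0 < β := by positivity
  have hβK : 2 * β * K = κ := by rw [hβ]; field_simp
  set r := max ((3 + γ) / 4) (1 - κ / 4) with hr
  have hr1 : (3 + γ) / 4 ≤ r := le_max_left _ _
  have hr2 : 1 - κ / 4 ≤ r := le_max_right _ _
  refine ⟨β, r, hβ0, by linarith, max_lt (by linarith) (by linarith), fun s hs f hf =>
    ⟨measurable_integral_etaKernel hf.1 1, fun x y => ?_⟩⟩
  have hint := fun x => hd.integral_le 1 x
  simp only [NNReal.coe_one, mul_one, ← hγ] at hint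
  have i1 := fun x => hd.integrable 1 x
  have i2 := fun x => hd.integrable_of_hasOsc hf 1 x
  simp only [NNReal.coe_one] at i1 i2
  have hx := hint x
  have hy := hint y
  have hVx := lyapunov_pos δ x
  have hVy := lyapunov_pos δ y
  rw [mul_comm r s, mul_assoc]
  -- if one of the points is far out, the drift of `lyapunov δ` gives the contraction; otherwise
  -- the common part of the two laws does
  rcases le_total R₀ (lyapunov δ x + lyapunov δ y) with hbig | hsmall
  · refine (abs_integral_sub_integral_le (m := 1) (by simp) (by simp) (i1 x) (i1 y) (i2 x) (i2 y) hf.2).trans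
      (mul_le_mul_of_nonneg_left ?_ hs)
    have h1 : 4 * K ≤ (1 - γ) * (lyapunov δ x + lyapunov δ y) := by
      rw [hR0, div_le_iff₀ hγ'] at hbig; linarith
    have h2 := mul_le_mul_of_nonneg_left (add_le_add hx hy) hβ0.le
    have h3 := mul_le_mul_of_nonneg_left h1 hβ0.le
    have h4 : 0 < β * (lyapunov δ x + lyapunov δ y) := by positivity
    have h5 := mul_le_mul_of_nonneg_right hr1 h4.le
    linarith
  · have hle : ∀ z, lyapunov δ z ≤ R₀ → ENNReal.ofReal κ • volume.restrict (Icc (R - 1) R) ≤ etaKernel w 1 z := by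
      intro z hz
      refine Measure.le_iff.2 fun A hA => ?_
      refine hmin z ?_ A hA
      rw [hR, le_div_iff₀ hδ]
      linarith [one_add_abs_le_lyapunov δ z]
    refine (abs_integral_sub_integral_le_of_minorization hκ.le hs hβ0.le (hle x (by linarith)) (hle y (by linarith))
      (fun a => (lyapunov_pos δ a).le) (i1 x) (i1 y) (i2 x) (i2 y) hf.2).trans (mul_le_mul_of_nonneg_left ?_ hs)
    have h2 := mul_le_mul_of_nonneg_left (add_le_add hx hy) hβ0.le
    have h4 : 0 < β * (lyapunov δ x + lyapunov δ y) := by positivity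
    have h5 := mul_le_mul_of_nonneg_right (show γ ≤ r by linarith) h4.le
    linarith

end

section

variable {w : ℝ → ℝ} [hw : IsRate w] {δ c K : ℝ} (hd : HasDrift w δ c K)

omit hw in
lemma two_le_lyapunov (δ x : ℝ) : 2 ≤ lyapunov δ x := by
  have h := Real.add_one_le_exp (δ * x)
  have h' := Real.add_one_le_exp (-(δ * x))
  unfold lyapunov
  linarith

/-- The Chapman–Kolmogorov equation for integrals. -/
lemma integral_etaKernel_add (s t : ℝ≥0) (x : ℝ) {f : ℝ → ℝ}
    (hf : Integrable f (etaKernel w (s + t : ℝ≥0) x)) :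
    ∫ y, f y ∂(etaKernel w (s + t : ℝ≥0) x) = ∫ y, (∫ z, f z ∂(etaKernel w t y)) ∂(etaKernel w s x) := by
  set κ : ℝ≥0 → Kernel ℝ ℝ := fun t => ⟨etaKernel w t, measurable_etaKernel w t⟩ with hκ
  have h : etaKernel w (s + t : ℝ≥0) x = (κ t ∘ₖ κ s) x := by
    refine Measure.ext_of_lintegral _ fun f hf => ?_
    rw [Kernel.lintegral_comp _ _ _ hf]
    exact lintegral_etaKernel_add' w s t x hf
  rw [h] at hf ⊢
  rw [Kernel.integral_comp hf]
  rfl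

/-- The mean of `η` at time `t`. -/
def etaMean (w : ℝ → ℝ) (t x : ℝ) : ℝ := ∫ y, y ∂(etaKernel w t x)

include hd

omit hw in
/-- The identity has a finite weighted oscillation, since it grows more slowly than `lyapunov δ`.
-/
lemma HasDrift.hasOsc_id {β : ℝ} (hβ : 0 < β) : HasOsc δ β (1 / (δ * β)) fun y => y := by
  refine ⟨measurable_id, fun a b => ?_⟩
  have hδ := hd.δ_pos
  rw [div_mul_eq_mul_div, one_mul, le_div_iff₀ (by positivity)]
  have h1 := mul_le_mul_of_nonneg_left (one_add_abs_le_lyapunov δ a) hβ.le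
  have h2 := mul_le_mul_of_nonneg_left (one_add_abs_le_lyapunov δ b) hβ.le
  have h3 := mul_le_mul_of_nonneg_right (abs_sub a b) (mul_pos hδ hβ).le
  linarith

omit hw in
lemma HasDrift.integrable_id [hw : IsRate w] (t : ℝ≥0) (x : ℝ) : Integrable (fun y => y) (etaKernel w t x) :=
  hd.integrable_of_hasOsc (hd.hasOsc_id one_pos) t x

omit hw in
lemma HasDrift.hasOsc_etaMean [hw : IsRate w] {β : ℝ} (hβ : 0 < β) (t : ℝ≥0) :
    HasOsc δ β ((1 + K * β) * (1 / (δ * β))) (etaMean w t) := by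
  refine ⟨measurable_integral_etaKernel measurable_id t, fun a b => ?_⟩
  have hδ := hd.δ_pos
  have hK := hd.K_pos
  refine (abs_integral_sub_integral_le (m := 1) (by simp) (by simp) (hd.integrable t a) (hd.integrable t b)
    (hd.integrable_id t a) (hd.integrable_id t b) (hd.hasOsc_id hβ).2).trans ?_
  have h1 := add_le_add (hd.integral_le' t a) (hd.integral_le' t b)
  have h2 := mul_le_mul_of_nonneg_left h1 hβ.le
  have ha := lyapunov_pos δ a
  have hb := lyapunov_pos δ b
  rw [mul_comm (1 + K * β), mul_assoc]
  refine mul_le_mul_of_nonneg_left ?_ (by positivity)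
  have h3 : 0 < K * β * (β * lyapunov δ a + β * lyapunov δ b) := by positivity
  linarith

/-- The mean of `η` converges exponentially fast to a constant. -/
lemma HasDrift.exists_etaMean_limit : ∃ m C a, 0 < C ∧ 0 < a ∧ ∀ (t : ℝ≥0) (x : ℝ),
    |etaMean w t x - m| ≤ C * Real.exp (-a * t) * lyapunov δ x := by
  obtain ⟨β, r, hβ, hr0, hr1, hcontr⟩ := hd.exists_contraction
  have hδ := hd.δ_pos
  have hK := hd.K_pos
  set S := (1 + K * β) * (1 / (δ * β)) with hS
  have hS0 : 0 < S := by positivity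
  have hstep : ∀ (t : ℝ≥0) x, etaMean w (1 + t : ℝ≥0) x = ∫ y, etaMean w t y ∂(etaKernel w 1 x) := fun t x => by
    have := integral_etaKernel_add 1 t x (hd.integrable_id (1 + t) x)
    rw [NNReal.coe_one] at this
    exact this
  have hosc : ∀ (n : ℕ) (t : ℝ≥0), HasOsc δ β (r ^ n * S) (etaMean w (n + t : ℝ≥0)) := by
    intro n t
    induction n with
    | zero => rw [pow_zero, one_mul, Nat.cast_zero, zero_add]; exact hd.hasOsc_etaMean hβ t
    | succ n ih =>
      have h1 := hcontr _ (by positivity) _ ih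
      simp only [← hstep] at h1
      rw [pow_succ', mul_assoc]
      convert! h1 using 2
      push_cast; ring
  set a := -Real.log r with ha
  have ha0 : 0 < a := neg_pos.2 (Real.log_neg hr0 hr1)
  -- the oscillation at an arbitrary time
  have hosc' : ∀ t : ℝ≥0, HasOsc δ β (Real.exp a * S * Real.exp (-a * t)) (etaMean w t) := by
    intro t
    have h1 := hosc ⌊t⌋₊ (t - ⌊t⌋₊)
    rw [add_tsub_cancel_of_le (Nat.floor_le (zero_le : 0 ≤ t))] at h1
    refine ⟨h1.1, fun x y => (h1.2 x y).trans ?_⟩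
    have h2 : r ^ ⌊t⌋₊ ≤ Real.exp a * Real.exp (-a * t) := by
      rw [← Real.exp_add, ← Real.rpow_natCast, Real.rpow_def_of_pos hr0, Real.exp_le_exp]
      have h3 : (t : ℝ) ≤ ⌊t⌋₊ + 1 := by exact_mod_cast (Nat.lt_floor_add_one t).le
      have h4 := mul_le_mul_of_nonneg_left h3 ha0.le
      have : Real.log r = -a := by rw [ha]; ring
      rw [this]; linarith
    have hx := lyapunov_pos δ x
    have hy := lyapunov_pos δ y
    refine mul_le_mul_of_nonneg_right ?_ (by positivity)
    calc r ^ ⌊t⌋₊ * S ≤ Real.exp a * Real.exp (-a * t) * S := by gcongr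
      _ = _ := by ring
  set D := Real.exp a * S * (2 + 2 * β + β * K) with hD
  have hD0 : 0 < D := by positivity
  -- by the Markov property, the mean at time `s + t` is an average of means at time `t`
  have hcauchy : ∀ (s t : ℝ≥0) x, |etaMean w (s + t : ℝ≥0) x - etaMean w t x| ≤ D * Real.exp (-a * t) * lyapunov δ x := by
    intro s t x
    have hi : Integrable (etaMean w t) (etaKernel w s x) := hd.integrable_of_hasOsc (hosc' t) s x
    have h1 : etaMean w (s + t : ℝ≥0) x - etaMean w t x
        = ∫ y, (etaMean w t y - etaMean w t x) ∂(etaKernel w s x) := by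
      rw [integral_sub hi (integrable_const _), integral_const, probReal_univ, one_smul]
      congr 1
      exact integral_etaKernel_add s t x (hd.integrable_id (s + t) x)
    have hVi := hd.integrable s x
    rw [h1, ← Real.norm_eq_abs]
    refine (norm_integral_le_of_norm_le
      (g := fun y => Real.exp a * S * Real.exp (-a * t) * (2 + β * lyapunov δ y + β * lyapunov δ x)) ?_
      (ae_of_all _ fun y => (hosc' t).2 y x)).trans ?_
    · exact (((integrable_const _).add (hVi.const_mul _)).add (integrable_const _)).const_mul _
    · have hVi' : Integrable (fun y => 2 + β * lyapunov δ y) (etaKernel w s x) :=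
        (integrable_const _).add (hVi.const_mul _)
      rw [integral_const_mul, integral_add hVi' (integrable_const _), integral_add (integrable_const _)
        (hVi.const_mul _), integral_const, integral_const, probReal_univ, one_smul, one_smul, integral_const_mul]
      have h2 := mul_le_mul_of_nonneg_left (hd.integral_le' s x) hβ.le
      have hV := two_le_lyapunov δ x
      have h3 : 2 + β * (∫ y, lyapunov δ y ∂(etaKernel w s x)) + β * lyapunov δ x
          ≤ (2 + 2 * β + β * K) * lyapunov δ x := by
        have := mul_le_mul_of_nonneg_left hV (mul_pos hβ hK).le
        have := mul_pos hβ hK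
        linarith
      calc _ ≤ Real.exp a * S * Real.exp (-a * t) * ((2 + 2 * β + β * K) * lyapunov δ x) := by gcongr
        _ = _ := by rw [hD]; ring
  have hexp : Tendsto (fun n : ℕ => Real.exp (-a * n)) atTop (𝓝 0) := by
    have := (tendsto_natCast_atTop_atTop (R := ℝ)).const_mul_atTop ha0
    simpa only [neg_mul, Function.comp_def] using Real.tendsto_exp_neg_atTop_nhds_zero.comp this
  -- a limit along the integers, at the point `0`
  obtain ⟨m, hm⟩ : ∃ m, Tendsto (fun n : ℕ => etaMean w n 0) atTop (𝓝 m) := by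
    refine cauchySeq_tendsto_of_complete (cauchySeq_of_le_tendsto_0' (fun n : ℕ => D * Real.exp (-a * n) * lyapunov δ 0)
      (fun n k hnk => ?_) ?_)
    · have := hcauchy ((k - n : ℕ) : ℝ≥0) n 0
      rw [← Nat.cast_add, Nat.sub_add_cancel hnk] at this
      rw [dist_comm, Real.dist_eq]
      simpa using this
    · simpa using (hexp.const_mul D).mul_const (lyapunov δ 0)
  have hlim : ∀ x, Tendsto (fun n : ℕ => etaMean w n x) atTop (𝓝 m) := by
    intro x
    have h1 : Tendsto (fun n : ℕ => etaMean w n x - etaMean w n 0) atTop (𝓝 0) := by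
      refine squeeze_zero_norm (a := fun n : ℕ => Real.exp a * S * Real.exp (-a * n) *
        (2 + β * lyapunov δ x + β * lyapunov δ 0)) (fun n => (hosc' n).2 x 0) ?_
      simpa using (hexp.const_mul (Real.exp a * S)).mul_const (2 + β * lyapunov δ x + β * lyapunov δ 0)
    simpa using h1.add hm
  refine ⟨m, D, a, hD0, ha0, fun t x => ?_⟩
  -- compare with a late integer time
  have h1 : Tendsto (fun n : ℕ => |etaMean w t x - etaMean w n x|) atTop (𝓝 |etaMean w t x - m|) :=
    ((hlim x).const_sub _).abs
  refine le_of_tendsto h1 ?_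
  filter_upwards [eventually_ge_atTop ⌈t⌉₊] with n hn
  have hn' : t ≤ n := (Nat.le_ceil t).trans (by exact_mod_cast hn)
  have := hcauchy (n - t) t x
  rw [tsub_add_cancel_of_le hn', abs_sub_comm] at this
  exact_mod_cast this

end

/-! ### The stationary mean vanishes -/

/-- The two parts of a square on both sides of the graph of a step function, in a random setting. -/
lemma integral_min_add_integral_min {Ω : Type*} [MeasurableSpace Ω] {P : Measure Ω} [IsProbabilityMeasure P]
    {Φ Ψ : ℝ → Ω → ℝ} (hΦ : Measurable fun p : ℝ × Ω => Φ p.1 p.2) (hΨ : Measurable fun p : ℝ × Ω => Ψ p.1 p.2)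
    (hΦ0 : ∀ᵐ ω ∂P, ∀ s, 0 ≤ s → 0 ≤ Φ s ω) (hΨ0 : ∀ᵐ ω ∂P, ∀ s, 0 ≤ s → 0 ≤ Ψ s ω)
    (hdual : ∀ᵐ ω ∂P, ∀ s y, 0 ≤ s → 0 ≤ y → (y < Φ s ω ↔ ¬ s < Ψ y ω)) {L : ℝ} (hL : 0 ≤ L) :
    Integrable (fun s => (∫ ω, min (Φ s ω) L ∂P) + ∫ ω, min (Ψ s ω) L ∂P) (volume.restrict (Ioc 0 L)) ∧
    ∫ s in Ioc 0 L, ((∫ ω, min (Φ s ω) L ∂P) + ∫ ω, min (Ψ s ω) L ∂P) = L * L := by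
  -- `min a L` is the length of the part of `(0, L]` below `a`; by Fubini, the two integrals are
  -- the areas of the two parts of the square `(0, L]²`
  have hvol : ∀ a : ℝ, 0 ≤ a → ENNReal.ofReal (min a L) = ∫⁻ y in Ioc 0 L, (if y < a then 1 else 0) := by
    intro a ha
    have h1 : (fun y : ℝ => if y < a then (1 : ℝ≥0∞) else 0) = (Iio a).indicator 1 := by
      ext y; simp [indicator_apply]
    rw [h1, lintegral_indicator_one measurableSet_Iio, Measure.restrict_apply measurableSet_Iio]
    rcases le_or_gt a L with h | h
    · have h2 : Iio a ∩ Ioc 0 L = Ioo 0 a := by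
        ext y; simp only [mem_inter_iff, mem_Iio, mem_Ioc, mem_Ioo]
        exact ⟨fun h => ⟨h.2.1, h.1⟩, fun h' => ⟨h'.2, h'.1, h'.2.le.trans h⟩⟩
      rw [min_eq_left h, h2, Real.volume_Ioo, sub_zero]
    · have h2 : Iio a ∩ Ioc 0 L = Ioc 0 L := inter_eq_right.2 fun y hy => hy.2.trans_lt h
      rw [min_eq_right h.le, h2, Real.volume_Ioc, sub_zero]
  have hmeas : ∀ {Θ : ℝ → Ω → ℝ}, Measurable (fun p : ℝ × Ω => Θ p.1 p.2) →
      Measurable fun p : (Ω × ℝ) × ℝ => if p.2 < Θ p.1.2 p.1.1 then (1 : ℝ≥0∞) else 0 := by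
    intro Θ hΘ
    refine Measurable.ite (measurableSet_lt measurable_snd ?_) measurable_const measurable_const
    exact hΘ.comp (by fun_prop : Measurable fun p : (Ω × ℝ) × ℝ => (p.1.2, p.1.1))
  have hconv : ∀ {Θ : ℝ → Ω → ℝ}, Measurable (fun p : ℝ × Ω => Θ p.1 p.2) →
      (∀ᵐ ω ∂P, ∀ s, 0 ≤ s → 0 ≤ Θ s ω) →
      Integrable (fun s => ∫ ω, min (Θ s ω) L ∂P) (volume.restrict (Ioc 0 L)) ∧
      ∫ s in Ioc 0 L, (∫ ω, min (Θ s ω) L ∂P)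
        = (∫⁻ ω, (∫⁻ s in Ioc 0 L, ∫⁻ y in Ioc 0 L, if y < Θ s ω then 1 else 0) ∂P).toReal := by
    intro Θ hΘ hΘ0
    have hm1 : ∀ s, Measurable (Θ s) := fun s => hΘ.comp (by fun_prop : Measurable fun ω : Ω => (s, ω))
    have hnn : ∀ s, 0 ≤ s → ∀ᵐ ω ∂P, 0 ≤ min (Θ s ω) L := fun s hs => by
      filter_upwards [hΘ0] with ω h using le_min (h s hs) hL
    have hbd : ∀ s, 0 ≤ s → ∀ᵐ ω ∂P, ‖min (Θ s ω) L‖ ≤ L := fun s hs => by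
      filter_upwards [hnn s hs] with ω h
      rw [Real.norm_eq_abs, abs_of_nonneg h]
      exact min_le_right _ _
    have hi : ∀ s, 0 ≤ s → Integrable (fun ω => min (Θ s ω) L) P := fun s hs =>
      Integrable.of_bound ((hm1 s).min measurable_const).aestronglyMeasurable L (hbd s hs)
    have hsm : StronglyMeasurable fun s => ∫ ω, min (Θ s ω) L ∂P :=
      (hΘ.min measurable_const).stronglyMeasurable.integral_prod_right'
    have hposI : ∀ s, 0 ≤ s → 0 ≤ ∫ ω, min (Θ s ω) L ∂P := fun s hs => integral_nonneg_of_ae (hnn s hs)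
    have hI : Integrable (fun s => ∫ ω, min (Θ s ω) L ∂P) (volume.restrict (Ioc 0 L)) := by
      refine Integrable.of_bound hsm.aestronglyMeasurable L
        ((ae_restrict_iff' measurableSet_Ioc).2 (ae_of_all _ fun s hs => ?_))
      refine (norm_integral_le_of_norm_le_const (hbd s hs.1.le)).trans ?_
      simp
    refine ⟨hI, ?_⟩
    rw [integral_eq_lintegral_of_nonneg_ae ((ae_restrict_iff' measurableSet_Ioc).2
      (ae_of_all _ fun s hs => hposI s hs.1.le)) hsm.aestronglyMeasurable]
    congr 1
    have h1 : ∀ s ∈ Ioc 0 L, ENNReal.ofReal (∫ ω, min (Θ s ω) L ∂P)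
        = ∫⁻ ω, (∫⁻ y in Ioc 0 L, if y < Θ s ω then 1 else 0) ∂P := by
      intro s hs
      rw [ofReal_integral_eq_lintegral_ofReal (hi s hs.1.le) (hnn s hs.1.le)]
      refine lintegral_congr_ae ?_
      filter_upwards [hΘ0] with ω h using hvol _ (h s hs.1.le)
    rw [setLIntegral_congr_fun measurableSet_Ioc h1]
    refine lintegral_lintegral_swap (Measurable.aemeasurable ?_)
    exact (hmeas hΘ).lintegral_prod_right'.comp measurable_swap
  obtain ⟨i1, e1⟩ := hconv hΦ hΦ0
  obtain ⟨i2, e2⟩ := hconv hΨ hΨ0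
  refine ⟨i1.add i2, ?_⟩
  rw [integral_add i1 i2, e1, e2]
  have hswap : ∀ ω, ∫⁻ s in Ioc 0 L, ∫⁻ y in Ioc 0 L, (if y < Ψ s ω then (1 : ℝ≥0∞) else 0)
      = ∫⁻ s in Ioc 0 L, ∫⁻ y in Ioc 0 L, (if s < Ψ y ω then 1 else 0) := fun ω => by
    refine lintegral_lintegral_swap (Measurable.aemeasurable ?_)
    exact (hmeas hΨ).comp (by fun_prop : Measurable fun p : ℝ × ℝ => (((ω, p.1), p.2) : (Ω × ℝ) × ℝ))
  simp only [hswap]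
  have hsum : (∫⁻ ω, (∫⁻ s in Ioc 0 L, ∫⁻ y in Ioc 0 L, if y < Φ s ω then 1 else 0) ∂P)
      + (∫⁻ ω, (∫⁻ s in Ioc 0 L, ∫⁻ y in Ioc 0 L, if s < Ψ y ω then 1 else 0) ∂P)
      = ENNReal.ofReal L * ENNReal.ofReal L := by
    rw [← lintegral_add_left ((hmeas hΦ).lintegral_prod_right'.lintegral_prod_right')]
    have h : ∀ᵐ ω ∂P, (∫⁻ s in Ioc 0 L, ∫⁻ y in Ioc 0 L, if y < Φ s ω then (1 : ℝ≥0∞) else 0)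
        + (∫⁻ s in Ioc 0 L, ∫⁻ y in Ioc 0 L, if s < Ψ y ω then (1 : ℝ≥0∞) else 0)
        = ENNReal.ofReal L * ENNReal.ofReal L := by
      filter_upwards [hdual] with ω h
      have hm2 : Measurable fun p : ℝ × ℝ => if p.2 < Φ p.1 ω then (1 : ℝ≥0∞) else 0 :=
        (hmeas hΦ).comp (by fun_prop : Measurable fun p : ℝ × ℝ => (((ω, p.1), p.2) : (Ω × ℝ) × ℝ))
      rw [← lintegral_add_left hm2.lintegral_prod_right']
      have h1 : ∀ s ∈ Ioc 0 L, (∫⁻ y in Ioc 0 L, if y < Φ s ω then (1 : ℝ≥0∞) else 0)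
          + (∫⁻ y in Ioc 0 L, if s < Ψ y ω then (1 : ℝ≥0∞) else 0) = ENNReal.ofReal L := by
        intro s hs
        have hm3 : Measurable fun y : ℝ => if y < Φ s ω then (1 : ℝ≥0∞) else 0 :=
          hm2.comp (by fun_prop : Measurable fun y : ℝ => (s, y))
        rw [← lintegral_add_left hm3]
        -- every point of the square is in exactly one of the two parts
        have h2 : ∀ y ∈ Ioc 0 L, (if y < Φ s ω then (1 : ℝ≥0∞) else 0) + (if s < Ψ y ω then (1 : ℝ≥0∞) else 0)
            = 1 := by
          intro y hy
          have h3 := h s y hs.1.le hy.1.le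
          by_cases h4 : s < Ψ y ω <;> simp [h3, h4]
        refine (setLIntegral_congr_fun measurableSet_Ioc h2).trans ?_
        rw [setLIntegral_const, Real.volume_Ioc, sub_zero, one_mul]
      refine (setLIntegral_congr_fun measurableSet_Ioc h1).trans ?_
      rw [setLIntegral_const, Real.volume_Ioc, sub_zero]
    rw [lintegral_congr_ae h, lintegral_const, measure_univ, mul_one]
  have hfin : ENNReal.ofReal L * ENNReal.ofReal L ≠ ∞ := ENNReal.mul_ne_top ENNReal.ofReal_ne_top ENNReal.ofReal_ne_top
  rw [← hsum] at hfin
  rw [← ENNReal.toReal_add (ENNReal.add_ne_top.1 hfin).1 (ENNReal.add_ne_top.1 hfin).2, hsum,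
    ENNReal.toReal_mul, ENNReal.toReal_ofReal hL]

/-! ### The staircase of the two local times -/

lemma sum_range_eq_add_etaTime (z : ℕ → ℝ) (n : ℕ) :
    ∑ i ∈ Finset.range (2 * n + 1), z i = z 0 + etaTime (fun i => z (i + 1)) n := by
  rw [Finset.sum_range_succ', etaTime, add_comm]

lemma add_etaPath {z : ℕ → ℝ} (hz : ∀ n, 0 ≤ z n + z (n + 1)) {n : ℕ} {t : ℝ}
    (h1 : etaTime z n ≤ t) (h2 : t < etaTime z (n + 1)) :
    t + etaPath z t = z 0 + etaTime (fun i => z (i + 1)) n := by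
  rw [etaPath_eq_etaFlow z hz n h1 h2, ← sum_range_eq_add_etaTime, Finset.sum_range_succ, etaFlow, etaTime]
  ring

/-- The two staircases, one in terms of the local time on each side of the edge, are inverse to each
other. -/
lemma lt_add_etaPath_iff {z : ℕ → ℝ} (hz : ∀ n, 0 ≤ z n + z (n + 1)) (h0 : z 0 = 0)
    (hT : Tendsto (etaTime z) atTop atTop) (hT' : Tendsto (etaTime fun i => z (i + 1)) atTop atTop)
    {s y : ℝ} (hs : 0 ≤ s) (hy : 0 ≤ y) :
    y < s + etaPath z s ↔ ¬ s < y + etaPath (fun i => z (i + 1)) y := by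
  have hz' : ∀ n, 0 ≤ z (n + 1) + z (n + 1 + 1) := fun n => hz (n + 1)
  have hm := monotone_etaTime hz
  have hm' := monotone_etaTime (z := fun i => z (i + 1)) hz'
  obtain ⟨a1, a2⟩ := stepIndex_spec hT (t := s) (by simpa using hs)
  obtain ⟨b1, b2⟩ := stepIndex_spec hT' (t := y) (by simpa using hy)
  set n := stepIndex (etaTime z) s
  set k := stepIndex (etaTime fun i => z (i + 1)) y
  have e2 : z 1 + etaTime (fun i => z (i + 1 + 1)) k = etaTime z (k + 1) := by
    have h := sum_range_eq_add_etaTime (fun i => z (i + 1)) k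
    simp only [zero_add] at h
    rw [← h, etaTime, show 2 * (k + 1) = 2 * k + 1 + 1 by ring, Finset.sum_range_succ' z (2 * k + 1), h0, add_zero]
  rw [add_etaPath hz a1 a2, add_etaPath hz' b1 b2, h0, zero_add, zero_add, e2, not_lt]
  constructor
  · intro h
    have hk : k < n := hm'.reflect_lt (b1.trans_lt h)
    exact (hm hk).trans a1
  · intro h
    by_contra! hlt
    have hk : n < k + 1 := hm'.reflect_lt (hlt.trans_lt b2)
    have : n + 1 ≤ k + 1 := hk
    exact absurd (a2.trans_le (hm this)) (not_lt.2 h)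

section

variable {w : ℝ → ℝ} [hw : IsRate w]

lemma isExpSeq_shift {Ω : Type*} [MeasurableSpace Ω] {P : Measure Ω} [IsProbabilityMeasure P]
    {e : ℕ → Ω → ℝ} (he : IsExpSeq P e) (p : ℕ) : IsExpSeq P fun n => e (n + p) where
  measurable _ := he.measurable _
  indep := he.indep.precomp (add_left_injective p)
  law _ := he.law _

/-- After its first step, the chain starts afresh from a point with distribution `Q(-x, ·)`. -/
lemma map_etaPath_chain_succ (x t : ℝ) :
    expSeqMeasure.map (fun e => etaPath (fun i => chain w x e (i + 1)) t) = (Q w (-x)).bind (etaKernel w t) := by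
  have he := isExpSeq_expSeqMeasure
  have hm : Measurable fun e : ℕ → ℝ => etaPath (fun i => chain w x e (i + 1)) t :=
    measurable_etaPath (fun n => he.measurable_chain w x (n + 1)) measurable_const
  refine Measure.ext_of_lintegral _ fun f hf => ?_
  rw [Measure.lintegral_bind (measurable_etaKernel w t).aemeasurable hf.aemeasurable, lintegral_map hf hm]
  have hchain : ∀ e : ℕ → ℝ, (fun i => chain w x e (i + 1)) = chain w (nextPoint w (-x) (e 0)) fun i => e (i + 1) :=
    fun e => funext fun i => chain_add w x e 1 i
  simp only [hchain]
  have hY : Measurable fun (e : ℕ → ℝ) (n : ℕ) => e (n + 1) := by fun_prop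
  have hF : Measurable fun q : ℝ × (ℕ → ℝ) => f (etaPath (chain w (nextPoint w (-x) q.1) q.2) t) :=
    hf.comp (measurable_etaPath_chain w ((measurable_nextPoint_right w (-x)).comp measurable_fst)
      measurable_const measurable_snd)
  have hind : Indep (MeasurableSpace.comap (fun e : ℕ → ℝ => e 0) inferInstance)
      (MeasurableSpace.comap (fun (e : ℕ → ℝ) (n : ℕ) => e (n + 1)) inferInstance) expSeqMeasure := by
    have h1 := indep_iSup_of_disjoint (fun i => (he.measurable i).comap_le) he.indep
      (S := {0}) (T := {n | 0 < n}) (by simp)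
    refine indep_of_indep_of_le_left (indep_of_indep_of_le_right h1 ?_) ?_
    · rw [MeasurableSpace.pi_eq_generateFrom_projections, MeasurableSpace.comap_generateFrom]
      refine MeasurableSpace.generateFrom_le ?_
      rintro _ ⟨_, ⟨n, A, hA, rfl⟩, rfl⟩
      refine le_iSup₂ (f := fun i (_ : i ∈ {n : ℕ | 0 < n}) => MeasurableSpace.comap (fun e : ℕ → ℝ => e i)
        inferInstance) (n + 1) (Nat.succ_pos n) _ ⟨A, hA, rfl⟩
    · simp
  have h0 : Measurable[MeasurableSpace.comap (fun e : ℕ → ℝ => e 0) inferInstance] fun e : ℕ → ℝ => e 0 :=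
    comap_measurable _
  have h2 := setLIntegral_of_indep (he.measurable 0).comap_le hY hind h0 (B := univ)
    (@MeasurableSet.univ _ (MeasurableSpace.comap (fun e : ℕ → ℝ => e 0) inferInstance)) hF
  rw [setLIntegral_univ, setLIntegral_univ, (isExpSeq_shift he 1).map_eq] at h2
  have hg : Measurable fun y => ∫⁻ z, f z ∂(etaKernel w t y) :=
    measurable_lintegral_etaKernel w measurable_id measurable_const (hf.comp measurable_snd)
  have h3 := lintegral_map (μ := expSeqMeasure) hg ((measurable_nextPoint_right w (-x)).comp (he.measurable 0))
  rw [← Measure.map_map (measurable_nextPoint_right w (-x)) (he.measurable 0), he.law, map_nextPoint] at h3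
  rw [h3, h2]
  refine lintegral_congr fun e => ?_
  rw [lintegral_etaKernel w _ _ hf]
  rfl

variable {δ c K : ℝ} (hd : HasDrift w δ c K)

omit hw in
/-- The truncation of a law with exponential moments at a high level hardly changes its mean. -/
lemma abs_integral_min_sub_le {μ : Measure ℝ} [IsProbabilityMeasure μ] {δ m ε B s L : ℝ} (hδ : 0 < δ)
    (hV : Integrable (lyapunov δ) μ) (hB : ∫ y, lyapunov δ y ∂μ ≤ B) (hi : Integrable (fun y => y) μ)
    (hm : |∫ y, y ∂μ - m| ≤ ε) :
    |∫ y, min (s + y) L ∂μ - (s + m)| ≤ ε + B / δ * Real.exp (-(δ * (L - s))) := by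
  have h1 : ∀ y, min (s + y) L = s + y - max (s + y - L) 0 := fun y => by
    rcases le_total (s + y) L with h | h
    · rw [min_eq_left h, max_eq_right (by linarith)]; ring
    · rw [min_eq_right h, max_eq_left (by linarith)]; ring
  have h2 : ∀ y, max (s + y - L) 0 ≤ 1 / δ * Real.exp (-(δ * (L - s))) * lyapunov δ y := fun y => by
    have h3 : δ * max (s + y - L) 0 ≤ Real.exp (δ * (s + y - L)) := by
      rcases le_total (s + y - L) 0 with h | h
      · rw [max_eq_right h, mul_zero]; exact (Real.exp_pos _).le
      · rw [max_eq_left h]; linarith [Real.add_one_le_exp (δ * (s + y - L))]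
    have h4 : Real.exp (δ * (s + y - L)) = Real.exp (-(δ * (L - s))) * Real.exp (δ * y) := by
      rw [← Real.exp_add]; ring_nf
    have h5 : Real.exp (δ * y) ≤ lyapunov δ y := by
      have := Real.exp_pos (-(δ * y)); unfold lyapunov; linarith
    rw [one_div, mul_assoc, inv_mul_eq_div, le_div_iff₀ hδ, mul_comm _ δ]
    refine h3.trans (h4.le.trans ?_)
    gcongr
  have hmi : Integrable (fun y => max (s + y - L) 0) μ :=
    ((((integrable_const s).add hi).sub (integrable_const L)).sup (integrable_const 0))
  have hsi : Integrable (fun y => s + y) μ := (integrable_const s).add hi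
  have e1 : ∫ y, min (s + y) L ∂μ - (s + m) = (∫ y, y ∂μ - m) - ∫ y, max (s + y - L) 0 ∂μ := by
    simp only [h1]
    rw [integral_sub hsi hmi, integral_add (integrable_const s) hi, integral_const, probReal_univ, one_smul]
    ring
  have h6 : 0 ≤ ∫ y, max (s + y - L) 0 ∂μ := integral_nonneg fun y => le_max_right _ _
  have h7 : ∫ y, max (s + y - L) 0 ∂μ ≤ B / δ * Real.exp (-(δ * (L - s))) := by
    refine (integral_mono hmi (hV.const_mul _) h2).trans ?_
    rw [integral_const_mul]
    calc _ ≤ 1 / δ * Real.exp (-(δ * (L - s))) * B := by gcongr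
      _ = _ := by ring
  rw [e1]
  refine (abs_sub _ _).trans (add_le_add hm ?_)
  rwa [abs_of_nonneg h6]

end

lemma setIntegral_exp_neg_le {a : ℝ} (ha : 0 < a) (L : ℝ) : ∫ s in Ioc 0 L, Real.exp (-a * s) ≤ 1 / a := by
  have h := integral_exp_mul_Ioi (a := -a) (by linarith) 0
  rw [mul_zero, Real.exp_zero, neg_div_neg_eq] at h
  rw [← h]
  exact setIntegral_mono_set (integrableOn_exp_mul_Ioi (by linarith) 0)
    (ae_of_all _ fun s => (Real.exp_pos _).le) (LE.le.eventuallyLE Ioc_subset_Ioi_self)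

lemma setIntegral_exp_neg_sub_le {a : ℝ} (ha : 0 < a) {L : ℝ} (hL : 0 ≤ L) :
    ∫ s in Ioc 0 L, Real.exp (-(a * (L - s))) ≤ 1 / a := by
  rw [← intervalIntegral.integral_of_le hL,
    intervalIntegral.integral_comp_sub_left (fun s => Real.exp (-(a * s))), sub_self, sub_zero,
    intervalIntegral.integral_of_le hL]
  simp only [← neg_mul]
  exact setIntegral_exp_neg_le ha L

section

variable {w : ℝ → ℝ} [hw : IsRate w] {δ c K : ℝ} (hd : HasDrift w δ c K)

/-- The integral of the law of `η`, started from the distribution `ν`. -/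
lemma integral_bind_etaKernel {ν : Measure ℝ} [IsProbabilityMeasure ν] (t : ℝ) {f : ℝ → ℝ}
    (hf : Integrable f (ν.bind (etaKernel w t))) :
    ∫ y, f y ∂(ν.bind (etaKernel w t)) = ∫ x, (∫ y, f y ∂(etaKernel w t x)) ∂ν := by
  set κ : Kernel ℝ ℝ := ⟨etaKernel w t, measurable_etaKernel w t⟩ with hκ
  exact Kernel.integral_comp (η := κ) (κ := Kernel.const Unit ν) (a := ()) hf

include hd

/-- The mean of `η`, started from `0`, tends to `0` exponentially fast. The limit of the mean is
the same for the two sides of the edge, and it vanishes because the two staircases are inverse to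
each other. -/
lemma HasDrift.exists_abs_etaMean_le : ∃ C a, 0 < C ∧ 0 < a ∧ ∀ t : ℝ≥0, |etaMean w t 0| ≤ C * Real.exp (-a * t) := by
  obtain ⟨m, C, a, hC, ha, hmean⟩ := hd.exists_etaMean_limit
  have hδ := hd.δ_pos
  have hK := hd.K_pos
  have hVm := measurable_lyapunov δ
  have hVpos := fun y => (lyapunov_pos δ y).le
  have hV0 : lyapunov δ 0 = 2 := by simp [lyapunov]; norm_num
  have hVQ : Integrable (lyapunov δ) (Q w 0) := by
    refine ⟨hVm.aestronglyMeasurable, ?_⟩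
    rw [hasFiniteIntegral_iff_ofReal (ae_of_all _ hVpos)]
    exact hd.jump
  set q := ∫ y, lyapunov δ y ∂(Q w 0) with hq
  have hq2 : 2 ≤ q := by
    have h := integral_mono (integrable_const 2) hVQ (two_le_lyapunov δ)
    simpa using h
  set B := q + K with hB
  -- the law on the other side of the edge
  set law : ℝ → Measure ℝ := fun t => (Q w 0).bind (etaKernel w t) with hlaw
  have hlawp : ∀ t, IsProbabilityMeasure (law t) := fun t => by
    have h := map_etaPath_chain_succ (w := w) 0 t
    rw [neg_zero] at h
    rw [hlaw]; simp only
    rw [← h]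
    exact Measure.isProbabilityMeasure_map (measurable_etaPath
      (fun n => isExpSeq_expSeqMeasure.measurable_chain w 0 (n + 1)) measurable_const).aemeasurable
  have hlawV : ∀ t : ℝ≥0, ∫⁻ y, ENNReal.ofReal (lyapunov δ y) ∂(law t) ≤ ENNReal.ofReal B := by
    intro t
    rw [hlaw]; simp only
    rw [Measure.lintegral_bind (measurable_etaKernel w t).aemeasurable hVm.ennreal_ofReal.aemeasurable]
    have h1 : ∀ x, ∫⁻ y, ENNReal.ofReal (lyapunov δ y) ∂(etaKernel w t x) ≤ ENNReal.ofReal (lyapunov δ x + K) := by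
      intro x
      rw [← ofReal_integral_eq_lintegral_ofReal (hd.integrable t x) (ae_of_all _ hVpos)]
      exact ENNReal.ofReal_le_ofReal (hd.integral_le' t x)
    refine (lintegral_mono h1).trans ?_
    have hVQK : Integrable (fun x => lyapunov δ x + K) (Q w 0) := hVQ.add (integrable_const K)
    rw [← ofReal_integral_eq_lintegral_ofReal hVQK
      (ae_of_all _ fun x => add_nonneg (hVpos x) hK.le), integral_add hVQ (integrable_const _), integral_const,
      probReal_univ, one_smul]
  have hlawi : ∀ t : ℝ≥0, Integrable (lyapunov δ) (law t) := fun t => by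
    refine ⟨hVm.aestronglyMeasurable, ?_⟩
    rw [hasFiniteIntegral_iff_ofReal (ae_of_all _ hVpos)]
    exact (hlawV t).trans_lt ENNReal.ofReal_lt_top
  have hlawB : ∀ t : ℝ≥0, ∫ y, lyapunov δ y ∂(law t) ≤ B := fun t => by
    rw [integral_eq_lintegral_of_nonneg_ae (ae_of_all _ hVpos) hVm.aestronglyMeasurable]
    exact ENNReal.toReal_le_of_le_ofReal (by positivity) (hlawV t)
  have hlawid : ∀ t : ℝ≥0, Integrable (fun y => y) (law t) := fun t => by
    refine ((hlawi t).const_mul (1 / δ)).mono' measurable_id.aestronglyMeasurable (ae_of_all _ fun y => ?_)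
    rw [Real.norm_eq_abs, one_div, inv_mul_eq_div, le_div_iff₀ hδ]
    linarith [one_add_abs_le_lyapunov δ y]
  have hlawm : ∀ t : ℝ≥0, |∫ y, y ∂(law t) - m| ≤ C * q * Real.exp (-a * t) := by
    intro t
    rw [hlaw]; simp only
    rw [integral_bind_etaKernel _ (hlawid t)]
    have hgi : Integrable (etaMean w t) (Q w 0) := by
      refine ((hVQ.const_mul (C * Real.exp (-a * t))).add (integrable_const |m|)).mono'
        (measurable_integral_etaKernel measurable_id t).aestronglyMeasurable (ae_of_all _ fun x => ?_)
      have := abs_sub_abs_le_abs_sub (etaMean w t x) m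
      have := hmean t x
      rw [Real.norm_eq_abs]
      simp only [Pi.add_apply]
      linarith
    have h1 : ∫ x, (∫ y, y ∂(etaKernel w t x)) ∂(Q w 0) - m = ∫ x, (etaMean w t x - m) ∂(Q w 0) := by
      rw [integral_sub hgi (integrable_const _), integral_const, probReal_univ, one_smul]
      rfl
    rw [h1, ← Real.norm_eq_abs]
    refine (norm_integral_le_of_norm_le (hVQ.const_mul (C * Real.exp (-a * t)))
      (ae_of_all _ fun x => hmean t x)).trans (le_of_eq ?_)
    rw [integral_const_mul]; ring
  have hm0 : m = 0 := by
    have he := isExpSeq_expSeqMeasure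
    -- the two parts of the square of side `L` have the mean areas `L² / 2 + m L + O(1)`, and
    -- their sum is `L²`; hence `m L` is bounded
    have hbound : ∀ L : ℝ, 0 ≤ L → 2 * (|m| * L) ≤ 2 * (C * q / a + B / δ / δ) := by
      intro L hL
      set Φ : ℝ → (ℕ → ℝ) → ℝ := fun s e => s + etaPath (chain w 0 e) s with hΦ
      set Ψ : ℝ → (ℕ → ℝ) → ℝ := fun s e => s + etaPath (fun i => chain w 0 e (i + 1)) s with hΨ
      have hnn : ∀ (e : ℕ → ℝ) (p : ℕ) n, 0 ≤ chain w 0 e (n + p) + chain w 0 e (n + 1 + p) := fun e p n => by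
        rw [add_right_comm]; exact chain_add_nonneg w 0 e (n + p)
      have hae := he.ae_regular
      have hz1 : ∀ e : ℕ → ℝ, 0 ≤ chain w 0 e 1 := fun e => by
        have := chain_add_nonneg w 0 e 0
        rwa [chain, zero_add] at this
      have hdual : ∀ᵐ e ∂expSeqMeasure, ∀ s y, 0 ≤ s → 0 ≤ y → (y < Φ s e ↔ ¬ s < Ψ y e) := by
        filter_upwards [hae] with e h s y hs hy
        exact lt_add_etaPath_iff (chain_add_nonneg w 0 e) rfl (tendsto_etaTime_chain w 0 h)
          (tendsto_etaTime_chain_succ w 0 h) hs hy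
      have h0 : ∀ᵐ e ∂expSeqMeasure, ∀ s, 0 ≤ s → 0 ≤ Φ s e := by
        filter_upwards [hae] with e h s hs
        obtain ⟨h1, h2⟩ := stepIndex_spec (tendsto_etaTime_chain w 0 h) (t := s) (by simpa using hs)
        simp only [hΦ]
        rw [add_etaPath (chain_add_nonneg w 0 e) h1 h2]
        have := monotone_etaTime (z := fun i => chain w 0 e (i + 1)) (hnn e 1) (Nat.zero_le (stepIndex (etaTime (chain w 0 e)) s))
        rw [etaTime_zero] at this
        exact add_nonneg le_rfl this
      have h0' : ∀ᵐ e ∂expSeqMeasure, ∀ s, 0 ≤ s → 0 ≤ Ψ s e := by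
        filter_upwards [hae] with e h s hs
        obtain ⟨h1, h2⟩ := stepIndex_spec (tendsto_etaTime_chain_succ w 0 h) (t := s) (by simpa using hs)
        simp only [hΨ]
        rw [add_etaPath (hnn e 1) h1 h2]
        have := monotone_etaTime (z := fun i => chain w 0 e (i + 2)) (hnn e 2)
          (Nat.zero_le (stepIndex (etaTime fun i => chain w 0 e (i + 1)) s))
        rw [etaTime_zero] at this
        exact add_nonneg (hz1 e) this
      have hΦm : Measurable fun p : ℝ × (ℕ → ℝ) => Φ p.1 p.2 :=
        measurable_fst.add (measurable_etaPath_chain w measurable_const measurable_fst measurable_snd)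
      have hΨm : Measurable fun p : ℝ × (ℕ → ℝ) => Ψ p.1 p.2 :=
        measurable_fst.add (measurable_etaPath
          (fun n => (he.measurable_chain w 0 (n + 1)).comp measurable_snd) measurable_fst)
      obtain ⟨hI, harea⟩ := integral_min_add_integral_min hΦm hΨm h0 h0' hdual hL
      have hM0 : ∀ s : ℝ, ∫ e, min (Φ s e) L ∂expSeqMeasure = ∫ y, min (s + y) L ∂(etaKernel w s 0) := fun s => by
        have hm : Measurable fun e : ℕ → ℝ => etaPath (chain w 0 e) s :=
          measurable_etaPath_chain w measurable_const measurable_const measurable_id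
        rw [etaKernel, integral_map hm.aemeasurable (by fun_prop)]
      have hM1 : ∀ s : ℝ, ∫ e, min (Ψ s e) L ∂expSeqMeasure = ∫ y, min (s + y) L ∂(law s) := fun s => by
        have h := map_etaPath_chain_succ (w := w) 0 s
        rw [neg_zero] at h
        simp only [hlaw]
        rw [← h, integral_map (measurable_etaPath (fun n => he.measurable_chain w 0 (n + 1))
          measurable_const).aemeasurable (by fun_prop)]
      have hdev : ∀ s ∈ Ioc 0 L, ‖(∫ e, min (Φ s e) L ∂expSeqMeasure) + (∫ e, min (Ψ s e) L ∂expSeqMeasure)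
          - 2 * (s + m)‖ ≤ 2 * (C * q * Real.exp (-a * s) + B / δ * Real.exp (-(δ * (L - s)))) := by
        intro s hs
        lift s to ℝ≥0 using hs.1.le
        have d0 := abs_integral_min_sub_le (L := L) (s := s) (m := m) (ε := C * q * Real.exp (-a * s)) (B := B) hδ
          (hd.integrable s 0) ((hd.integral_le' s 0).trans (by rw [hV0, hB]; linarith)) (hd.integrable_id s 0) (by
            refine (hmean s 0).trans ?_
            rw [hV0, mul_right_comm]
            gcongr)
        have d1 := abs_integral_min_sub_le (L := L) (s := s) (m := m) (ε := C * q * Real.exp (-a * s)) (B := B) hδ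
          (hlawi s) (hlawB s) (hlawid s) (hlawm s)
        rw [hM0, hM1, Real.norm_eq_abs]
        rw [abs_le] at d0 d1 ⊢
        constructor <;> linarith [d0.1, d0.2, d1.1, d1.2]
      have hlin : ∫ s in Ioc 0 L, 2 * (s + m) = L * L + 2 * (m * L) := by
        rw [← intervalIntegral.integral_of_le hL, intervalIntegral.integral_const_mul,
          intervalIntegral.integral_add (by simp) (by simp), integral_id, intervalIntegral.integral_const]
        simp only [smul_eq_mul]
        ring
      have hlinI : Integrable (fun s => 2 * (s + m)) (volume.restrict (Ioc 0 L)) :=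
        (by fun_prop : Continuous fun s : ℝ => 2 * (s + m)).integrableOn_Ioc
      have i1 : Integrable (fun s => Real.exp (-a * s)) (volume.restrict (Ioc 0 L)) :=
        (by fun_prop : Continuous fun s : ℝ => Real.exp (-a * s)).integrableOn_Ioc
      have i2 : Integrable (fun s => Real.exp (-(δ * (L - s)))) (volume.restrict (Ioc 0 L)) :=
        (by fun_prop : Continuous fun s : ℝ => Real.exp (-(δ * (L - s)))).integrableOn_Ioc
      have h3 := norm_integral_le_of_norm_le (μ := volume.restrict (Ioc 0 L))
        (((i1.const_mul (C * q)).add (i2.const_mul (B / δ))).const_mul 2)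
        ((ae_restrict_iff' measurableSet_Ioc).2 (ae_of_all _ hdev))
      have h4 : ∫ s in Ioc 0 L, 2 * (C * q * Real.exp (-a * s) + B / δ * Real.exp (-(δ * (L - s))))
          ≤ 2 * (C * q / a + B / δ / δ) := by
        rw [integral_const_mul, integral_add (i1.const_mul (C * q)) (i2.const_mul (B / δ)),
          integral_const_mul, integral_const_mul]
        have j1 := setIntegral_exp_neg_le ha L
        have j2 := setIntegral_exp_neg_sub_le hδ hL
        rw [div_eq_mul_one_div (C * q) a, div_eq_mul_one_div (B / δ) δ]
        gcongr
      rw [integral_sub hI hlinI, harea, hlin, sub_add_cancel_left, norm_neg, Real.norm_eq_abs, abs_mul, abs_mul,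
        abs_of_nonneg hL, abs_two] at h3
      exact h3.trans h4
    by_contra hne
    have hpos : 0 < |m| := abs_pos.2 hne
    have h1 := hbound ((C * q / a + B / δ / δ + 1) / |m|) (by positivity)
    rw [mul_div_cancel₀ _ hpos.ne'] at h1
    linarith
  refine ⟨C * 2, a, by positivity, ha, fun t => ?_⟩
  have := hmean t 0
  rw [hm0, sub_zero, hV0] at this
  linarith

end

/-! ### The square root as a superharmonic function -/

lemma sqrt_one_add_le {z : ℝ} (hz : -1 ≤ z) : √(1 + z) ≤ 1 + z / 2 - z ^ 2 / 8 + z ^ 3 / 16 := by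
  have h0 : 0 ≤ 1 + z / 2 - z ^ 2 / 8 + z ^ 3 / 16 := by
    nlinarith [mul_nonneg (by linarith : 0 ≤ z + 1) (sq_nonneg (z - 3 / 2)), sq_nonneg (z - 1)]
  refine Real.sqrt_le_iff.2 ⟨h0, ?_⟩
  have h1 : (1 + z / 2 - z ^ 2 / 8 + z ^ 3 / 16) ^ 2 = 1 + z + z ^ 4 * ((z - 2) ^ 2 + 16) / 256 := by ring
  rw [h1]
  have : 0 ≤ z ^ 4 * ((z - 2) ^ 2 + 16) / 256 := by positivity
  linarith

section

variable {w : ℝ → ℝ} [hw : IsRate w] {δ c K : ℝ} (hd : HasDrift w δ c K)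

lemma ae_neg_le_etaKernel (t : ℝ≥0) : ∀ᵐ y ∂(etaKernel w t 0), -(t : ℝ) ≤ y := by
  have hm : Measurable fun e : ℕ → ℝ => etaPath (chain w 0 e) t :=
    measurable_etaPath_chain w measurable_const measurable_const measurable_id
  rw [etaKernel, ae_map_iff hm.aemeasurable measurableSet_Ici]
  filter_upwards [isExpSeq_expSeqMeasure.ae_regular] with e h
  obtain ⟨h1, h2⟩ := stepIndex_spec (tendsto_etaTime_chain w 0 h) (t := t) (by simp)
  have h3 := add_etaPath (chain_add_nonneg w 0 e) h1 h2
  have h4 := monotone_etaTime (z := fun i => chain w 0 e (i + 1)) (fun n => chain_add_nonneg w 0 e (n + 1))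
    (Nat.zero_le (stepIndex (etaTime (chain w 0 e)) t))
  rw [etaTime_zero] at h4
  rw [chain, zero_add] at h3
  linarith

/-- The probability of no jump up to time `t`. -/
lemma exp_neg_cumRate_le_etaKernel (t : ℝ≥0) :
    ENNReal.ofReal (Real.exp (-cumRate w t)) ≤ etaKernel w t 0 {-(t : ℝ)} := by
  have h := lintegral_etaKernel_eq_tsum w t 0 (f := ({-(t : ℝ)} : Set ℝ).indicator 1)
    (measurable_one.indicator (measurableSet_singleton _))
  rw [lintegral_indicator_one (measurableSet_singleton _)] at h
  rw [h]
  refine le_trans ?_ (ENNReal.le_tsum 0)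
  rw [jumpOp, survival_eta]
  simp [etaFlow]

include hd

omit hw in
lemma HasDrift.abs_pow_le (n : ℕ) (y : ℝ) : |y| ^ n ≤ n.factorial / δ ^ n * lyapunov δ y := by
  have hδ := hd.δ_pos
  have h1 := Real.pow_div_factorial_le_exp (δ * |y|) (by positivity) n
  have h2 : Real.exp (δ * |y|) ≤ lyapunov δ y := by
    have e1 := Real.exp_pos (δ * y)
    have e2 := Real.exp_pos (-(δ * y))
    unfold lyapunov
    rcases abs_cases y with ⟨h, -⟩ | ⟨h, -⟩
    · rw [h]; linarith
    · rw [h, mul_neg]; linarith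
  have h3 := h1.trans h2
  have hf : (0 : ℝ) < n.factorial := by positivity
  rw [div_le_iff₀ hf, mul_pow] at h3
  rw [div_mul_eq_mul_div, le_div_iff₀ (by positivity)]
  linarith

omit hw in
lemma HasDrift.integrable_pow (n : ℕ) (t : ℝ≥0) (x : ℝ) : Integrable (fun y => y ^ n) (etaKernel w t x) := by
  refine ((hd.integrable t x).const_mul (n.factorial / δ ^ n)).mono' (by fun_prop) (ae_of_all _ fun y => ?_)
  rw [Real.norm_eq_abs, abs_pow]
  exact hd.abs_pow_le n y

/-- The second moment does not degenerate. -/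
lemma HasDrift.exists_le_integral_sq : ∃ v, 0 < v ∧ ∀ t : ℝ≥0, 1 ≤ t → v ≤ ∫ y, y ^ 2 ∂(etaKernel w t 0) := by
  have hδ := hd.δ_pos
  have hK := hd.K_pos
  set R := 2 * (2 + K) / δ + 2 with hR
  have hR2 : 2 ≤ R := by rw [hR]; have : 0 ≤ 2 * (2 + K) / δ := by positivity
                         linarith
  obtain ⟨κ, hκ, hmin⟩ := exists_minorization w R (by linarith)
  refine ⟨κ / 2, by positivity, fun t ht => ?_⟩
  have hV0 : lyapunov δ 0 = 2 := by simp [lyapunov]; norm_num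
  have hin : ∀ y, |y| ≤ R → ENNReal.ofReal κ ≤ ∫⁻ z, ENNReal.ofReal (z ^ 2) ∂(etaKernel w 1 y) := by
    intro y hy
    have hle : ENNReal.ofReal κ • volume.restrict (Icc (R - 1) R) ≤ etaKernel w 1 y :=
      Measure.le_iff.2 fun A hA => hmin y hy A hA
    refine le_trans ?_ (lintegral_mono' hle (le_refl fun z : ℝ => ENNReal.ofReal (z ^ 2)))
    rw [lintegral_smul_measure, smul_eq_mul]
    refine le_mul_of_one_le_right (zero_le) ?_
    have h1 : ∫⁻ z in Icc (R - 1) R, 1 ≤ ∫⁻ z in Icc (R - 1) R, ENNReal.ofReal (z ^ 2) := by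
      refine setLIntegral_mono' measurableSet_Icc fun z hz => ?_
      rw [ENNReal.one_le_ofReal]
      nlinarith [hz.1]
    refine le_trans ?_ h1
    simp
  -- at time `t - 1` the process is in `[-R, R]` with probability at least `1/2`, and the
  -- minorization puts some mass on `[R - 1, R]` at time `t`
  have hprob : ENNReal.ofReal (1 / 2) ≤ etaKernel w (t - 1 : ℝ≥0) 0 {y | |y| ≤ R} := by
    have hmR : MeasurableSet {y : ℝ | |y| ≤ R} := measurableSet_le (by fun_prop) measurable_const
    have h1 := (hd.integrable (t - 1) 0).mono_measure (Measure.restrict_le_self (s := {y : ℝ | |y| ≤ R}ᶜ))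
    have h2 : (etaKernel w (t - 1 : ℝ≥0) 0).real {y | |y| ≤ R}ᶜ * (δ * R) ≤ 2 + K := by
      have h3 : ∫ y in {y : ℝ | |y| ≤ R}ᶜ, δ * R ∂(etaKernel w (t - 1 : ℝ≥0) 0)
          ≤ ∫ y in {y : ℝ | |y| ≤ R}ᶜ, lyapunov δ y ∂(etaKernel w (t - 1 : ℝ≥0) 0) := by
        refine setIntegral_mono_on (integrable_const _) h1 hmR.compl fun y hy => ?_
        have hy' : R < |y| := by simpa using hy
        have := one_add_abs_le_lyapunov δ y
        have := mul_le_mul_of_nonneg_left hy'.le hδ.le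
        linarith
      have h4 := setIntegral_le_integral (hd.integrable (t - 1) 0) (ae_of_all _ fun y => (lyapunov_pos δ y).le)
        (s := {y : ℝ | |y| ≤ R}ᶜ)
      have h5 := hd.integral_le' (t - 1) 0
      rw [setIntegral_const, smul_eq_mul] at h3
      rw [hV0] at h5
      linarith
    have h6 : 2 * (2 + K) ≤ δ * R := by
      have h : δ * (2 * (2 + K) / δ) = 2 * (2 + K) := by field_simp
      have h' : δ * R = δ * (2 * (2 + K) / δ) + 2 * δ := by rw [hR]; ring
      rw [h', h]; linarith
    have h7 : (etaKernel w (t - 1 : ℝ≥0) 0).real {y | |y| ≤ R}ᶜ ≤ 1 / 2 := by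
      have h8 : (0 : ℝ) ≤ (etaKernel w (t - 1 : ℝ≥0) 0).real {y | |y| ≤ R}ᶜ := measureReal_nonneg
      have h9 := mul_le_mul_of_nonneg_left h6 h8
      by_contra! hlt
      nlinarith
    rw [probReal_compl_eq_one_sub hmR] at h7
    rw [← ofReal_measureReal]
    exact ENNReal.ofReal_le_ofReal (by linarith)
  have hlow : ENNReal.ofReal (κ / 2) ≤ ∫⁻ y, ENNReal.ofReal (y ^ 2) ∂(etaKernel w t 0) := by
    have hck := lintegral_etaKernel_add' w (t - 1) 1 0 (f := fun y => ENNReal.ofReal (y ^ 2)) (by fun_prop)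
    rw [tsub_add_cancel_of_le ht] at hck
    rw [hck]
    refine le_trans ?_ (setLIntegral_le_lintegral {y : ℝ | |y| ≤ R} _)
    refine le_trans ?_ (setLIntegral_mono' (measurableSet_le (by fun_prop) measurable_const)
      (f := fun _ => ENNReal.ofReal κ) fun y hy => ?_)
    · rw [setLIntegral_const, div_eq_mul_one_div, ENNReal.ofReal_mul hκ.le]
      gcongr
    · rw [NNReal.coe_one]; exact hin y hy
  rw [← ofReal_integral_eq_lintegral_ofReal (hd.integrable_pow 2 t 0) (ae_of_all _ fun y => sq_nonneg y)] at hlow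
  exact (ENNReal.ofReal_le_ofReal_iff (integral_nonneg fun y => sq_nonneg y)).1 hlow

/-- Far from `0`, the square root of the local time is a supermartingale. -/
lemma HasDrift.exists_integral_sqrt_le : ∃ L₀ : ℝ≥0, ∀ t : ℝ≥0, L₀ ≤ t →
    Integrable (fun y => √(t + y)) (etaKernel w t 0) ∧ ∫ y, √(t + y) ∂(etaKernel w t 0) ≤ √t := by
  obtain ⟨C, a, hC, ha, hmean⟩ := hd.exists_abs_etaMean_le
  obtain ⟨v, hv, hvar⟩ := hd.exists_le_integral_sq
  have hδ := hd.δ_pos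
  have hK := hd.K_pos
  have hV0 : lyapunov δ 0 = 2 := by simp [lyapunov]; norm_num
  set C₃ := (Nat.factorial 3 : ℝ) / δ ^ 3 * (2 + K) with hC3
  have hC3p : 0 < C₃ := by positivity
  -- in the expansion of `√(t + y)` the first moment is exponentially small, and the second
  -- moment, whose coefficient is negative, dominates the third one
  have hlim : ∀ᶠ t : ℝ in atTop, 8 * C * (t ^ 2 * Real.exp (-a * t)) ≤ v ∧ C₃ ≤ v * t ∧ 1 ≤ t := by
    have h1 : Tendsto (fun t : ℝ => 8 * C * (t ^ 2 * Real.exp (-a * t))) atTop (𝓝 (8 * C * 0)) := by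
      refine Tendsto.const_mul _ ?_
      have := Real.tendsto_pow_mul_exp_neg_atTop_nhds_zero 2
      have h2 := (this.comp (tendsto_id.const_mul_atTop ha)).const_mul (1 / a ^ 2)
      rw [mul_zero] at h2
      refine h2.congr fun t => ?_
      simp only [Function.comp_def, id, neg_mul]
      field_simp
    rw [mul_zero] at h1
    have h2 : Tendsto (fun t : ℝ => v * t) atTop atTop := tendsto_id.const_mul_atTop hv
    filter_upwards [h1.eventually_le_const hv, h2.eventually_ge_atTop C₃, eventually_ge_atTop 1] with t a b c
    exact ⟨a, b, c⟩
  obtain ⟨L, hL⟩ := eventually_atTop.1 hlim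
  refine ⟨L.toNNReal, fun t ht => ?_⟩
  obtain ⟨h1, h2, h3⟩ := hL t (Real.toNNReal_le_iff_le_coe.1 ht)
  have ht0 : (0 : ℝ) < t := by linarith
  have i1 := hd.integrable_pow 1 t 0
  have i2 := hd.integrable_pow 2 t 0
  have i3 := hd.integrable_pow 3 t 0
  simp only [pow_one] at i1
  have hpt : ∀ᵐ y ∂(etaKernel w t 0), √(t + y)
      ≤ √t * (1 + 1 / (2 * t) * y - 1 / (8 * t ^ 2) * y ^ 2 + 1 / (16 * t ^ 3) * y ^ 3) := by
    filter_upwards [ae_neg_le_etaKernel (w := w) t] with y hy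
    have e1 : (t : ℝ) + y = t * (1 + y / t) := by field_simp
    have e2 := sqrt_one_add_le (z := y / t) (by rw [le_div_iff₀ ht0]; linarith)
    rw [e1, Real.sqrt_mul ht0.le]
    refine mul_le_mul_of_nonneg_left (e2.trans (le_of_eq ?_)) (Real.sqrt_nonneg _)
    field_simp
  have hgi : Integrable (fun y => √t * (1 + 1 / (2 * t) * y - 1 / (8 * t ^ 2) * y ^ 2 + 1 / (16 * t ^ 3) * y ^ 3))
      (etaKernel w t 0) :=
    ((((integrable_const _).add (i1.const_mul _)).sub (i2.const_mul _)).add (i3.const_mul _)).const_mul _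
  have hsi : Integrable (fun y => √(t + y)) (etaKernel w t 0) := by
    refine hgi.mono' (by fun_prop) ?_
    filter_upwards [hpt] with y hy
    rwa [Real.norm_eq_abs, abs_of_nonneg (Real.sqrt_nonneg _)]
  refine ⟨hsi, (integral_mono_ae hsi hgi hpt).trans ?_⟩
  have j1 : Integrable (fun y : ℝ => 1 + 1 / (2 * (t : ℝ)) * y) (etaKernel w t 0) := (integrable_const _).add (i1.const_mul _)
  have j2 : Integrable (fun y : ℝ => 1 + 1 / (2 * (t : ℝ)) * y - 1 / (8 * (t : ℝ) ^ 2) * y ^ 2) (etaKernel w t 0) :=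
    j1.sub (i2.const_mul _)
  rw [integral_const_mul, integral_add j2 (i3.const_mul _), integral_sub j1 (i2.const_mul _),
    integral_add (integrable_const _) (i1.const_mul _), integral_const, probReal_univ, one_smul,
    integral_const_mul, integral_const_mul, integral_const_mul]
  refine mul_le_of_le_one_right (Real.sqrt_nonneg _) ?_
  have m1 : ∫ y, y ∂(etaKernel w t 0) ≤ C * Real.exp (-a * t) := (le_abs_self _).trans (hmean t)
  have m2 := hvar t (by exact_mod_cast h3)
  have m3 : ∫ y, y ^ 3 ∂(etaKernel w t 0) ≤ C₃ := by
    have h4 : ∫ y, y ^ 3 ∂(etaKernel w t 0) ≤ ∫ y, (Nat.factorial 3 : ℝ) / δ ^ 3 * lyapunov δ y ∂(etaKernel w t 0) :=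
      integral_mono i3 ((hd.integrable t 0).const_mul _) fun y =>
        ((le_abs_self _).trans (abs_pow y 3).le).trans (hd.abs_pow_le 3 y)
    rw [integral_const_mul] at h4
    refine h4.trans ?_
    have h5 := hd.integral_le' t 0
    rw [hV0] at h5
    rw [hC3]
    gcongr
  have k1 := mul_le_mul_of_nonneg_left m1 (by positivity : (0 : ℝ) ≤ 1 / (2 * t))
  have k2 := mul_le_mul_of_nonneg_left m2 (by positivity : (0 : ℝ) ≤ 1 / (8 * t ^ 2))
  have k3 := mul_le_mul_of_nonneg_left m3 (by positivity : (0 : ℝ) ≤ 1 / (16 * (t : ℝ) ^ 3))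
  have k4 : 1 / (2 * t) * (C * Real.exp (-a * t)) - 1 / (8 * t ^ 2) * v + 1 / (16 * (t : ℝ) ^ 3) * C₃
      = (8 * C * (t ^ 2 * Real.exp (-a * t)) - v * t + (C₃ - v * t)) / (16 * t ^ 3) := by
    field_simp
    ring
  have k5 : (8 * C * (t ^ 2 * Real.exp (-a * t)) - v * t + (C₃ - v * t)) / (16 * (t : ℝ) ^ 3) ≤ 0 := by
    refine div_nonpos_of_nonpos_of_nonneg ?_ (by positivity)
    have := mul_le_mul_of_nonneg_left h3 hv.le
    linarith
  linarith

end

/-! ### Absorption at zero -/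

/-- The probability that the chain `l ↦ l + η(l)`, with an independent copy of `η` started from `0`
in each step, has not reached `0` after `n` steps. -/
def aliveProb (w : ℝ → ℝ) : ℕ → ℝ → ℝ≥0∞
  | 0 => fun l => if l = 0 then 0 else 1
  | n + 1 => fun l => ∫⁻ y, aliveProb w n (l + y) ∂(etaKernel w l 0)

section

variable (w : ℝ → ℝ) [hw : IsRate w]

lemma measurable_aliveProb (n : ℕ) : Measurable (aliveProb w n) := by
  induction n with
  | zero => exact Measurable.ite (measurableSet_singleton 0) measurable_const measurable_const
  | succ n ih =>
    exact measurable_lintegral_etaKernel w measurable_const measurable_id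
      (f := fun l y => aliveProb w n (l + y)) (ih.comp (measurable_fst.add measurable_snd))

lemma aliveProb_le_one (n : ℕ) (l : ℝ) : aliveProb w n l ≤ 1 := by
  induction n generalizing l with
  | zero => simp only [aliveProb]; split_ifs <;> simp
  | succ n ih =>
    rw [aliveProb]
    refine (lintegral_mono fun y => ih (l + y)).trans ?_
    simp

lemma aliveProb_zero (n : ℕ) : aliveProb w n 0 = 0 := by
  induction n with
  | zero => simp [aliveProb]
  | succ n ih =>
    simp only [aliveProb]
    rw [etaKernel_zero, lintegral_dirac' _ (by
      exact (measurable_aliveProb w n).comp (measurable_const_add 0)), add_zero, ih]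

lemma aliveProb_succ_le (n : ℕ) (l : ℝ) : aliveProb w (n + 1) l ≤ aliveProb w n l := by
  induction n generalizing l with
  | zero =>
    rcases eq_or_ne l 0 with rfl | h
    · rw [aliveProb_zero]; exact zero_le
    · refine (aliveProb_le_one w 1 l).trans ?_
      simp only [aliveProb, if_neg h]; exact le_rfl
  | succ n ih =>
    rw [aliveProb]
    exact lintegral_mono fun y => ih (l + y)

lemma antitone_aliveProb (l : ℝ) : Antitone fun n => aliveProb w n l :=
  antitone_nat_of_succ_le fun n => aliveProb_succ_le w n l

/-- The probability that the chain never reaches `0`. -/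
def neverProb (w : ℝ → ℝ) (l : ℝ) : ℝ := (⨅ n, aliveProb w n l).toReal

lemma measurable_neverProb : Measurable (neverProb w) :=
  (Measurable.iInf fun n => measurable_aliveProb w n).ennreal_toReal

lemma iInf_aliveProb_ne_top (l : ℝ) : ⨅ n, aliveProb w n l ≠ ∞ :=
  ((iInf_le _ 0).trans_lt ((aliveProb_le_one w 0 l).trans_lt ENNReal.one_lt_top)).ne

omit hw in
lemma neverProb_nonneg (l : ℝ) : 0 ≤ neverProb w l := ENNReal.toReal_nonneg

lemma neverProb_le_one (l : ℝ) : neverProb w l ≤ 1 :=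
  ENNReal.toReal_le_of_le_ofReal zero_le_one (by
    rw [ENNReal.ofReal_one]; exact (iInf_le _ 0).trans (aliveProb_le_one w 0 l))

lemma neverProb_zero : neverProb w 0 = 0 := by
  simp [neverProb, aliveProb_zero]

lemma integrable_neverProb (t : ℝ) (l x : ℝ) : Integrable (fun y => neverProb w (l + y)) (etaKernel w t x) :=
  Integrable.of_bound ((measurable_neverProb w).comp (measurable_const_add l)).aestronglyMeasurable 1
    (ae_of_all _ fun y => by
      rw [Real.norm_eq_abs, abs_of_nonneg (neverProb_nonneg w _)]; exact neverProb_le_one w _)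

/-- `neverProb` is harmonic for the chain. -/
lemma neverProb_eq (l : ℝ) : neverProb w l = ∫ y, neverProb w (l + y) ∂(etaKernel w l 0) := by
  have hm : ∀ n, Measurable fun y => aliveProb w n (l + y) := fun n =>
    (measurable_aliveProb w n).comp (measurable_const_add l)
  have h1 : ⨅ n, aliveProb w n l = ∫⁻ y, (⨅ n, aliveProb w n (l + y)) ∂(etaKernel w l 0) := by
    rw [lintegral_iInf hm (fun n k hnk y => antitone_aliveProb w (l + y) hnk)]
    · refine le_antisymm (le_iInf fun n => (iInf_le _ (n + 1)).trans_eq rfl) (le_iInf fun n => ?_)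
      exact (iInf_le _ n).trans (aliveProb_succ_le w n l)
    · refine ((lintegral_mono fun y => aliveProb_le_one w 0 (l + y)).trans_lt ?_).ne
      simp
  rw [integral_eq_lintegral_of_nonneg_ae (ae_of_all _ fun y => neverProb_nonneg w _)
    (integrable_neverProb w l l 0).aestronglyMeasurable, neverProb, h1]
  congr 1
  refine lintegral_congr fun y => ?_
  rw [neverProb, ENNReal.ofReal_toReal (iInf_aliveProb_ne_top w _)]

/-- A bound of `neverProb` that vanishes at `0` improves by the probability to reach `0` in one
step. -/
lemma integral_indicator_le (t : ℝ≥0) {d : ℝ} (hd : 0 ≤ d) :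
    Integrable (fun y => if (t : ℝ) + y = 0 then 0 else d) (etaKernel w t 0) ∧
    ∫ y, (if (t : ℝ) + y = 0 then 0 else d) ∂(etaKernel w t 0) ≤ d * (1 - Real.exp (-cumRate w t)) := by
  have h1 : (fun y => if (t : ℝ) + y = 0 then 0 else d) = ({-(t : ℝ)} : Set ℝ)ᶜ.indicator fun _ => d := by
    ext y
    have : y = -(t : ℝ) ↔ (t : ℝ) + y = 0 := by constructor <;> intro h <;> linarith
    simp [indicator_apply, this]
  have hms := measurableSet_singleton (-(t : ℝ))
  rw [h1]
  refine ⟨(integrable_const d).indicator hms.compl, ?_⟩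
  rw [integral_indicator hms.compl, setIntegral_const, smul_eq_mul, probReal_compl_eq_one_sub hms, mul_comm]
  have h2 := exp_neg_cumRate_le_etaKernel (w := w) t
  rw [← ofReal_measureReal, ENNReal.ofReal_le_ofReal_iff measureReal_nonneg] at h2
  gcongr

variable {w}

/-- A maximum principle. Near `0` the chain is absorbed in one step with a probability that is
bounded from below, and from far away it comes back: `neverProb` is harmonic and bounded, and it
is compared with the superharmonic function `√` which tends to infinity. -/
lemma neverProb_eq_zero (t : ℝ≥0) : neverProb w t = 0 := by
  obtain ⟨δ, c, K, hdr⟩ := exists_hasDrift w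
  obtain ⟨L₀, hL₀⟩ := hdr.exists_integral_sqrt_le
  have hG : ∀ {a b : ℝ}, a ≤ b → Real.exp (-cumRate w b) ≤ Real.exp (-cumRate w a) := fun h =>
    Real.exp_le_exp.2 (neg_le_neg ((strictMono_cumRate w).monotone h))
  have hq1 : ∀ L : ℝ≥0, 0 ≤ 1 - Real.exp (-cumRate w L) ∧ 1 - Real.exp (-cumRate w L) < 1 := fun L => by
    have h1 := hG L.2
    simp only [cumRate_zero, neg_zero, Real.exp_zero, NNReal.val_eq_coe] at h1
    have h2 := Real.exp_pos (-cumRate w L)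
    constructor <;> linarith
  -- a bound `s` improves to `(1 - exp (-G(L₀))) s`
  have step : ∀ s : ℝ, 0 ≤ s → (∀ l : ℝ≥0, neverProb w l ≤ s) →
      ∀ l : ℝ≥0, neverProb w l ≤ (1 - Real.exp (-cumRate w L₀)) * s := by
    intro s hs hle
    set A := (1 - Real.exp (-cumRate w L₀)) * s with hA
    have hA0 : 0 ≤ A := mul_nonneg (hq1 L₀).1 hs
    have hnear : ∀ l : ℝ≥0, l ≤ L₀ → neverProb w l ≤ A := by
      intro l hl
      obtain ⟨i1, i2⟩ := integral_indicator_le w l hs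
      rw [neverProb_eq]
      refine (integral_mono_ae (integrable_neverProb w l l 0) i1 ?_).trans (i2.trans ?_)
      · filter_upwards [ae_neg_le_etaKernel (w := w) l] with y hy
        by_cases h : (l : ℝ) + y = 0
        · simp [h, neverProb_zero]
        · rw [if_neg h]
          have := hle ⟨l + y, by linarith⟩
          exact this
      · rw [hA, mul_comm]
        gcongr
        exact (strictMono_cumRate w).monotone (by exact_mod_cast hl)
    have hsqrt : ∀ ε : ℝ, 0 < ε → ∀ l : ℝ≥0, neverProb w l ≤ A + ε * √l := by
      intro ε hε
      -- above this level there is nothing to prove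
      set L : ℝ≥0 := (s / ε).toNNReal ^ 2 with hL
      have hfar : ∀ l : ℝ≥0, L ≤ l → neverProb w l ≤ A + ε * √l := by
        intro l hl
        have h1 : s / ε ≤ √l := by
          refine Real.le_sqrt_of_sq_le ?_
          have h2 : ((L : ℝ≥0) : ℝ) ≤ l := by exact_mod_cast hl
          rwa [hL, NNReal.coe_pow, Real.coe_toNNReal _ (by positivity)] at h2
        rw [div_le_iff₀ hε] at h1
        linarith [hle l]
      set q := 1 - Real.exp (-cumRate w L) with hq
      -- between the levels `L₀` and `L`, the bound is iterated: each step gains the factor `q`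
      -- because of the absorption, and the function `A + ε √l` is superharmonic there
      have hiter : ∀ n : ℕ, ∀ l : ℝ≥0, neverProb w l ≤ A + ε * √l + if (l : ℝ) = 0 then 0 else q ^ n := by
        intro n
        induction n with
        | zero =>
          intro l
          have h0 : 0 ≤ ε * √l := by positivity
          by_cases h : (l : ℝ) = 0
          · rw [if_pos h, h, neverProb_zero]; simpa using hA0
          · rw [if_neg h, pow_zero]; linarith [neverProb_le_one w l]
        | succ n ih =>
          intro l
          have h0 : 0 ≤ ε * √l := by positivity
          have hqn : 0 ≤ q ^ (n + 1) := pow_nonneg (hq1 L).1 _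
          have hqn' : 0 ≤ q ^ n := pow_nonneg (hq1 L).1 _
          have hite : 0 ≤ if (l : ℝ) = 0 then 0 else q ^ (n + 1) := by split_ifs <;> simp [hqn]
          rcases le_total l L₀ with h1 | h1
          · linarith [hnear l h1]
          rcases le_total L l with h2 | h2
          · linarith [hfar l h2]
          by_cases hl0 : (l : ℝ) = 0
          · rw [hl0, neverProb_zero]; simpa using hA0
          obtain ⟨j1, j2⟩ := hL₀ l h1
          obtain ⟨i1, i2⟩ := integral_indicator_le w l hqn'
          have hi : Integrable (fun y => A + ε * √(l + y)) (etaKernel w l 0) :=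
            (integrable_const _).add (j1.const_mul _)
          rw [neverProb_eq, if_neg hl0]
          refine (integral_mono_ae (integrable_neverProb w l l 0) (hi.add i1) ?_).trans ?_
          · filter_upwards [ae_neg_le_etaKernel (w := w) l] with y hy
            exact ih ⟨l + y, by linarith⟩
          · simp only [Pi.add_apply]
            rw [integral_add hi i1, integral_add (integrable_const _) (j1.const_mul _), integral_const,
              probReal_univ, one_smul, integral_const_mul]
            have h3 : q ^ n * (1 - Real.exp (-cumRate w l)) ≤ q ^ n * q := by
              rw [hq]; gcongr
              exact (strictMono_cumRate w).monotone (by exact_mod_cast h2)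
            rw [pow_succ]
            gcongr
            exact i2.trans h3
      intro l
      have hlim : Tendsto (fun n : ℕ => A + ε * √l + q ^ n) atTop (𝓝 (A + ε * √l + 0)) :=
        (tendsto_pow_atTop_nhds_zero_of_lt_one (hq1 L).1 (hq1 L).2).const_add _
      rw [add_zero] at hlim
      refine ge_of_tendsto hlim (Eventually.of_forall fun n => (hiter n l).trans ?_)
      have : 0 ≤ q ^ n := pow_nonneg (hq1 L).1 _
      split_ifs <;> linarith
    intro l
    -- the comparison holds for all `ε > 0`
    have hlim : Tendsto (fun ε : ℝ => A + ε * √l) (𝓝[>] 0) (𝓝 (A + 0 * √l)) :=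
      ((tendsto_id.mul_const _).const_add _).mono_left nhdsWithin_le_nhds
    rw [zero_mul, add_zero] at hlim
    exact ge_of_tendsto hlim (eventually_nhdsWithin_of_forall fun ε hε => hsqrt ε hε l)
  have hall : ∀ n : ℕ, ∀ l : ℝ≥0, neverProb w l ≤ (1 - Real.exp (-cumRate w L₀)) ^ n := by
    intro n
    induction n with
    | zero => intro l; simpa using neverProb_le_one w l
    | succ n ih =>
      intro l
      rw [pow_succ']
      exact step _ (pow_nonneg (hq1 L₀).1 _) ih l
  exact le_antisymm (ge_of_tendsto' (tendsto_pow_atTop_nhds_zero_of_lt_one (hq1 L₀).1 (hq1 L₀).2)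
    fun n => hall n t) (neverProb_nonneg w _)

/-- The chain reaches `0` almost surely. -/
lemma tendsto_aliveProb (l : ℝ≥0) : Tendsto (fun n => aliveProb w n l) atTop (𝓝 0) := by
  have h := tendsto_atTop_iInf (antitone_aliveProb w l)
  have h0 := neverProb_eq_zero (w := w) l
  rw [neverProb, ENNReal.toReal_eq_zero_iff] at h0
  rwa [h0.resolve_right (iInf_aliveProb_ne_top w l)] at h

end

/-! ### Measurability of the functionals of a path -/

section Measurability

variable {Ω : Type*} [mΩ : MeasurableSpace Ω]

/-- A right continuous process with discrete values is jointly measurable. -/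
lemma measurable_uncurry_of_right_continuous {X : ℝ≥0 → Ω → ℤ} (hm : ∀ t, Measurable (X t))
    (hr : ∀ ω t, ContinuousWithinAt (fun s => X s ω) (Ici t) t) :
    Measurable fun q : ℝ≥0 × Ω => X q.1 q.2 := by
  set T : ℕ → ℝ≥0 → ℝ≥0 := fun m t => ((⌊t * (m + 1)⌋₊ + 1 : ℕ) : ℝ≥0) / (m + 1) with hT
  have hlt : ∀ m t, t ≤ T m t := fun m t => by
    rw [hT]; simp only
    rw [le_div_iff₀ (by positivity)]
    push_cast
    exact (Nat.lt_floor_add_one _).le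
  have hle : ∀ m t, T m t ≤ t + 1 / (m + 1) := fun m t => by
    have h := Nat.floor_le (show 0 ≤ t * (m + 1) from zero_le)
    have : T m t = (⌊t * (m + 1)⌋₊ : ℝ≥0) / (m + 1) + 1 / (m + 1) := by
      rw [hT]; simp only; push_cast; rw [add_div]
    rw [this]
    gcongr
    rwa [div_le_iff₀ (by positivity)]
  have hlim : ∀ t, Tendsto (fun m => T m t) atTop (𝓝[Ici t] t) := fun t => by
    refine tendsto_nhdsWithin_iff.2 ⟨?_, Eventually.of_forall fun m => hlt m t⟩
    have h1 : Tendsto (fun m : ℕ => t + 1 / ((m : ℝ≥0) + 1)) atTop (𝓝 (t + 0)) :=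
      tendsto_const_nhds.add tendsto_one_div_add_atTop_nhds_zero_nat
    rw [add_zero] at h1
    exact tendsto_of_tendsto_of_tendsto_of_le_of_le tendsto_const_nhds h1 (fun m => hlt m t) fun m => hle m t
  refine measurable_of_tendsto_metrizable (f := fun m (q : ℝ≥0 × Ω) => X (T m q.1) q.2) (fun m => ?_)
    (tendsto_pi_nhds.2 fun q => (hr q.2 q.1).tendsto.comp (hlim q.1))
  have h1 : Measurable fun q : ℕ × Ω => X (((q.1 + 1 : ℕ) : ℝ≥0) / (m + 1)) q.2 :=
    measurable_from_prod_countable_right fun j => hm (((j + 1 : ℕ) : ℝ≥0) / (m + 1))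
  have h2 : Measurable fun q : ℝ≥0 × Ω => (⌊q.1 * (m + 1)⌋₊, q.2) :=
    (Nat.measurable_floor.comp (measurable_fst.mul_const _)).prodMk measurable_snd
  exact h1.comp h2

/-- Measurability of a first entrance time. -/
lemma measurable_sInf {α : Type*} [MeasurableSpace α] {A : ℝ≥0 → α → Prop}
    (hm : ∀ t, MeasurableSet {a | A t a})
    (hA : ∀ a t b, A t a → t < b → ∃ n : ℕ, TopologicalSpace.denseSeq ℝ≥0 n < b ∧
      A (TopologicalSpace.denseSeq ℝ≥0 n) a) :
    Measurable fun a => sInf {t | A t a} := by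
  set q := TopologicalSpace.denseSeq ℝ≥0
  refine measurable_of_Iio fun b => ?_
  have key : (fun a => sInf {t | A t a}) ⁻¹' Iio b
      = (⋃ n ∈ {n | q n < b}, {a | A (q n) a}) ∪ ({a | 0 < b} ∩ ⋂ n, {a | A (q n) a}ᶜ) := by
    ext a
    simp only [mem_preimage, mem_Iio, mem_union, mem_iUnion, mem_inter_iff, mem_ofPred_eq, mem_iInter,
      mem_compl_iff, exists_prop]
    constructor
    · intro h
      by_cases hne : {t | A t a}.Nonempty
      · obtain ⟨t, ht, htb⟩ := exists_lt_of_csInf_lt hne h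
        exact Or.inl (hA a t b ht htb)
      · exact Or.inr ⟨(zero_le).trans_lt h, fun n hn => hne ⟨_, hn⟩⟩
    · rintro (⟨n, hn, hAn⟩ | ⟨hb, hn⟩)
      · exact (csInf_le (OrderBot.bddBelow {t | A t a}) hAn).trans_lt hn
      · have : {t | A t a} = ∅ := by
          refine eq_empty_of_forall_notMem fun t ht => ?_
          obtain ⟨n, -, h⟩ := hA a t (t + 1) ht (lt_add_one t)
          exact hn n h
        rw [this, NNReal.sInf_empty]
        exact hb
  rw [key]
  exact (MeasurableSet.biUnion (to_countable _) fun n _ => hm _).union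
    ((MeasurableSet.const _).inter (MeasurableSet.iInter fun n => (hm _).compl))

lemma measurable_sInf_lt {α : Type*} [MeasurableSpace α] {f : ℝ≥0 → α → ℝ} {g : α → ℝ}
    (hf : ∀ t, Measurable (f t)) (hmono : ∀ a, Monotone fun t => f t a) (hg : Measurable g) :
    Measurable fun a => sInf {t | g a < f t a} := by
  refine measurable_sInf (A := fun t a => g a < f t a) (fun t => measurableSet_lt hg (hf t)) ?_
  intro a t b h htb
  obtain ⟨n, hn⟩ := (TopologicalSpace.denseRange_denseSeq ℝ≥0).exists_mem_open isOpen_Ioo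
    (nonempty_Ioo.2 htb)
  exact ⟨n, hn.2, h.trans_le (hmono a hn.1.le)⟩

lemma localTime_ne_top (x : ℝ≥0 → ℤ) (t : ℝ≥0) (k : ℤ) :
    volume {s : ℝ | 0 ≤ s ∧ s < t ∧ x s.toNNReal = k} ≠ ∞ :=
  ((measure_mono (show {s : ℝ | 0 ≤ s ∧ s < t ∧ x s.toNNReal = k} ⊆ Ico 0 (t : ℝ) from
    fun s hs => ⟨hs.1, hs.2.1⟩)).trans_lt (by simp)).ne

lemma monotone_localTime (x : ℝ≥0 → ℤ) (k : ℤ) : Monotone fun t => localTime x t k := by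
  intro s t hst
  refine ENNReal.toReal_mono (localTime_ne_top x t k) (measure_mono fun r hr => ?_)
  have h : (s : ℝ) ≤ t := by exact_mod_cast hst
  exact ⟨hr.1, hr.2.1.trans_le h, hr.2.2⟩

lemma monotone_edgeTime (x : ℝ≥0 → ℤ) (k : ℤ) : Monotone fun t => edgeTime x t k :=
  (monotone_localTime x k).add (monotone_localTime x (k + 1))

lemma measurable_localTime {X : ℝ≥0 → Ω → ℤ} (hX : Measurable fun q : ℝ≥0 × Ω => X q.1 q.2) (k : ℤ) :
    Measurable fun q : ℝ≥0 × Ω => localTime (fun t => X t q.2) q.1 k := by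
  have hS : MeasurableSet {r : (ℝ≥0 × Ω) × ℝ | 0 ≤ r.2 ∧ r.2 < r.1.1 ∧ X r.2.toNNReal r.1.2 = k} := by
    refine measurableSet_and (measurableSet_le measurable_const measurable_snd) (measurableSet_and
      (measurableSet_lt measurable_snd (by fun_prop)) ?_)
    have h : Measurable fun r : (ℝ≥0 × Ω) × ℝ => (r.2.toNNReal, r.1.2) := by fun_prop
    exact measurableSet_eq_fun (hX.comp h) measurable_const
  exact (measurable_measure_prodMk_left hS).ennreal_toReal

lemma measurable_theta {X : ℝ≥0 → Ω → ℤ} (hX : Measurable fun q : ℝ≥0 × Ω => X q.1 q.2) (k : ℤ) :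
    Measurable fun q : ℝ≥0 × Ω => theta (fun t => X t q.2) q.1 k := by
  refine measurable_sInf_lt (f := fun t (q : ℝ≥0 × Ω) => edgeTime (fun t => X t q.2) t k)
    (g := fun q => (q.1 : ℝ)) (fun t => ?_) (fun q => monotone_edgeTime _ k) (by fun_prop)
  have h : Measurable fun q : ℝ≥0 × Ω => (t, q.2) := by fun_prop
  exact ((measurable_localTime hX k).comp h).add ((measurable_localTime hX (k + 1)).comp h)

lemma measurable_alpha {X : ℝ≥0 → Ω → ℤ} (hX : Measurable fun q : ℝ≥0 × Ω => X q.1 q.2) (k : ℤ) :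
    Measurable fun q : ℝ≥0 × Ω => alpha (fun t => X t q.2) k q.1 := by
  have h : Measurable fun q : ℝ≥0 × Ω => X (theta (fun t => X t q.2) q.1 k) q.2 :=
    hX.comp ((measurable_theta hX k).prodMk measurable_snd)
  exact (Measurable.ite (measurableSet_eq_fun h measurable_const) measurable_const measurable_const).sub
    (Measurable.ite (measurableSet_eq_fun h measurable_const) measurable_const measurable_const)

lemma measurable_xi {X : ℝ≥0 → Ω → ℤ} (hX : Measurable fun q : ℝ≥0 × Ω => X q.1 q.2) (k : ℤ) :
    Measurable fun q : ℝ≥0 × Ω => xi (fun t => X t q.2) k q.1 := by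
  have h := (measurable_theta hX k).prodMk measurable_snd
  exact ((measurable_localTime hX (k + 1)).comp h).sub ((measurable_localTime hX k).comp h)

lemma measurable_eta {X : ℝ≥0 → Ω → ℤ} (hX : Measurable fun q : ℝ≥0 × Ω => X q.1 q.2) (σ : ℤˣ) (k : ℤ) :
    Measurable fun q : ℝ≥0 × Ω => eta (fun t => X t q.2) σ k q.1 := by
  have hb : Measurable fun q : ℝ≥0 × Ω => beta (fun t => X t q.2) σ k q.1 := by
    refine measurable_sInf_lt
      (f := fun t (q : ℝ≥0 × Ω) => localTime (alpha (fun t => X t q.2) k) t σ)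
      (g := fun q => (q.1 : ℝ)) (fun t => ?_) (fun q => monotone_localTime _ _) (by fun_prop)
    have h : Measurable fun q : ℝ≥0 × Ω => (t, q.2) := by fun_prop
    exact (measurable_localTime (X := fun t ω => alpha (fun t => X t ω) k t) (measurable_alpha hX k) σ).comp h
  exact ((measurable_xi hX k).comp (hb.prodMk measurable_snd)).const_mul _

lemma measurable_jumpTime {X : ℝ≥0 → Ω → ℤ} (hX : Measurable fun q : ℝ≥0 × Ω => X q.1 q.2)
    (hr : ∀ ω t, ContinuousWithinAt (fun s => X s ω) (Ici t) t) (n : ℕ) :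
    Measurable fun ω => jumpTime (fun t => X t ω) n := by
  induction n with
  | zero => exact measurable_const
  | succ n ih =>
    refine measurable_sInf (A := fun t ω => jumpTime (fun t => X t ω) n < t ∧
      X t ω ≠ X (jumpTime (fun t => X t ω) n) ω) (fun t => ?_) ?_
    · have h1 : Measurable fun ω => X t ω := hX.comp (measurable_const.prodMk measurable_id)
      have h2 : Measurable fun ω => X (jumpTime (fun t => X t ω) n) ω := hX.comp (ih.prodMk measurable_id)
      exact measurableSet_and (measurableSet_lt ih measurable_const) (measurableSet_eq_fun h1 h2).compl
    · intro ω t b ⟨h1, h2⟩ htb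
      have h3 : ∀ᶠ s in 𝓝[Ici t] t, X s ω = X t ω :=
        (hr ω t).tendsto.eventually_mem (show ({X t ω} : Set ℤ) ∈ 𝓝 (X t ω) by simp)
      obtain ⟨c, hc, hc2⟩ := (mem_nhdsGE_iff_exists_Ico_subset' (lt_add_one t)).1 h3
      obtain ⟨j, hj⟩ := (TopologicalSpace.denseRange_denseSeq ℝ≥0).exists_mem_open isOpen_Ioo
        (nonempty_Ioo.2 (lt_min htb hc))
      refine ⟨j, hj.2.trans_le (min_le_left _ _), h1.trans hj.1, ?_⟩
      have h4 : X (TopologicalSpace.denseSeq ℝ≥0 j) ω = X t ω := hc2 ⟨hj.1.le, hj.2.trans_le (min_le_right _ _)⟩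
      rwa [h4]

end Measurability

/-! ### Local times of step functions -/

/-- The local time at `k` after the first `n` steps of the path which is at `p i` in the time
interval `[S i, S (i + 1))`. -/
def occ (S : ℕ → ℝ) (p : ℕ → ℤ) (n : ℕ) (k : ℤ) : ℝ :=
  ∑ i ∈ Finset.range n, if p i = k then S (i + 1) - S i else 0

lemma occ_succ (S : ℕ → ℝ) (p : ℕ → ℤ) (n : ℕ) (k : ℤ) :
    occ S p (n + 1) k = occ S p n k + if p n = k then S (n + 1) - S n else 0 := by
  rw [occ, occ, Finset.sum_range_succ]

@[simp] lemma occ_zero (S : ℕ → ℝ) (p : ℕ → ℤ) (k : ℤ) : occ S p 0 k = 0 := by simp [occ]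

@[simp] lemma localTime_zero (x : ℝ≥0 → ℤ) (k : ℤ) : localTime x 0 k = 0 := by
  have : {s : ℝ | 0 ≤ s ∧ s < (0 : ℝ≥0) ∧ x s.toNNReal = k} = ∅ := by
    ext s
    simp only [mem_ofPred_eq, mem_empty_iff_false, iff_false, NNReal.coe_zero]
    rintro ⟨h1, h2, -⟩
    linarith
  rw [localTime, this]; simp

lemma localTime_add_of_const {x : ℝ≥0 → ℤ} {a b : ℝ≥0} (hab : a ≤ b) {v : ℤ}
    (hx : ∀ t, a ≤ t → t < b → x t = v) (k : ℤ) :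
    localTime x b k = localTime x a k + if v = k then (b : ℝ) - a else 0 := by
  have hab' : (a : ℝ) ≤ b := by exact_mod_cast hab
  have hI : ∀ s : ℝ, s ∈ Ico (a : ℝ) b → x s.toNNReal = v := fun s hs =>
    hx _ (NNReal.le_toNNReal_of_coe_le hs.1) (by
      rw [← NNReal.coe_lt_coe, Real.coe_toNNReal _ (a.2.trans hs.1)]; exact hs.2)
  by_cases hv : v = k
  · have hU : {s : ℝ | 0 ≤ s ∧ s < b ∧ x s.toNNReal = k}
        = {s : ℝ | 0 ≤ s ∧ s < a ∧ x s.toNNReal = k} ∪ Ico (a : ℝ) b := by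
      ext s
      simp only [mem_ofPred_eq, mem_union]
      constructor
      · rintro ⟨h1, h2, h3⟩
        rcases lt_or_ge s a with h | h
        · exact Or.inl ⟨h1, h, h3⟩
        · exact Or.inr ⟨h, h2⟩
      · rintro (⟨h1, h2, h3⟩ | h)
        · exact ⟨h1, h2.trans_le hab', h3⟩
        · exact ⟨a.2.trans h.1, h.2, (hI s h).trans hv⟩
    have hd : Disjoint {s : ℝ | 0 ≤ s ∧ s < a ∧ x s.toNNReal = k} (Ico (a : ℝ) b) :=
      disjoint_left.2 fun s h1 h2 => absurd h1.2.1 (not_lt.2 h2.1)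
    rw [localTime, hU, measure_union hd measurableSet_Ico, ENNReal.toReal_add (localTime_ne_top x a k)
      (by simp), if_pos hv, Real.volume_Ico, ENNReal.toReal_ofReal (by linarith), localTime]
  · have hU : {s : ℝ | 0 ≤ s ∧ s < b ∧ x s.toNNReal = k}
        = {s : ℝ | 0 ≤ s ∧ s < a ∧ x s.toNNReal = k} := by
      ext s
      simp only [mem_ofPred_eq]
      constructor
      · rintro ⟨h1, h2, h3⟩
        rcases lt_or_ge s a with h | h
        · exact ⟨h1, h, h3⟩
        · exact absurd ((hI s ⟨h, h2⟩).symm.trans h3) hv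
      · rintro ⟨h1, h2, h3⟩
        exact ⟨h1, h2.trans_le hab', h3⟩
    rw [localTime, hU, if_neg hv, add_zero, localTime]

/-- The path `x` is at `p n` in the time interval `[S n, S (n + 1))`. -/
structure IsStepPath (x : ℝ≥0 → ℤ) (S : ℕ → ℝ) (p : ℕ → ℤ) : Prop where
  zero : S 0 = 0
  mono : Monotone S
  eq : ∀ n (t : ℝ≥0), S n ≤ t → t < S (n + 1) → x t = p n

lemma IsStepPath.nonneg {x : ℝ≥0 → ℤ} {S : ℕ → ℝ} {p : ℕ → ℤ} (h : IsStepPath x S p) (n : ℕ) : 0 ≤ S n :=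
  h.zero ▸ h.mono (Nat.zero_le n)

lemma IsStepPath.localTime_eq {x : ℝ≥0 → ℤ} {S : ℕ → ℝ} {p : ℕ → ℤ} (h : IsStepPath x S p) (n : ℕ)
    {t : ℝ≥0} (h1 : S n ≤ t) (h2 : t ≤ S (n + 1)) (k : ℤ) :
    localTime x t k = occ S p n k + if p n = k then t - S n else 0 := by
  have step : ∀ (n : ℕ) (t : ℝ≥0), S n ≤ t → t ≤ S (n + 1) → localTime x (S n).toNNReal k = occ S p n k →
      localTime x t k = occ S p n k + if p n = k then t - S n else 0 := by
    intro n t h1 h2 h3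
    have hle : (S n).toNNReal ≤ t := Real.toNNReal_le_iff_le_coe.2 h1
    rw [localTime_add_of_const hle (v := p n) (fun r hr1 hr2 => h.eq n r (Real.toNNReal_le_iff_le_coe.1 hr1)
      (lt_of_lt_of_le (by exact_mod_cast hr2) h2)) k, h3, Real.coe_toNNReal _ (h.nonneg n)]
  have hS : ∀ n, localTime x (S n).toNNReal k = occ S p n k := by
    intro n
    induction n with
    | zero => rw [h.zero]; simp
    | succ n ih =>
      have h4 := step n (S (n + 1)).toNNReal (by
        rw [Real.coe_toNNReal _ (h.nonneg _)]; exact h.mono (Nat.le_succ n)) (by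
        rw [Real.coe_toNNReal _ (h.nonneg _)]) ih
      rw [h4, Real.coe_toNNReal _ (h.nonneg _), occ_succ]
  exact step n t h1 h2 (hS n)

/-- A right continuous inverse on an interval in which the function grows with unit speed. -/
lemma sInf_lt_eq {f : ℝ≥0 → ℝ} (hf : Monotone f) {a : ℝ≥0} {b d s : ℝ}
    (hfa : ∀ t : ℝ≥0, (a : ℝ) ≤ t → (t : ℝ) ≤ a + d → f t = b + (t - a)) (h1 : b ≤ s) (h2 : s < b + d) :
    ((sInf {t : ℝ≥0 | s < f t} : ℝ≥0) : ℝ) = a + (s - b) ∧ {t : ℝ≥0 | s < f t}.Nonempty := by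
  obtain ⟨c, hc⟩ : ∃ c : ℝ≥0, (c : ℝ) = a + (s - b) := ⟨⟨a + (s - b), by have := a.2; linarith [NNReal.coe_nonneg a]⟩, rfl⟩
  have hfc : f c = s := by rw [hfa c (by linarith) (by linarith)]; linarith
  have hgt : ∀ t : ℝ≥0, c < t → s < f t := by
    intro t ht
    have ht' : (c : ℝ) < t := by exact_mod_cast ht
    obtain ⟨m, hm⟩ : ∃ m : ℝ≥0, m = min t (a + d).toNNReal := ⟨_, rfl⟩
    have hd : (((a : ℝ) + d).toNNReal : ℝ) = a + d := Real.coe_toNNReal _ (by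
      have := NNReal.coe_nonneg a; linarith)
    have hm' : (m : ℝ) = min (t : ℝ) (a + d) := by rw [hm, NNReal.coe_min, hd]
    have hcm : (c : ℝ) < m := by rw [hm']; exact lt_min ht' (by linarith)
    have : f m = b + (m - a) := hfa m (by linarith) (by rw [hm']; exact min_le_right _ _)
    have hmt : m ≤ t := by rw [hm]; exact min_le_left _ _
    have := hf hmt
    linarith
  have hset : {t : ℝ≥0 | s < f t} = Ioi c := by
    ext t
    refine ⟨fun ht => ?_, fun ht => hgt t ht⟩
    by_contra hcon
    have h3 := hf (not_lt.1 hcon)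
    have h4 : s < f t := ht
    linarith
  rw [hset, csInf_Ioi, hc]
  exact ⟨rfl, nonempty_Ioi⟩

/-! ### The skeleton of the walk -/

/-- The jump times `S` and the successive positions `p` of a nearest neighbour walk which starts
at `0`. -/
structure IsSkeleton (S : ℕ → ℝ) (p : ℕ → ℤ) : Prop where
  zero : S 0 = 0
  start : p 0 = 0
  lt : ∀ n, S n < S (n + 1)
  step : ∀ n, p (n + 1) = p n + 1 ∨ p (n + 1) = p n - 1

/-- The sign `+1` if the walk is to the right of the edge `⟨k, k+1⟩` after `n` jumps, and `-1` if
it is to the left. -/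
def side (p : ℕ → ℤ) (n : ℕ) (k : ℤ) : ℤ := if k < p n then 1 else -1

/-- The number of times that the walk crossed the edge `⟨k, k+1⟩` in its first `n` jumps. -/
def crossed (p : ℕ → ℤ) (n : ℕ) (k : ℤ) : ℕ :=
  ∑ i ∈ Finset.range n, if (k < p i ↔ k < p (i + 1)) then 0 else 1

/-- After `n` jumps, the local time at the endpoint of the edge `⟨k, k+1⟩` on the side of the
walk, minus the local time at the other endpoint. -/
def clock (S : ℕ → ℝ) (p : ℕ → ℤ) (n : ℕ) (k : ℤ) : ℝ :=
  side p n k * (occ S p n (k + 1) - occ S p n k)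

/-- The value of `clock` immediately before the `(n + 1)`-st jump. -/
def preClock (S : ℕ → ℝ) (p : ℕ → ℤ) (n : ℕ) (k : ℤ) : ℝ :=
  clock S p n k + if p n = k ∨ p n = k + 1 then S (n + 1) - S n else 0

/-- The value of `clock` immediately before the `j`-th crossing of the edge `⟨k, k+1⟩`, if this
is one of the first `n` jumps, and `0` otherwise. -/
def switchPt (S : ℕ → ℝ) (p : ℕ → ℤ) (n : ℕ) (k : ℤ) (j : ℕ) : ℝ :=
  ∑ i ∈ Finset.range n, if ¬(k < p i ↔ k < p (i + 1)) ∧ crossed p i k + 1 = j then -clock S p (i + 1) k else 0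

lemma crossed_succ (p : ℕ → ℤ) (n : ℕ) (k : ℤ) :
    crossed p (n + 1) k = crossed p n k + if (k < p n ↔ k < p (n + 1)) then 0 else 1 := by
  rw [crossed, crossed, Finset.sum_range_succ]

lemma crossed_mono (p : ℕ → ℤ) (k : ℤ) : Monotone fun n => crossed p n k :=
  monotone_nat_of_le_succ fun n => by rw [crossed_succ]; exact Nat.le_add_right _ _

lemma side_succ (p : ℕ → ℤ) (n : ℕ) (k : ℤ) :
    side p (n + 1) k = if (k < p n ↔ k < p (n + 1)) then side p n k else -side p n k := by
  unfold side
  by_cases h1 : k < p n <;> by_cases h2 : k < p (n + 1) <;> simp [h1, h2]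

lemma side_eq (p : ℕ → ℤ) (n : ℕ) (k : ℤ) : side p n k = side p 0 k * (-1) ^ crossed p n k := by
  induction n with
  | zero => simp [crossed]
  | succ n ih =>
    rw [side_succ, crossed_succ]
    split_ifs
    · rw [add_zero, ih]
    · rw [pow_succ, ih]; ring

lemma side_mul_occ_succ (S : ℕ → ℝ) (p : ℕ → ℤ) (n : ℕ) (k : ℤ) :
    side p n k * (occ S p (n + 1) (k + 1) - occ S p (n + 1) k) = preClock S p n k := by
  rw [preClock, clock, occ_succ, occ_succ, side]
  have hk : k ≠ k + 1 := by lia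
  rcases eq_or_ne (p n) k with h | h
  · rw [if_neg (by lia), if_neg (by lia), if_pos h, if_pos (Or.inl h)]
    push_cast; ring
  rcases eq_or_ne (p n) (k + 1) with h' | h'
  · rw [if_pos (by lia), if_pos h', if_neg h, if_pos (Or.inr h')]
    push_cast; ring
  · rw [if_neg h', if_neg h, if_neg (not_or.2 ⟨h, h'⟩)]
    ring

lemma clock_succ (S : ℕ → ℝ) (p : ℕ → ℤ) (n : ℕ) (k : ℤ) :
    clock S p (n + 1) k
      = if (k < p n ↔ k < p (n + 1)) then preClock S p n k else -preClock S p n k := by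
  rw [clock, side_succ, ← side_mul_occ_succ]
  split_ifs
  · rfl
  · push_cast; ring

lemma switchPt_succ (S : ℕ → ℝ) (p : ℕ → ℤ) (n : ℕ) (k : ℤ) (j : ℕ) :
    switchPt S p (n + 1) k j = switchPt S p n k j
      + if ¬(k < p n ↔ k < p (n + 1)) ∧ crossed p n k + 1 = j then preClock S p n k else 0 := by
  rw [switchPt, switchPt, Finset.sum_range_succ]
  congr 1
  by_cases h : ¬(k < p n ↔ k < p (n + 1)) ∧ crossed p n k + 1 = j
  · rw [if_pos h, if_pos h, clock_succ, if_neg h.1, neg_neg]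
  · rw [if_neg h, if_neg h]

lemma switchPt_eq_zero (S : ℕ → ℝ) (p : ℕ → ℤ) (n : ℕ) (k : ℤ) {j : ℕ} (hj : j = 0 ∨ crossed p n k < j) :
    switchPt S p n k j = 0 := by
  refine Finset.sum_eq_zero fun i hi => if_neg fun ⟨h1, h2⟩ => ?_
  have hle := crossed_mono p k (show i + 1 ≤ n from Finset.mem_range.1 hi)
  simp only [crossed_succ, if_neg h1] at hle
  lia

lemma switchPt_stable (S : ℕ → ℝ) (p : ℕ → ℤ) {n m : ℕ} (hnm : n ≤ m) (k : ℤ) {j : ℕ}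
    (hj : j ≤ crossed p n k) : switchPt S p m k j = switchPt S p n k j := by
  induction m, hnm using Nat.le_induction with
  | base => rfl
  | succ m hm ih =>
    have := crossed_mono p k hm
    simp only at this
    rw [switchPt_succ, if_neg (by lia), add_zero, ih]

lemma switchPt_of_crossing (S : ℕ → ℝ) {p : ℕ → ℤ} {n : ℕ} {k : ℤ} (hc : ¬(k < p n ↔ k < p (n + 1))) :
    switchPt S p (n + 1) k (crossed p n k + 1) = preClock S p n k := by
  rw [switchPt_succ, if_pos ⟨hc, rfl⟩, switchPt_eq_zero S p n k (Or.inr (Nat.lt_succ_self _)), zero_add]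

lemma crossing_iff {p : ℕ → ℤ} {n : ℕ} (hstep : p (n + 1) = p n + 1 ∨ p (n + 1) = p n - 1) (k : ℤ) :
    ¬(k < p n ↔ k < p (n + 1)) ↔
      (p n = k ∧ p (n + 1) = p n + 1) ∨ (p n = k + 1 ∧ p (n + 1) = p n - 1) := by
  rcases hstep with h | h <;> rw [h] <;> lia

namespace IsSkeleton

variable {S : ℕ → ℝ} {p : ℕ → ℤ} (h : IsSkeleton S p)

include h

lemma clock_le_preClock (n : ℕ) (k : ℤ) : clock S p n k ≤ preClock S p n k := by
  rw [preClock]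
  have := h.lt n
  split_ifs <;> linarith

lemma clock_lt_preClock {n : ℕ} {k : ℤ} (hc : ¬(k < p n ↔ k < p (n + 1))) :
    clock S p n k < preClock S p n k := by
  rw [preClock, if_pos]
  · linarith [h.lt n]
  · rcases (crossing_iff (h.step n) k).1 hc with h1 | h1
    · exact Or.inl h1.1
    · exact Or.inr h1.1

lemma neg_switchPt_le_clock (n : ℕ) (k : ℤ) : -switchPt S p n k (crossed p n k) ≤ clock S p n k := by
  induction n with
  | zero => simp [switchPt, clock]
  | succ n ih =>
    by_cases hc : (k < p n ↔ k < p (n + 1))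
    · rw [clock_succ, if_pos hc, crossed_succ, if_pos hc, add_zero, switchPt_stable S p (Nat.le_succ n) k le_rfl]
      exact ih.trans (h.clock_le_preClock n k)
    · rw [clock_succ, if_neg hc, crossed_succ, if_neg hc, switchPt_of_crossing S hc]

lemma neg_switchPt_lt {n : ℕ} {k : ℤ} {j : ℕ} (hj : j < crossed p n k) :
    -switchPt S p n k j < switchPt S p n k (j + 1) := by
  induction n with
  | zero => simp [crossed] at hj
  | succ n ih =>
    rw [crossed_succ] at hj
    rcases lt_or_ge j (crossed p n k) with h1 | h1
    · rw [switchPt_stable S p (Nat.le_succ n) k h1.le, switchPt_stable S p (Nat.le_succ n) k h1]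
      exact ih h1
    · by_cases hc : (k < p n ↔ k < p (n + 1))
      · rw [if_pos hc] at hj; lia
      · rw [if_neg hc] at hj
        have hj' : j = crossed p n k := by lia
        subst hj'
        rw [switchPt_of_crossing S hc, switchPt_stable S p (Nat.le_succ n) k le_rfl]
        exact (h.neg_switchPt_le_clock n k).trans_lt (h.clock_lt_preClock hc)

/-- The local time at the endpoint opposite to the walk is the sum of the switching points. -/
lemma occ_opposite (n : ℕ) (k : ℤ) :
    (if k < p n then occ S p n k else occ S p n (k + 1))
      = ∑ i ∈ Finset.range (crossed p n k + 1), switchPt S p n k i := by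
  induction n with
  | zero => simp [crossed, switchPt]
  | succ n ih =>
    have hstab : ∑ i ∈ Finset.range (crossed p n k + 1), switchPt S p (n + 1) k i
        = ∑ i ∈ Finset.range (crossed p n k + 1), switchPt S p n k i :=
      Finset.sum_congr rfl fun i hi => switchPt_stable S p (Nat.le_succ n) k (by
        have := Finset.mem_range.1 hi; lia)
    by_cases hc : (k < p n ↔ k < p (n + 1))
    · rw [crossed_succ, if_pos hc, add_zero, hstab, ← ih, occ_succ, occ_succ]
      by_cases hk : k < p n
      · rw [if_pos hk, if_pos (hc.1 hk), if_neg (by lia), add_zero]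
      · rw [if_neg hk, if_neg (hc.not.1 hk), if_neg (by lia), add_zero]
    · rw [crossed_succ, if_neg hc, Finset.sum_range_succ, hstab, ← ih, switchPt_of_crossing S hc, preClock,
        clock, side, occ_succ, occ_succ]
      rcases (crossing_iff (h.step n) k).1 hc with ⟨h1, h2⟩ | ⟨h1, h2⟩
      · rw [if_pos (by lia), if_pos h1, if_neg (by lia), if_neg (by lia), if_pos (Or.inl h1)]
        push_cast; ring
      · rw [if_neg (by lia), if_pos h1, if_pos (by lia), if_pos (by lia), if_pos (Or.inr h1)]
        push_cast; ring

/-- The local time at the endpoint on the side of the walk exceeds the other one by the value of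
the clock. -/
lemma occ_current (n : ℕ) (k : ℤ) :
    (if k < p n then occ S p n (k + 1) else occ S p n k)
      = ∑ i ∈ Finset.range (crossed p n k + 1), switchPt S p n k i + clock S p n k := by
  rw [← h.occ_opposite, clock, side]
  split_ifs <;> (push_cast; ring)

end IsSkeleton

/-! ### The exponential variables of an edge -/

/-- The exponential variables `e` of an edge are compatible with the switching points `z₀, …, z_c`
of the past and with the current value `u` of the clock. -/
structure Compatible (w : ℝ → ℝ) (z : ℕ → ℝ) (c : ℕ) (u : ℝ) (e : ℕ → ℝ) : Prop where
  zero : z 0 = 0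
  past : ∀ j < c, e j = cumRate w (z (j + 1)) - cumRate w (-z j)
  lt : ∀ j < c, -z j < z (j + 1)
  current : cumRate w u - cumRate w (-z c) ≤ e c

section

variable {w : ℝ → ℝ} [hw : IsRate w] {z : ℕ → ℝ} {c : ℕ} {u : ℝ} {e : ℕ → ℝ}

/-- The chain driven by compatible variables passes through the switching points of the past. -/
lemma Compatible.chain_eq (h : Compatible w z c u e) {j : ℕ} (hj : j ≤ c) : chain w 0 e j = z j := by
  induction j with
  | zero => rw [chain, h.zero]
  | succ j ih => rw [chain_succ, ih (by lia), h.past j hj, nextPoint_cumRate_sub w (h.lt j hj).le]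

/-- The clock has not yet reached the next point of the chain. -/
lemma Compatible.le_chain (h : Compatible w z c u e) : u ≤ chain w 0 e (c + 1) := by
  rw [chain_succ, h.chain_eq le_rfl, le_nextPoint_iff]
  linarith [h.current, le_max_left (e c) 0]

lemma Compatible.sum_chain (h : Compatible w z c u e) :
    ∑ i ∈ Finset.range (c + 1), chain w 0 e i = ∑ i ∈ Finset.range (c + 1), z i :=
  Finset.sum_congr rfl fun i hi => h.chain_eq (by have := Finset.mem_range.1 hi; lia)

end

/-! ### Two competing clocks -/

/-- The density of the first ringing time of two independent clocks with rates `w (u₁ + ·)` and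
`w (u₂ + ·)`, on the event that the first clock rings first. -/
def raceDensity (w : ℝ → ℝ) (u₁ u₂ v : ℝ) : ℝ≥0∞ :=
  ENNReal.ofReal (w (u₁ + v) *
    Real.exp (-((cumRate w (u₁ + v) - cumRate w u₁) + (cumRate w (u₂ + v) - cumRate w u₂))))

/-- The conditional probability that the exponential variable of a clock is larger than `b`, given
that it is larger than `a`. -/
def residual (b a : ℝ) : ℝ≥0∞ := ENNReal.ofReal (Real.exp (-(max (b - a) 0)))

section

variable (w : ℝ → ℝ) [hw : IsRate w]

lemma measurable_raceDensity : Measurable fun q : (ℝ × ℝ) × ℝ => raceDensity w q.1.1 q.1.2 q.2 := by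
  have := measurable_rate w
  have := measurable_cumRate w
  unfold raceDensity
  fun_prop

lemma measurable_residual : Measurable fun q : ℝ × ℝ => residual q.1 q.2 := by
  unfold residual
  fun_prop

lemma Q_Ioi_max_nextPoint (u β : ℝ) {v : ℝ} (hv : 0 ≤ v) :
    Q w u (Ioi (max (nextPoint w u β) (u + v)))
      = ENNReal.ofReal (Real.exp (-(cumRate w (u + v) - cumRate w u)))
        * residual β (cumRate w (u + v) - cumRate w u) := by
  have hG := (strictMono_cumRate w).monotone
  have h1 : cumRate w u ≤ cumRate w (u + v) := hG (by linarith)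
  rw [Q_Ioi (w := w) ((le_nextPoint w u β).trans (le_max_left _ _)), hG.map_max, cumRate_nextPoint, residual,
    ← ENNReal.ofReal_mul (Real.exp_pos _).le, ← Real.exp_add]
  congr 3
  rw [← neg_add, neg_inj]
  rcases le_total (cumRate w (u + v) - cumRate w u) β with h | h
  · rw [max_eq_left (by linarith : 0 ≤ β - _), max_eq_left (by linarith : 0 ≤ β), max_eq_left (by linarith)]
    ring
  · rw [max_eq_right (by linarith : β - _ ≤ 0), max_eq_right]
    · ring
    · rcases le_total β 0 with h2 | h2
      · rw [max_eq_right h2]; linarith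
      · rw [max_eq_left h2]; linarith

lemma Q_Ioi_nextPoint (u β : ℝ) : Q w u (Ioi (nextPoint w u β)) = residual β 0 := by
  have h := Q_Ioi_max_nextPoint w u β le_rfl
  rw [add_zero, sub_self, max_eq_left (le_nextPoint w u β)] at h
  simpa using h

/-- The integral over the first ringing time, on the event that the first clock rings first, in
terms of the two independent ringing points. -/
lemma lintegral_race (u₁ u₂ β₁ β₂ : ℝ) :
    ∫⁻ v in Ioi (0 : ℝ), raceDensity w u₁ u₂ v *
        ((if β₁ < cumRate w (u₁ + v) - cumRate w u₁ then 1 else 0)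
          * residual β₂ (cumRate w (u₂ + v) - cumRate w u₂))
      = ((Q w u₁).prod (Q w u₂)) {q | nextPoint w u₁ β₁ < q.1 ∧ nextPoint w u₂ β₂ < q.2 ∧
          q.1 - u₁ < q.2 - u₂} := by
  have hms : MeasurableSet {q : ℝ × ℝ | nextPoint w u₁ β₁ < q.1 ∧ nextPoint w u₂ β₂ < q.2 ∧
          q.1 - u₁ < q.2 - u₂} :=
    measurableSet_and (measurableSet_lt measurable_const measurable_fst)
      (measurableSet_and (measurableSet_lt measurable_const measurable_snd)
        (measurableSet_lt (by fun_prop) (by fun_prop)))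
  rw [Measure.prod_apply hms, lintegral_Q w u₁ (measurable_measure_prodMk_left hms)]
  refine setLIntegral_congr_fun measurableSet_Ioi fun v hv => ?_
  have hv0 : (0 : ℝ) < v := hv
  have hset : Prod.mk (u₁ + v) ⁻¹' {q : ℝ × ℝ | nextPoint w u₁ β₁ < q.1 ∧ nextPoint w u₂ β₂ < q.2 ∧
          q.1 - u₁ < q.2 - u₂}
      = if β₁ < cumRate w (u₁ + v) - cumRate w u₁ then Ioi (max (nextPoint w u₂ β₂) (u₂ + v)) else ∅ := by
    have hiff : nextPoint w u₁ β₁ < u₁ + v ↔ β₁ < cumRate w (u₁ + v) - cumRate w u₁ := by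
      rw [← (strictMono_cumRate w).lt_iff_lt, cumRate_nextPoint]
      have := (strictMono_cumRate w) (show u₁ < u₁ + v by linarith)
      rcases le_total β₁ 0 with h | h
      · rw [max_eq_right h]; constructor <;> intro <;> linarith
      · rw [max_eq_left h]; constructor <;> intro <;> linarith
    ext y
    by_cases hc : β₁ < cumRate w (u₁ + v) - cumRate w u₁
    · simp only [mem_preimage, mem_ofPred_eq, if_pos hc, hiff.2 hc, true_and, mem_Ioi, max_lt_iff]
      refine and_congr_right fun _ => ?_
      constructor <;> intro <;> linarith
    · simp only [mem_preimage, mem_ofPred_eq, if_neg hc, mt hiff.1 hc, false_and, mem_empty_iff_false]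
  simp only [hset]
  by_cases hc : β₁ < cumRate w (u₁ + v) - cumRate w u₁
  · rw [if_pos hc, if_pos hc, one_mul, Q_Ioi_max_nextPoint w u₂ β₂ hv0.le, ← mul_assoc, raceDensity,
      ← ENNReal.ofReal_mul (mul_nonneg (hw.pos _).le (Real.exp_pos _).le), mul_assoc (w _), ← Real.exp_add,
      neg_add]
  · rw [if_neg hc, if_neg hc, zero_mul, mul_zero, measure_empty, mul_zero]

/-- The competition between two exponential clocks does not change the joint law of their
exponential variables: conditioning on the first ringing time and on the clock which rings, and
keeping the residual part of the other variable, gives two independent variables back. -/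
theorem two_clocks (u₁ u₂ β₁ β₂ : ℝ) :
    (∫⁻ v in Ioi (0 : ℝ), raceDensity w u₁ u₂ v *
        ((if β₁ < cumRate w (u₁ + v) - cumRate w u₁ then 1 else 0)
          * residual β₂ (cumRate w (u₂ + v) - cumRate w u₂)))
      + (∫⁻ v in Ioi (0 : ℝ), raceDensity w u₂ u₁ v *
        ((if β₂ < cumRate w (u₂ + v) - cumRate w u₂ then 1 else 0)
          * residual β₁ (cumRate w (u₁ + v) - cumRate w u₁)))
      = residual β₁ 0 * residual β₂ 0 := by
  rw [lintegral_race, lintegral_race, ← Q_Ioi_nextPoint w u₁ β₁, ← Q_Ioi_nextPoint w u₂ β₂,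
    ← Measure.prod_prod, ← Measure.prod_swap (μ := Q w u₁) (ν := Q w u₂),
    Measure.map_apply measurable_swap]
  -- almost surely the two clocks do not ring at the same time
  · have hD : ((Q w u₁).prod (Q w u₂)) {q | q.1 - u₁ = q.2 - u₂} = 0 := by
      have hms : MeasurableSet {q : ℝ × ℝ | q.1 - u₁ = q.2 - u₂} :=
        measurableSet_eq_fun (by fun_prop) (by fun_prop)
      rw [Measure.measure_prod_null hms]
      refine Eventually.of_forall fun y => ?_
      have : Prod.mk y ⁻¹' {q : ℝ × ℝ | q.1 - u₁ = q.2 - u₂} = {y - u₁ + u₂} := by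
        ext y'
        simp only [mem_preimage, mem_ofPred_eq, mem_singleton_iff]
        constructor <;> intro h <;> linarith
      show Q w u₂ (Prod.mk y ⁻¹' {q : ℝ × ℝ | q.1 - u₁ = q.2 - u₂}) = 0
      rw [this]
      simp
    rw [← measure_union]
    · refine measure_congr ?_
      rw [Filter.eventuallyEq_set]
      have hae : ∀ᵐ q ∂((Q w u₁).prod (Q w u₂)), ¬ (q.1 - u₁ = q.2 - u₂) := by
        rw [ae_iff]; simpa using hD
      filter_upwards [hae] with q hq
      simp only [mem_union, mem_ofPred_eq, mem_preimage, Prod.fst_swap, Prod.snd_swap, mem_prod, mem_Ioi]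
      constructor
      · rintro (h | h)
        · exact ⟨h.1, h.2.1⟩
        · exact ⟨h.2.1, h.1⟩
      · intro h
        rcases lt_or_gt_of_ne hq with h1 | h1
        · exact Or.inl ⟨h.1, h.2, h1⟩
        · exact Or.inr ⟨h.2, h.1, h1⟩
    · refine disjoint_left.2 fun q h1 h2 => ?_
      have h3 := h1.2.2
      have h4 : q.2 - u₂ < q.1 - u₁ := h2.2.2
      linarith
    · exact measurable_swap (measurableSet_and (measurableSet_lt measurable_const measurable_fst)
        (measurableSet_and (measurableSet_lt measurable_const measurable_snd)
        (measurableSet_lt (by fun_prop) (by fun_prop))))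
  · exact measurableSet_and (measurableSet_lt measurable_const measurable_fst)
      (measurableSet_and (measurableSet_lt measurable_const measurable_snd)
        (measurableSet_lt (by fun_prop) (by fun_prop)))

lemma lintegral_raceDensity_add (u₁ u₂ : ℝ) :
    (∫⁻ v in Ioi (0 : ℝ), raceDensity w u₁ u₂ v) + (∫⁻ v in Ioi (0 : ℝ), raceDensity w u₂ u₁ v) = 1 := by
  have hneg : ∀ (u : ℝ) {v : ℝ}, v ∈ Ioi (0 : ℝ) → -1 < cumRate w (u + v) - cumRate w u := fun u v hv => by
    have := (strictMono_cumRate w).monotone (show u ≤ u + v by linarith [show (0 : ℝ) < v from hv])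
    linarith
  have hres : ∀ a, -1 < a → residual (-1) a = 1 := fun a ha => by
    rw [residual, max_eq_right (by linarith)]; simp
  have h := two_clocks w u₁ u₂ (-1) (-1)
  rw [hres 0 (by norm_num), mul_one] at h
  rw [← h]
  congr 1 <;>
  · refine setLIntegral_congr_fun measurableSet_Ioi fun v hv => ?_
    rw [if_pos (hneg _ hv), hres _ (hneg _ hv), mul_one, mul_one]

end

/-! ### Measurability of the skeleton -/

section

variable {Ω : Type*} {𝒢 : MeasurableSpace Ω} {S : ℕ → Ω → ℝ} {p : ℕ → Ω → ℤ} {n : ℕ}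

lemma measurable_eval_countable {ι β : Type*} [Countable ι] [MeasurableSpace ι]
    [MeasurableSingletonClass ι] [MeasurableSpace β] {f : ι → Ω → β} (hf : ∀ i, Measurable[𝒢] (f i))
    {N : Ω → ι} (hN : Measurable[𝒢] N) : Measurable[𝒢] fun ω => f (N ω) ω := by
  have h : Measurable fun q : ι × Ω => f q.1 q.2 := measurable_from_prod_countable_right hf
  exact h.comp (hN.prodMk measurable_id)

lemma measurable_occ (hS : ∀ i ≤ n, Measurable[𝒢] (S i)) (hp : ∀ i < n, Measurable[𝒢] (p i)) (k : ℤ) :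
    Measurable[𝒢] fun ω => occ (fun i => S i ω) (fun i => p i ω) n k := by
  refine Finset.measurable_fun_sum _ fun i hi => ?_
  have hi' := Finset.mem_range.1 hi
  exact Measurable.ite (measurableSet_eq_fun (hp i hi') measurable_const)
    ((hS _ hi').sub (hS _ hi'.le)) measurable_const

lemma measurableSet_crossing (hp : ∀ i ≤ n + 1, Measurable[𝒢] (p i)) (k : ℤ) :
    MeasurableSet[𝒢] {ω | k < p n ω ↔ k < p (n + 1) ω} := by
  have h1 : ∀ i ≤ n + 1, MeasurableSet[𝒢] {ω | k < p i ω} := fun i hi =>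
    measurableSet_lt measurable_const (hp i hi)
  have : {ω | k < p n ω ↔ k < p (n + 1) ω} = ({ω | k < p n ω} ∩ {ω | k < p (n + 1) ω})
      ∪ ({ω | k < p n ω}ᶜ ∩ {ω | k < p (n + 1) ω}ᶜ) := by
    ext ω
    simp only [mem_ofPred_eq, mem_union, mem_inter_iff, mem_compl_iff]
    tauto
  rw [this]
  exact ((h1 n (by lia)).inter (h1 _ le_rfl)).union ((h1 n (by lia)).compl.inter (h1 _ le_rfl).compl)

lemma measurable_crossed (hp : ∀ i ≤ n, Measurable[𝒢] (p i)) (k : ℤ) :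
    Measurable[𝒢] fun ω => crossed (fun i => p i ω) n k := by
  refine Finset.measurable_fun_sum _ fun i hi => ?_
  have hi' := Finset.mem_range.1 hi
  exact Measurable.ite (measurableSet_crossing (fun j hj => hp j (by lia)) k) measurable_const measurable_const

lemma measurable_clock (hS : ∀ i ≤ n, Measurable[𝒢] (S i)) (hp : ∀ i ≤ n, Measurable[𝒢] (p i)) (k : ℤ) :
    Measurable[𝒢] fun ω => clock (fun i => S i ω) (fun i => p i ω) n k := by
  refine Measurable.mul ?_ ((measurable_occ hS (fun i hi => hp i hi.le) _).sub
    (measurable_occ hS (fun i hi => hp i hi.le) _))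
  have h : Measurable[𝒢] fun ω => side (fun i => p i ω) n k :=
    Measurable.ite (measurableSet_lt measurable_const (hp n le_rfl)) measurable_const measurable_const
  exact (measurable_of_countable (fun z : ℤ => (z : ℝ))).comp h

lemma measurable_switchPt (hS : ∀ i ≤ n, Measurable[𝒢] (S i)) (hp : ∀ i ≤ n, Measurable[𝒢] (p i)) (k : ℤ)
    (j : ℕ) : Measurable[𝒢] fun ω => switchPt (fun i => S i ω) (fun i => p i ω) n k j := by
  refine Finset.measurable_fun_sum _ fun i hi => ?_
  have hi' := Finset.mem_range.1 hi
  refine Measurable.ite (measurableSet_and (measurableSet_crossing (fun j hj => hp j (by lia)) k).compl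
    (measurableSet_eq_fun ((measurable_crossed (fun j hj => hp j (by lia)) k).add_const 1) measurable_const))
    (measurable_clock (fun j hj => hS j (by lia)) (fun j hj => hp j (by lia)) k).neg measurable_const

end

/-! ### The law of one step of the walk -/

section

variable {Ω : Type*}

/-- The `n`-th jump time of the process `X`, as a real number. (If there is no further jump,
`jumpTime` takes the value `0`, but this has probability zero.) -/
def jt (X : ℝ≥0 → Ω → ℤ) (n : ℕ) (ω : Ω) : ℝ := jumpTime (fun t => X t ω) n

/-- The position of the process `X` after its `n`-th jump. -/
def jp (X : ℝ≥0 → Ω → ℤ) (n : ℕ) (ω : Ω) : ℤ := X (jumpTime (fun t => X t ω) n) ω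

/-- After the `n`-th jump, the local time at the position of the walk minus the local time at the
neighbour in direction `e`. -/
def rateArg (X : ℝ≥0 → Ω → ℤ) (n : ℕ) (e : ℤˣ) (ω : Ω) : ℝ :=
  localTime (fun t => X t ω) (jumpTime (fun t => X t ω) n) (jp X n ω)
    - localTime (fun t => X t ω) (jumpTime (fun t => X t ω) n) (jp X n ω + (e : ℤ))

lemma measurable_history_jt (X : ℝ≥0 → Ω → ℤ) {i n : ℕ} (hi : i ≤ n) : Measurable[history X n] (jt X i) := by
  have h := comap_measurable (m := (inferInstance : MeasurableSpace (Fin (n + 1) → ℝ≥0 × ℤ)))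
    (fun (ω : Ω) (i : Fin (n + 1)) =>
      (jumpTime (fun t => X t ω) i, X (jumpTime (fun t => X t ω) i) ω))
  have h2 : Measurable fun f : Fin (n + 1) → ℝ≥0 × ℤ => ((f ⟨i, by lia⟩).1 : ℝ) :=
    measurable_coe_nnreal_real.comp (measurable_fst.comp (measurable_pi_apply _))
  exact h2.comp h

lemma measurable_history_jp (X : ℝ≥0 → Ω → ℤ) {i n : ℕ} (hi : i ≤ n) : Measurable[history X n] (jp X i) := by
  have h := comap_measurable (m := (inferInstance : MeasurableSpace (Fin (n + 1) → ℝ≥0 × ℤ)))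
    (fun (ω : Ω) (i : Fin (n + 1)) =>
      (jumpTime (fun t => X t ω) i, X (jumpTime (fun t => X t ω) i) ω))
  have h2 : Measurable fun f : Fin (n + 1) → ℝ≥0 × ℤ => (f ⟨i, by lia⟩).2 :=
    measurable_snd.comp (measurable_pi_apply _)
  exact h2.comp h

variable [mΩ : MeasurableSpace Ω] {w : ℝ → ℝ} {P : Measure Ω} {X : ℝ≥0 → Ω → ℤ}

namespace IsWalk

variable (hX : IsWalk w P X)

include hX

lemma measurable_uncurry : Measurable fun q : ℝ≥0 × Ω => X q.1 q.2 :=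
  measurable_uncurry_of_right_continuous hX.measurable hX.right_continuous

lemma measurable_jumpTime (n : ℕ) : Measurable fun ω => jumpTime (fun t => X t ω) n :=
  RepellingWalk.measurable_jumpTime hX.measurable_uncurry hX.right_continuous n

lemma measurable_jp (n : ℕ) : Measurable (jp X n) :=
  hX.measurable_uncurry.comp ((hX.measurable_jumpTime n).prodMk measurable_id)

lemma measurable_jt (n : ℕ) : Measurable (jt X n) :=
  measurable_coe_nnreal_real.comp (hX.measurable_jumpTime n)

lemma history_le (n : ℕ) : history X n ≤ mΩ := by
  refine Measurable.comap_le (measurable_pi_lambda _ fun i => ?_)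
  exact (hX.measurable_jumpTime i).prodMk (hX.measurable_jp i)

lemma measurable_rateArg (n : ℕ) (e : ℤˣ) : Measurable (rateArg X n e) := by
  have h : ∀ k, Measurable fun ω => localTime (fun t => X t ω) (jumpTime (fun t => X t ω) n) k := fun k =>
    (measurable_localTime hX.measurable_uncurry k).comp ((hX.measurable_jumpTime n).prodMk measurable_id)
  have h1 := measurable_eval_countable h (hX.measurable_jp n)
  have h2 := measurable_eval_countable h ((hX.measurable_jp n).add_const (e : ℤ))
  exact h1.sub h2

variable [hw : IsRate w]

/-- The law of the next jump, as the law of the competition between the clocks of the two edges at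
the position of the walk. -/
lemma measure_jump (n : ℕ) {B : Set Ω} (hB : MeasurableSet[history X n] B) (e : ℤˣ) (u : ℝ≥0) :
    P (B ∩ {ω | jt X n ω + u < jt X (n + 1) ω ∧ jp X (n + 1) ω = jp X n ω + (e : ℤ)})
      = ∫⁻ ω in B, (∫⁻ v in Ioi (u : ℝ), raceDensity w (rateArg X n e ω) (rateArg X n (-e) ω) v) ∂P := by
  have h := hX.jump_law n B hB e u
  have hset : {ω | jt X n ω + u < jt X (n + 1) ω ∧ jp X (n + 1) ω = jp X n ω + (e : ℤ)}
      = {ω | jumpTime (fun t => X t ω) n + u < jumpTime (fun t => X t ω) (n + 1) ∧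
        X (jumpTime (fun t => X t ω) (n + 1)) ω = X (jumpTime (fun t => X t ω) n) ω + (e : ℤ)} := by
    ext ω
    simp only [mem_ofPred_eq, jt, jp]
    refine and_congr_left fun _ => ?_
    exact_mod_cast Iff.rfl
  rw [hset, h]
  refine lintegral_congr fun ω => setLIntegral_congr_fun measurableSet_Ioi fun v _ => ?_
  have hr : ∀ e' y, jumpRate w (fun t => X t ω) n e' y = w (rateArg X n e' ω + y) := fun e' y => by
    rw [jumpRate, rateArg, jp]; congr 1; ring
  have hint : ∀ a, IntervalIntegrable (fun y => w (a + y)) volume 0 v := fun a =>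
    (show Monotone fun y => w (a + y) from fun y y' h => hw.mono (by linarith)).intervalIntegrable
  simp only [hr]
  rw [intervalIntegral.integral_add (hint _) (hint _), integral_rate_add, integral_rate_add, add_zero, add_zero,
    raceDensity]
  rcases Int.units_eq_one_or e with rfl | rfl
  · rfl
  · rw [neg_neg, add_comm (cumRate w (rateArg X n 1 ω + v) - _)]

omit hw in
/-- The event that the `(n + 1)`-st jump takes place and has the direction `e`. -/
lemma measurableSet_jump (n : ℕ) (e : ℤˣ) :
    MeasurableSet {ω | jt X n ω < jt X (n + 1) ω ∧ jp X (n + 1) ω = jp X n ω + (e : ℤ)} :=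
  measurableSet_and (measurableSet_lt (hX.measurable_jt _) (hX.measurable_jt _))
    (measurableSet_eq_fun (hX.measurable_jp _) ((hX.measurable_jp _).add_const _))

omit hX hw mΩ in
lemma disjoint_jump (n : ℕ) :
    Disjoint {ω | jt X n ω < jt X (n + 1) ω ∧ jp X (n + 1) ω = jp X n ω + ((1 : ℤˣ) : ℤ)}
      {ω | jt X n ω < jt X (n + 1) ω ∧ jp X (n + 1) ω = jp X n ω + ((-1 : ℤˣ) : ℤ)} := by
  refine disjoint_left.2 fun ω h1 h2 => ?_
  have h3 := h1.2.symm.trans h2.2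
  simp at h3

/-- The total mass of the densities of the next jump is `1`, so that almost surely there is always
a next jump, to a neighbour. -/
lemma ae_isSkeleton [IsProbabilityMeasure P] :
    ∀ᵐ ω ∂P, IsSkeleton (fun n => jt X n ω) (fun n => jp X n ω) := by
  have h : ∀ᵐ ω ∂P, ∀ n, jt X n ω < jt X (n + 1) ω ∧
      (jp X (n + 1) ω = jp X n ω + 1 ∨ jp X (n + 1) ω = jp X n ω - 1) := by
    refine ae_all_iff.2 fun n => ?_
    have hm := measure_union (μ := P) (disjoint_jump (X := X) n) (hX.measurableSet_jump n (-1))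
    have hu : ∀ e : ℤˣ, P {ω | jt X n ω < jt X (n + 1) ω ∧ jp X (n + 1) ω = jp X n ω + (e : ℤ)}
        = ∫⁻ ω, (∫⁻ v in Ioi (0 : ℝ), raceDensity w (rateArg X n e ω) (rateArg X n (-e) ω) v) ∂P := fun e => by
      have := hX.measure_jump n (B := univ) (@MeasurableSet.univ _ (history X n)) e 0
      simpa using this
    have hmeas : Measurable fun ω =>
        ∫⁻ v in Ioi (0 : ℝ), raceDensity w (rateArg X n 1 ω) (rateArg X n (-1) ω) v := by
      have h1 : Measurable fun q : Ω × ℝ => raceDensity w (rateArg X n 1 q.1) (rateArg X n (-1) q.1) q.2 :=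
        (measurable_raceDensity w).comp
          ((((hX.measurable_rateArg n 1).comp measurable_fst).prodMk
            ((hX.measurable_rateArg n (-1)).comp measurable_fst)).prodMk measurable_snd)
      exact h1.lintegral_prod_right'
    rw [hu, hu, neg_neg, ← lintegral_add_left hmeas] at hm
    simp only [lintegral_raceDensity_add, lintegral_one, measure_univ] at hm
    have hae := (prob_compl_eq_zero_iff ((hX.measurableSet_jump n 1).union (hX.measurableSet_jump n (-1)))).2 hm
    filter_upwards [compl_mem_ae_iff.2 hae] with ω hω
    rw [compl_compl] at hω
    rcases hω with hω | hω
    · exact ⟨hω.1, Or.inl (by simpa using hω.2)⟩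
    · exact ⟨hω.1, Or.inr (by have := hω.2; simp at this; lia)⟩
  filter_upwards [h] with ω hω
  exact ⟨by simp [jt, jumpTime], by simp [jp, jumpTime, hX.start], fun n => (hω n).1, fun n => (hω n).2⟩

end IsWalk

omit mΩ in
lemma isStepPath_jumpTime {ω : Ω} (h : IsSkeleton (fun n => jt X n ω) (fun n => jp X n ω)) :
    IsStepPath (fun t => X t ω) (fun n => jt X n ω) (fun n => jp X n ω) where
  zero := h.zero
  mono := monotone_nat_of_le_succ fun n => (h.lt n).le
  eq n t h1 h2 := by
    by_contra hne
    rcases eq_or_lt_of_le h1 with h3 | h3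
    · have : jumpTime (fun t => X t ω) n = t := NNReal.coe_injective h3
      exact hne (by rw [jp, this])
    · have h4 : jumpTime (fun t => X t ω) (n + 1) ≤ t :=
        csInf_le (OrderBot.bddBelow _) ⟨by exact_mod_cast h3, hne⟩
      have h5 : jt X (n + 1) ω ≤ t := by exact_mod_cast h4
      linarith

omit mΩ in
/-- At the jump times, the local times of the path are those of its skeleton. -/
lemma localTime_jumpTime {ω : Ω} (h : IsSkeleton (fun n => jt X n ω) (fun n => jp X n ω)) (n : ℕ) (k : ℤ) :
    localTime (fun t => X t ω) (jumpTime (fun t => X t ω) n) k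
      = occ (fun n => jt X n ω) (fun n => jp X n ω) n k := by
  have h1 := (isStepPath_jumpTime h).localTime_eq n (t := jumpTime (fun t => X t ω) n) le_rfl (h.lt n).le k
  rw [h1]
  have : ((jumpTime (fun t => X t ω) n : ℝ≥0) : ℝ) - jt X n ω = 0 := sub_self _
  rw [this, ite_self, add_zero]

omit mΩ in
/-- The jump to the right is governed by the clock of the edge to the right of the walk, and the
jump to the left by the one to the left. -/
lemma rateArg_one {ω : Ω} (h : IsSkeleton (fun n => jt X n ω) (fun n => jp X n ω)) (n : ℕ) :
    rateArg X n 1 ω = clock (fun n => jt X n ω) (fun n => jp X n ω) n (jp X n ω) := by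
  rw [rateArg, localTime_jumpTime h, localTime_jumpTime h, clock, side, if_neg (lt_irrefl _)]
  push_cast; ring

omit mΩ in
lemma rateArg_neg_one {ω : Ω} (h : IsSkeleton (fun n => jt X n ω) (fun n => jp X n ω)) (n : ℕ) :
    rateArg X n (-1) ω = clock (fun n => jt X n ω) (fun n => jp X n ω) n (jp X n ω - 1) := by
  rw [rateArg, localTime_jumpTime h, localTime_jumpTime h, clock, side, if_pos (by lia), sub_add_cancel]
  push_cast
  rw [one_mul, ← sub_eq_add_neg]

end

section

/-- Two finite measures on `α × ℝ` agree if they agree on the products with the right half-lines. -/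
lemma ext_prod_Ioi {α : Type*} [MeasurableSpace α] {μ ν : Measure (α × ℝ)} [IsFiniteMeasure μ]
    (huniv : μ univ = ν univ)
    (h : ∀ C : Set α, MeasurableSet C → ∀ u : ℝ, μ (C ×ˢ Ioi u) = ν (C ×ˢ Ioi u)) : μ = ν := by
  have hgen : (inferInstance : MeasurableSpace (α × ℝ))
      = MeasurableSpace.generateFrom (image2 (· ×ˢ ·) {s : Set α | MeasurableSet s} (range (Ioi : ℝ → Set ℝ))) := by
    rw [← generateFrom_prod_eq]
    · rw [MeasurableSpace.generateFrom_measurableSet, ← borel_eq_generateFrom_Ioi,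
        ← BorelSpace.measurable_eq (α := ℝ)]
    · exact isCountablySpanning_measurableSet
    · refine ⟨fun n : ℕ => Ioi (-(n : ℝ)), fun n => mem_range_self _, eq_univ_of_forall fun x => ?_⟩
      obtain ⟨n, hn⟩ := exists_nat_gt (-x)
      exact mem_iUnion.2 ⟨n, by rw [mem_Ioi]; linarith⟩
  refine ext_of_generate_finite _ hgen (MeasurableSpace.isPiSystem_measurableSet.prod isPiSystem_Ioi) ?_ huniv
  rintro _ ⟨C, hC, _, ⟨u, rfl⟩, rfl⟩
  exact h C hC u

end

section

variable {Ω : Type*} [mΩ : MeasurableSpace Ω] {w : ℝ → ℝ} {P : Measure Ω} [IsProbabilityMeasure P]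
  {X : ℝ≥0 → Ω → ℤ} (hX : IsWalk w P X) [hw : IsRate w]

include hX hw

omit [IsProbabilityMeasure P] in
lemma IsWalk.measurable_raceDensity (n : ℕ) (e : ℤˣ) : Measurable fun q : Ω × ℝ =>
    raceDensity w (rateArg X n e q.1) (rateArg X n (-e) q.1) q.2 :=
  (RepellingWalk.measurable_raceDensity w).comp
    ((((hX.measurable_rateArg n e).comp measurable_fst).prodMk
      ((hX.measurable_rateArg n (-e)).comp measurable_fst)).prodMk measurable_snd)

/-- The joint law of the past, the next holding time and the direction of the next jump. -/
lemma IsWalk.lintegral_step (n : ℕ) (e : ℤˣ) {α : Type*} [MeasurableSpace α] {ζ : Ω → α}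
    (hζ : Measurable[history X n] ζ) {F : α × ℝ → ℝ≥0∞} (hF : Measurable F) :
    ∫⁻ ω in {ω | jt X n ω < jt X (n + 1) ω ∧ jp X (n + 1) ω = jp X n ω + (e : ℤ)},
        F (ζ ω, jt X (n + 1) ω - jt X n ω) ∂P
      = ∫⁻ ω, (∫⁻ v in Ioi (0 : ℝ),
          raceDensity w (rateArg X n e ω) (rateArg X n (-e) ω) v * F (ζ ω, v)) ∂P := by
  obtain ⟨A, hA⟩ : ∃ A, A = {ω | jt X n ω < jt X (n + 1) ω ∧ jp X (n + 1) ω = jp X n ω + (e : ℤ)} := ⟨_, rfl⟩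
  have hAm : MeasurableSet A := hA ▸ hX.measurableSet_jump n e
  have hζm : Measurable ζ := hζ.mono (hX.history_le n) le_rfl
  have hm1 : Measurable fun ω => (ζ ω, jt X (n + 1) ω - jt X n ω) :=
    hζm.prodMk ((hX.measurable_jt _).sub (hX.measurable_jt _))
  have hm2 : Measurable fun q : Ω × ℝ => (ζ q.1, q.2) := (hζm.comp measurable_fst).prodMk measurable_snd
  have hd := hX.measurable_raceDensity n e
  have key : (P.restrict A).map (fun ω => (ζ ω, jt X (n + 1) ω - jt X n ω))
      = (((P.prod (volume.restrict (Ioi 0))).withDensity fun q =>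
          raceDensity w (rateArg X n e q.1) (rateArg X n (-e) q.1) q.2)).map fun q => (ζ q.1, q.2) := by
    have hR : ∀ C : Set α, MeasurableSet C → ∀ u : ℝ≥0,
        (((P.prod (volume.restrict (Ioi 0))).withDensity fun q =>
          raceDensity w (rateArg X n e q.1) (rateArg X n (-e) q.1) q.2)).map (fun q => (ζ q.1, q.2)) (C ×ˢ Ioi (u : ℝ))
        = P (ζ ⁻¹' C ∩ {ω | jt X n ω + u < jt X (n + 1) ω ∧ jp X (n + 1) ω = jp X n ω + (e : ℤ)}) := by
      intro C hC u
      rw [Measure.map_apply hm2 (hC.prod measurableSet_Ioi), hX.measure_jump n (hζ hC) e u]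
      have hpre : (fun q : Ω × ℝ => (ζ q.1, q.2)) ⁻¹' (C ×ˢ Ioi (u : ℝ)) = (ζ ⁻¹' C) ×ˢ Ioi (u : ℝ) := by
        ext q; simp
      rw [hpre, withDensity_apply _ ((hζm hC).prod measurableSet_Ioi), ← Measure.prod_restrict,
        Measure.restrict_restrict measurableSet_Ioi, inter_eq_left.2 (Ioi_subset_Ioi (show (0 : ℝ) ≤ u from u.2)),
        lintegral_prod _ hd.aemeasurable]
    have hL : ∀ C : Set α, MeasurableSet C → ∀ u : ℝ,
        (P.restrict A).map (fun ω => (ζ ω, jt X (n + 1) ω - jt X n ω)) (C ×ˢ Ioi u)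
        = P (ζ ⁻¹' C ∩ {ω | jt X n ω + u.toNNReal < jt X (n + 1) ω ∧ jp X (n + 1) ω = jp X n ω + (e : ℤ)}) := by
      intro C hC u
      rw [Measure.map_apply hm1 (hC.prod measurableSet_Ioi),
        Measure.restrict_apply (hm1 (hC.prod measurableSet_Ioi))]
      congr 1
      ext ω
      simp only [hA, mem_inter_iff, mem_preimage, mem_prod, mem_Ioi, mem_ofPred_eq, Real.coe_toNNReal']
      constructor
      · rintro ⟨⟨h1, h2⟩, h3, h4⟩
        exact ⟨h1, by rcases max_cases u 0 with h | h <;> linarith, h4⟩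
      · rintro ⟨h1, h2, h3⟩
        exact ⟨⟨h1, by linarith [le_max_left u 0]⟩, by linarith [le_max_right u 0], h3⟩
    have hneg : ∀ (C : Set α) (u : ℝ), MeasurableSet C → u ≤ 0 →
        (((P.prod (volume.restrict (Ioi 0))).withDensity fun q =>
          raceDensity w (rateArg X n e q.1) (rateArg X n (-e) q.1) q.2)).map (fun q => (ζ q.1, q.2)) (C ×ˢ Ioi u)
        = (((P.prod (volume.restrict (Ioi 0))).withDensity fun q =>
          raceDensity w (rateArg X n e q.1) (rateArg X n (-e) q.1) q.2)).map (fun q => (ζ q.1, q.2)) (C ×ˢ Ioi 0) := by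
      intro C u hC hu
      have hpre : ∀ u : ℝ, (fun q : Ω × ℝ => (ζ q.1, q.2)) ⁻¹' (C ×ˢ Ioi u) = (ζ ⁻¹' C) ×ˢ Ioi u := fun u => by
        ext q; simp
      rw [Measure.map_apply hm2 (hC.prod measurableSet_Ioi), Measure.map_apply hm2 (hC.prod measurableSet_Ioi),
        hpre, hpre, withDensity_apply _ ((hζm hC).prod measurableSet_Ioi),
        withDensity_apply _ ((hζm hC).prod measurableSet_Ioi), ← Measure.prod_restrict, ← Measure.prod_restrict,
        Measure.restrict_restrict measurableSet_Ioi, Measure.restrict_restrict measurableSet_Ioi, inter_self,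
        inter_eq_right.2 (Ioi_subset_Ioi hu)]
    have hall : ∀ C : Set α, MeasurableSet C → ∀ u : ℝ,
        (P.restrict A).map (fun ω => (ζ ω, jt X (n + 1) ω - jt X n ω)) (C ×ˢ Ioi u)
        = (((P.prod (volume.restrict (Ioi 0))).withDensity fun q =>
          raceDensity w (rateArg X n e q.1) (rateArg X n (-e) q.1) q.2)).map (fun q => (ζ q.1, q.2)) (C ×ˢ Ioi u) := by
      intro C hC u
      rw [hL C hC u]
      rcases le_total u 0 with hu | hu
      · rw [hneg C u hC hu, Real.toNNReal_of_nonpos hu, ← hR C hC 0]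
        rfl
      · rw [← hR C hC u.toNNReal, Real.coe_toNNReal u hu]
    refine ext_prod_Ioi ?_ hall
    have h0 := hall univ MeasurableSet.univ (-1)
    have hpre : (fun q : Ω × ℝ => (ζ q.1, q.2)) ⁻¹' (univ ×ˢ Ioi (-1 : ℝ)) = univ ×ˢ Ioi (-1 : ℝ) := by
      ext q; simp
    have h1 : (P.restrict A).map (fun ω => (ζ ω, jt X (n + 1) ω - jt X n ω)) univ
        = (P.restrict A).map (fun ω => (ζ ω, jt X (n + 1) ω - jt X n ω)) (univ ×ˢ Ioi (-1)) := by
      rw [Measure.map_apply hm1 MeasurableSet.univ, Measure.map_apply hm1 (MeasurableSet.univ.prod measurableSet_Ioi),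
        Measure.restrict_apply (hm1 MeasurableSet.univ),
        Measure.restrict_apply (hm1 (MeasurableSet.univ.prod measurableSet_Ioi))]
      congr 1
      ext ω
      simp only [hA, preimage_univ, mem_inter_iff, mem_univ, true_and, mem_preimage, mem_prod, mem_Ioi, mem_ofPred_eq]
      constructor
      · intro h; exact ⟨by linarith [h.1], h⟩
      · intro h; exact h.2
    rw [h1, h0, Measure.map_apply hm2 MeasurableSet.univ,
      Measure.map_apply hm2 (MeasurableSet.univ.prod measurableSet_Ioi), hpre, preimage_univ,
      withDensity_apply _ MeasurableSet.univ, withDensity_apply _ (MeasurableSet.univ.prod measurableSet_Ioi),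
      ← univ_prod_univ, ← Measure.prod_restrict, ← Measure.prod_restrict,
      Measure.restrict_restrict measurableSet_Ioi, inter_eq_right.2 (Ioi_subset_Ioi (by norm_num)),
      Measure.restrict_univ, Measure.restrict_univ]
  rw [← hA]
  have hF' : Measurable fun q : Ω × ℝ => F (ζ q.1, q.2) := hF.comp hm2
  have e1 : ∫⁻ ω in A, F (ζ ω, jt X (n + 1) ω - jt X n ω) ∂P
      = ∫⁻ y, F y ∂((P.restrict A).map fun ω => (ζ ω, jt X (n + 1) ω - jt X n ω)) := by
    rw [lintegral_map hF hm1]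
  rw [e1, key, lintegral_map hF hm2, lintegral_withDensity_eq_lintegral_mul _ hd hF',
    lintegral_prod _ (hd.mul hF').aemeasurable]
  rfl

end

/-! ### Arrays of independent exponential variables -/

/-- The law of independent standard exponential variables, a sequence for each edge. -/
def expArrayMeasure : Measure (ℤ → ℕ → ℝ) := Measure.infinitePi fun _ => expSeqMeasure

instance : IsProbabilityMeasure expArrayMeasure := by unfold expArrayMeasure; infer_instance

lemma expArrayMeasure_eq : expArrayMeasure
    = (Measure.infinitePi fun _ : ℤ × ℕ => expMeasure 1).map (MeasurableEquiv.curry ℤ ℕ ℝ) :=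
  (Measure.infinitePi_map_curry fun (_ : ℤ) (_ : ℕ) => expMeasure 1).symm

lemma expArrayMeasure_box (F : Finset (ℤ × ℕ)) {t : ℤ × ℕ → Set ℝ} (ht : ∀ q, MeasurableSet (t q)) :
    expArrayMeasure {γ | ∀ q ∈ F, γ q.1 q.2 ∈ t q} = ∏ q ∈ F, expMeasure 1 (t q) := by
  have hms : MeasurableSet {γ : ℤ → ℕ → ℝ | ∀ q ∈ F, γ q.1 q.2 ∈ t q} := by
    have : {γ : ℤ → ℕ → ℝ | ∀ q ∈ F, γ q.1 q.2 ∈ t q} = ⋂ q ∈ F, {γ | γ q.1 q.2 ∈ t q} := by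
      ext γ; simp
    rw [this]
    refine Finset.measurableSet_biInter _ fun q _ => ?_
    exact ((measurable_pi_apply q.2).comp (measurable_pi_apply q.1)) (ht q)
  rw [expArrayMeasure_eq, Measure.map_apply (MeasurableEquiv.measurable _) hms,
    ← Measure.infinitePi_pi (fun _ : ℤ × ℕ => expMeasure 1) fun q _ => ht q]
  rfl

lemma expMeasure_Ioi_sub (b a : ℝ) : expMeasure 1 (Ioi (b - a)) = residual b a := by
  rcases le_total 0 (b - a) with h | h
  · rw [expMeasure_Ioi h, residual, max_eq_left h]
  · rw [residual, max_eq_right h, neg_zero, Real.exp_zero, ENNReal.ofReal_one,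
      ← prob_compl_eq_zero_iff measurableSet_Ioi, compl_Ioi]
    exact measure_mono_null (Iic_subset_Iic.2 h) expMeasure_Iic_zero

/-- The variables `E k j` are independent and standard exponential. -/
structure IsExpArray {Ω : Type*} [MeasurableSpace Ω] (P : Measure Ω) (E : ℤ → ℕ → Ω → ℝ) : Prop where
  measurable : ∀ k j, Measurable (E k j)
  map_eq : P.map (fun ω k j => E k j ω) = expArrayMeasure

section

variable {Ω : Type*} [mΩ : MeasurableSpace Ω] {P : Measure Ω} [IsProbabilityMeasure P] {E : ℤ → ℕ → Ω → ℝ}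

omit [IsProbabilityMeasure P] in
lemma IsExpArray.measurable_array (h : IsExpArray P E) : Measurable fun ω k j => E k j ω :=
  measurable_pi_lambda _ fun k => measurable_pi_lambda _ fun j => h.measurable k j

/-- The half-lines determine the joint law. -/
lemma isExpArray_of_tail (hm : ∀ k j, Measurable (E k j))
    (h : ∀ (F : Finset (ℤ × ℕ)) (b : ℤ × ℕ → ℝ),
      P {ω | ∀ q ∈ F, b q < E q.1 q.2 ω} = ∏ q ∈ F, residual (b q) 0) : IsExpArray P E := by
  refine ⟨hm, ?_⟩
  have h1 : ∀ (q : ℤ × ℕ) (b : ℝ), P (E q.1 q.2 ⁻¹' Ioi b) = residual b 0 := fun q b => by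
    have h2 := h {q} fun _ => b
    simp only [Finset.mem_singleton, forall_eq, Finset.prod_singleton] at h2
    exact h2
  have hlaw : ∀ q : ℤ × ℕ, P.map (E q.1 q.2) = expMeasure 1 := fun q => by
    have : IsProbabilityMeasure (P.map (E q.1 q.2)) := Measure.isProbabilityMeasure_map (hm _ _).aemeasurable
    refine ext_of_generate_finite _ (borel_eq_generateFrom_Ioi ℝ ▸ BorelSpace.measurable_eq) isPiSystem_Ioi ?_ (by simp)
    rintro _ ⟨b, rfl⟩
    rw [Measure.map_apply (hm _ _) measurableSet_Ioi, h1, ← expMeasure_Ioi_sub, sub_zero]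
  have hind : iIndepFun (fun (q : ℤ × ℕ) => E q.1 q.2) P := by
    refine iIndepSets.iIndep (fun q => (hm q.1 q.2).comap_le)
      (fun q => preimage (E q.1 q.2) '' range Ioi) (fun q => ?_) (fun q => ?_) ?_
    · exact (isPiSystem_Ioi (α := ℝ)).comap (E q.1 q.2)
    · rw [← MeasurableSpace.comap_generateFrom, ← borel_eq_generateFrom_Ioi, ← BorelSpace.measurable_eq (α := ℝ)]
    · rw [iIndepSets_iff]
      intro F f hf
      choose! b hb using fun q hq => hf q hq
      have hb' : ∀ q ∈ F, ∃ a : ℝ, E q.1 q.2 ⁻¹' Ioi a = f q := fun q hq => by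
        obtain ⟨⟨a, ha⟩, h2⟩ := hb q hq
        exact ⟨a, by rw [← h2, ← ha]⟩
      choose! a ha using hb'
      have e1 : ⋂ q ∈ F, f q = {ω | ∀ q ∈ F, a q < E q.1 q.2 ω} := by
        ext ω
        simp only [mem_iInter, mem_ofPred_eq]
        refine forall₂_congr fun q hq => ?_
        rw [← ha q hq]; rfl
      rw [e1, h]
      refine Finset.prod_congr rfl fun q hq => ?_
      rw [← ha q hq, h1]
  have hmap := (iIndepFun_iff_map_fun_eq_infinitePi_map fun q : ℤ × ℕ => hm q.1 q.2).1 hind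
  simp only [hlaw] at hmap
  have hmq : Measurable fun ω (q : ℤ × ℕ) => E q.1 q.2 ω := measurable_pi_lambda _ fun q => hm q.1 q.2
  rw [expArrayMeasure_eq, ← hmap]
  exact (Measure.map_map (μ := P) (MeasurableEquiv.curry ℤ ℕ ℝ).measurable hmq).symm

namespace IsExpArray

variable (h : IsExpArray P E)

include h

omit [IsProbabilityMeasure P] in
lemma map_row (k : ℤ) : P.map (fun ω j => E k j ω) = expSeqMeasure := by
  have h1 : (fun ω j => E k j ω) = (fun γ : ℤ → ℕ → ℝ => γ k) ∘ fun ω k j => E k j ω := rfl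
  rw [h1, ← Measure.map_map (measurable_pi_apply k) h.measurable_array, h.map_eq, expArrayMeasure]
  exact Measure.infinitePi_map_eval _ k

lemma indep : iIndepFun (fun (k : ℤ) ω (j : ℕ) => E k j ω) P := by
  rw [iIndepFun_iff_map_fun_eq_infinitePi_map fun k => measurable_pi_lambda _ fun j => h.measurable k j, h.map_eq,
    expArrayMeasure]
  congr 1
  ext1 k
  exact (h.map_row k).symm

lemma isExpSeq (k : ℤ) : IsExpSeq P (E k) where
  measurable := h.measurable k
  indep := by
    have h1 := isExpSeq_expSeqMeasure.indep
    rw [← h.map_row k] at h1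
    have hrow : Measurable fun ω j => E k j ω := measurable_pi_lambda _ fun j => h.measurable k j
    rw [iIndepFun_iff_map_fun_eq_infinitePi_map (h.measurable k), h.map_row k, expSeqMeasure]
    congr 1
    ext1 j
    have h2 : E k j = (fun e : ℕ → ℝ => e j) ∘ fun ω j => E k j ω := rfl
    rw [h2, ← Measure.map_map (measurable_pi_apply j) hrow, h.map_row k]
    exact (isExpSeq_expSeqMeasure.law j).symm
  law j := by
    have hrow : Measurable fun ω j => E k j ω := measurable_pi_lambda _ fun j => h.measurable k j
    have h2 : E k j = (fun e : ℕ → ℝ => e j) ∘ fun ω j => E k j ω := rfl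
    rw [h2, ← Measure.map_map (measurable_pi_apply j) hrow, h.map_row k]
    exact isExpSeq_expSeqMeasure.law j

end IsExpArray

lemma isExpArray_expArrayMeasure : IsExpArray expArrayMeasure fun k j γ => γ k j where
  measurable k j := (measurable_pi_apply j).comp (measurable_pi_apply k)
  map_eq := Measure.map_id

end

/-! ### The exponential variables of the walk -/

/-- The exponential variable which corresponds to the `(j + 1)`-st crossing of the edge `⟨k, k+1⟩`,
provided that this is one of the first `n` jumps. -/
def expVar (w : ℝ → ℝ) (S : ℕ → ℝ) (p : ℕ → ℤ) (n : ℕ) (k : ℤ) (j : ℕ) : ℝ :=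
  cumRate w (switchPt S p n k (j + 1)) - cumRate w (-switchPt S p n k j)

/-- The part of the exponential variable of the next crossing of the edge `⟨k, k+1⟩` which elapsed
until the `n`-th jump. -/
def age (w : ℝ → ℝ) (S : ℕ → ℝ) (p : ℕ → ℤ) (n : ℕ) (k : ℤ) : ℝ :=
  cumRate w (clock S p n k) - cumRate w (-switchPt S p n k (crossed p n k))

/-- The conditional probability that the exponential variable of a crossing is larger than `b`,
given the first `n` jumps. -/
def tailProb (w : ℝ → ℝ) (S : ℕ → ℝ) (p : ℕ → ℤ) (n : ℕ) (k : ℤ) (j : ℕ) (b : ℝ) : ℝ≥0∞ :=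
  if j < crossed p n k then (if b < expVar w S p n k j then 1 else 0)
  else residual b (if j = crossed p n k then age w S p n k else 0)

section

variable {w : ℝ → ℝ} {S : ℕ → ℝ} {p : ℕ → ℤ}

lemma expVar_stable {n m : ℕ} (hnm : n ≤ m) {k : ℤ} {j : ℕ} (hj : j < crossed p n k) :
    expVar w S p m k j = expVar w S p n k j := by
  rw [expVar, expVar, switchPt_stable S p hnm k hj, switchPt_stable S p hnm k hj.le]

lemma tailProb_succ_of_stay {n : ℕ} {k : ℤ} (hc : k < p n ↔ k < p (n + 1)) (j : ℕ) (b : ℝ) :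
    tailProb w S p (n + 1) k j b = if j = crossed p n k then
      residual b (cumRate w (preClock S p n k) - cumRate w (-switchPt S p n k (crossed p n k)))
      else tailProb w S p n k j b := by
  have hcr : crossed p (n + 1) k = crossed p n k := by rw [crossed_succ, if_pos hc, add_zero]
  rw [tailProb, tailProb, hcr]
  by_cases h1 : j = crossed p n k
  · rw [if_neg (by lia), if_pos h1, if_pos h1, age, clock_succ, if_pos hc, hcr,
      switchPt_stable S p (Nat.le_succ n) k le_rfl]
  · rw [if_neg h1, if_neg h1, if_neg h1]
    by_cases h2 : j < crossed p n k
    · rw [if_pos h2, if_pos h2, expVar_stable (Nat.le_succ n) h2]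
    · rw [if_neg h2, if_neg h2]

lemma tailProb_succ_of_crossing {n : ℕ} {k : ℤ} (hc : ¬(k < p n ↔ k < p (n + 1))) (j : ℕ) (b : ℝ) :
    tailProb w S p (n + 1) k j b = if j = crossed p n k then
      (if b < cumRate w (preClock S p n k) - cumRate w (-switchPt S p n k (crossed p n k)) then 1 else 0)
      else tailProb w S p n k j b := by
  have hcr : crossed p (n + 1) k = crossed p n k + 1 := by rw [crossed_succ, if_neg hc]
  rw [tailProb, tailProb, hcr]
  by_cases h1 : j = crossed p n k
  · rw [if_pos (by lia), if_pos h1, expVar, h1, switchPt_of_crossing S hc,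
      switchPt_stable S p (Nat.le_succ n) k le_rfl]
  · rw [if_neg h1, if_neg h1]
    by_cases h2 : j < crossed p n k
    · rw [if_pos h2, if_pos (by lia), expVar_stable (Nat.le_succ n) h2]
    · rw [if_neg h2, if_neg (by lia)]
      by_cases h3 : j = crossed p n k + 1
      · rw [if_pos h3, age, clock_succ, if_neg hc, hcr, switchPt_of_crossing S hc, sub_self]
      · rw [if_neg h3]

lemma residual_age (n : ℕ) (k : ℤ) (b v : ℝ) :
    residual b (cumRate w (clock S p n k + v) - cumRate w (-switchPt S p n k (crossed p n k)))
      = residual (b - age w S p n k) (cumRate w (clock S p n k + v) - cumRate w (clock S p n k)) := by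
  rw [residual, residual, age]; congr 4; ring

/-- The factor of an edge which is not adjacent to the position of the walk does not change. -/
lemma tailProb_succ_of_far {n : ℕ} (hstep : p (n + 1) = p n + 1 ∨ p (n + 1) = p n - 1) {k : ℤ}
    (h1 : p n ≠ k) (h2 : p n ≠ k + 1) (j : ℕ) (b : ℝ) :
    tailProb w S p (n + 1) k j b = tailProb w S p n k j b := by
  rw [tailProb_succ_of_stay (by rcases hstep with h | h <;> rw [h] <;> lia)]
  split_ifs with hj
  · rw [preClock, if_neg (not_or.2 ⟨h1, h2⟩), add_zero, tailProb, if_neg (by lia), if_pos hj, age]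
  · rfl

lemma prod_split {ι : Type*} [DecidableEq ι] (F : Finset ι) (f : ι → ℝ≥0∞) {a b : ι} (hab : a ≠ b) :
    ∏ q ∈ F, f q = (∏ q ∈ F, if q = a ∨ q = b then 1 else f q)
      * ((if a ∈ F then f a else 1) * (if b ∈ F then f b else 1)) := by
  have h : ∀ a, (if a ∈ F then f a else 1) = ∏ q ∈ F, if a = q then f q else 1 := fun a => by
    rw [Finset.prod_ite_eq F a]
  rw [h a, h b, ← Finset.prod_mul_distrib, ← Finset.prod_mul_distrib]
  refine Finset.prod_congr rfl fun q _ => ?_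
  by_cases h1 : q = a
  · subst h1; simp [hab.symm]
  · by_cases h2 : q = b
    · subst h2; simp [hab]
    · simp [h1, h2, Ne.symm h1, Ne.symm h2]

/-- The threshold for the residual part of the current exponential variable of the edge
`⟨k, k+1⟩`. The value `-1` makes the corresponding factor equal to `1` if the variable does not
occur in `F`. -/
def threshold (w : ℝ → ℝ) (F : Finset (ℤ × ℕ)) (b : ℤ × ℕ → ℝ) (S : ℕ → ℝ) (p : ℕ → ℤ) (n : ℕ) (k : ℤ) : ℝ :=
  if (k, crossed p n k) ∈ F then b (k, crossed p n k) - age w S p n k else -1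

/-- The product of the factors which do not change in the next jump. -/
def restProb (w : ℝ → ℝ) (F : Finset (ℤ × ℕ)) (b : ℤ × ℕ → ℝ) (S : ℕ → ℝ) (p : ℕ → ℤ) (n : ℕ) : ℝ≥0∞ :=
  ∏ q ∈ F, if (p n = q.1 ∨ p n = q.1 + 1) ∧ q.2 = crossed p n q.1 then 1 else tailProb w S p n q.1 q.2 (b q)

lemma residual_of_lt {b a : ℝ} (h : b ≤ a) : residual b a = 1 := by
  rw [residual, max_eq_right (by linarith), neg_zero, Real.exp_zero, ENNReal.ofReal_one]

/-- A jump only changes the factors of the current variables of the two edges at the position of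
the walk. -/
lemma prod_adjacent (F : Finset (ℤ × ℕ)) (b : ℤ × ℕ → ℝ) (n : ℕ) (f : ℤ × ℕ → ℝ≥0∞)
    (hf : ∀ q ∈ F, ¬((p n = q.1 ∨ p n = q.1 + 1) ∧ q.2 = crossed p n q.1) →
      f q = tailProb w S p n q.1 q.2 (b q)) :
    ∏ q ∈ F, f q = restProb w F b S p n *
      ((if (p n, crossed p n (p n)) ∈ F then f (p n, crossed p n (p n)) else 1)
      * (if (p n - 1, crossed p n (p n - 1)) ∈ F then f (p n - 1, crossed p n (p n - 1)) else 1)) := by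
  rw [prod_split F f (a := (p n, crossed p n (p n))) (b := (p n - 1, crossed p n (p n - 1)))
    (fun h' => by have := congrArg Prod.fst h'; simp only at this; lia), restProb]
  congr 1
  refine Finset.prod_congr rfl fun q hq => ?_
  have hiff : (q = (p n, crossed p n (p n)) ∨ q = (p n - 1, crossed p n (p n - 1)))
      ↔ ((p n = q.1 ∨ p n = q.1 + 1) ∧ q.2 = crossed p n q.1) := by
    obtain ⟨k, j⟩ := q
    simp only [Prod.mk.injEq]
    constructor
    · rintro (⟨rfl, rfl⟩ | ⟨rfl, rfl⟩)
      · exact ⟨Or.inl rfl, rfl⟩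
      · exact ⟨Or.inr (by ring), rfl⟩
    · rintro ⟨h | h, h2⟩
      · exact Or.inl ⟨h.symm, by rw [h2, h]⟩
      · have h3 : p n - 1 = k := by lia
        exact Or.inr ⟨h3.symm, by rw [h2, h3]⟩
  by_cases h : (p n = q.1 ∨ p n = q.1 + 1) ∧ q.2 = crossed p n q.1
  · rw [if_pos (hiff.2 h), if_pos h]
  · rw [if_neg (hiff.not.2 h), if_neg h, hf q hq h]

/-- The conditional probability before the jump, as a constant times the tail probabilities of the
two competing clocks. -/
lemma prod_tailProb (F : Finset (ℤ × ℕ)) (b : ℤ × ℕ → ℝ) (n : ℕ) :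
    ∏ q ∈ F, tailProb w S p n q.1 q.2 (b q) = restProb w F b S p n *
      (residual (threshold w F b S p n (p n)) 0 * residual (threshold w F b S p n (p n - 1)) 0) := by
  rw [prod_adjacent F b n (fun q => tailProb w S p n q.1 q.2 (b q)) fun q _ _ => rfl]
  have h : ∀ k : ℤ, (if (k, crossed p n k) ∈ F then tailProb w S p n k (crossed p n k) (b (k, crossed p n k)) else 1)
      = residual (threshold w F b S p n k) 0 := fun k => by
    rw [threshold]
    split_ifs
    · rw [tailProb, if_neg (lt_irrefl _), if_pos rfl, residual, residual, sub_zero]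
    · rw [residual_of_lt (by norm_num)]
  rw [h, h]

end

section

variable {w : ℝ → ℝ} [hw : IsRate w] {S : ℕ → ℝ} {p : ℕ → ℤ} (h : IsSkeleton S p)

include h

/-- The effect of one jump across the edge `⟨k₁, k₁+1⟩`, if `⟨k₂, k₂+1⟩` is the other edge at the
position of the walk. -/
lemma IsSkeleton.tailProb_succ (n : ℕ) {k₁ k₂ : ℤ} (hk₁ : p n = k₁ ∨ p n = k₁ + 1) (hk₂ : p n = k₂ ∨ p n = k₂ + 1)
    (h1 : ¬(k₁ < p n ↔ k₁ < p (n + 1))) (h2 : k₂ < p n ↔ k₂ < p (n + 1)) (F : Finset (ℤ × ℕ)) (b : ℤ × ℕ → ℝ) :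
    (if (k₁, crossed p n k₁) ∈ F then tailProb w S p (n + 1) k₁ (crossed p n k₁) (b (k₁, crossed p n k₁)) else 1)
      = (if threshold w F b S p n k₁ < cumRate w (clock S p n k₁ + (S (n + 1) - S n)) - cumRate w (clock S p n k₁)
        then 1 else 0) ∧
    (if (k₂, crossed p n k₂) ∈ F then tailProb w S p (n + 1) k₂ (crossed p n k₂) (b (k₂, crossed p n k₂)) else 1)
      = residual (threshold w F b S p n k₂)
        (cumRate w (clock S p n k₂ + (S (n + 1) - S n)) - cumRate w (clock S p n k₂)) := by
  have hpre : ∀ k, (p n = k ∨ p n = k + 1) → preClock S p n k = clock S p n k + (S (n + 1) - S n) :=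
    fun k hk => by rw [preClock, if_pos hk]
  have hpos : ∀ k, -1 < cumRate w (clock S p n k + (S (n + 1) - S n)) - cumRate w (clock S p n k) := fun k => by
    have := (strictMono_cumRate w).monotone
      (show clock S p n k ≤ clock S p n k + (S (n + 1) - S n) by linarith [h.lt n])
    linarith
  constructor
  · rw [threshold]
    by_cases hF : (k₁, crossed p n k₁) ∈ F
    · rw [if_pos hF, if_pos hF, tailProb_succ_of_crossing h1, if_pos rfl, hpre _ hk₁, age]
      congr 1
      rw [eq_iff_iff]
      constructor <;> intro <;> linarith
    · rw [if_neg hF, if_neg hF, if_pos (hpos _)]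
  · rw [threshold]
    by_cases hF : (k₂, crossed p n k₂) ∈ F
    · rw [if_pos hF, if_pos hF, tailProb_succ_of_stay h2, if_pos rfl, hpre _ hk₂, residual_age]
    · rw [if_neg hF, if_neg hF, residual_of_lt (hpos _).le]

omit hw in
/-- The conditional probability after the jump: only the two current variables at the position of
the walk have got new factors. -/
lemma IsSkeleton.prod_tailProb_succ (n : ℕ) (F : Finset (ℤ × ℕ)) (b : ℤ × ℕ → ℝ) :
    ∏ q ∈ F, tailProb w S p (n + 1) q.1 q.2 (b q) = restProb w F b S p n *
      ((if (p n, crossed p n (p n)) ∈ F then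
          tailProb w S p (n + 1) (p n) (crossed p n (p n)) (b (p n, crossed p n (p n))) else 1)
      * (if (p n - 1, crossed p n (p n - 1)) ∈ F then
          tailProb w S p (n + 1) (p n - 1) (crossed p n (p n - 1)) (b (p n - 1, crossed p n (p n - 1))) else 1)) := by
  refine prod_adjacent F b n (fun q => tailProb w S p (n + 1) q.1 q.2 (b q)) fun q _ hq => ?_
  by_cases hadj : p n = q.1 ∨ p n = q.1 + 1
  · have hne : q.2 ≠ crossed p n q.1 := fun h' => hq ⟨hadj, h'⟩
    by_cases hc : q.1 < p n ↔ q.1 < p (n + 1)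
    · rw [tailProb_succ_of_stay hc, if_neg hne]
    · rw [tailProb_succ_of_crossing hc, if_neg hne]
  · rw [not_or] at hadj
    exact tailProb_succ_of_far (h.step n) hadj.1 hadj.2 _ _

end

section

variable {Ω : Type*} {𝒢 : MeasurableSpace Ω} {S : ℕ → Ω → ℝ} {p : ℕ → Ω → ℤ} {n : ℕ}
  (w : ℝ → ℝ) [hw : IsRate w]

lemma measurable_expVar (hS : ∀ i ≤ n, Measurable[𝒢] (S i)) (hp : ∀ i ≤ n, Measurable[𝒢] (p i)) (k : ℤ)
    (j : ℕ) : Measurable[𝒢] fun ω => expVar w (fun i => S i ω) (fun i => p i ω) n k j :=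
  ((measurable_cumRate w).comp (measurable_switchPt hS hp k (j + 1))).sub
    ((measurable_cumRate w).comp (measurable_switchPt hS hp k j).neg)

lemma measurable_age (hS : ∀ i ≤ n, Measurable[𝒢] (S i)) (hp : ∀ i ≤ n, Measurable[𝒢] (p i)) (k : ℤ) :
    Measurable[𝒢] fun ω => age w (fun i => S i ω) (fun i => p i ω) n k :=
  ((measurable_cumRate w).comp (measurable_clock hS hp k)).sub
    ((measurable_cumRate w).comp (measurable_eval_countable (fun j => measurable_switchPt hS hp k j)
      (measurable_crossed hp k)).neg)

lemma measurable_tailProb (hS : ∀ i ≤ n, Measurable[𝒢] (S i)) (hp : ∀ i ≤ n, Measurable[𝒢] (p i)) (k : ℤ)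
    (j : ℕ) (b : ℝ) : Measurable[𝒢] fun ω => tailProb w (fun i => S i ω) (fun i => p i ω) n k j b := by
  refine Measurable.ite (measurableSet_lt measurable_const (measurable_crossed hp k))
    (Measurable.ite (measurableSet_lt measurable_const (measurable_expVar w hS hp k j)) measurable_const
      measurable_const) ?_
  have h : Measurable[𝒢] fun ω => ((b, if j = crossed (fun i => p i ω) n k
      then age w (fun i => S i ω) (fun i => p i ω) n k else 0) : ℝ × ℝ) :=
    measurable_const.prodMk (Measurable.ite (measurableSet_eq_fun measurable_const (measurable_crossed hp k))
      (measurable_age w hS hp k) measurable_const)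
  exact measurable_residual.comp h

lemma measurable_threshold (F : Finset (ℤ × ℕ)) (b : ℤ × ℕ → ℝ) (hS : ∀ i ≤ n, Measurable[𝒢] (S i))
    (hp : ∀ i ≤ n, Measurable[𝒢] (p i)) (k : ℤ) :
    Measurable[𝒢] fun ω => threshold w F b (fun i => S i ω) (fun i => p i ω) n k := by
  have hc : Measurable[𝒢] fun ω => (k, crossed (fun i => p i ω) n k) :=
    measurable_const.prodMk (measurable_crossed hp k)
  refine Measurable.ite (hc (F.measurableSet)) (Measurable.sub ?_ (measurable_age w hS hp k)) measurable_const
  exact (measurable_of_countable b).comp hc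

lemma measurable_restProb (F : Finset (ℤ × ℕ)) (b : ℤ × ℕ → ℝ) (hS : ∀ i ≤ n, Measurable[𝒢] (S i))
    (hp : ∀ i ≤ n, Measurable[𝒢] (p i)) :
    Measurable[𝒢] fun ω => restProb w F b (fun i => S i ω) (fun i => p i ω) n := by
  refine Finset.measurable_fun_prod _ fun q _ => ?_
  have hc : MeasurableSet[𝒢] {ω | (p n ω = q.1 ∨ p n ω = q.1 + 1) ∧ q.2 = crossed (fun i => p i ω) n q.1} :=
    measurableSet_and ((measurableSet_eq_fun (hp n le_rfl) measurable_const).union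
      (measurableSet_eq_fun (hp n le_rfl) measurable_const))
      (measurableSet_eq_fun measurable_const (measurable_crossed hp q.1))
  exact Measurable.ite hc measurable_const (measurable_tailProb w hS hp _ _ _)

end

section

variable {Ω : Type*} [mΩ : MeasurableSpace Ω] {w : ℝ → ℝ} {P : Measure Ω} [IsProbabilityMeasure P]
  {X : ℝ≥0 → Ω → ℤ} (hX : IsWalk w P X) [hw : IsRate w]

include hX hw

/-- The conditional probabilities of the event that the exponential variables are larger than given
numbers are a martingale. -/
lemma IsWalk.lintegral_tailProb_succ (F : Finset (ℤ × ℕ)) (b : ℤ × ℕ → ℝ) (n : ℕ) :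
    ∫⁻ ω, ∏ q ∈ F, tailProb w (fun i => jt X i ω) (fun i => jp X i ω) (n + 1) q.1 q.2 (b q) ∂P
      = ∫⁻ ω, ∏ q ∈ F, tailProb w (fun i => jt X i ω) (fun i => jp X i ω) n q.1 q.2 (b q) ∂P := by
  have hS : ∀ i ≤ n, Measurable[history X n] (jt X i) := fun i hi => measurable_history_jt X hi
  have hp : ∀ i ≤ n, Measurable[history X n] (jp X i) := fun i hi => measurable_history_jp X hi
  have hpn := hp n le_rfl
  have hpn' : Measurable[history X n] fun ω => jp X n ω - 1 := hpn.sub_const 1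
  -- everything the next step depends on
  obtain ⟨ζ, hζdef⟩ : ∃ ζ : Ω → ℝ≥0∞ × (ℝ × ℝ) × ℝ × ℝ, ζ = fun ω =>
    (restProb w F b (fun i => jt X i ω) (fun i => jp X i ω) n,
      (threshold w F b (fun i => jt X i ω) (fun i => jp X i ω) n (jp X n ω),
        threshold w F b (fun i => jt X i ω) (fun i => jp X i ω) n (jp X n ω - 1)),
      clock (fun i => jt X i ω) (fun i => jp X i ω) n (jp X n ω),
      clock (fun i => jt X i ω) (fun i => jp X i ω) n (jp X n ω - 1)) := ⟨_, rfl⟩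
  have hζ : Measurable[history X n] ζ := by
    rw [hζdef]
    exact (measurable_restProb w F b hS hp).prodMk
      (((measurable_eval_countable (fun k => measurable_threshold w F b hS hp k) hpn).prodMk
        (measurable_eval_countable (fun k => measurable_threshold w F b hS hp k) hpn')).prodMk
      ((measurable_eval_countable (fun k => measurable_clock hS hp k) hpn).prodMk
        (measurable_eval_countable (fun k => measurable_clock hS hp k) hpn')))
  have hind : ∀ {f g : (ℝ≥0∞ × (ℝ × ℝ) × ℝ × ℝ) × ℝ → ℝ}, Measurable f → Measurable g →
      Measurable fun q => if f q < g q then (1 : ℝ≥0∞) else 0 := fun hf hg =>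
    Measurable.ite (measurableSet_lt hf hg) measurable_const measurable_const
  have hG := measurable_cumRate w
  have hres : ∀ {f g : (ℝ≥0∞ × (ℝ × ℝ) × ℝ × ℝ) × ℝ → ℝ}, Measurable f → Measurable g →
      Measurable fun q => residual (f q) (g q) := fun hf hg => measurable_residual.comp (hf.prodMk hg)
  -- the product after the jump, on the event that the edge to the right is crossed
  obtain ⟨F1, hF1⟩ : ∃ F1 : (ℝ≥0∞ × (ℝ × ℝ) × ℝ × ℝ) × ℝ → ℝ≥0∞, F1 = fun q => q.1.1 *
    ((if q.1.2.1.1 < cumRate w (q.1.2.2.1 + q.2) - cumRate w q.1.2.2.1 then 1 else 0)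
      * residual q.1.2.1.2 (cumRate w (q.1.2.2.2 + q.2) - cumRate w q.1.2.2.2)) := ⟨_, rfl⟩
  -- the same on the event that the edge to the left is crossed
  obtain ⟨F2, hF2⟩ : ∃ F2 : (ℝ≥0∞ × (ℝ × ℝ) × ℝ × ℝ) × ℝ → ℝ≥0∞, F2 = fun q => q.1.1 *
    ((if q.1.2.1.2 < cumRate w (q.1.2.2.2 + q.2) - cumRate w q.1.2.2.2 then 1 else 0)
      * residual q.1.2.1.1 (cumRate w (q.1.2.2.1 + q.2) - cumRate w q.1.2.2.1)) := ⟨_, rfl⟩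
  have hF1m : Measurable F1 := by
    rw [hF1]
    exact (by fun_prop : Measurable fun q : (ℝ≥0∞ × (ℝ × ℝ) × ℝ × ℝ) × ℝ => q.1.1).mul
      ((hind (by fun_prop) (by fun_prop)).mul (hres (by fun_prop) (by fun_prop)))
  have hF2m : Measurable F2 := by
    rw [hF2]
    exact (by fun_prop : Measurable fun q : (ℝ≥0∞ × (ℝ × ℝ) × ℝ × ℝ) × ℝ => q.1.1).mul
      ((hind (by fun_prop) (by fun_prop)).mul (hres (by fun_prop) (by fun_prop)))
  have hsk := hX.ae_isSkeleton
  have hA := hX.measurableSet_jump n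
  -- split according to the direction of the jump
  have hae : ∀ᵐ ω ∂P, ω ∈ {ω | jt X n ω < jt X (n + 1) ω ∧ jp X (n + 1) ω = jp X n ω + ((1 : ℤˣ) : ℤ)}
      ∪ {ω | jt X n ω < jt X (n + 1) ω ∧ jp X (n + 1) ω = jp X n ω + ((-1 : ℤˣ) : ℤ)} := by
    filter_upwards [hsk] with ω hω
    rcases hω.step n with h1 | h1
    · exact Or.inl ⟨hω.lt n, by simpa using h1⟩
    · exact Or.inr ⟨hω.lt n, by simpa [← sub_eq_add_neg] using h1⟩
  rw [← Measure.restrict_eq_self_of_ae_mem hae, lintegral_union (hA (-1)) (disjoint_jump n),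
    Measure.restrict_eq_self_of_ae_mem hae]
  have e1 : ∫⁻ ω in {ω | jt X n ω < jt X (n + 1) ω ∧ jp X (n + 1) ω = jp X n ω + ((1 : ℤˣ) : ℤ)},
      ∏ q ∈ F, tailProb w (fun i => jt X i ω) (fun i => jp X i ω) (n + 1) q.1 q.2 (b q) ∂P
      = ∫⁻ ω in {ω | jt X n ω < jt X (n + 1) ω ∧ jp X (n + 1) ω = jp X n ω + ((1 : ℤˣ) : ℤ)},
        F1 (ζ ω, jt X (n + 1) ω - jt X n ω) ∂P := by
    refine setLIntegral_congr_fun_ae (hA 1) ?_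
    filter_upwards [hsk] with ω hω hdir
    have hdir' : jp X (n + 1) ω = jp X n ω + 1 := by simpa using hdir.2
    obtain ⟨h1, h2⟩ := hω.tailProb_succ (w := w) n (k₁ := jp X n ω) (k₂ := jp X n ω - 1) (Or.inl rfl)
      (Or.inr (by ring)) (by simp only [hdir']; lia) (by simp only [hdir']; lia) F b
    rw [hω.prod_tailProb_succ, h1, h2, hF1, hζdef]
  have e2 : ∫⁻ ω in {ω | jt X n ω < jt X (n + 1) ω ∧ jp X (n + 1) ω = jp X n ω + ((-1 : ℤˣ) : ℤ)},
      ∏ q ∈ F, tailProb w (fun i => jt X i ω) (fun i => jp X i ω) (n + 1) q.1 q.2 (b q) ∂P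
      = ∫⁻ ω in {ω | jt X n ω < jt X (n + 1) ω ∧ jp X (n + 1) ω = jp X n ω + ((-1 : ℤˣ) : ℤ)},
        F2 (ζ ω, jt X (n + 1) ω - jt X n ω) ∂P := by
    refine setLIntegral_congr_fun_ae (hA (-1)) ?_
    filter_upwards [hsk] with ω hω hdir
    have hdir' : jp X (n + 1) ω = jp X n ω - 1 := by simpa [← sub_eq_add_neg] using hdir.2
    obtain ⟨h1, h2⟩ := hω.tailProb_succ (w := w) n (k₁ := jp X n ω - 1) (k₂ := jp X n ω) (Or.inr (by ring))
      (Or.inl rfl) (by simp only [hdir']; lia) (by simp only [hdir']; lia) F b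
    rw [hω.prod_tailProb_succ, h1, h2, hF2, hζdef]
    simp only
    rw [mul_comm (residual _ _)]
  have hmeas : Measurable fun ω => ∫⁻ v in Ioi (0 : ℝ),
      raceDensity w (rateArg X n 1 ω) (rateArg X n (-1) ω) v * F1 (ζ ω, v) := by
    have h1 : Measurable fun q : Ω × ℝ => (ζ q.1, q.2) :=
      ((hζ.mono (hX.history_le n) le_rfl).comp measurable_fst).prodMk measurable_snd
    exact ((hX.measurable_raceDensity n 1).mul (hF1m.comp h1)).lintegral_prod_right'
  rw [e1, e2, hX.lintegral_step n 1 hζ hF1m, hX.lintegral_step n (-1) hζ hF2m, neg_neg,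
    ← lintegral_add_left hmeas]
  refine lintegral_congr_ae ?_
  filter_upwards [hsk] with ω hω
  rw [prod_tailProb, rateArg_one hω, rateArg_neg_one hω, ← two_clocks w
    (clock (fun i => jt X i ω) (fun i => jp X i ω) n (jp X n ω))
    (clock (fun i => jt X i ω) (fun i => jp X i ω) n (jp X n ω - 1)), mul_add, hF1, hF2, hζdef]
  simp only
  have hc : ∀ (u₁ u₂ β₁ β₂ : ℝ), Measurable fun v => raceDensity w u₁ u₂ v *
      ((if β₁ < cumRate w (u₁ + v) - cumRate w u₁ then (1 : ℝ≥0∞) else 0)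
        * residual β₂ (cumRate w (u₂ + v) - cumRate w u₂)) := by
    intro u₁ u₂ β₁ β₂
    refine Measurable.mul ?_ (Measurable.mul ?_ ?_)
    · have := (RepellingWalk.measurable_raceDensity w).comp (by fun_prop : Measurable fun v : ℝ => ((u₁, u₂), v))
      exact this
    · exact Measurable.ite (measurableSet_lt measurable_const (by fun_prop)) measurable_const measurable_const
    · have := measurable_residual.comp (by fun_prop : Measurable fun v : ℝ =>
        (β₂, cumRate w (u₂ + v) - cumRate w u₂))
      exact this
  rw [← lintegral_const_mul _ (hc _ _ _ _), ← lintegral_const_mul _ (hc _ _ _ _)]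
  congr 1 <;>
  · refine lintegral_congr fun v => ?_
    rw [mul_left_comm]

/-- Before the first jump, the conditional probabilities are those of independent standard
exponential variables. -/
lemma IsWalk.lintegral_tailProb (F : Finset (ℤ × ℕ)) (b : ℤ × ℕ → ℝ) (n : ℕ) :
    ∫⁻ ω, ∏ q ∈ F, tailProb w (fun i => jt X i ω) (fun i => jp X i ω) n q.1 q.2 (b q) ∂P
      = ∏ q ∈ F, residual (b q) 0 := by
  induction n with
  | zero =>
    have : ∀ ω, ∏ q ∈ F, tailProb w (fun i => jt X i ω) (fun i => jp X i ω) 0 q.1 q.2 (b q)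
        = ∏ q ∈ F, residual (b q) 0 := fun ω => Finset.prod_congr rfl fun q _ => by
      simp [tailProb, crossed, age, clock, switchPt]
    simp [this]
  | succ n ih => rw [hX.lintegral_tailProb_succ, ih]

end

/-- The exponential variables of the crossings among the first `n` jumps, completed by the
independent variables `γ`: the variable of the current crossing is its elapsed part plus `γ`. -/
def completion (w : ℝ → ℝ) (S : ℕ → ℝ) (p : ℕ → ℤ) (n : ℕ) (γ : ℤ → ℕ → ℝ) (k : ℤ) (j : ℕ) : ℝ :=
  if j < crossed p n k then expVar w S p n k j
  else γ k j + if j = crossed p n k then age w S p n k else 0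

section

variable {w : ℝ → ℝ} [hw : IsRate w]

omit hw in
/-- `tailProb` is indeed the conditional probability, given the skeleton. -/
lemma expArrayMeasure_completion (S : ℕ → ℝ) (p : ℕ → ℤ) (n : ℕ) (F : Finset (ℤ × ℕ)) (b : ℤ × ℕ → ℝ) :
    expArrayMeasure {γ | ∀ q ∈ F, b q < completion w S p n γ q.1 q.2}
      = ∏ q ∈ F, tailProb w S p n q.1 q.2 (b q) := by
  have hset : {γ : ℤ → ℕ → ℝ | ∀ q ∈ F, b q < completion w S p n γ q.1 q.2}
      = {γ | ∀ q ∈ F, γ q.1 q.2 ∈ (if q.2 < crossed p n q.1 then {x : ℝ | b q < expVar w S p n q.1 q.2}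
        else Ioi (b q - if q.2 = crossed p n q.1 then age w S p n q.1 else 0))} := by
    ext γ
    simp only [mem_ofPred_eq]
    refine forall₂_congr fun q _ => ?_
    rw [completion]
    by_cases h : q.2 < crossed p n q.1
    · rw [if_pos h, if_pos h, mem_ofPred_eq]
    · rw [if_neg h, if_neg h, mem_Ioi, sub_lt_iff_lt_add]
  rw [hset, expArrayMeasure_box]
  · refine Finset.prod_congr rfl fun q _ => ?_
    rw [tailProb]
    by_cases h : q.2 < crossed p n q.1
    · rw [if_pos h, if_pos h]
      by_cases h2 : b q < expVar w S p n q.1 q.2 <;> simp [h2]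
    · rw [if_neg h, if_neg h, expMeasure_Ioi_sub]
  · intro q
    split_ifs
    · exact MeasurableSet.const _
    · exact measurableSet_Ioi
    · exact measurableSet_Ioi

lemma measurable_completion {α : Type*} [MeasurableSpace α] {S : ℕ → α → ℝ} {p : ℕ → α → ℤ}
    (hS : ∀ i, Measurable (S i)) (hp : ∀ i, Measurable (p i)) {γ : α → ℤ → ℕ → ℝ} (hγ : Measurable γ)
    (n : ℕ) (k : ℤ) (j : ℕ) :
    Measurable fun a => completion w (fun i => S i a) (fun i => p i a) n (γ a) k j := by
  have hc := measurable_crossed (n := n) (fun i _ => hp i) k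
  refine Measurable.ite (measurableSet_lt measurable_const hc)
    (measurable_expVar w (fun i _ => hS i) (fun i _ => hp i) k j) (Measurable.add ?_ ?_)
  · exact (measurable_pi_apply j).comp ((measurable_pi_apply k).comp hγ)
  · exact Measurable.ite (measurableSet_eq_fun measurable_const hc)
      (measurable_age w (fun i _ => hS i) (fun i _ => hp i) k) measurable_const

variable {Ω : Type*} [mΩ : MeasurableSpace Ω] {P : Measure Ω} [IsProbabilityMeasure P]
  {X : ℝ≥0 → Ω → ℤ} (hX : IsWalk w P X)

include hX in
/-- The completed variables have the same law after any number of jumps. -/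
theorem IsWalk.isExpArray_completion (n : ℕ) :
    IsExpArray (P.prod expArrayMeasure) fun k j (q : Ω × (ℤ → ℕ → ℝ)) =>
      completion w (fun i => jt X i q.1) (fun i => jp X i q.1) n q.2 k j := by
  have hm : ∀ k j, Measurable fun q : Ω × (ℤ → ℕ → ℝ) =>
      completion w (fun i => jt X i q.1) (fun i => jp X i q.1) n q.2 k j := fun k j =>
    measurable_completion (S := fun i (q : Ω × (ℤ → ℕ → ℝ)) => jt X i q.1) (p := fun i q => jp X i q.1)
      (fun i => (hX.measurable_jt i).comp measurable_fst) (fun i => (hX.measurable_jp i).comp measurable_fst)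
      measurable_snd n k j
  refine isExpArray_of_tail hm fun F b => ?_
  have hms : MeasurableSet {q : Ω × (ℤ → ℕ → ℝ) | ∀ r ∈ F,
      b r < completion w (fun i => jt X i q.1) (fun i => jp X i q.1) n q.2 r.1 r.2} := by
    have : {q : Ω × (ℤ → ℕ → ℝ) | ∀ r ∈ F,
      b r < completion w (fun i => jt X i q.1) (fun i => jp X i q.1) n q.2 r.1 r.2}
      = ⋂ r ∈ F, {q | b r < completion w (fun i => jt X i q.1) (fun i => jp X i q.1) n q.2 r.1 r.2} := by
      ext q; simp
    rw [this]
    exact Finset.measurableSet_biInter _ fun r _ => measurableSet_lt measurable_const (hm r.1 r.2)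
  rw [Measure.prod_apply hms, ← hX.lintegral_tailProb F b n]
  refine lintegral_congr fun ω => ?_
  rw [← expArrayMeasure_completion]
  rfl

omit hw in
/-- Completed by positive numbers, the variables drive a chain that agrees with the past of the
walk. -/
lemma IsSkeleton.compatible_completion [IsRate w] {S : ℕ → ℝ} {p : ℕ → ℤ} (h : IsSkeleton S p) (n : ℕ)
    {γ : ℤ → ℕ → ℝ} (hγ : ∀ k j, 0 ≤ γ k j) (k : ℤ) :
    Compatible w (switchPt S p n k) (crossed p n k) (clock S p n k) (completion w S p n γ k) where
  zero := switchPt_eq_zero S p n k (Or.inl rfl)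
  past j hj := by rw [completion, if_pos hj, expVar]
  lt j hj := h.neg_switchPt_lt hj
  current := by
    rw [completion, if_neg (lt_irrefl _), if_pos rfl, age]
    linarith [hγ k (crossed p n k)]

end

/-! ### The walk does not explode -/

section

variable (w : ℝ → ℝ) [hw : IsRate w]

/-- The probability that none of two clocks rings before time `1`. -/
lemma lintegral_raceDensity_Ioi_one (u₁ u₂ : ℝ) :
    (∫⁻ v in Ioi (1 : ℝ), raceDensity w u₁ u₂ v) + (∫⁻ v in Ioi (1 : ℝ), raceDensity w u₂ u₁ v)
      = ENNReal.ofReal (Real.exp (-((cumRate w (u₁ + 1) - cumRate w u₁) + (cumRate w (u₂ + 1) - cumRate w u₂)))) := by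
  have hpos : ∀ u, 0 ≤ cumRate w (u + 1) - cumRate w u := fun u =>
    sub_nonneg.2 ((strictMono_cumRate w).monotone (by linarith))
  have h := two_clocks w u₁ u₂ (cumRate w (u₁ + 1) - cumRate w u₁) (cumRate w (u₂ + 1) - cumRate w u₂)
  have h1 : ∀ u₁ u₂, ∫⁻ v in Ioi (0 : ℝ), raceDensity w u₁ u₂ v *
      ((if cumRate w (u₁ + 1) - cumRate w u₁ < cumRate w (u₁ + v) - cumRate w u₁ then 1 else 0)
        * residual (cumRate w (u₂ + 1) - cumRate w u₂) (cumRate w (u₂ + v) - cumRate w u₂))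
      = ∫⁻ v in Ioi (1 : ℝ), raceDensity w u₁ u₂ v := by
    intro u₁ u₂
    rw [← lintegral_indicator measurableSet_Ioi, ← lintegral_indicator measurableSet_Ioi]
    refine lintegral_congr fun v => ?_
    by_cases hv : 1 < v
    · have h2 : cumRate w (u₁ + 1) - cumRate w u₁ < cumRate w (u₁ + v) - cumRate w u₁ :=
        sub_lt_sub_right (strictMono_cumRate w (by linarith)) _
      have h3 : cumRate w (u₂ + 1) - cumRate w u₂ ≤ cumRate w (u₂ + v) - cumRate w u₂ :=
        sub_le_sub_right ((strictMono_cumRate w).monotone (by linarith)) _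
      rw [indicator_of_mem (show v ∈ Ioi (0 : ℝ) from by rw [mem_Ioi]; linarith),
        indicator_of_mem (show v ∈ Ioi (1 : ℝ) from hv), if_pos h2, residual_of_lt h3, mul_one, mul_one]
    · have h2 : ¬ cumRate w (u₁ + 1) - cumRate w u₁ < cumRate w (u₁ + v) - cumRate w u₁ :=
        not_lt.2 (sub_le_sub_right ((strictMono_cumRate w).monotone (by linarith)) _)
      rw [indicator_of_notMem (show v ∉ Ioi (1 : ℝ) from hv), indicator_apply_eq_zero]
      intro
      rw [if_neg h2, zero_mul, mul_zero]
  rw [h1, h1] at h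
  rw [h, residual, residual, sub_zero, sub_zero, max_eq_left (hpos _), max_eq_left (hpos _),
    ← ENNReal.ofReal_mul (Real.exp_pos _).le, ← Real.exp_add, neg_add]

end

lemma localTime_nonneg (x : ℝ≥0 → ℤ) (t : ℝ≥0) (k : ℤ) : 0 ≤ localTime x t k := ENNReal.toReal_nonneg

lemma localTime_le (x : ℝ≥0 → ℤ) (t : ℝ≥0) (k : ℤ) : localTime x t k ≤ t := by
  refine ENNReal.toReal_le_of_le_ofReal t.2 ((measure_mono (show _ ⊆ Ico 0 (t : ℝ) from
    fun s hs => ⟨hs.1, hs.2.1⟩)).trans ?_)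
  rw [Real.volume_Ico, sub_zero]

section

variable {Ω : Type*} [mΩ : MeasurableSpace Ω] {w : ℝ → ℝ} {P : Measure Ω} [IsProbabilityMeasure P]
  {X : ℝ≥0 → Ω → ℤ} (hX : IsWalk w P X) [hw : IsRate w]

include hX hw

/-- If the jump times stay below `R`, then all holding times are larger than `1` with a probability
that is bounded from below, hence the jump times stay below `R - 1`. -/
lemma IsWalk.measure_bounded_le (R : ℝ) :
    ENNReal.ofReal (Real.exp (-(2 * w (R + 1)))) * P {ω | ∀ n, jt X n ω ≤ R} ≤ P {ω | ∀ n, jt X n ω ≤ R - 1} := by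
  have hsk := hX.ae_isSkeleton
  obtain ⟨c, hc⟩ : ∃ c, c = ENNReal.ofReal (Real.exp (-(2 * w (R + 1)))) := ⟨_, rfl⟩
  have hms : ∀ (n : ℕ) (R : ℝ), MeasurableSet {ω | jt X n ω ≤ R} := fun n R =>
    measurableSet_le (hX.measurable_jt n) measurable_const
  have hlim : ∀ R : ℝ, Tendsto (fun n => P {ω | jt X n ω ≤ R}) atTop (𝓝 (P {ω | ∀ n, jt X n ω ≤ R})) := by
    intro R
    have e1 : ∀ n, P {ω | jt X n ω ≤ R} = P (⋂ i ∈ {i | i ≤ n}, {ω | jt X i ω ≤ R}) := fun n => by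
      refine measure_congr ?_
      rw [Filter.eventuallyEq_set]
      filter_upwards [hsk] with ω hω
      simp only [mem_ofPred_eq, mem_iInter]
      constructor
      · intro h i hi
        exact ((strictMono_nat_of_lt_succ hω.lt).monotone hi).trans h
      · intro h; exact h n le_rfl
    have e2 : {ω | ∀ n, jt X n ω ≤ R} = ⋂ n, ⋂ i ∈ {i | i ≤ n}, {ω | jt X i ω ≤ R} := by
      ext ω
      simp only [mem_ofPred_eq, mem_iInter]
      exact ⟨fun h n i _ => h i, fun h n => h n n le_rfl⟩
    simp only [e1, e2]
    refine tendsto_measure_iInter_atTop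
      (fun n => (MeasurableSet.biInter (to_countable _) fun i _ => hms i R).nullMeasurableSet) ?_ ⟨0, measure_ne_top _ _⟩
    exact fun n m hnm => biInter_subset_biInter_left fun i hi => le_trans hi hnm
  -- the mass which leaves `[0, R]` in one step
  have hstep : ∀ n, c * P {ω | jt X n ω ≤ R} + P {ω | jt X (n + 1) ω ≤ R}
      ≤ P {ω | jt X n ω ≤ R - 1} + P {ω | jt X n ω ≤ R} := by
    intro n
    have hB : MeasurableSet[history X n] {ω | jt X n ω ≤ R} :=
      measurableSet_le (measurable_history_jt X le_rfl) measurable_const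
    obtain ⟨D, hD⟩ : ∃ D : ℤˣ → Set Ω, D = fun e : ℤˣ =>
      {ω | jt X n ω + (1 : ℝ≥0) < jt X (n + 1) ω ∧ jp X (n + 1) ω = jp X n ω + (e : ℤ)} := ⟨_, rfl⟩
    have hDm : ∀ e, MeasurableSet (D e) := fun e => by
      rw [hD]
      exact measurableSet_and (measurableSet_lt ((hX.measurable_jt _).add_const _) (hX.measurable_jt _))
        (measurableSet_eq_fun (hX.measurable_jp _) ((hX.measurable_jp _).add_const _))
    have hdis : Disjoint (D 1) (D (-1)) := by
      rw [hD]
      refine disjoint_left.2 fun ω h1 h2 => ?_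
      have h3 := h1.2.symm.trans h2.2
      simp at h3
    have h1 : c * P {ω | jt X n ω ≤ R} ≤ P ({ω | jt X n ω ≤ R} ∩ (D 1 ∪ D (-1))) := by
      have hmeas : Measurable fun ω =>
          ∫⁻ v in Ioi (1 : ℝ), raceDensity w (rateArg X n 1 ω) (rateArg X n (-1) ω) v :=
        (hX.measurable_raceDensity n 1).lintegral_prod_right'
      rw [inter_union_distrib_left, measure_union (hdis.mono inter_subset_right inter_subset_right)
        ((hms n R).inter (hDm _)), hD, hX.measure_jump n hB, hX.measure_jump n hB, neg_neg, NNReal.coe_one,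
        ← lintegral_add_left hmeas, ← setLIntegral_const]
      refine setLIntegral_mono' (hms n R) fun ω hω => ?_
      rw [lintegral_raceDensity_Ioi_one, hc]
      refine ENNReal.ofReal_le_ofReal (Real.exp_le_exp.2 (neg_le_neg ?_))
      have hr : ∀ e, cumRate w (rateArg X n e ω + 1) - cumRate w (rateArg X n e ω) ≤ w (R + 1) := fun e => by
        refine (cumRate_sub_le_mul_sub w (by linarith)).trans ?_
        rw [add_sub_cancel_left, mul_one]
        refine hw.mono ?_
        -- local times are at most `R` up to time `R`, which bounds both rates during the next
        -- unit of time by `w (R + 1)`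
        have h3 : rateArg X n e ω ≤ jt X n ω := by
          rw [rateArg]
          have h4 := localTime_le (fun t => X t ω) (jumpTime (fun t => X t ω) n) (jp X n ω)
          have h5 := localTime_nonneg (fun t => X t ω) (jumpTime (fun t => X t ω) n) (jp X n ω + (e : ℤ))
          rw [jt]
          linarith
        have h4 : jt X n ω ≤ R := hω
        linarith
      linarith [hr 1, hr (-1)]
    have h2 : P ({ω | jt X n ω ≤ R} ∩ (D 1 ∪ D (-1))) + P {ω | jt X (n + 1) ω ≤ R}
        = P (({ω | jt X n ω ≤ R} ∩ (D 1 ∪ D (-1))) ∪ {ω | jt X (n + 1) ω ≤ R})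
          + P (({ω | jt X n ω ≤ R} ∩ (D 1 ∪ D (-1))) ∩ {ω | jt X (n + 1) ω ≤ R}) :=
      (measure_union_add_inter _ (hms _ _)).symm
    have h3 : P (({ω | jt X n ω ≤ R} ∩ (D 1 ∪ D (-1))) ∪ {ω | jt X (n + 1) ω ≤ R}) ≤ P {ω | jt X n ω ≤ R} := by
      refine measure_mono_ae ?_
      filter_upwards [hsk] with ω hω h
      rcases h with h | h
      · exact h.1
      · exact (hω.lt n).le.trans h
    have h4 : P (({ω | jt X n ω ≤ R} ∩ (D 1 ∪ D (-1))) ∩ {ω | jt X (n + 1) ω ≤ R}) ≤ P {ω | jt X n ω ≤ R - 1} := by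
      refine measure_mono fun ω h => ?_
      have h5 : jt X (n + 1) ω ≤ R := h.2
      have h6 : jt X n ω + (1 : ℝ≥0) < jt X (n + 1) ω := by
        have := h.1.2
        rw [hD] at this
        rcases this with h6 | h6 <;> exact h6.1
      rw [mem_ofPred_eq]
      push_cast at h6
      linarith
    calc c * P {ω | jt X n ω ≤ R} + P {ω | jt X (n + 1) ω ≤ R}
        ≤ P ({ω | jt X n ω ≤ R} ∩ (D 1 ∪ D (-1))) + P {ω | jt X (n + 1) ω ≤ R} := by gcongr
      _ ≤ P {ω | jt X n ω ≤ R - 1} + P {ω | jt X n ω ≤ R} := by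
        rw [h2, add_comm]; gcongr
  -- in the limit `n → ∞` the common term cancels
  have hl := le_of_tendsto_of_tendsto' ((ENNReal.Tendsto.const_mul (a := c) (hlim R)
    (Or.inr (by rw [hc]; exact ENNReal.ofReal_ne_top))).add ((tendsto_add_atTop_iff_nat 1).2 (hlim R)))
    ((hlim (R - 1)).add (hlim R)) hstep
  rw [← hc]
  exact (ENNReal.add_le_add_iff_right (measure_ne_top _ _)).1 hl

/-- The jump times tend to infinity. -/
theorem IsWalk.ae_tendsto_jt : ∀ᵐ ω ∂P, Tendsto (fun n => jt X n ω) atTop atTop := by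
  have h0 : ∀ N : ℕ, P {ω | ∀ n, jt X n ω ≤ (N : ℝ) - 1} = 0 := by
    intro N
    induction N with
    | zero =>
      have : {ω | ∀ n, jt X n ω ≤ ((0 : ℕ) : ℝ) - 1} = ∅ := by
        refine eq_empty_of_forall_notMem fun ω h => ?_
        have h1 := h 0
        have h2 : 0 ≤ jt X 0 ω := NNReal.coe_nonneg _
        norm_num at h1
        linarith
      rw [this, measure_empty]
    | succ N ih =>
      have h1 := hX.measure_bounded_le (N : ℝ)
      rw [ih, nonpos_iff_eq_zero, mul_eq_zero] at h1
      rcases h1 with h1 | h1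
      · exact absurd h1 (by simpa using Real.exp_pos _)
      · simpa using h1
  have h1 : ∀ᵐ ω ∂P, ∀ N : ℕ, ¬ ∀ n, jt X n ω ≤ (N : ℝ) - 1 := ae_all_iff.2 fun N => by
    rw [ae_iff]; simpa using h0 N
  filter_upwards [h1, hX.ae_isSkeleton] with ω hω hsk
  refine tendsto_atTop_atTop_of_monotone (strictMono_nat_of_lt_succ hsk.lt).monotone fun b => ?_
  obtain ⟨N, hN⟩ := exists_nat_gt (b + 1)
  have := hω N
  push Not at this
  obtain ⟨n, hn⟩ := this
  exact ⟨n, by linarith⟩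

end

/-! ### The local times on both sides of an edge -/

section

variable {w : ℝ → ℝ} [hw : IsRate w] {e : ℕ → ℝ} {p : ℕ}

lemma etaTime_shift {z : ℕ → ℝ} (h0 : z 0 = 0) (hp : p ≤ 1) (m : ℕ) :
    etaTime (fun i => z (i + p)) m = ∑ i ∈ Finset.range (2 * m + p), z i := by
  rcases Nat.le_one_iff_eq_zero_or_eq_one.1 hp with rfl | rfl
  · rfl
  · rw [Finset.sum_range_succ', h0, add_zero, etaTime]

lemma tendsto_etaTime_shift (he : Regular e) (hp : p ≤ 1) :
    Tendsto (etaTime fun i => chain w 0 e (i + p)) atTop atTop := by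
  rcases Nat.le_one_iff_eq_zero_or_eq_one.1 hp with rfl | rfl
  · exact tendsto_etaTime_chain w 0 he
  · exact tendsto_etaTime_chain_succ w 0 he

lemma chain_shift_add_nonneg (p n : ℕ) :
    0 ≤ chain w 0 e (n + p) + chain w 0 e (n + 1 + p) := by
  have := chain_add_nonneg w 0 e (n + p)
  rwa [add_right_comm] at this

lemma add_etaPath_shift (hp : p ≤ 1) {m : ℕ} {s : ℝ}
    (h1 : etaTime (fun i => chain w 0 e (i + p)) m ≤ s) (h2 : s < etaTime (fun i => chain w 0 e (i + p)) (m + 1)) :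
    s + etaPath (fun i => chain w 0 e (i + p)) s = ∑ i ∈ Finset.range (2 * m + p + 1), chain w 0 e i := by
  rw [add_etaPath (chain_shift_add_nonneg p) h1 h2]
  refine (sum_range_eq_add_etaTime (fun i => chain w 0 e (i + p)) m).symm.trans ?_
  rcases Nat.le_one_iff_eq_zero_or_eq_one.1 hp with rfl | rfl
  · rfl
  · rw [Finset.sum_range_succ' _ (2 * m + 1)]
    simp [chain]

/-- The local time on one side of an edge, in terms of the local time `s` on the other side. -/
lemma sum_le_add_etaPath (he : Regular e) (hp : p ≤ 1) {m : ℕ} {s : ℝ}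
    (h : ∑ i ∈ Finset.range (2 * m + p), chain w 0 e i ≤ s) :
    ∑ i ∈ Finset.range (2 * m + p + 1), chain w 0 e i ≤ s + etaPath (fun i => chain w 0 e (i + p)) s := by
  have hT := tendsto_etaTime_shift (w := w) he hp
  have hmono := monotone_etaTime (chain_shift_add_nonneg (w := w) (e := e) p)
  rw [← etaTime_shift (z := chain w 0 e) rfl hp] at h
  obtain ⟨h1, h2⟩ := stepIndex_spec hT (t := s) (by
    rw [etaTime_zero]
    have := hmono (Nat.zero_le m)
    rw [etaTime_zero] at this
    linarith)
  rw [add_etaPath_shift hp h1 h2]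
  obtain ⟨M, hM⟩ : ∃ M, M = stepIndex (etaTime fun i => chain w 0 e (i + p)) s := ⟨_, rfl⟩
  rw [← hM] at h1 h2 ⊢
  have hmM : m ≤ M := by
    by_contra hcon
    have := hmono (show M + 1 ≤ m by lia)
    linarith
  have hmono' : Monotone fun m => ∑ i ∈ Finset.range (2 * m + p + 1), chain w 0 e i := by
    refine monotone_nat_of_le_succ fun m => ?_
    rw [show 2 * (m + 1) + p + 1 = 2 * m + p + 1 + 1 + 1 by ring,
      Finset.sum_range_succ _ (2 * m + p + 1 + 1), Finset.sum_range_succ _ (2 * m + p + 1)]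
    have := chain_add_nonneg w 0 e (2 * m + p + 1)
    linarith
  exact hmono' hmM

lemma zero_le_chain_one : 0 ≤ chain w 0 e 1 := by
  have := chain_add_nonneg w 0 e 0
  simpa [chain] using this

lemma add_etaPath_nonneg (he : Regular e) (hp : p ≤ 1) {s : ℝ} (hs : 0 ≤ s) :
    0 ≤ s + etaPath (fun i => chain w 0 e (i + p)) s := by
  have h := sum_le_add_etaPath (w := w) he hp (m := 0) (s := s)
  rcases Nat.le_one_iff_eq_zero_or_eq_one.1 hp with rfl | rfl
  · simpa [chain, hs] using h
  · have h1 := zero_le_chain_one (w := w) (e := e)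
    have h2 : chain w 0 e 0 = 0 := rfl
    simp only [mul_zero, zero_add, Finset.sum_range_succ, Finset.sum_range_zero, h2] at h
    linarith [h hs]

variable {z : ℕ → ℝ} {c m : ℕ} {u s : ℝ}

/-- The bound for the local time on the side opposite to the walk, if the local time on its own
side is at most `s`. -/
lemma Compatible.opposite_le (h : Compatible w z c u e) (he : Regular e) (hp : p ≤ 1) (hu : -z c ≤ u)
    (hc : c = 2 * m + p) (hs : ∑ i ∈ Finset.range (c + 1), z i + u ≤ s) :
    ∑ i ∈ Finset.range (c + 1), z i ≤ s + etaPath (fun i => chain w 0 e (i + p)) s := by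
  have h1 : ∑ i ∈ Finset.range (2 * m + p), chain w 0 e i ≤ s := by
    have h2 := h.sum_chain
    have h3 := h.chain_eq le_rfl
    rw [Finset.sum_range_succ] at h2
    rw [← hc]
    linarith
  rw [← h.sum_chain, hc]
  exact sum_le_add_etaPath he hp h1

/-- The bound for the local time on the side of the walk, if the local time on the other side is
at most `s`. -/
lemma Compatible.current_le (h : Compatible w z c u e) (he : Regular e) (hp : p ≤ 1)
    (hc : c + 1 = 2 * m + p) (hs : ∑ i ∈ Finset.range (c + 1), z i ≤ s) :
    ∑ i ∈ Finset.range (c + 1), z i + u ≤ s + etaPath (fun i => chain w 0 e (i + p)) s := by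
  have h1 : ∑ i ∈ Finset.range (2 * m + p), chain w 0 e i ≤ s := by rw [← hc, h.sum_chain]; exact hs
  have h2 := sum_le_add_etaPath he hp h1
  have h3 := h.sum_chain
  have h4 := h.le_chain
  rw [← hc, Finset.sum_range_succ] at h2
  linarith

end

section

variable {w : ℝ → ℝ} [hw : IsRate w] {S : ℕ → ℝ} {p : ℕ → ℤ} (h : IsSkeleton S p) {n : ℕ} {k : ℤ} {e : ℕ → ℝ}
  (hE : Compatible w (switchPt S p n k) (crossed p n k) (clock S p n k) e) (he : Regular e) {s : ℝ}

include h

omit hw in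
/-- The walk is on the right of an edge according to its initial side and to the parity of the
number of crossings. -/
lemma IsSkeleton.lt_iff_even (n : ℕ) (k : ℤ) : k < p n ↔ (k < 0 ↔ Even (crossed p n k)) := by
  have h1 := side_eq p n k
  rw [side, side, h.start] at h1
  rcases Nat.even_or_odd (crossed p n k) with he | he
  · rw [he.neg_one_pow, mul_one] at h1
    simp only [he, iff_true]
    split_ifs at h1 <;> simp_all
    lia
  · rw [he.neg_one_pow] at h1
    have he' := Nat.not_even_iff_odd.2 he
    simp only [he', iff_false]
    split_ifs at h1 <;> simp_all

include hE he

/-- The local time at `k + 1` is bounded by means of the local time at `k`. -/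
lemma IsSkeleton.occ_right_le (hs : occ S p n k ≤ s) :
    occ S p n (k + 1) ≤ s + etaPath (fun i => chain w 0 e (i + if 0 ≤ k then 0 else 1)) s := by
  have h1 := h.occ_opposite n k
  have h2 := h.occ_current n k
  have h3 := h.neg_switchPt_le_clock n k
  have h4 := h.lt_iff_even n k
  have hp : (if 0 ≤ k then 0 else 1) ≤ 1 := by split_ifs <;> simp
  by_cases hk : k < p n
  · rw [if_pos hk] at h1 h2
    rw [h2]
    rw [h1] at hs
    obtain ⟨m, hm⟩ : ∃ m, crossed p n k + 1 = 2 * m + if 0 ≤ k then 0 else 1 := by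
      rcases lt_or_ge k 0 with h0 | h0
      · obtain ⟨m, hm⟩ := (h4.1 hk).1 h0
        exact ⟨m, by rw [if_neg (not_le.2 h0)]; lia⟩
      · have : ¬ Even (crossed p n k) := fun hev => absurd ((h4.1 hk).2 hev) (not_lt.2 h0)
        obtain ⟨m, hm⟩ := Nat.not_even_iff_odd.1 this
        exact ⟨m + 1, by rw [if_pos h0]; lia⟩
    exact hE.current_le he hp hm hs
  · rw [if_neg hk] at h1 h2
    rw [h1]
    rw [h2] at hs
    obtain ⟨m, hm⟩ : ∃ m, crossed p n k = 2 * m + if 0 ≤ k then 0 else 1 := by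
      rcases lt_or_ge k 0 with h0 | h0
      · have : ¬ Even (crossed p n k) := fun hev => hk (h4.2 (by simp [h0, hev]))
        obtain ⟨m, hm⟩ := Nat.not_even_iff_odd.1 this
        exact ⟨m, by rw [if_neg (not_le.2 h0)]; lia⟩
      · have : Even (crossed p n k) := by
          by_contra hev
          exact hk (h4.2 (by simp [not_lt.2 h0, hev]))
        obtain ⟨m, hm⟩ := this
        exact ⟨m, by rw [if_pos h0]; lia⟩
    exact hE.opposite_le he hp h3 hm hs

/-- The local time at `k` is bounded by means of the local time at `k + 1`. -/
lemma IsSkeleton.occ_left_le (hs : occ S p n (k + 1) ≤ s) :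
    occ S p n k ≤ s + etaPath (fun i => chain w 0 e (i + if k < 0 then 0 else 1)) s := by
  have h1 := h.occ_opposite n k
  have h2 := h.occ_current n k
  have h3 := h.neg_switchPt_le_clock n k
  have h4 := h.lt_iff_even n k
  have hp : (if k < 0 then 0 else 1) ≤ 1 := by split_ifs <;> simp
  by_cases hk : k < p n
  · rw [if_pos hk] at h1 h2
    rw [h1]
    rw [h2] at hs
    obtain ⟨m, hm⟩ : ∃ m, crossed p n k = 2 * m + if k < 0 then 0 else 1 := by
      rcases lt_or_ge k 0 with h0 | h0
      · obtain ⟨m, hm⟩ := (h4.1 hk).1 h0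
        exact ⟨m, by rw [if_pos h0]; lia⟩
      · have : ¬ Even (crossed p n k) := fun hev => absurd ((h4.1 hk).2 hev) (not_lt.2 h0)
        obtain ⟨m, hm⟩ := Nat.not_even_iff_odd.1 this
        exact ⟨m, by rw [if_neg (not_lt.2 h0)]; lia⟩
    exact hE.opposite_le he hp h3 hm hs
  · rw [if_neg hk] at h1 h2
    rw [h2]
    rw [h1] at hs
    obtain ⟨m, hm⟩ : ∃ m, crossed p n k + 1 = 2 * m + if k < 0 then 0 else 1 := by
      rcases lt_or_ge k 0 with h0 | h0
      · have : ¬ Even (crossed p n k) := fun hev => hk (h4.2 (by simp [h0, hev]))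
        obtain ⟨m, hm⟩ := Nat.not_even_iff_odd.1 this
        exact ⟨m + 1, by rw [if_pos h0]; lia⟩
      · have : Even (crossed p n k) := by
          by_contra hev
          exact hk (h4.2 (by simp [not_lt.2 h0, hev]))
        obtain ⟨m, hm⟩ := this
        exact ⟨m, by rw [if_neg (not_lt.2 h0)]; lia⟩
    exact hE.current_le he hp hm hs

end

/-! ### Bounding all local times by means of one of them -/

/-- The chain `l ↦ l + η(l)` which starts from `s`; in its `i`-th step, `η` is the path with the
switching points `z i`. It dominates the local times at successive sites. -/
def spread (z : ℕ → ℕ → ℝ) (s : ℝ) : ℕ → ℝ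
  | 0 => s
  | i + 1 => spread z s i + etaPath (z i) (spread z s i)

/-- The switching points which determine the local times to the right of `j`, starting with the
edge `⟨j, j+1⟩`. -/
def rightSeq (w : ℝ → ℝ) (E : ℤ → ℕ → ℝ) (j : ℤ) (i : ℕ) : ℕ → ℝ :=
  fun m => chain w 0 (E (j + i)) (m + if 0 ≤ j + i then 0 else 1)

/-- The switching points which determine the local times to the left of `j`, starting with the
edge `⟨j-1, j⟩`. -/
def leftSeq (w : ℝ → ℝ) (E : ℤ → ℕ → ℝ) (j : ℤ) (i : ℕ) : ℕ → ℝ :=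
  fun m => chain w 0 (E (j - (i + 1))) (m + if j - (i + 1) < 0 then 0 else 1)

/-- A bound for the sum of all local times if the local time at `j` is at most `s`. -/
def totalSpread (w : ℝ → ℝ) (E : ℤ → ℕ → ℝ) (j : ℤ) (s : ℝ) : ℝ≥0∞ :=
  ∑' i, ENNReal.ofReal (spread (rightSeq w E j) s i) + ∑' i, ENNReal.ofReal (spread (leftSeq w E j) s (i + 1))

lemma IsSkeleton.occ_nonneg {S : ℕ → ℝ} {p : ℕ → ℤ} (h : IsSkeleton S p) (n : ℕ) (k : ℤ) : 0 ≤ occ S p n k :=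
  Finset.sum_nonneg fun i _ => by have := h.lt i; split_ifs <;> linarith

/-- The local times add up to the elapsed time. -/
lemma IsSkeleton.tsum_occ {S : ℕ → ℝ} {p : ℕ → ℤ} (h : IsSkeleton S p) (n : ℕ) :
    ∑' k, ENNReal.ofReal (occ S p n k) = ENNReal.ofReal (S n) := by
  induction n with
  | zero => simp [h.zero]
  | succ n ih =>
    have h1 : ∀ k, ENNReal.ofReal (occ S p (n + 1) k)
        = ENNReal.ofReal (occ S p n k) + if k = p n then ENNReal.ofReal (S (n + 1) - S n) else 0 := fun k => by
      have := h.lt n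
      rw [occ_succ]
      by_cases hk : p n = k
      · rw [if_pos hk, if_pos hk.symm, ENNReal.ofReal_add (h.occ_nonneg n k) (by linarith)]
      · rw [if_neg hk, if_neg (Ne.symm hk), add_zero, add_zero]
    simp_rw [h1]
    have h0 : 0 ≤ S n := h.zero ▸ (strictMono_nat_of_lt_succ h.lt).monotone (Nat.zero_le n)
    rw [ENNReal.tsum_add, ih, tsum_ite_eq, ← ENNReal.ofReal_add h0 (by linarith [h.lt n])]
    congr 1; ring

/-- If the local time at `j` is at most `s`, then the elapsed time is bounded by a quantity which
only depends on the driving variables and on `s`. -/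
lemma IsSkeleton.le_totalSpread {w : ℝ → ℝ} [hw : IsRate w] {S : ℕ → ℝ} {p : ℕ → ℤ} (h : IsSkeleton S p) {n : ℕ}
    {E : ℤ → ℕ → ℝ} (hE : ∀ k, Compatible w (switchPt S p n k) (crossed p n k) (clock S p n k) (E k))
    (he : ∀ k, Regular (E k)) {j : ℤ} {s : ℝ} (hs : occ S p n j ≤ s) :
    ENNReal.ofReal (S n) ≤ totalSpread w E j s := by
  have hr : ∀ i : ℕ, occ S p n (j + i) ≤ spread (rightSeq w E j) s i := by
    intro i
    induction i with
    | zero => simpa [spread] using hs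
    | succ i ih =>
      have := h.occ_right_le (hE (j + i)) (he _) ih
      rw [spread]
      push_cast
      rw [← add_assoc]
      exact this
  have hl : ∀ i : ℕ, occ S p n (j - i) ≤ spread (leftSeq w E j) s i := by
    intro i
    induction i with
    | zero => simpa [spread] using hs
    | succ i ih =>
      have := h.occ_left_le (hE (j - (i + 1))) (he _) (s := spread (leftSeq w E j) s i) (by
        rw [sub_add_eq_sub_sub, sub_add_cancel]; exact ih)
      rw [spread]
      push_cast
      exact this
  rw [← h.tsum_occ n, ← (Equiv.addLeft j).tsum_eq, totalSpread]
  have hsum := HasSum.of_nat_of_neg_add_one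
    (f := fun i : ℤ => ENNReal.ofReal (occ S p n (Equiv.addLeft j i)))
    ENNReal.summable.hasSum ENNReal.summable.hasSum
  rw [hsum.tsum_eq]
  refine add_le_add (ENNReal.tsum_le_tsum fun i => ENNReal.ofReal_le_ofReal ?_)
    (ENNReal.tsum_le_tsum fun i => ENNReal.ofReal_le_ofReal ?_)
  · exact hr i
  · have := hl (i + 1)
    simp only [Equiv.coe_addLeft]
    rw [← sub_eq_add_neg]
    push_cast at this
    exact this

section

variable {w : ℝ → ℝ} [hw : IsRate w] {Ω : Type*} [mΩ : MeasurableSpace Ω] {P : Measure Ω} [IsProbabilityMeasure P]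

/-- The chain `l ↦ l + η(l)` reaches `0` and then stays there. The finitely many steps before `i₀`
may use the paths through the other half of the switching points. -/
lemma ae_spread_eventually_zero {R : ℕ → Ω → ℕ → ℝ} (hR : ∀ i, Measurable (R i)) (hind : iIndepFun R P)
    (hlaw : ∀ i, P.map (R i) = expSeqMeasure) {p : ℕ → ℕ} (hp : ∀ i, p i ≤ 1) {i₀ : ℕ} (hp0 : ∀ i, i₀ ≤ i → p i = 0)
    {s : ℝ} (hs : 0 ≤ s) :
    ∀ᵐ ω ∂P, ∃ i₁, ∀ i, i₁ ≤ i → spread (fun i m => chain w 0 (R i ω) (m + p i)) s i = 0 := by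
  obtain ⟨sp, hsp⟩ : ∃ sp : ℕ → Ω → ℝ, sp = fun i ω => spread (fun i m => chain w 0 (R i ω) (m + p i)) s i := ⟨_, rfl⟩
  have hsucc : ∀ i ω, sp (i + 1) ω = sp i ω + etaPath (fun m => chain w 0 (R i ω) (m + p i)) (sp i ω) := by
    intro i ω; rw [hsp]; rfl
  have hstep : ∀ (p : ℕ) {α : Type _} [MeasurableSpace α] {l : α → ℝ} {r : α → ℕ → ℝ}, Measurable l → Measurable r →
      Measurable fun a => l a + etaPath (fun m => chain w 0 (r a) (m + p)) (l a) := fun p _ _ l r hl hr =>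
    hl.add (measurable_etaPath (fun n => measurable_chain w measurable_const (e := fun i a => r a i) _
      fun i _ => (measurable_pi_apply i).comp hr) hl)
  obtain ⟨𝒢, h𝒢⟩ : ∃ 𝒢 : ℕ → MeasurableSpace Ω, 𝒢 = fun i =>
    ⨆ m ∈ {m | m < i}, MeasurableSpace.comap (R m) inferInstance := ⟨_, rfl⟩
  have hle : ∀ i, 𝒢 i ≤ mΩ := fun i => by rw [h𝒢]; exact iSup₂_le fun m _ => (hR m).comap_le
  have hmono : ∀ i, 𝒢 i ≤ 𝒢 (i + 1) := fun i => by
    rw [h𝒢]; exact biSup_mono fun m hm => Nat.lt_succ_of_lt hm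
  have hmR : ∀ i, Measurable[𝒢 (i + 1)] (R i) := fun i => by
    rw [measurable_iff_comap_le, h𝒢]
    exact le_iSup₂ (f := fun m (_ : m ∈ {m | m < i + 1}) => MeasurableSpace.comap (R m) inferInstance) i
      (Nat.lt_succ_self i)
  have hm : ∀ i, Measurable[𝒢 i] (sp i) := by
    intro i
    induction i with
    | zero => rw [hsp]; exact @measurable_const _ _ _ (𝒢 0) s
    | succ i ih =>
      have : sp (i + 1) = fun ω => sp i ω + etaPath (fun m => chain w 0 (R i ω) (m + p i)) (sp i ω) :=
        funext fun ω => hsucc i ω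
      rw [this]
      have h1 := hstep (p i) (α := ℝ × (ℕ → ℝ)) measurable_fst measurable_snd
      exact h1.comp ((ih.mono (hmono i) le_rfl).prodMk (hmR i))
  have hreg : ∀ᵐ ω ∂P, ∀ i, Regular (R i ω) := ae_all_iff.2 fun i => by
    have := isExpSeq_expSeqMeasure.ae_regular
    rw [← hlaw i] at this
    exact ae_of_ae_map (hR i).aemeasurable this
  have hnn : ∀ᵐ ω ∂P, ∀ i, 0 ≤ sp i ω := by
    filter_upwards [hreg] with ω hω i
    induction i with
    | zero => rw [hsp]; exact hs
    | succ i ih => rw [hsucc]; exact add_etaPath_nonneg (hω i) (hp i) ih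
  -- one step of the chain
  have hone : ∀ i, i₀ ≤ i → ∀ n, ∫⁻ ω, aliveProb w n (sp (i + 1) ω) ∂P = ∫⁻ ω, aliveProb w (n + 1) (sp i ω) ∂P := by
    intro i hi n
    have hI : Indep (𝒢 i) (MeasurableSpace.comap (R i) inferInstance) P := by
      have h1 := indep_iSup_of_disjoint (fun i => (hR i).comap_le) hind (S := {m | m < i}) (T := {i}) (by simp)
      simp only [mem_singleton_iff, iSup_iSup_eq_left] at h1
      rw [h𝒢]
      exact h1
    have hF : Measurable fun q : ℝ × (ℕ → ℝ) => aliveProb w n (q.1 + etaPath (fun m => chain w 0 q.2 (m + 0)) q.1) :=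
      (measurable_aliveProb w n).comp (hstep 0 measurable_fst measurable_snd)
    have h2 := setLIntegral_of_indep (hle i) (hR i) hI (hm i) (@MeasurableSet.univ _ (𝒢 i)) hF
    rw [Measure.restrict_univ, hlaw i] at h2
    simp only [hsucc, hp0 i hi]
    rw [h2]
    refine lintegral_congr fun ω => ?_
    exact (lintegral_etaKernel w _ _ ((measurable_aliveProb w n).comp (measurable_const_add (sp i ω)))).symm
  -- from the step `i₀` on, the process is the time homogeneous chain of `aliveProb`
  have hmany : ∀ n m, ∫⁻ ω, aliveProb w m (sp (i₀ + n) ω) ∂P = ∫⁻ ω, aliveProb w (n + m) (sp i₀ ω) ∂P := by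
    intro n
    induction n with
    | zero => intro m; rw [add_zero, zero_add]
    | succ n ih =>
      intro m
      rw [← add_assoc, hone _ (Nat.le_add_right _ _), ih, show n + (m + 1) = n + 1 + m by ring]
  have hlim : Tendsto (fun n => ∫⁻ ω, aliveProb w n (sp i₀ ω) ∂P) atTop (𝓝 0) := by
    have h1 := tendsto_lintegral_of_dominated_convergence (μ := P) (F := fun n ω => aliveProb w n (sp i₀ ω))
      (f := fun _ => 0) (fun _ => 1) (fun n => (measurable_aliveProb w n).comp ((hm i₀).mono (hle _) le_rfl))
      (fun n => ae_of_all _ fun ω => aliveProb_le_one w n _) (by simp) (by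
        filter_upwards [hnn] with ω hω
        exact tendsto_aliveProb ⟨sp i₀ ω, hω i₀⟩)
    simpa using h1
  have hzero : P {ω | ∀ n, sp (i₀ + n) ω ≠ 0} = 0 := by
    refine le_antisymm (ge_of_tendsto' hlim fun n => ?_) zero_le
    have h1 := hmany n 0
    rw [add_zero] at h1
    rw [← h1]
    have h2 : ∀ ω, aliveProb w 0 (sp (i₀ + n) ω) = ({ω | sp (i₀ + n) ω ≠ 0} : Set Ω).indicator 1 ω := fun ω => by
      by_cases h : sp (i₀ + n) ω = 0 <;> simp [aliveProb, h]
    simp_rw [h2]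
    have hms : MeasurableSet {ω | sp (i₀ + n) ω ≠ 0} :=
      (measurableSet_eq_fun ((hm _).mono (hle _) le_rfl) measurable_const).compl
    rw [lintegral_indicator_one hms]
    exact measure_mono fun ω hω => hω n
  have hae : ∀ᵐ ω ∂P, ¬ ∀ n, sp (i₀ + n) ω ≠ 0 := by rw [ae_iff]; simpa using hzero
  filter_upwards [hae, hreg] with ω h1 h2
  push Not at h1
  obtain ⟨n, hn⟩ := h1
  refine ⟨i₀ + n, fun i hi => ?_⟩
  have : sp i ω = 0 := by
    induction i, hi using Nat.le_induction with
    | base => exact hn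
    | succ i hi ih =>
      rw [hsucc, ih, zero_add, hp0 i (by lia)]
      exact etaPath_zero (chain_add_nonneg w 0 (R i ω)) (chain_add_pos w 0 ((h2 i).1 0))
  rw [hsp] at this
  exact this

lemma tsum_ofReal_lt_top {f : ℕ → ℝ} {i₁ : ℕ} (h : ∀ i, i₁ ≤ i → f i = 0) : ∑' i, ENNReal.ofReal (f i) < ∞ := by
  rw [tsum_eq_sum (s := Finset.range i₁) fun i hi => by
    rw [h i (by simpa using hi), ENNReal.ofReal_zero]]
  exact ENNReal.sum_lt_top.2 fun i _ => ENNReal.ofReal_lt_top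

variable {E : ℤ → ℕ → Ω → ℝ} (hE : IsExpArray P E)

include hE in
/-- If the local time at one site is bounded, then so is the sum of all local times. -/
lemma IsExpArray.ae_totalSpread_lt_top (j : ℤ) {s : ℝ} (hs : 0 ≤ s) :
    ∀ᵐ ω ∂P, totalSpread w (fun k m => E k m ω) j s < ∞ := by
  have hrow : ∀ k, Measurable fun ω m => E k m ω := fun k => measurable_pi_lambda _ fun m => hE.measurable k m
  have h1 := ae_spread_eventually_zero (w := w) (R := fun (i : ℕ) ω m => E (j + i) m ω) (P := P) (fun i => hrow _)
    (hE.indep.precomp (g := fun i : ℕ => j + (i : ℤ)) fun a b h => by simpa using h) (fun i => hE.map_row _)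
    (p := fun i => if 0 ≤ j + (i : ℤ) then 0 else 1) (fun i => by split_ifs <;> simp) (i₀ := j.natAbs)
    (fun i hi => if_pos (by lia)) hs
  have h2 := ae_spread_eventually_zero (w := w) (R := fun (i : ℕ) ω m => E (j - (i + 1)) m ω) (P := P)
    (fun i => hrow _)
    (hE.indep.precomp (g := fun i : ℕ => j - ((i : ℤ) + 1)) fun a b h => by simpa using h) (fun i => hE.map_row _)
    (p := fun i => if j - ((i : ℤ) + 1) < 0 then 0 else 1) (fun i => by split_ifs <;> simp)
    (i₀ := j.natAbs) (fun i hi => if_pos (by lia)) hs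
  filter_upwards [h1, h2] with ω ⟨i₁, h3⟩ ⟨i₂, h4⟩
  exact ENNReal.add_lt_top.2 ⟨tsum_ofReal_lt_top (i₁ := i₁) h3,
    tsum_ofReal_lt_top (i₁ := i₂) fun i hi => h4 (i + 1) (by lia)⟩

omit mΩ hw in
lemma measurable_spread {α : Type*} [MeasurableSpace α] {z : ℕ → ℕ → α → ℝ} (hz : ∀ i m, Measurable (z i m))
    (s : ℝ) (i : ℕ) : Measurable fun a => spread (fun i m => z i m a) s i := by
  induction i with
  | zero => exact measurable_const
  | succ i ih => exact ih.add (measurable_etaPath (hz i) ih)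

lemma measurable_totalSpread (j : ℤ) (s : ℝ) : Measurable fun E : ℤ → ℕ → ℝ => totalSpread w E j s := by
  have hc : ∀ k m, Measurable fun E : ℤ → ℕ → ℝ => chain w 0 (E k) m := fun k m =>
    measurable_chain w measurable_const (e := fun i (E : ℤ → ℕ → ℝ) => E k i) m fun i _ =>
      (measurable_pi_apply i).comp (measurable_pi_apply k)
  refine Measurable.add (Measurable.tsum fun i => ?_) (Measurable.tsum fun i => ?_)
  · exact (measurable_spread (z := fun i m (E : ℤ → ℕ → ℝ) => rightSeq w E j i m) (fun i m => hc _ _) s i).ennreal_ofReal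
  · exact (measurable_spread (z := fun i m (E : ℤ → ℕ → ℝ) => leftSeq w E j i m) (fun i m => hc _ _) s (i + 1)).ennreal_ofReal

end

/-! ### Recurrence -/

lemma monotone_occ {S : ℕ → ℝ} {p : ℕ → ℤ} (h : IsSkeleton S p) (k : ℤ) : Monotone fun n => occ S p n k :=
  monotone_nat_of_le_succ fun n => by
    rw [occ_succ]
    have := h.lt n
    split_ifs <;> linarith

/-- If the local times at both endpoints of an edge are infinite, it is crossed infinitely often. -/
lemma IsSkeleton.tendsto_crossed {S : ℕ → ℝ} {p : ℕ → ℤ} (h : IsSkeleton S p) {k : ℤ}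
    (h0 : Tendsto (fun n => occ S p n k) atTop atTop) (h1 : Tendsto (fun n => occ S p n (k + 1)) atTop atTop) :
    Tendsto (fun n => crossed p n k) atTop atTop := by
  refine tendsto_atTop_atTop_of_monotone (crossed_mono p k) fun b => ?_
  by_contra! hcon
  -- the number of crossings is eventually constant
  obtain ⟨c, n₀, hc⟩ : ∃ c n₀, ∀ n, n₀ ≤ n → crossed p n k = c := by
    have hfin : (range fun n => crossed p n k).Finite :=
      (Set.finite_Iic b).subset (by rintro _ ⟨n, rfl⟩; exact (hcon n).le)
    obtain ⟨_, ⟨n₀, rfl⟩, hn₀⟩ := hfin.exists_maximal (range_nonempty _)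
    refine ⟨_, n₀, fun n hn => le_antisymm ?_ (crossed_mono p k hn)⟩
    by_contra! hlt
    exact absurd (hn₀ (mem_range_self n) hlt.le) (not_le.2 hlt)
  have h2 : ∀ n, n₀ ≤ n → (if k < p n then occ S p n k else occ S p n (k + 1))
      = ∑ i ∈ Finset.range (c + 1), switchPt S p n₀ k i := by
    intro n hn
    rw [h.occ_opposite, hc n hn]
    exact Finset.sum_congr rfl fun i hi => switchPt_stable S p hn k (by
      rw [hc n₀ le_rfl]; have := Finset.mem_range.1 hi; lia)
  obtain ⟨n, h3, h4, h5⟩ := ((h0.eventually_gt_atTop (∑ i ∈ Finset.range (c + 1), switchPt S p n₀ k i)).and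
    ((h1.eventually_gt_atTop (∑ i ∈ Finset.range (c + 1), switchPt S p n₀ k i)).and
      (eventually_ge_atTop n₀))).exists
  have := h2 n h5
  split_ifs at this <;> linarith

section

variable {Ω : Type*} [mΩ : MeasurableSpace Ω] {w : ℝ → ℝ} {P : Measure Ω} [IsProbabilityMeasure P]
  {X : ℝ≥0 → Ω → ℤ} (hX : IsWalk w P X) [hw : IsRate w]

include hX hw

/-- The probability that the local time at `j` is small although the time is large is at most the
probability that the total local time in the corresponding chain is large. -/
lemma IsWalk.measure_occ_le (n : ℕ) (j : ℤ) (s R : ℝ) :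
    P {ω | occ (fun i => jt X i ω) (fun i => jp X i ω) n j ≤ s ∧ R ≤ jt X n ω}
      ≤ expArrayMeasure {E | ENNReal.ofReal R ≤ totalSpread w E j s} := by
  have hE := hX.isExpArray_completion n
  have hms : MeasurableSet {E : ℤ → ℕ → ℝ | ENNReal.ofReal R ≤ totalSpread w E j s} :=
    measurableSet_le measurable_const (measurable_totalSpread j s)
  rw [← hE.map_eq, Measure.map_apply hE.measurable_array hms]
  have h1 : P {ω | occ (fun i => jt X i ω) (fun i => jp X i ω) n j ≤ s ∧ R ≤ jt X n ω}
      = (P.prod expArrayMeasure) ({ω | occ (fun i => jt X i ω) (fun i => jp X i ω) n j ≤ s ∧ R ≤ jt X n ω} ×ˢ univ) := by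
    rw [Measure.prod_prod, measure_univ, mul_one]
  rw [h1]
  refine measure_mono_ae ?_
  have hreg : ∀ᵐ q ∂(P.prod expArrayMeasure), ∀ k, Regular fun j =>
      completion w (fun i => jt X i q.1) (fun i => jp X i q.1) n q.2 k j :=
    ae_all_iff.2 fun k => (hE.isExpSeq k).ae_regular
  have hsk : ∀ᵐ q ∂(P.prod expArrayMeasure), IsSkeleton (fun n => jt X n q.1) (fun n => jp X n q.1) :=
    Measure.quasiMeasurePreserving_fst.ae hX.ae_isSkeleton
  have hpos : ∀ᵐ q ∂(P.prod expArrayMeasure), ∀ k j, 0 ≤ q.2 k j :=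
    Measure.quasiMeasurePreserving_snd.ae (p := fun γ : ℤ → ℕ → ℝ => ∀ k j, 0 ≤ γ k j) (by
      refine ae_all_iff.2 fun k => ?_
      filter_upwards [(isExpArray_expArrayMeasure.isExpSeq k).ae_regular] with γ hγ j
      exact (hγ.1 j).le)
  filter_upwards [hreg, hsk, hpos] with q h2 h3 h4 h5
  refine (ENNReal.ofReal_le_ofReal h5.1.2).trans ?_
  exact h3.le_totalSpread (fun k => h3.compatible_completion n h4 k) h2 h5.1.1

/-- Recurrence: if the local time at `j` stayed bounded, then so would the elapsed time, by a
random variable whose law does not depend on the number of jumps; but the jump times tend to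
infinity. -/
lemma IsWalk.ae_tendsto_occ (j : ℤ) :
    ∀ᵐ ω ∂P, Tendsto (fun n => occ (fun i => jt X i ω) (fun i => jp X i ω) n j) atTop atTop := by
  have hocc : ∀ n, Measurable fun ω => occ (fun i => jt X i ω) (fun i => jp X i ω) n j := fun n =>
    measurable_occ (fun i _ => hX.measurable_jt i) (fun i _ => hX.measurable_jp i) j
  have h0 : ∀ s : ℕ, P {ω | ∀ n, occ (fun i => jt X i ω) (fun i => jp X i ω) n j ≤ s} = 0 := by
    intro s
    -- the right-hand side of the estimate tends to `0`
    have hlim : Tendsto (fun R : ℕ => expArrayMeasure {E | ENNReal.ofReal R ≤ totalSpread w E j s}) atTop (𝓝 0) := by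
      have h1 := tendsto_measure_iInter_atTop (μ := expArrayMeasure)
        (s := fun R : ℕ => {E : ℤ → ℕ → ℝ | ENNReal.ofReal R ≤ totalSpread w E j s})
        (fun R => (measurableSet_le measurable_const (measurable_totalSpread j s)).nullMeasurableSet)
        (fun R R' hR E hE => (ENNReal.ofReal_le_ofReal (by exact_mod_cast hR)).trans hE) ⟨0, measure_ne_top _ _⟩
      have h2 : expArrayMeasure (⋂ R : ℕ, {E : ℤ → ℕ → ℝ | ENNReal.ofReal R ≤ totalSpread w E j s}) = 0 := by
        have h3 := isExpArray_expArrayMeasure.ae_totalSpread_lt_top (w := w) j (s := s) (Nat.cast_nonneg s)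
        refine measure_mono_null (fun E hE => ?_) (ae_iff.1 h3)
        simp only [mem_iInter, mem_ofPred_eq, ENNReal.ofReal_natCast] at hE
        simp only [mem_ofPred_eq, not_lt, top_le_iff]
        by_contra hne
        obtain ⟨R, hR⟩ := ENNReal.exists_nat_gt hne
        exact absurd (hE R) (not_le.2 hR)
      rw [h2] at h1
      exact h1
    refine le_antisymm (ge_of_tendsto' hlim fun R => ?_) zero_le
    have hS : Tendsto (fun n => P {ω | jt X n ω < R}) atTop (𝓝 0) := by
      have hms : ∀ n, MeasurableSet {ω | jt X n ω < R} := fun n => measurableSet_lt (hX.measurable_jt n) measurable_const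
      have h1 : ∀ᵐ ω ∂P, ∀ᶠ n in atTop, ω ∈ ({ω | jt X n ω < R} : Set Ω) ↔ ω ∈ (∅ : Set Ω) := by
        filter_upwards [hX.ae_tendsto_jt] with ω hω
        filter_upwards [hω.eventually_ge_atTop (R : ℝ)] with n hn
        simp [hn]
      have h2 := tendsto_measure_of_ae_tendsto_indicator_of_isFiniteMeasure atTop (μ := P) MeasurableSet.empty hms h1
      rwa [measure_empty] at h2
    have h1 : Tendsto (fun n => expArrayMeasure {E | ENNReal.ofReal R ≤ totalSpread w E j s} + P {ω | jt X n ω < R})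
        atTop (𝓝 (expArrayMeasure {E | ENNReal.ofReal R ≤ totalSpread w E j s} + 0)) := hS.const_add _
    rw [add_zero] at h1
    refine ge_of_tendsto' h1 fun n => ?_
    refine le_trans (measure_mono (t := {ω | occ (fun i => jt X i ω) (fun i => jp X i ω) n j ≤ s ∧ R ≤ jt X n ω}
      ∪ {ω | jt X n ω < R}) fun ω hω => ?_) ((measure_union_le _ _).trans (add_le_add_left (hX.measure_occ_le n j s R) _))
    rcases lt_or_ge (jt X n ω) R with h | h
    · exact Or.inr h
    · exact Or.inl ⟨hω n, h⟩
  have h1 : ∀ᵐ ω ∂P, ∀ s : ℕ, ¬ ∀ n, occ (fun i => jt X i ω) (fun i => jp X i ω) n j ≤ s := ae_all_iff.2 fun s => by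
    rw [ae_iff]; simpa using h0 s
  filter_upwards [h1, hX.ae_isSkeleton] with ω hω hsk
  refine tendsto_atTop_atTop_of_monotone (monotone_occ hsk j) fun b => ?_
  obtain ⟨s, hs⟩ := exists_nat_ge b
  have := hω s
  push Not at this
  obtain ⟨n, hn⟩ := this
  exact ⟨n, hs.trans hn.le⟩

/-- The walk crosses every edge infinitely often. -/
theorem IsWalk.ae_tendsto_crossed :
    ∀ᵐ ω ∂P, ∀ k, Tendsto (fun n => crossed (fun i => jp X i ω) n k) atTop atTop := by
  have h := ae_all_iff.2 hX.ae_tendsto_occ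
  filter_upwards [h, hX.ae_isSkeleton] with ω hω hsk k
  exact hsk.tendsto_crossed (hω k) (hω (k + 1))

end

/-! ### The exponential variables of all crossings -/

/-- The exponential variable which corresponds to the `(j + 1)`-st crossing of the edge `⟨k,
k+1⟩`. It is written as the upper limit of a sequence which is constant after that crossing. -/
def edgeVar {Ω : Type*} (w : ℝ → ℝ) (X : ℝ≥0 → Ω → ℤ) (k : ℤ) (j : ℕ) (ω : Ω) : ℝ :=
  limsup (fun n => expVar w (fun i => jt X i ω) (fun i => jp X i ω) n k j) atTop

section

variable {Ω : Type*} {w : ℝ → ℝ} {X : ℝ≥0 → Ω → ℤ}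

lemma edgeVar_eq {n : ℕ} {k : ℤ} {j : ℕ} {ω : Ω} (hj : j < crossed (fun i => jp X i ω) n k) :
    edgeVar w X k j ω = expVar w (fun i => jt X i ω) (fun i => jp X i ω) n k j := by
  refine (tendsto_const_nhds.congr' ?_).limsup_eq
  filter_upwards [eventually_ge_atTop n] with m hm
  exact (expVar_stable hm hj).symm

/-- Since the edge will be crossed again, the exponential variable of the current crossing is at
least its part which has elapsed. -/
lemma IsSkeleton.compatible_edgeVar [IsRate w] {ω : Ω} (h : IsSkeleton (fun n => jt X n ω) (fun n => jp X n ω)) {k : ℤ}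
    (hc : Tendsto (fun n => crossed (fun i => jp X i ω) n k) atTop atTop) (n : ℕ) :
    Compatible w (switchPt (fun i => jt X i ω) (fun i => jp X i ω) n k) (crossed (fun i => jp X i ω) n k)
      (clock (fun i => jt X i ω) (fun i => jp X i ω) n k) (fun j => edgeVar w X k j ω) where
  zero := switchPt_eq_zero _ _ n k (Or.inl rfl)
  past j hj := by rw [edgeVar_eq hj, expVar]
  lt j hj := h.neg_switchPt_lt hj
  current := by
    -- until the next crossing the clock increases
    have hG := (strictMono_cumRate w).monotone
    have hex : ∃ m, n ≤ m ∧ ¬(k < jp X m ω ↔ k < jp X (m + 1) ω) := by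
      by_contra! hcon
      have hconst : ∀ m, n ≤ m → crossed (fun i => jp X i ω) m k = crossed (fun i => jp X i ω) n k := by
        intro m hm
        induction m, hm using Nat.le_induction with
        | base => rfl
        | succ m hm ih => rw [crossed_succ, if_pos (hcon m hm), add_zero, ih]
      obtain ⟨m, h1, h2⟩ := ((hc.eventually_gt_atTop (crossed (fun i => jp X i ω) n k)).and
        (eventually_ge_atTop n)).exists
      exact absurd (hconst m h2) h1.ne'
    classical
    obtain ⟨hm1, hm2⟩ := Nat.find_spec hex
    obtain ⟨m, hm⟩ : ∃ m, m = Nat.find hex := ⟨_, rfl⟩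
    rw [← hm] at hm1 hm2
    have hmin : ∀ i, n ≤ i → i < m → (k < jp X i ω ↔ k < jp X (i + 1) ω) := fun i h1 h2 => by
      by_contra h3
      exact Nat.find_min hex (hm ▸ h2) ⟨h1, h3⟩
    have hind : ∀ i, n ≤ i → i ≤ m → crossed (fun i => jp X i ω) i k = crossed (fun i => jp X i ω) n k ∧
        clock (fun i => jt X i ω) (fun i => jp X i ω) n k ≤ clock (fun i => jt X i ω) (fun i => jp X i ω) i k := by
      intro i hi
      induction i, hi using Nat.le_induction with
      | base => intro; exact ⟨rfl, le_rfl⟩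
      | succ i hi ih =>
        intro him
        obtain ⟨h1, h2⟩ := ih (by lia)
        have h3 := hmin i hi (by lia)
        rw [crossed_succ, if_pos h3, clock_succ, if_pos h3]
        exact ⟨h1, h2.trans (h.clock_le_preClock i k)⟩
    obtain ⟨h1, h2⟩ := hind m hm1 le_rfl
    have h3 : crossed (fun i => jp X i ω) n k < crossed (fun i => jp X i ω) (m + 1) k := by
      rw [crossed_succ, if_neg hm2, h1]; exact Nat.lt_succ_self _
    rw [edgeVar_eq h3, expVar, ← h1, switchPt_of_crossing _ hm2, h1,
      switchPt_stable _ _ (show n ≤ m + 1 by lia) k le_rfl]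
    exact sub_le_sub_right (hG (h2.trans (h.clock_le_preClock m k))) _

end

section

variable {Ω : Type*} [mΩ : MeasurableSpace Ω] {w : ℝ → ℝ} {P : Measure Ω} [IsProbabilityMeasure P]
  {X : ℝ≥0 → Ω → ℤ} (hX : IsWalk w P X) [hw : IsRate w]

include hX hw

/-- The exponential variables of all crossings are independent. -/
theorem IsWalk.isExpArray_edgeVar : IsExpArray P (edgeVar w X) := by
  have hm : ∀ k j, Measurable (edgeVar w X k j) := fun k j =>
    Measurable.limsup fun n => measurable_expVar w (fun i _ => hX.measurable_jt i) (fun i _ => hX.measurable_jp i) k j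
  refine isExpArray_of_tail hm fun F b => ?_
  have hms : MeasurableSet {ω | ∀ q ∈ F, b q < edgeVar w X q.1 q.2 ω} := by
    have : {ω | ∀ q ∈ F, b q < edgeVar w X q.1 q.2 ω} = ⋂ q ∈ F, {ω | b q < edgeVar w X q.1 q.2 ω} := by
      ext ω; simp
    rw [this]
    exact Finset.measurableSet_biInter _ fun q _ => measurableSet_lt measurable_const (hm _ _)
  have hlim : Tendsto (fun n => ∫⁻ ω, ∏ q ∈ F, tailProb w (fun i => jt X i ω) (fun i => jp X i ω) n q.1 q.2 (b q) ∂P)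
      atTop (𝓝 (∫⁻ ω, ({ω | ∀ q ∈ F, b q < edgeVar w X q.1 q.2 ω} : Set Ω).indicator 1 ω ∂P)) := by
    refine tendsto_lintegral_of_dominated_convergence (fun _ => 1) (fun n => ?_) (fun n => ae_of_all _ fun ω => ?_)
      (by simp) ?_
    · exact Finset.measurable_fun_prod _ fun q _ => measurable_tailProb w (fun i _ => hX.measurable_jt i)
        (fun i _ => hX.measurable_jp i) _ _ _
    · refine Finset.prod_le_one' fun q _ => ?_
      have hres : ∀ b a, residual b a ≤ 1 := fun b a => by
        rw [residual, ENNReal.ofReal_le_one, Real.exp_le_one_iff]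
        linarith [le_max_right (b - a) 0]
      rw [tailProb]
      split_ifs <;> first | exact le_rfl | exact zero_le | exact hres _ _
    -- after all crossings which belong to `F`, the conditional probability is the indicator
    -- function of the event
    · filter_upwards [hX.ae_tendsto_crossed] with ω hω
      refine tendsto_const_nhds.congr' ?_
      have h1 : ∀ᶠ n in atTop, ∀ q ∈ F, q.2 < crossed (fun i => jp X i ω) n q.1 :=
        (Finset.eventually_all F).2 fun q _ => (hω q.1).eventually_gt_atTop q.2
      filter_upwards [h1] with n hn
      have h2 : ∀ q ∈ F, tailProb w (fun i => jt X i ω) (fun i => jp X i ω) n q.1 q.2 (b q)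
          = if b q < edgeVar w X q.1 q.2 ω then 1 else 0 := fun q hq => by
        rw [tailProb, if_pos (hn q hq), edgeVar_eq (hn q hq)]
      rw [Finset.prod_congr rfl h2]
      by_cases hall : ∀ q ∈ F, b q < edgeVar w X q.1 q.2 ω
      · rw [indicator_of_mem (show ω ∈ {ω | ∀ q ∈ F, b q < edgeVar w X q.1 q.2 ω} from hall)]
        exact (Finset.prod_eq_one fun q hq => if_pos (hall q hq)).symm
      · rw [indicator_of_notMem (show ω ∉ {ω | ∀ q ∈ F, b q < edgeVar w X q.1 q.2 ω} from hall)]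
        push Not at hall
        obtain ⟨q, hq, hq2⟩ := hall
        exact (Finset.prod_eq_zero hq (if_neg (not_lt.2 hq2))).symm
  simp_rw [hX.lintegral_tailProb F b, lintegral_indicator_one hms] at hlim
  exact tendsto_nhds_unique hlim tendsto_const_nhds

end

/-! ### The edge processes of a path as functions of the switching points -/

/-- The numbers `z₀ = 0, z₁, z₂, …` are the switching points of the edge `⟨k, k+1⟩`. -/
structure IsSwitching (S : ℕ → ℝ) (p : ℕ → ℤ) (k : ℤ) (z : ℕ → ℝ) : Prop where
  zero : z 0 = 0
  add_nonneg : ∀ m, 0 ≤ z m + z (m + 1)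
  switchPt_eq : ∀ n j, j ≤ crossed p n k → switchPt S p n k j = z j
  -- the clock of the current crossing has not passed its switching point
  clock_le : ∀ n, clock S p n k ≤ z (crossed p n k + 1)
  tendsto_crossed : Tendsto (fun n => crossed p n k) atTop atTop
  tendsto_edgeSwitch : Tendsto (edgeSwitch z) atTop atTop
  tendsto_etaTime : ∀ q ≤ 1, Tendsto (etaTime fun i => z (i + q)) atTop atTop

lemma edgeSwitch_eq {z : ℕ → ℝ} (h0 : z 0 = 0) (m : ℕ) :
    edgeSwitch z m = 2 * ∑ i ∈ Finset.range (m + 1), z i - z m := by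
  induction m with
  | zero => simp [h0]
  | succ m ih => rw [edgeSwitch_succ, ih, Finset.sum_range_succ _ (m + 1)]; ring

section

variable {a : ℤ} {z : ℕ → ℝ}

/-- The sign of the edge process is a step function, whose steps are the intervals between the
switches. -/
lemma isStepPath_edgePath (hz : ∀ n, 0 ≤ z n + z (n + 1)) :
    IsStepPath (fun s => (edgePath a z s).1) (edgeSwitch z) fun m => a * (-1) ^ m where
  zero := edgeSwitch_zero z
  mono := monotone_edgeSwitch hz
  eq m s h1 h2 := by
    simp only [edgePath, stepIndex_eq (monotone_edgeSwitch hz) h1 h2]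
    rfl

lemma sign_cases (ha : a = 1 ∨ a = -1) (m : ℕ) : a * (-1) ^ m = 1 ∨ a * (-1) ^ m = -1 := by
  rcases ha with rfl | rfl <;> rcases neg_one_pow_eq_or ℤ m with h | h <;> simp [h]

lemma edgePath_fst_cases (ha : a = 1 ∨ a = -1) (s : ℝ) :
    (edgePath a z s).1 = 1 ∨ (edgePath a z s).1 = -1 := sign_cases ha _

lemma edgePath_snd (hz : ∀ n, 0 ≤ z n + z (n + 1)) {m : ℕ} {s : ℝ} (h1 : edgeSwitch z m ≤ s)
    (h2 : s < edgeSwitch z (m + 1)) :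
    (edgePath a z s).2 = ((a * (-1) ^ m : ℤ) : ℝ) * (s - edgeSwitch z m - z m) := by
  rw [edgePath, stepIndex_eq (monotone_edgeSwitch hz) h1 h2]
  simp only [edgeFlow, edgeState]
  ring

lemma continuousWithinAt_edgePath_fst (hz : ∀ n, 0 ≤ z n + z (n + 1))
    (hT : Tendsto (edgeSwitch z) atTop atTop) (s : ℝ≥0) :
    ContinuousWithinAt (fun s : ℝ≥0 => (edgePath a z s).1) (Ici s) s := by
  obtain ⟨h1, h2⟩ := stepIndex_spec hT (t := (s : ℝ)) (by simp)
  have hp := isStepPath_edgePath (a := a) hz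
  refine tendsto_const_nhds.congr' ?_
  have h3 : ∀ᶠ r : ℝ≥0 in 𝓝[≥] s, (r : ℝ) < edgeSwitch z (stepIndex (edgeSwitch z) s + 1) :=
    nhdsWithin_le_nhds (NNReal.continuous_coe.continuousAt.eventually_lt continuousAt_const h2)
  filter_upwards [h3, self_mem_nhdsWithin] with r hr1 hr2
  have hr3 : (s : ℝ) ≤ r := by exact_mod_cast hr2
  exact (hp.eq _ s h1 h2).trans (hp.eq _ r (h1.trans hr3) hr1).symm

/-- The local times of the sign between its first switches: the differences telescope. -/
lemma occ_sub_occ (h0 : z 0 = 0) (ha : a = 1 ∨ a = -1) (m : ℕ) :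
    occ (edgeSwitch z) (fun m => a * (-1) ^ m) m 1 - occ (edgeSwitch z) (fun m => a * (-1) ^ m) m (-1)
      = -((a * (-1) ^ m : ℤ) : ℝ) * z m := by
  induction m with
  | zero => simp [h0]
  | succ m ih =>
    rw [occ_succ, occ_succ, edgeSwitch_succ, add_sub_cancel_left, pow_succ]
    rcases sign_cases ha m with h | h <;>
    · rw [h] at ih
      simp only [← mul_assoc, h]
      norm_num at ih ⊢
      linarith

/-- `ξ` is the integral of `α`. -/
lemma edgePath_snd_eq_localTime (h0 : z 0 = 0) (hz : ∀ n, 0 ≤ z n + z (n + 1)) (hT : Tendsto (edgeSwitch z) atTop atTop)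
    (ha : a = 1 ∨ a = -1) (s : ℝ≥0) :
    (edgePath a z s).2 = localTime (fun s => (edgePath a z s).1) s 1 - localTime (fun s => (edgePath a z s).1) s (-1) := by
  obtain ⟨h1, h2⟩ := stepIndex_spec hT (t := (s : ℝ)) (by simp)
  obtain ⟨m, hm⟩ : ∃ m, m = stepIndex (edgeSwitch z) s := ⟨_, rfl⟩
  rw [← hm] at h1 h2
  have hp := isStepPath_edgePath (a := a) hz
  have := occ_sub_occ h0 ha m
  rw [hp.localTime_eq m h1 h2.le, hp.localTime_eq m h1 h2.le, edgePath_snd hz h1 h2]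
  rcases sign_cases ha m with h | h <;>
  · rw [h] at this
    simp only [h]
    norm_num at this ⊢
    linarith

/-- The integral of a path with values `±1` is the difference of its two local times. -/
lemma integral_sign_eq {x : ℝ≥0 → ℤ} (hx : Measurable x) (hv : ∀ s, x s = 1 ∨ x s = -1) (s : ℝ≥0) :
    ∫ u in (0 : ℝ)..s, (x u.toNNReal : ℝ) = localTime x s 1 - localTime x s (-1) := by
  have hm : ∀ k, MeasurableSet {u : ℝ | x u.toNNReal = k} := fun k =>
    measurableSet_eq_fun (hx.comp measurable_real_toNNReal) measurable_const
  have hloc : ∀ k, ∫ u in Ico (0 : ℝ) s, ({u : ℝ | x u.toNNReal = k} : Set ℝ).indicator 1 u = localTime x s k := fun k => by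
    rw [integral_indicator_one (hm k), localTime, Measure.real, Measure.restrict_apply (hm k)]
    congr 2
    ext u
    simp only [mem_inter_iff, mem_ofPred_eq, mem_Ico]
    tauto
  rw [intervalIntegral.integral_of_le s.coe_nonneg, ← integral_Ico_eq_integral_Ioc, ← hloc, ← hloc, ← integral_sub]
  · refine integral_congr_ae (ae_of_all _ fun u => ?_)
    rcases hv u.toNNReal with h | h <;> simp [indicator, h]
  all_goals exact (integrable_const (1 : ℝ)).indicator (hm _)

/-- Up to the switch `2n + q` of the sign, which is a switch to the state `σ`, the time spent in
`σ` is the starting time of the `n`-th period of the path through every other switching point. -/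
lemma occ_sign (ha : a = 1 ∨ a = -1) {σ : ℤ} {q : ℕ} (hq : q ≤ 1) (hσ : a * (-1) ^ q = σ) (n : ℕ) :
    occ (edgeSwitch z) (fun m => a * (-1) ^ m) (2 * n + q) σ = etaTime (fun i => z (i + q)) n := by
  have hne : σ ≠ -σ := by
    have := sign_cases ha q
    rw [hσ] at this
    lia
  have hsgn : ∀ n, a * (-1) ^ (2 * n + q) = σ := fun n => by rw [pow_add, pow_mul]; simp [hσ]
  have hsgn' : ∀ n, a * (-1) ^ (2 * n + q + 1) = -σ := fun n => by
    rw [pow_succ, ← mul_assoc, hsgn]; ring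
  induction n with
  | zero =>
    rcases Nat.le_one_iff_eq_zero_or_eq_one.1 hq with rfl | rfl
    · simp
    · have h1 : a ≠ σ := by simp at hσ; lia
      simp [occ, h1]
  | succ n ih =>
    rw [show 2 * (n + 1) + q = 2 * n + q + 1 + 1 by ring, occ_succ, occ_succ, ih, hsgn, hsgn', if_pos rfl,
      if_neg hne.symm, edgeSwitch_succ, etaTime_succ, show 2 * n + 1 + q = 2 * n + q + 1 by ring]
    ring

end

section

variable {x : ℝ≥0 → ℤ} {S : ℕ → ℝ} {p : ℕ → ℤ} {k : ℤ} {z : ℕ → ℝ}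

lemma IsSwitching.preClock_le (hz : IsSwitching S p k z) (n : ℕ) : preClock S p n k ≤ z (crossed p n k + 1) := by
  by_cases hc : (k < p n ↔ k < p (n + 1))
  · have h1 := hz.clock_le (n + 1)
    rwa [clock_succ, if_pos hc, crossed_succ, if_pos hc, add_zero] at h1
  · rw [← switchPt_of_crossing S hc]
    exact (hz.switchPt_eq _ _ (by rw [crossed_succ, if_neg hc])).le

/-- The local time on the edge after `n` jumps. -/
lemma IsSwitching.occ_add_occ (hz : IsSwitching S p k z) (h : IsSkeleton S p) (n : ℕ) :
    occ S p n k + occ S p n (k + 1) = 2 * ∑ i ∈ Finset.range (crossed p n k + 1), z i + clock S p n k := by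
  have h1 := h.occ_opposite n k
  have h2 := h.occ_current n k
  rw [Finset.sum_congr rfl fun i hi => hz.switchPt_eq n i (by have := Finset.mem_range.1 hi; lia)] at h1 h2
  split_ifs at h1 h2 <;> linarith

/-- The edge process is the piecewise linear path with the given switching points. -/
theorem IsSwitching.edge_eq (hz : IsSwitching S p k z) (h : IsSkeleton S p) (hx : IsStepPath x S p) (s : ℝ≥0) :
    {t : ℝ≥0 | (s : ℝ) < edgeTime x t k}.Nonempty ∧
      (alpha x k s, xi x k s) = edgePath (side p 0 k) z s := by
  -- `τ n` is the local time on the edge after `n` jumps, and `n` is chosen such that the local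
  -- time on the edge exceeds `s` for the first time during the holding period after the `n`-th
  -- jump
  obtain ⟨τ, hτ⟩ : ∃ τ : ℕ → ℝ, τ = fun n => occ S p n k + occ S p n (k + 1) := ⟨_, rfl⟩
  have hlow : ∀ n, edgeSwitch z (crossed p n k) ≤ τ n := fun n => by
    have h1 := h.neg_switchPt_le_clock n k
    rw [hz.switchPt_eq n _ le_rfl] at h1
    rw [edgeSwitch_eq hz.zero, hτ]
    simp only
    rw [hz.occ_add_occ h]
    linarith
  have hlim : Tendsto τ atTop atTop :=
    tendsto_atTop_mono hlow (hz.tendsto_edgeSwitch.comp hz.tendsto_crossed)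
  obtain ⟨h1, h2⟩ := stepIndex_spec hlim (t := (s : ℝ)) (by rw [hτ]; simp)
  obtain ⟨n, hn⟩ : ∃ n, n = stepIndex τ s := ⟨_, rfl⟩
  rw [← hn] at h1 h2
  have hτ1 : τ (n + 1) = τ n + if p n = k ∨ p n = k + 1 then S (n + 1) - S n else 0 := by
    rw [hτ]
    simp only [occ_succ]
    have : k ≠ k + 1 := by lia
    by_cases hk : p n = k
    · simp [hk]; ring
    · by_cases hk' : p n = k + 1
      · simp [hk']; ring
      · simp [hk, hk']
  -- the local time on the edge grows during this period, hence the walk is at one of its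
  -- endpoints
  have hinc : p n = k ∨ p n = k + 1 := by
    by_contra hcon
    rw [if_neg hcon, add_zero] at hτ1
    linarith
  rw [if_pos hinc] at hτ1
  obtain ⟨b, hb⟩ : ∃ b : ℝ≥0, (b : ℝ) = S n := ⟨⟨S n, hx.nonneg n⟩, rfl⟩
  have hgrow : ∀ t : ℝ≥0, (b : ℝ) ≤ t → (t : ℝ) ≤ b + (S (n + 1) - S n) → edgeTime x t k = τ n + (t - b) := by
    intro t ht1 ht2
    rw [hb] at ht1 ht2 ⊢
    rw [edgeTime, hx.localTime_eq n ht1 (by linarith), hx.localTime_eq n ht1 (by linarith), hτ]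
    rcases hinc with hk | hk
    · rw [if_pos hk, if_neg (by lia)]; ring
    · rw [if_neg (by lia), if_pos hk]; ring
  obtain ⟨h3, h4⟩ := sInf_lt_eq (monotone_edgeTime x k) hgrow h1 (by linarith)
  refine ⟨h4, ?_⟩
  obtain ⟨θ, hθ⟩ : ∃ θ, θ = theta x s k := ⟨_, rfl⟩
  have hθ' : (θ : ℝ) = S n + (s - τ n) := by rw [hθ, theta, h3, hb]
  have hxθ : x θ = p n := hx.eq n θ (by linarith) (by linarith)
  -- the position in the edge process
  have hα : alpha x k s = side p n k := by
    rw [alpha, ← hθ, hxθ, side]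
    rcases hinc with hk | hk
    · rw [if_neg (by lia), if_pos hk, if_neg (by lia)]; rfl
    · rw [if_pos hk, if_neg (by lia), if_pos (by lia)]; rfl
  have hξ : xi x k s = side p n k * (clock S p n k + (s - τ n)) := by
    rw [xi, ← hθ, hx.localTime_eq n (by linarith) (by linarith), hx.localTime_eq n (by linarith) (by linarith), hθ',
      clock, side]
    rcases hinc with hk | hk
    · rw [if_neg (by lia), if_pos hk, if_neg (by lia)]; push_cast; ring
    · rw [if_pos hk, if_neg (by lia), if_pos (by lia)]; push_cast; ring
  -- `s` is between two switches of the path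
  have hS1 : edgeSwitch z (crossed p n k) ≤ s := (hlow n).trans h1
  have hS2 : (s : ℝ) < edgeSwitch z (crossed p n k + 1) := by
    have h5 := hz.preClock_le n
    rw [preClock, if_pos hinc] at h5
    have h6 := hz.occ_add_occ h n
    rw [edgeSwitch_succ, edgeSwitch_eq hz.zero]
    rw [hτ] at h2 hτ1
    simp only at h2 hτ1
    linarith
  have h6 := hz.occ_add_occ h n
  refine Prod.ext ?_ ?_
  · rw [(isStepPath_edgePath hz.add_nonneg).eq _ s hS1 hS2, ← side_eq]; exact hα
  · rw [edgePath_snd hz.add_nonneg hS1 hS2, ← side_eq, edgeSwitch_eq hz.zero]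
    simp only [hξ]
    rw [hτ]
    simp only [h6]
    ring

lemma IsSwitching.alpha_eq (hz : IsSwitching S p k z) (h : IsSkeleton S p) (hx : IsStepPath x S p) :
    alpha x k = fun s : ℝ≥0 => (edgePath (side p 0 k) z s).1 :=
  funext fun s => congrArg Prod.fst (hz.edge_eq h hx s).2

lemma IsSwitching.xi_eq (hz : IsSwitching S p k z) (h : IsSkeleton S p) (hx : IsStepPath x S p) (s : ℝ≥0) :
    xi x k s = (edgePath (side p 0 k) z s).2 :=
  congrArg Prod.snd (hz.edge_eq h hx s).2

lemma side_cases (p : ℕ → ℤ) (n : ℕ) (k : ℤ) : side p n k = 1 ∨ side p n k = -1 := by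
  rw [side]; split_ifs <;> simp

/-- Each of the two `η` processes of an edge is the path through every other switching point. -/
theorem IsSwitching.eta_eq (hz : IsSwitching S p k z) (h : IsSkeleton S p) (hx : IsStepPath x S p) {σ : ℤˣ} {q : ℕ}
    (hq : q ≤ 1) (hσ : side p 0 k * (-1) ^ q = σ) (t : ℝ≥0) :
    {s : ℝ≥0 | (t : ℝ) < localTime (alpha x k) s σ}.Nonempty ∧
      eta x σ k t = etaPath (fun i => z (i + q)) t := by
  have ha := side_cases p 0 k
  have hnn : ∀ n, 0 ≤ z (n + q) + z (n + 1 + q) := fun n => by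
    have := hz.add_nonneg (n + q)
    rwa [add_right_comm] at this
  obtain ⟨h1, h2⟩ := stepIndex_spec (hz.tendsto_etaTime q hq) (t := (t : ℝ)) (by simp)
  -- the time `t` is in the `n`-th period of the path, that is, in the interval after the switch
  -- `2n + q` of the sign
  obtain ⟨n, hn⟩ : ∃ n, n = stepIndex (etaTime fun i => z (i + q)) t := ⟨_, rfl⟩
  rw [← hn] at h1 h2
  have hp := isStepPath_edgePath (a := side p 0 k) hz.add_nonneg
  have hsgn : side p 0 k * (-1) ^ (2 * n + q) = σ := by rw [pow_add, pow_mul]; simp [hσ]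
  obtain ⟨b, hb⟩ : ∃ b : ℝ≥0, (b : ℝ) = edgeSwitch z (2 * n + q) := ⟨⟨_, hp.nonneg (2 * n + q)⟩, rfl⟩
  have hT := edgeSwitch_succ z (2 * n + q)
  rw [etaTime_succ, show 2 * n + 1 + q = 2 * n + q + 1 by ring] at h2
  have hgrow : ∀ s : ℝ≥0, (b : ℝ) ≤ s → (s : ℝ) ≤ b + (z (2 * n + q) + z (2 * n + q + 1)) →
      localTime (alpha x k) s σ = etaTime (fun i => z (i + q)) n + (s - b) := by
    intro s hs1 hs2
    rw [hb] at hs1 hs2 ⊢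
    rw [hz.alpha_eq h hx, hp.localTime_eq (2 * n + q) hs1 (by linarith), occ_sign ha hq hσ, if_pos hsgn]
  obtain ⟨h3, h4⟩ := sInf_lt_eq (monotone_localTime (alpha x k) σ) hgrow h1 (by linarith)
  refine ⟨h4, ?_⟩
  have hβ : (beta x σ k t : ℝ) = edgeSwitch z (2 * n + q) + (t - etaTime (fun i => z (i + q)) n) := by
    rw [beta, h3, hb]
  have hsq : ((σ : ℤ) : ℝ) * ((σ : ℤ) : ℝ) = 1 := by
    rcases Int.units_eq_one_or σ with rfl | rfl <;> norm_num
  rw [eta, hz.xi_eq h hx, edgePath_snd hz.add_nonneg (by linarith) (by linarith : _ < edgeSwitch z (2 * n + q + 1)), hsgn,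
    etaPath_eq_etaFlow (fun i => z (i + q)) hnn n h1 (by
      rw [etaTime_succ, show 2 * n + 1 + q = 2 * n + q + 1 by ring]; exact h2), etaFlow, hβ]
  linear_combination (z (2 * n + q) - (t - etaTime (fun i => z (i + q)) n)) * hsq

end

/-- The chain driven by the exponential variables of an edge consists of its switching points. -/
lemma isSwitching_chain {Ω : Type*} {w : ℝ → ℝ} [IsRate w] {X : ℝ≥0 → Ω → ℤ} {ω : Ω} {k : ℤ}
    (h : IsSkeleton (fun n => jt X n ω) (fun n => jp X n ω))
    (hc : Tendsto (fun n => crossed (fun i => jp X i ω) n k) atTop atTop)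
    (hr : Regular fun j => edgeVar w X k j ω) :
    IsSwitching (fun n => jt X n ω) (fun n => jp X n ω) k (chain w 0 fun j => edgeVar w X k j ω) where
  zero := rfl
  add_nonneg := chain_add_nonneg w 0 _
  switchPt_eq n _ hj := ((h.compatible_edgeVar hc n).chain_eq hj).symm
  clock_le n := (h.compatible_edgeVar hc n).le_chain
  tendsto_crossed := hc
  tendsto_edgeSwitch := tendsto_edgeSwitch_chain w 0 hr
  tendsto_etaTime _ hq := tendsto_etaTime_shift hr hq

/-! ### The laws of the edge processes -/

/-- The initial sign of `α_k`: the walk starts at `0`. -/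
def startSign (k : ℤ) : ℤ := if k < 0 then 1 else -1

/-- The parity of the switching points which carry the process `η_{k,σ}`: `0` if `σ` is the
initial sign of `α_k`, and `1` otherwise. -/
def etaShift (σ : ℤˣ) (k : ℤ) : ℕ := if startSign k = σ then 0 else 1

lemma startSign_mul_self (k : ℤ) : startSign k * startSign k = 1 := by
  rw [startSign]; split_ifs <;> norm_num

lemma etaShift_le_one (σ : ℤˣ) (k : ℤ) : etaShift σ k ≤ 1 := by
  rw [etaShift]; split_ifs <;> simp

lemma startSign_mul_pow (σ : ℤˣ) (k : ℤ) : startSign k * (-1) ^ etaShift σ k = σ := by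
  rw [etaShift, startSign]
  rcases Int.units_eq_one_or σ with rfl | rfl <;> by_cases hk : k < 0 <;> simp [hk]

lemma IsSkeleton.side_zero {S : ℕ → ℝ} {p : ℕ → ℤ} (h : IsSkeleton S p) (k : ℤ) : side p 0 k = startSign k := by
  rw [side, startSign, h.start]

section

variable {Ω : Type*} [mΩ : MeasurableSpace Ω] {w : ℝ → ℝ} {P : Measure Ω} [IsProbabilityMeasure P]
  {X : ℝ≥0 → Ω → ℤ} (hX : IsWalk w P X) [hw : IsRate w]

include hX hw

/-- Almost surely, all the edge processes are the piecewise linear paths whose switching points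
are the chains driven by the independent arrays of exponential variables. -/
theorem IsWalk.ae_isSwitching : ∀ᵐ ω ∂P,
    IsSkeleton (fun n => jt X n ω) (fun n => jp X n ω) ∧
      ∀ k, IsSwitching (fun n => jt X n ω) (fun n => jp X n ω) k (chain w 0 fun j => edgeVar w X k j ω) := by
  have hreg : ∀ᵐ ω ∂P, ∀ k, Regular fun j => edgeVar w X k j ω :=
    ae_all_iff.2 fun k => (hX.isExpArray_edgeVar.isExpSeq k).ae_regular
  filter_upwards [hX.ae_isSkeleton, hX.ae_tendsto_crossed, hreg] with ω h1 h2 h3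
  exact ⟨h1, fun k => isSwitching_chain h1 (h2 k) (h3 k)⟩

lemma IsWalk.ae_edge_eq : ∀ᵐ ω ∂P, ∀ (k : ℤ) (s : ℝ≥0),
    {t : ℝ≥0 | (s : ℝ) < edgeTime (fun t => X t ω) t k}.Nonempty ∧
      (alpha (fun t => X t ω) k s, xi (fun t => X t ω) k s)
        = edgePath (startSign k) (chain w 0 fun j => edgeVar w X k j ω) s := by
  filter_upwards [hX.ae_isSwitching] with ω ⟨h, hz⟩ k s
  rw [← h.side_zero k]
  exact (hz k).edge_eq h (isStepPath_jumpTime h) s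

lemma IsWalk.ae_eta_eq : ∀ᵐ ω ∂P, ∀ (k : ℤ) (σ : ℤˣ) (t : ℝ≥0),
    {s : ℝ≥0 | (t : ℝ) < localTime (alpha (fun t => X t ω) k) s σ}.Nonempty ∧
      eta (fun t => X t ω) σ k t
        = etaPath (fun i => chain w 0 (fun j => edgeVar w X k j ω) (i + etaShift σ k)) t := by
  filter_upwards [hX.ae_isSwitching] with ω ⟨h, hz⟩ k σ t
  refine (hz k).eta_eq h (isStepPath_jumpTime h) (etaShift_le_one σ k) ?_ t
  rw [h.side_zero, startSign_mul_pow]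

/-- The regularity of the edge processes, read off from the piecewise linear paths. -/
lemma IsWalk.ae_edge_regular : ∀ᵐ ω ∂P, ∀ (k : ℤ) (s : ℝ≥0),
    (alpha (fun t => X t ω) k s = 1 ∨ alpha (fun t => X t ω) k s = -1) ∧
      ContinuousWithinAt (alpha (fun t => X t ω) k) (Ici s) s ∧
      xi (fun t => X t ω) k s = ∫ u in (0 : ℝ)..s, (alpha (fun t => X t ω) k u.toNNReal : ℝ) := by
  filter_upwards [hX.ae_isSwitching] with ω ⟨h, hz⟩ k s
  have hx := isStepPath_jumpTime h
  have hk := hz k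
  have ha := side_cases (fun n => jp X n ω) 0 k
  rw [hk.xi_eq h hx, edgePath_snd_eq_localTime hk.zero hk.add_nonneg hk.tendsto_edgeSwitch ha, ← hk.alpha_eq h hx]
  refine ⟨?_, ?_, (integral_sign_eq ?_ ?_ s).symm⟩
  · rw [hk.alpha_eq h hx]
    exact edgePath_fst_cases ha s
  · rw [hk.alpha_eq h hx]
    exact continuousWithinAt_edgePath_fst hk.add_nonneg hk.tendsto_edgeSwitch s
  · rw [hk.alpha_eq h hx]
    exact measurable_fst.comp (measurable_edgePath (α := ℝ≥0) _ (fun n => measurable_const) measurable_coe_nnreal_real)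
  · intro s
    rw [hk.alpha_eq h hx]
    exact edgePath_fst_cases ha s

lemma IsWalk.ae_edge_zero : ∀ᵐ ω ∂P, ∀ k : ℤ,
    xi (fun t => X t ω) k 0 = 0 ∧ alpha (fun t => X t ω) k 0 = if k < 0 then 1 else -1 := by
  have hreg : ∀ᵐ ω ∂P, ∀ k, Regular fun j => edgeVar w X k j ω :=
    ae_all_iff.2 fun k => (hX.isExpArray_edgeVar.isExpSeq k).ae_regular
  filter_upwards [hX.ae_edge_eq, hreg] with ω hω hr k
  have h1 := (hω k 0).2
  rw [edgePath, NNReal.coe_zero, stepIndex_eq (m := 0) (monotone_edgeSwitch (chain_add_nonneg w 0 _)) (by simp) (by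
    rw [edgeSwitch_succ, edgeSwitch_zero, zero_add]
    exact chain_add_pos w 0 ((hr k).1 0))] at h1
  obtain ⟨h2, h3⟩ := Prod.ext_iff.1 h1
  simp only [edgeFlow, edgeState, edgeSwitch_zero, chain] at h2 h3
  refine ⟨by rw [h3]; simp, by rw [h2]; simp [startSign]⟩

lemma IsWalk.iIndepFun_edge :
    iIndepFun (fun (k : ℤ) (ω : Ω) (s : ℝ≥0) => (alpha (fun t => X t ω) k s, xi (fun t => X t ω) k s)) P := by
  have hm : ∀ k, Measurable fun (e : ℕ → ℝ) (s : ℝ≥0) => edgePath (startSign k) (chain w 0 e) s := fun k =>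
    measurable_pi_lambda _ fun s => measurable_edgePath _ (fun n => measurable_chain w measurable_const
      (e := fun i (e : ℕ → ℝ) => e i) n fun i _ => measurable_pi_apply i) measurable_const
  refine (hX.isExpArray_edgeVar.indep.comp _ hm).congr fun k => ?_
  filter_upwards [hX.ae_edge_eq] with ω hω
  exact funext fun s => (hω k s).2.symm

lemma IsWalk.iIndepFun_eta (ε : ℤ → ℤˣ) :
    iIndepFun (fun (k : ℤ) (ω : Ω) (t : ℝ≥0) => eta (fun t => X t ω) (ε k) k t) P := by
  have hm : ∀ k, Measurable fun (e : ℕ → ℝ) (t : ℝ≥0) => etaPath (fun i => chain w 0 e (i + etaShift (ε k) k)) t :=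
    fun k => measurable_pi_lambda _ fun s => measurable_etaPath (fun n => measurable_chain w measurable_const
      (e := fun i (e : ℕ → ℝ) => e i) _ fun i _ => measurable_pi_apply i) measurable_const
  refine (hX.isExpArray_edgeVar.indep.comp _ hm).congr fun k => ?_
  filter_upwards [hX.ae_eta_eq] with ω hω
  exact funext fun s => (hω k (ε k) s).2.symm

lemma IsWalk.isMarkovProcess_edge (k : ℤ) :
    IsMarkovProcess P (fun (s : ℝ≥0) (ω : Ω) => (alpha (fun t => X t ω) k s, xi (fun t => X t ω) k s))
      (edgeTransition w) := by
  refine ((hX.isExpArray_edgeVar.isExpSeq k).isJumpChain_edge w 0 (startSign_mul_self k)).markov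
    (isJumpData_edge w) ?_ fun s => ?_
  · filter_upwards [hX.ae_edge_eq] with ω hω n t h1 h2
    rw [(hω k t).2, edgePath, stepIndex_eq (monotone_edgeSwitch (chain_add_nonneg w 0 _)) h1 h2]
  · have hs : Measurable fun ω : Ω => (s, ω) := by fun_prop
    have h1 := (measurable_alpha hX.measurable_uncurry k).comp hs
    have h2 := (measurable_xi hX.measurable_uncurry k).comp hs
    simp only [Function.comp_def] at h1 h2
    exact h1.prodMk h2

lemma IsWalk.isMarkovProcess_eta (k : ℤ) (σ : ℤˣ) :
    IsMarkovProcess P (fun (t : ℝ≥0) (ω : Ω) => eta (fun t => X t ω) σ k t) (etaTransition w) := by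
  refine ((hX.isExpArray_edgeVar.isExpSeq k).isJumpChain_eta w 0 (etaShift σ k)).markov
    (isJumpData_eta w) ?_ fun t => ?_
  · filter_upwards [hX.ae_eta_eq] with ω hω n t h1 h2
    rw [(hω k σ t).2]
    exact etaPath_eq_etaFlow _ (chain_shift_add_nonneg _) n h1 h2
  · have h1 := (measurable_eta hX.measurable_uncurry σ k).comp (by fun_prop : Measurable fun ω : Ω => (t, ω))
    simp only [Function.comp_def] at h1
    exact h1

/-- The first point of the chain is `0`, and its second one is the first ringing point of a clock
started at `0`, with the distribution `Q 0`. -/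
lemma IsWalk.map_eta_zero (k : ℤ) (σ : ℤˣ) :
    P.map (fun ω => eta (fun t => X t ω) σ k 0)
      = if startSign k = σ then Measure.dirac 0 else Q w 0 := by
  have hE := hX.isExpArray_edgeVar.isExpSeq k
  have hae : (fun ω => eta (fun t => X t ω) σ k 0)
      =ᵐ[P] fun ω => chain w 0 (fun j => edgeVar w X k j ω) (etaShift σ k) := by
    filter_upwards [hX.ae_eta_eq, hE.ae_regular] with ω hω hr
    rw [(hω k σ 0).2, NNReal.coe_zero, etaPath_zero (chain_shift_add_nonneg _), zero_add]
    have := chain_add_pos w 0 (e := fun j => edgeVar w X k j ω) (hr.1 (etaShift σ k))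
    rwa [zero_add, add_comm 1 (etaShift σ k)]
  rw [Measure.map_congr hae, etaShift]
  split_ifs
  · simp [chain]
  · have h1 : (fun ω => chain w 0 (fun j => edgeVar w X k j ω) 1) = nextPoint w 0 ∘ edgeVar w X k 0 := by
      funext ω
      simp [chain]
    rw [h1, ← Measure.map_map (measurable_nextPoint_right w 0) (hE.measurable 0), hE.law 0, map_nextPoint]

end

end RepellingWalk

end

theorem mainTheorem4 {Ω : Type*} [MeasurableSpace Ω] (P : Measure Ω) [IsProbabilityMeasure P]
    (w : ℝ → ℝ) (w_pos : ∀ u, 0 < w u) (w_mono : Monotone w) (w_nonconst : ∃ u v, w u ≠ w v)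
    (X : ℝ≥0 → Ω → ℤ) (hX : RepellingWalk.IsWalk w P X) :
    -- the inverse local times `θ(s, k)` and `β_±(t, k)` are almost surely all finite
    (∀ᵐ ω ∂P,
      (∀ (k : ℤ) (s : ℝ≥0),
        {t : ℝ≥0 | (s : ℝ) < RepellingWalk.edgeTime (fun t => X t ω) t k}.Nonempty) ∧
      (∀ (k : ℤ) (σ : ℤˣ) (t : ℝ≥0),
        {s : ℝ≥0 | (t : ℝ) < RepellingWalk.localTime
          (RepellingWalk.alpha (fun t => X t ω) k) s σ}.Nonempty)) ∧
    -- (1) the edge processes `(α_k, ξ_k)`, `k ∈ ℤ`, are independent,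
    iIndepFun (fun (k : ℤ) (ω : Ω) (s : ℝ≥0) =>
      (RepellingWalk.alpha (fun t => X t ω) k s, RepellingWalk.xi (fun t => X t ω) k s)) P ∧
    -- they are Markov with the common transition function,
    (∀ k : ℤ, RepellingWalk.IsMarkovProcess P
      (fun (s : ℝ≥0) (ω : Ω) =>
        (RepellingWalk.alpha (fun t => X t ω) k s, RepellingWalk.xi (fun t => X t ω) k s))
      (RepellingWalk.edgeTransition w)) ∧
    -- `α_k` is right continuous with values in `{-1, +1}`, and `ξ_k` has derivative `α_k`,
    (∀ᵐ ω ∂P, ∀ (k : ℤ) (s : ℝ≥0),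
      (RepellingWalk.alpha (fun t => X t ω) k s = 1 ∨
        RepellingWalk.alpha (fun t => X t ω) k s = -1) ∧
      ContinuousWithinAt (RepellingWalk.alpha (fun t => X t ω) k) (Ici s) s ∧
      RepellingWalk.xi (fun t => X t ω) k s
        = ∫ u in (0 : ℝ)..s, (RepellingWalk.alpha (fun t => X t ω) k u.toNNReal : ℝ)) ∧
    -- and the initial states are deterministic;
    (∀ᵐ ω ∂P, ∀ k : ℤ,
      RepellingWalk.xi (fun t => X t ω) k 0 = 0 ∧
      RepellingWalk.alpha (fun t => X t ω) k 0 = if k < 0 then 1 else -1) ∧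
    -- (2) for every choice of one sign for each `k`, the processes `η_{k,±}` are independent,
    (∀ ε : ℤ → ℤˣ, iIndepFun (fun (k : ℤ) (ω : Ω) (t : ℝ≥0) =>
      RepellingWalk.eta (fun t => X t ω) (ε k) k t) P) ∧
    -- they are Markov with a common transition function,
    (∀ (k : ℤ) (σ : ℤˣ), RepellingWalk.IsMarkovProcess P
      (fun (t : ℝ≥0) (ω : Ω) => RepellingWalk.eta (fun t => X t ω) σ k t)
      (RepellingWalk.etaTransition w)) ∧
    -- and the initial distributions are `Q(0, ·)` or the point mass at `0`.
    (∀ k : ℤ,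
      P.map (fun ω => RepellingWalk.eta (fun t => X t ω) 1 k 0)
        = (if 0 ≤ k then RepellingWalk.Q w 0 else Measure.dirac 0) ∧
      P.map (fun ω => RepellingWalk.eta (fun t => X t ω) (-1) k 0)
        = (if 0 ≤ k then Measure.dirac 0 else RepellingWalk.Q w 0)) := by
  have : RepellingWalk.IsRate w := ⟨w_pos, w_mono, w_nonconst⟩
  refine ⟨?_, hX.iIndepFun_edge, hX.isMarkovProcess_edge, hX.ae_edge_regular, hX.ae_edge_zero, hX.iIndepFun_eta,
    hX.isMarkovProcess_eta, fun k => ⟨?_, ?_⟩⟩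
  · filter_upwards [hX.ae_edge_eq, hX.ae_eta_eq] with ω h1 h2
    exact ⟨fun k s => (h1 k s).1, fun k σ t => (h2 k σ t).1⟩
  · rw [hX.map_eta_zero, RepellingWalk.startSign]
    by_cases hk : 0 ≤ k <;> simp [hk]
  · rw [hX.map_eta_zero, RepellingWalk.startSign]
    by_cases hk : 0 ≤ k <;> simp [hk]
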